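/- **Conventions.** A *virtual double category* $\mathbb A$ has objects, vertical morphisms (forming a category), horizontal morphisms between objects, and multicells whose top boundary is a finite, possibly empty, path of horizontal morphisms, whose bottom boundary is one horizontal morphism and whose sides are vertical morphisms, with identity multicells and an associative and unital composition. Virtual double categories, virtual double functors and vertical transformations form a 2-category $\mathbf{VDBL}$. A *unital* virtual double category carries, for every object $D$, a chosen horizontal unit: a horizontal morphism $D\to D$ with an opcartesian nullary multicell with identity sides. $\mathbf{UVDBL}$ is the 2-category of unital virtual double categories, virtual double functors that preserve the chosen units strictly, and all vertical transformations. $2\text{-}\mathbf{CAT}$ is the 2-category of 2-categories, 2-functors and 2-natural transformations. Pullbacks are strict and 2-categorical (universal for 1-cells and for 2-cells). * $\mathbf{Set}_{\mathrm{hc}}$ has as vertical category the category of small sets, exactly one horizontal morphism between any two sets, and exactly one multicell with any given boundary; it is unital. $\mathbf{Set}_{\mathrm{lc}}$ is the 2-category of small sets and functions with exactly one 2-cell between any two parallel functions. * $\mathbb{S}\mathrm{pan}$ has small sets, functions, spans, and multimaps of spans (maps out of the iterated pullback of the top spans that are compatible with the sides). $J\colon\mathbf{Set}_{\mathrm{hc}}\to\mathbb{S}\mathrm{pan}$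 is the identity on vertical categories and sends the horizontal morphism $I\to I'$ to the span $I\leftarrow I\times I'\to I'$ of the projections. * $\mathbb{F}\mathrm{am}(\mathbb A)$: objects are small families $(A_i)_{i\in I}$ of objects of $\mathbb A$; vertical morphisms are functions between index sets with a family of vertical morphisms of $\mathbb A$; horizontal morphisms $(A_i)_{i\in I}\to(B_j)_{j\in I'}$ are spans $I\xleftarrow{l}S\xrightarrow{r}I'$ with a family of horizontal morphisms $A_{l(s)}\to B_{r(s)}$, $s\in S$; multicells are multimaps of spans with a family of multicells of $\mathbb A$ indexed by the iterated pullback of the top spans. Forgetting the families gives $\mathbb{F}\mathrm{am}(\mathbb A)\to\mathbb{S}\mathrm{pan}$. * $\mathbb{M}\mathrm{at}(\mathbb A)$: the same objects and vertical morphisms; horizontal morphisms are matrices of horizontal morphisms $A_i\to B_j$, $(i,j)\in I\times I'$; multicells are families of multicells of $\mathbb A$ indexed by sequences of indices. Taking index sets gives $\mathbb{M}\mathrm{at}(\mathbb A)\to\mathbf{Set}_{\mathrm{hc}}$, and regarding a matrix as a family indexed by the span $I\leftarrow I\times I'\to I'$ gives $\mathbb{M}\mathrm{at}(\mathbb A)\to\mathbb{F}\mathrm{am}(\mathbb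 A)$. * $\mathbb{M}\mathrm{od}(\mathbb A)$ is the unital virtual double category of monads (horizontal endomorphisms with a unit and a multiplication), monad morphisms, bimodules and equivariant multicells in $\mathbb A$, the chosen unit of a monad being the monad itself as a bimodule. Put $\mathbb{P}\mathrm{rof}(\mathbb A)=\mathbb{M}\mathrm{od}(\mathbb{M}\mathrm{at}(\mathbb A))$ and $\mathbb{P}\mathrm{rof}(\mathbf{Set})=\mathbb{M}\mathrm{od}(\mathbb{S}\mathrm{pan})$, the unital virtual double category of internal categories in $\mathbf{Set}$. * For a unital virtual double category $\mathbb D$, $\mathscr V(\mathbb D)$ is the 2-category of objects and vertical morphisms of $\mathbb D$, whose 2-cells are the multicells from a chosen unit to a chosen unit. * An $\mathbb A$-category has a small set of objects $x$, for each an object $|x|$ of $\mathbb A$, for each pair a horizontal morphism $C(x,y)\colon|x|\to|y|$, and nullary unit and binary composition multicells with identity sides subject to the unit and associativity laws. With $\mathbb A$-functors (a function $f$ on objects, vertical morphisms $|x|\to|fx|$ and multicells $C(x,y)\to D(fx,fy)$ compatible with units and composition) and $\mathbb A$-natural transformations (natural families of nullary multicells into the $D(fx,gx)$) they form a 2-category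 $\mathbb A\text{-}\mathbf{Cat}$. **Theorem.** Let $\mathbb A$ be a virtual double category. 1. The square $$\begin{array}{ccc}\mathbb{M}\mathrm{at}(\mathbb A)&\to&\mathbb{F}\mathrm{am}(\mathbb A)\\ \downarrow&&\downarrow\\ \mathbf{Set}_{\mathrm{hc}}&\xrightarrow{\,J\,}&\mathbb{S}\mathrm{pan}\end{array}$$ of the functors above is a pullback in $\mathbf{VDBL}$. 2. The square $$\begin{array}{ccc}\mathbb{P}\mathrm{rof}(\mathbb A)&\to&\mathbb{M}\mathrm{od}(\mathbb{F}\mathrm{am}(\mathbb A))\\ \downarrow&&\downarrow\\ \mathbf{Set}_{\mathrm{hc}}&\to&\mathbb{P}\mathrm{rof}(\mathbf{Set})\end{array}$$ is a pullback in $\mathbf{UVDBL}$. Here the upper and the right leg are obtained by applying $\mathbb{M}\mathrm{od}$ to those of 1, the left leg takes sets of objects, and the lower leg sends a set to the chaotic category on it; that is, it is $\mathbb{M}\mathrm{od}(J)$ composed with the inclusion $\mathbf{Set}_{\mathrm{hc}}\to\mathbb{M}\mathrm{od}(\mathbf{Set}_{\mathrm{hc}})$. 3. There is an isomorphism of 2-categories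 $\mathbb A\text{-}\mathbf{Cat}\cong\mathscr V(\mathbb{P}\mathrm{rof}(\mathbb A))$ that sends $C$ to the monad on the family $(|x|)_x$ with underlying matrix $(C(x,y))_{x,y}$, and with which the square $$\begin{array}{ccc}\mathbb A\text{-}\mathbf{Cat}&\to&\mathscr V\bigl(\mathbb{M}\mathrm{od}(\mathbb{F}\mathrm{am}(\mathbb A))\bigr)\\ \downarrow&&\downarrow\\ \mathbf{Set}_{\mathrm{lc}}&\to&\mathscr V(\mathbb{P}\mathrm{rof}(\mathbf{Set}))\end{array}$$ is a pullback in $2\text{-}\mathbf{CAT}$. Here the upper leg is the isomorphism followed by $\mathscr V$ of the upper leg of 2, the left leg takes sets of objects, and the right and the lower leg are $\mathscr V$ of those of 2. 4. $\mathscr V(\mathbb{P}\mathrm{rof}(\mathbf{Set}))$ is the 2-category $\mathbf{Cat}$ of small categories, in the form of internal categories in $\mathbf{Set}$: there is a 2-functor from it to the 2-category of small categories, functors and natural transformations that keeps sets of objects, is bijective on 1-cells and on 2-cells between given boundaries, and is surjective on objects up to isomorphism. The 2-functor $\mathbf{Set}_{\mathrm{lc}}\to\mathbf{Cat}$ of 3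 is fully faithful (bijective on 1-cells and on 2-cells between given boundaries), and the categories isomorphic to one in its image are exactly the chaotic ones, i.e. those with exactly one morphism from any object to any object. -/

import Mathlib

open CategoryTheory

universe o v h c o₁ v₁ h₁ c₁ o₂ v₂ h₂ c₂ o₃ v₃ h₃ c₃ o₄ v₄ h₄ c₄ u t w w₁ w₂ w₃ w₄

/-! ### Paths of horizontal morphisms and chains of multicells -/

/-- Finite composable sequences (possibly empty) of horizontal morphisms. -/
inductive HPath {O : Type o} (H : O → O → Type h) : O → O → Type (max o h)
  | nil (A : O) : HPath H A A
  | cons {A B C : O} (Γ : H A B) (p : HPath H B C) : HPath H A C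

namespace HPath

variable {O : Type o} {H : O → O → Type h}

/-- Concatenation of paths. -/
def append {A B : O} : HPath H A B → ∀ {C : O}, HPath H B C → HPath H A C
  | .nil _, _, q => q
  | .cons Γ p, _, q => .cons Γ (p.append q)

/-- The path consisting of one horizontal morphism. -/
abbrev one {A B : O} (Γ : H A B) : HPath H A B := .cons Γ (.nil B)

/-- The image of a path. -/
def map {O' : Type o₁} {H' : O' → O' → Type h₁} (F : O → O')
    (f : ∀ ⦃A B : O⦄, H A B → H' (F A) (F B)) {A B : O} : HPath H A B → HPath H' (F A) (F B)
  | .nil A => .nil (F A)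
  | .cons Γ p => .cons (f Γ) (p.map F f)

@[simp] theorem nil_append {A B : O} (q : HPath H A B) : (HPath.nil A).append q = q := rfl

@[simp] theorem cons_append {A B C D : O} (Γ : H A B) (p : HPath H B C) (q : HPath H C D) :
    (HPath.cons Γ p).append q = .cons Γ (p.append q) := rfl

@[simp] theorem append_nil {A B : O} (p : HPath H A B) : p.append (.nil B) = p := by
  induction p with
  | nil A => rfl
  | cons Γ p ih => simp [ih]

theorem append_assoc {A B C D : O} (p : HPath H A B) (q : HPath H B C) (r : HPath H C D) :
    (p.append q).append r = p.append (q.append r) := by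
  induction p with
  | nil A => rfl
  | cons Γ p ih => simp [ih]

theorem map_append {O' : Type o₁} {H' : O' → O' → Type h₁} (F : O → O')
    (f : ∀ ⦃A B : O⦄, H A B → H' (F A) (F B)) {A B C : O} (p : HPath H A B) (q : HPath H B C) :
    (p.append q).map F f = (p.map F f).append (q.map F f) := by
  induction p with
  | nil A => rfl
  | cons Γ p ih => simp [map, ih]

theorem map_map {O' : Type o₁} {H' : O' → O' → Type h₁} {O'' : Type o₂}
    {H'' : O'' → O'' → Type h₂} (F : O → O') (f : ∀ ⦃A B : O⦄, H A B → H' (F A) (F B))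
    (G : O' → O'') (g : ∀ ⦃A B : O'⦄, H' A B → H'' (G A) (G B)) {A B : O} (p : HPath H A B) :
    (p.map F f).map G g = p.map (fun X => G (F X)) (fun _ _ Γ => g (f Γ)) := by
  induction p with
  | nil A => rfl
  | cons Γ p ih => simp [map, ih]

end HPath

/-- The type of families of multicells, indexed by their boundaries:
top path, left and right vertical morphisms, bottom horizontal morphism. -/
abbrev CellFam (O : Type o) [Category.{v} O] (H : O → O → Type h) :=
  ∀ ⦃A B C D : O⦄, HPath H A B → (A ⟶ C) → (B ⟶ D) → H C D → Type c

/-- Chains of horizontally adjacent multicells `θ₁, …, θₘ`.  In `Sq K p u v q`, `p` is the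
concatenation of the top paths, `q` is the path of the bottom horizontal morphisms, `u` and `v`
are the outer vertical morphisms.  For `m = 0` the chain is a single vertical morphism. -/
inductive Sq {O : Type o} [Category.{v} O] {H : O → O → Type h} (K : CellFam.{o, v, h, c} O H) :
    ∀ {A B C D : O}, HPath H A B → (A ⟶ C) → (B ⟶ D) → HPath H C D → Type (max o v h c)
  | nil {A C : O} (u : A ⟶ C) : Sq K (.nil A) u u (.nil C)
  | cons {A B C D E F : O} {r : HPath H A B} {p : HPath H B E} {s : HPath H A E}
      {u : A ⟶ C} {w : B ⟶ D} {v : E ⟶ F} {Δ : H C D} {q : HPath H D F}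
      (θ : K r u w Δ) (Θ : Sq K p w v q) (h : r.append p = s) : Sq K s u v (.cons Δ q)

section Chains

variable {O : Type o} [Category.{v} O] {H : O → O → Type h} {K : CellFam.{o, v, h, c} O H}

/-- The chain consisting of one multicell. -/
def Sq.single {A B C D : O} {p : HPath H A B} {u : A ⟶ C} {v : B ⟶ D} {Γ : H C D}
    (θ : K p u v Γ) : Sq K p u v (HPath.one Γ) :=
  .cons θ (.nil v) p.append_nil

/-- The image of a chain. -/
def Sq.map {O' : Type o₁} [Category.{v₁} O'] {H' : O' → O' → Type h₁}
    {K' : CellFam.{o₁, v₁, h₁, c₁} O' H'} (F : O ⥤ O')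
    (f : ∀ ⦃A B : O⦄, H A B → H' (F.obj A) (F.obj B))
    (k : ∀ ⦃A B C D : O⦄ ⦃p : HPath H A B⦄ ⦃u : A ⟶ C⦄ ⦃v : B ⟶ D⦄ ⦃Γ : H C D⦄,
      K p u v Γ → K' (p.map F.obj f) (F.map u) (F.map v) (f Γ)) :
    ∀ {A B C D : O} {p : HPath H A B} {u : A ⟶ C} {v : B ⟶ D} {q : HPath H C D},
      Sq K p u v q → Sq K' (p.map F.obj f) (F.map u) (F.map v) (q.map F.obj f)
  | _, _, _, _, _, _, _, _, .nil u => .nil (F.map u)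
  | _, _, _, _, _, _, _, _, .cons θ Θ h =>
      .cons (k θ) (Sq.map F f k Θ) (by rw [← h, HPath.map_append])

/-- `HApp Θ₁ Θ₂ Θ`: the chain `Θ` is the concatenation of `Θ₁` and `Θ₂`. -/
inductive HApp : ∀ {A B C D E F : O} {p₁ : HPath H A B} {p₂ : HPath H B E} {p : HPath H A E}
    {u : A ⟶ C} {w : B ⟶ D} {v : E ⟶ F} {q₁ : HPath H C D} {q₂ : HPath H D F} {q : HPath H C F},
    Sq K p₁ u w q₁ → Sq K p₂ w v q₂ → Sq K p u v q → Prop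
  | nil {A C E F : O} {p : HPath H A E} {u : A ⟶ C} {v : E ⟶ F} {q : HPath H C F}
      (Θ : Sq K p u v q) : HApp (.nil u) Θ Θ
  | cons {A B C D E F X Y : O} {r : HPath H A B} {p₁ : HPath H B E} {p₂ : HPath H E X}
      {p : HPath H B X} {s₁ : HPath H A E} {s : HPath H A X} {u : A ⟶ C} {w : B ⟶ D} {w' : E ⟶ F}
      {v : X ⟶ Y} {Δ : H C D} {q₁ : HPath H D F} {q₂ : HPath H F Y} {q : HPath H D Y}
      {Θ₁ : Sq K p₁ w w' q₁} {Θ₂ : Sq K p₂ w' v q₂} {Θ : Sq K p w v q}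
      (θ : K r u w Δ) (a : HApp Θ₁ Θ₂ Θ) (h₁ : r.append p₁ = s₁) (h : r.append p = s) :
      HApp (.cons θ Θ₁ h₁) Θ₂ (.cons θ Θ h)

/-- The type of composition operations: a chain above a multicell is composed to a multicell
with the same top path and bottom morphism, and with composite vertical sides. -/
abbrev CompOp (K : CellFam.{o, v, h, c} O H) :=
  ∀ ⦃A B C D E F : O⦄ ⦃p : HPath H A B⦄ ⦃u : A ⟶ C⦄ ⦃v : B ⟶ D⦄ ⦃q : HPath H C D⦄
    ⦃u' : C ⟶ E⦄ ⦃v' : D ⟶ F⦄ ⦃Γ : H E F⦄ ⦃a : A ⟶ E⦄ ⦃b : B ⟶ F⦄,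
    Sq K p u v q → K q u' v' Γ → u ≫ u' = a → v ≫ v' = b → K p a b Γ

/-- `VComp comp Θ Ξ Φ`: the chain `Φ` is obtained from the chain `Θ` above the chain `Ξ` by
composing every multicell of `Ξ` with the part of `Θ` lying above it. -/
inductive VComp (comp : CompOp.{o, v, h, c} K) :
    ∀ {A B C D E F : O} {p : HPath H A B} {u : A ⟶ C} {v : B ⟶ D} {q : HPath H C D}
      {u' : C ⟶ E} {v' : D ⟶ F} {r : HPath H E F} {a : A ⟶ E} {b : B ⟶ F},
      Sq K p u v q → Sq K q u' v' r → Sq K p a b r → Prop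
  | nil {A B C : O} {u : A ⟶ B} {u' : B ⟶ C} {a : A ⟶ C} (h : u ≫ u' = a) :
      VComp comp (.nil u) (.nil u') (.nil a)
  | cons {A₁ A₂ A₃ B₁ B₂ B₃ C₁ C₂ C₃ : O} {p₁ : HPath H A₁ A₂} {p₂ : HPath H A₂ A₃}
      {p : HPath H A₁ A₃} {u : A₁ ⟶ B₁} {w : A₂ ⟶ B₂} {v : A₃ ⟶ B₃} {q₁ : HPath H B₁ B₂}
      {q₂ : HPath H B₂ B₃} {q : HPath H B₁ B₃} {u' : B₁ ⟶ C₁} {w' : B₂ ⟶ C₂} {v' : B₃ ⟶ C₃}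
      {Δ : H C₁ C₂} {r : HPath H C₂ C₃} {a : A₁ ⟶ C₁} {m : A₂ ⟶ C₂} {b : A₃ ⟶ C₃}
      {Θ₁ : Sq K p₁ u w q₁} {Θ₂ : Sq K p₂ w v q₂} {Θ : Sq K p u v q}
      {ξ : K q₁ u' w' Δ} {Ξ : Sq K q₂ w' v' r} {Φ : Sq K p₂ m b r}
      (happ : HApp Θ₁ Θ₂ Θ) (hu : u ≫ u' = a) (hw : w ≫ w' = m)
      (hq : q₁.append q₂ = q) (hp : p₁.append p₂ = p) (t : VComp comp Θ₂ Ξ Φ) :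
      VComp comp Θ (.cons ξ Ξ hq) (.cons (comp Θ₁ ξ hu hw) Φ hp)

/-- The chain of identity cells on a path. -/
def Sq.ids (ident : ∀ ⦃A B : O⦄ (Γ : H A B), K (HPath.one Γ) (𝟙 A) (𝟙 B) Γ) :
    ∀ {A B : O} (p : HPath H A B), Sq K p (𝟙 A) (𝟙 B) p
  | _, _, .nil A => .nil (𝟙 A)
  | _, _, .cons Γ p => .cons (ident Γ) (Sq.ids ident p) rfl

end Chains

/-! ### Virtual double categories -/

/-- Virtual double categories.  The composite of a chain `Θ` and a multicell `θ` below it has the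
composites of the vertical morphisms as its sides; `comp` takes these composites together with the
equations saying so, in order that the axioms are equations between elements of one set. -/
structure VDC where
  Obj : Type o
  [cat : Category.{v} Obj]
  Hor : Obj → Obj → Type h
  Cell : CellFam.{o, v, h, c} Obj Hor
  ident : ∀ ⦃A B : Obj⦄ (Γ : Hor A B), Cell (HPath.one Γ) (𝟙 A) (𝟙 B) Γ
  comp : CompOp.{o, v, h, c} Cell
  ident_comp : ∀ {A B C D : Obj} {p : HPath Hor A B} {u : A ⟶ C} {v : B ⟶ D} {Γ : Hor C D}
    (θ : Cell p u v Γ), comp (Sq.ids ident p) θ (Category.id_comp u) (Category.id_comp v) = θ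
  comp_ident : ∀ {A B C D : Obj} {p : HPath Hor A B} {u : A ⟶ C} {v : B ⟶ D} {Γ : Hor C D}
    (θ : Cell p u v Γ),
    comp (Sq.single θ) (ident Γ) (Category.comp_id u) (Category.comp_id v) = θ
  assoc : ∀ {A A' B B' C C' D D' : Obj} {p : HPath Hor A A'} {q : HPath Hor B B'}
    {r : HPath Hor C C'} {Γ : Hor D D'} {u : A ⟶ B} {v : A' ⟶ B'} {u' : B ⟶ C} {v' : B' ⟶ C'}
    {u'' : C ⟶ D} {v'' : C' ⟶ D'} {a : A ⟶ C} {b : A' ⟶ C'} {a' : B ⟶ D} {b' : B' ⟶ D'}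
    {x : A ⟶ D} {y : A' ⟶ D'} {Θ : Sq Cell p u v q} {Ξ : Sq Cell q u' v' r}
    {Φ : Sq Cell p a b r} (κ : Cell r u'' v'' Γ) (_ : VComp comp Θ Ξ Φ)
    (h₁ : u' ≫ u'' = a') (h₂ : v' ≫ v'' = b') (h₃ : u ≫ a' = x) (h₄ : v ≫ b' = y)
    (h₅ : a ≫ u'' = x) (h₆ : b ≫ v'' = y),
    comp Θ (comp Ξ κ h₁ h₂) h₃ h₄ = comp Φ κ h₅ h₆

attribute [instance] VDC.cat

namespace VDC

variable (A : VDC.{o, v, h, c})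

/-- Paths of horizontal morphisms. -/
abbrev Path (X Y : A.Obj) := HPath A.Hor X Y

/-- Chains of multicells. -/
abbrev Chain {X Y Z W : A.Obj} (p : A.Path X Y) (u : X ⟶ Z) (v : Y ⟶ W) (q : A.Path Z W) :=
  Sq A.Cell p u v q

/-- The chain of identity cells. -/
abbrev ids {X Y : A.Obj} (p : A.Path X Y) : A.Chain p (𝟙 X) (𝟙 Y) p := Sq.ids A.ident p

end VDC

/-- Virtual double functors. -/
structure VFunctor (A : VDC.{o, v, h, c}) (B : VDC.{o₁, v₁, h₁, c₁}) where
  toFunctor : A.Obj ⥤ B.Obj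
  hor : ∀ ⦃X Y : A.Obj⦄, A.Hor X Y → B.Hor (toFunctor.obj X) (toFunctor.obj Y)
  cell : ∀ ⦃X Y Z W : A.Obj⦄ ⦃p : A.Path X Y⦄ ⦃u : X ⟶ Z⦄ ⦃v : Y ⟶ W⦄ ⦃Γ : A.Hor Z W⦄,
    A.Cell p u v Γ → B.Cell (p.map toFunctor.obj hor) (toFunctor.map u) (toFunctor.map v) (hor Γ)
  cell_ident : ∀ {X Y : A.Obj} (Γ : A.Hor X Y), cell (A.ident Γ) ≍ B.ident (hor Γ)
  cell_comp : ∀ {X Y Z W V T : A.Obj} {p : A.Path X Y} {u : X ⟶ Z} {v : Y ⟶ W} {q : A.Path Z W}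
    {u' : Z ⟶ V} {v' : W ⟶ T} {Γ : A.Hor V T} {a : X ⟶ V} {b : Y ⟶ T}
    (Θ : A.Chain p u v q) (θ : A.Cell q u' v' Γ) (hu : u ≫ u' = a) (hv : v ≫ v' = b),
    cell (A.comp Θ θ hu hv) = B.comp (Θ.map toFunctor hor cell) (cell θ)
      (by rw [← hu, Functor.map_comp]) (by rw [← hv, Functor.map_comp])

namespace VDC

variable {A : VDC.{o, v, h, c}}

/-- Transport of a multicell along an equality of its top paths. -/
def castTop {X Y Z W : A.Obj} {p p' : A.Path X Y} {u : X ⟶ Z} {v : Y ⟶ W} {Γ : A.Hor Z W}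
    (e : p = p') (θ : A.Cell p u v Γ) : A.Cell p' u v Γ := e ▸ θ

theorem castTop_heq {X Y Z W : A.Obj} {p p' : A.Path X Y} {u : X ⟶ Z} {v : Y ⟶ W}
    {Γ : A.Hor Z W} (e : p = p') (θ : A.Cell p u v Γ) : castTop e θ ≍ θ := by
  subst e; rfl

theorem comp_heq {X Y Z W V T : A.Obj} {p p' : A.Path X Y} {u : X ⟶ Z} {v : Y ⟶ W}
    {q q' : A.Path Z W} {u' : Z ⟶ V} {v' : W ⟶ T} {Γ : A.Hor V T} {a a' : X ⟶ V} {b b' : Y ⟶ T}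
    {Θ : A.Chain p u v q} {θ : A.Cell q u' v' Γ} {Θ' : A.Chain p' u v q'}
    {θ' : A.Cell q' u' v' Γ} (hp : p = p') (hq : q = q') (hΘ : Θ ≍ Θ') (hθ : θ ≍ θ')
    (hu : u ≫ u' = a) (hv : v ≫ v' = b) (hu' : u ≫ u' = a') (hv' : v ≫ v' = b') :
    A.comp Θ θ hu hv ≍ A.comp Θ' θ' hu' hv' := by
  subst hp hq hΘ hθ hu hv hu' hv'; rfl

end VDC

theorem Sq.cons_heq {O : Type o} [Category.{v} O] {H : O → O → Type h} {K : CellFam.{o, v, h, c} O H}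
    {A B C D E F : O} {r r' : HPath H A B} {p p' : HPath H B E} {s s' : HPath H A E}
    {u : A ⟶ C} {w : B ⟶ D} {v : E ⟶ F} {Δ : H C D} {q q' : HPath H D F}
    {θ : K r u w Δ} {θ' : K r' u w Δ} {Θ : Sq K p w v q} {Θ' : Sq K p' w v q'}
    (hr : r = r') (hp : p = p') (hq : q = q') (hθ : θ ≍ θ') (hΘ : Θ ≍ Θ')
    (e : r.append p = s) (e' : r'.append p' = s') :
    Sq.cons θ Θ e ≍ Sq.cons θ' Θ' e' := by
  subst hr hp hq hθ hΘ e e'; rfl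

namespace VFunctor

variable {A : VDC.{o, v, h, c}} {B : VDC.{o₁, v₁, h₁, c₁}} {C : VDC.{o₂, v₂, h₂, c₂}}

/-- The action of a virtual double functor on paths of horizontal morphisms. -/
abbrev path (F : VFunctor A B) {X Y : A.Obj} (p : A.Path X Y) :
    B.Path (F.toFunctor.obj X) (F.toFunctor.obj Y) := p.map F.toFunctor.obj F.hor

/-- The action of a virtual double functor on chains of multicells. -/
abbrev chain (F : VFunctor A B) {X Y Z W : A.Obj} {p : A.Path X Y} {u : X ⟶ Z} {v : Y ⟶ W}
    {q : A.Path Z W} (Θ : A.Chain p u v q) :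
    B.Chain (F.path p) (F.toFunctor.map u) (F.toFunctor.map v) (F.path q) :=
  Θ.map F.toFunctor F.hor F.cell

theorem cell_heq (F : VFunctor A B) {X Y Z W : A.Obj} {p p' : A.Path X Y} {u u' : X ⟶ Z}
    {v v' : Y ⟶ W} {Γ : A.Hor Z W} {θ : A.Cell p u v Γ} {θ' : A.Cell p' u' v' Γ}
    (hp : p = p') (hu : u = u') (hv : v = v') (hθ : θ ≍ θ') : F.cell θ ≍ F.cell θ' := by
  subst hp hu hv hθ; rfl

theorem chain_chain (F : VFunctor A B) (G : VFunctor B C)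
    (k : ∀ ⦃X Y Z W : A.Obj⦄ ⦃p : A.Path X Y⦄ ⦃u : X ⟶ Z⦄ ⦃v : Y ⟶ W⦄ ⦃Γ : A.Hor Z W⦄,
      A.Cell p u v Γ → C.Cell (p.map (F.toFunctor ⋙ G.toFunctor).obj fun _ _ Γ => G.hor (F.hor Γ))
        ((F.toFunctor ⋙ G.toFunctor).map u) ((F.toFunctor ⋙ G.toFunctor).map v)
        (G.hor (F.hor Γ)))
    (hk : ∀ ⦃X Y Z W : A.Obj⦄ ⦃p : A.Path X Y⦄ ⦃u : X ⟶ Z⦄ ⦃v : Y ⟶ W⦄ ⦃Γ : A.Hor Z W⦄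
      (θ : A.Cell p u v Γ), k θ ≍ G.cell (F.cell θ))
    {X Y Z W : A.Obj} {p : A.Path X Y} {u : X ⟶ Z} {v : Y ⟶ W} {q : A.Path Z W}
    (Θ : A.Chain p u v q) : G.chain (F.chain Θ) ≍
      Θ.map (K' := C.Cell) (F.toFunctor ⋙ G.toFunctor) (fun _ _ Γ => G.hor (F.hor Γ)) k := by
  induction Θ with
  | nil u => rfl
  | cons θ Θ e ih =>
    exact Sq.cons_heq (K := C.Cell) (HPath.map_map _ _ _ _ _) (HPath.map_map _ _ _ _ _)
      (HPath.map_map _ _ _ _ _) (hk θ).symm ih _ _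

/-- Composition of virtual double functors. -/
def comp (F : VFunctor A B) (G : VFunctor B C) : VFunctor A C where
  toFunctor := F.toFunctor ⋙ G.toFunctor
  hor _ _ Γ := G.hor (F.hor Γ)
  cell _ _ _ _ p _ _ _ θ := VDC.castTop (HPath.map_map _ _ _ _ p) (G.cell (F.cell θ))
  cell_ident Γ := (VDC.castTop_heq _ _).trans
    ((G.cell_heq rfl (F.toFunctor.map_id _) (F.toFunctor.map_id _) (F.cell_ident Γ)).trans
      (G.cell_ident _))
  cell_comp {_ _ _ _ _ _ p _ _ q _ _ _ _ _} Θ θ hu hv := by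
    apply eq_of_heq
    refine (VDC.castTop_heq _ _).trans ?_
    rw [F.cell_comp, G.cell_comp]
    exact VDC.comp_heq (HPath.map_map _ _ _ _ p) (HPath.map_map _ _ _ _ q)
      (chain_chain F G _ (fun _ _ _ _ _ _ _ _ θ => VDC.castTop_heq _ _) Θ)
      (VDC.castTop_heq _ _).symm _ _ _ _

end VFunctor

/-- The chain of component cells of a transformation along a path. -/
def VTrans.chainOf {A : VDC.{o, v, h, c}} {B : VDC.{o₁, v₁, h₁, c₁}} {F G : VFunctor A B}
    (app : F.toFunctor ⟶ G.toFunctor)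
    (cellApp : ∀ ⦃X Y : A.Obj⦄ (Γ : A.Hor X Y),
      B.Cell (HPath.one (F.hor Γ)) (app.app X) (app.app Y) (G.hor Γ)) :
    ∀ {X Y : A.Obj} (p : A.Path X Y), B.Chain (F.path p) (app.app X) (app.app Y) (G.path p)
  | _, _, .nil X => .nil (app.app X)
  | _, _, .cons Γ p => .cons (cellApp Γ) (VTrans.chainOf app cellApp p) rfl

/-- Vertical transformations between virtual double functors. -/
@[ext]
structure VTrans {A : VDC.{o, v, h, c}} {B : VDC.{o₁, v₁, h₁, c₁}} (F G : VFunctor A B) where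
  app : F.toFunctor ⟶ G.toFunctor
  cellApp : ∀ ⦃X Y : A.Obj⦄ (Γ : A.Hor X Y),
    B.Cell (HPath.one (F.hor Γ)) (app.app X) (app.app Y) (G.hor Γ)
  naturality : ∀ ⦃X Y Z W : A.Obj⦄ ⦃p : A.Path X Y⦄ ⦃u : X ⟶ Z⦄ ⦃v : Y ⟶ W⦄ ⦃Γ : A.Hor Z W⦄
    (θ : A.Cell p u v Γ),
    B.comp (Sq.single (F.cell θ)) (cellApp Γ) rfl rfl =
      B.comp (VTrans.chainOf app cellApp p) (G.cell θ) (app.naturality u).symm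
        (app.naturality v).symm

namespace VTrans

variable {A : VDC.{o, v, h, c}} {B : VDC.{o₁, v₁, h₁, c₁}} {C : VDC.{o₂, v₂, h₂, c₂}}

theorem chain_whisker {G H : VFunctor A B} (α : VTrans G H) (F : VFunctor B C)
    {X Y : A.Obj} (p : A.Path X Y) :
    F.chain (VTrans.chainOf α.app α.cellApp p) ≍ VTrans.chainOf (F := G.comp F) (G := H.comp F)
      (Functor.whiskerRight α.app F.toFunctor) (fun _ _ Γ => F.cell (α.cellApp Γ)) p := by
  induction p with
  | nil X => rfl
  | cons Δ p ih =>
    exact Sq.cons_heq (K := C.Cell) rfl (HPath.map_map _ _ _ _ p) (HPath.map_map _ _ _ _ p)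
      HEq.rfl ih _ _

/-- The composite `α F` of a vertical transformation `α` with a virtual double functor `F`
out of the common codomain. -/
def whisker {G H : VFunctor A B} (α : VTrans G H) (F : VFunctor B C) :
    VTrans (G.comp F) (H.comp F) where
  app := Functor.whiskerRight α.app F.toFunctor
  cellApp _ _ Γ := F.cell (α.cellApp Γ)
  naturality X Y Z W p u v Γ θ := by
    have e := congrArg (fun x => F.cell x) (α.naturality θ)
    rw [F.cell_comp, F.cell_comp] at e
    apply eq_of_heq
    refine HEq.trans ?_ ((heq_of_eq e).trans ?_)
    · refine VDC.comp_heq (HPath.map_map _ _ _ _ p).symm rfl ?_ HEq.rfl _ _ _ _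
      exact Sq.cons_heq (K := C.Cell) (HPath.map_map _ _ _ _ p).symm rfl rfl
        (VDC.castTop_heq _ _) HEq.rfl _ _
    · refine VDC.comp_heq (HPath.map_map _ _ _ _ p) (HPath.map_map _ _ _ _ p) ?_
        (VDC.castTop_heq _ _).symm _ _ _ _
      exact chain_whisker α F p

end VTrans

/-! ### Pullbacks of virtual double categories -/

/-- The square with upper leg `P`, left leg `Q`, right leg `F` and lower leg `G` is a (strict)
pullback in the 2-category of virtual double categories, virtual double functors and vertical
transformations: it commutes and has the universal property of a pullback with respect to functors
as well as with respect to transformations. -/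
structure VDC.IsPullback {X : VDC.{o, v, h, c}} {Y : VDC.{o₁, v₁, h₁, c₁}}
    {Z : VDC.{o₂, v₂, h₂, c₂}} {W : VDC.{o₃, v₃, h₃, c₃}} (P : VFunctor X Y) (Q : VFunctor X Z)
    (F : VFunctor Y W) (G : VFunctor Z W) : Prop where
  comm : P.comp F = Q.comp G
  lift : ∀ (T : VDC.{o₄, v₄, h₄, c₄}) (R : VFunctor T Y) (S : VFunctor T Z),
    R.comp F = S.comp G → ∃! K : VFunctor T X, K.comp P = R ∧ K.comp Q = S
  lift₂ : ∀ (T : VDC.{o₄, v₄, h₄, c₄}) (K L : VFunctor T X) (α : VTrans (K.comp P) (L.comp P))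
    (β : VTrans (K.comp Q) (L.comp Q)), α.whisker F ≍ β.whisker G →
    ∃! γ : VTrans K L, γ.whisker P = α ∧ γ.whisker Q = β

theorem VComp.left {O : Type o} [Category.{v} O] {H : O → O → Type h} {K : CellFam.{o, v, h, c} O H}
    {comp : CompOp K} {A B C D E F : O} {p : HPath H A B} {u : A ⟶ C} {v : B ⟶ D}
    {q : HPath H C D} {u' : C ⟶ E} {v' : D ⟶ F} {r : HPath H E F} {a : A ⟶ E} {b : B ⟶ F}
    {Θ : Sq K p u v q} {Ξ : Sq K q u' v' r} {Φ : Sq K p a b r} (t : VComp comp Θ Ξ Φ) :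
    u ≫ u' = a := by
  cases t <;> assumption

theorem VComp.right {O : Type o} [Category.{v} O] {H : O → O → Type h}
    {K : CellFam.{o, v, h, c} O H}
    {comp : CompOp K} {A B C D E F : O} {p : HPath H A B} {u : A ⟶ C} {v : B ⟶ D}
    {q : HPath H C D} {u' : C ⟶ E} {v' : D ⟶ F} {r : HPath H E F} {a : A ⟶ E} {b : B ⟶ F}
    {Θ : Sq K p u v q} {Ξ : Sq K q u' v' r} {Φ : Sq K p a b r} (t : VComp comp Θ Ξ Φ) :
    v ≫ v' = b := by
  induction t <;> assumption

theorem HApp.top {O : Type o} [Category.{v} O] {H : O → O → Type h} {K : CellFam.{o, v, h, c} O H}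
    {A B C D E F : O} {p₁ : HPath H A B} {p₂ : HPath H B E} {p : HPath H A E}
    {u : A ⟶ C} {w : B ⟶ D} {v : E ⟶ F} {q₁ : HPath H C D} {q₂ : HPath H D F} {q : HPath H C F}
    {Θ₁ : Sq K p₁ u w q₁} {Θ₂ : Sq K p₂ w v q₂} {Θ : Sq K p u v q} (t : HApp Θ₁ Θ₂ Θ) :
    p₁.append p₂ = p := by
  induction t with
  | nil => rfl
  | cons θ a h₁ h ih => subst h₁ h ih; exact HPath.append_assoc _ _ _

theorem HApp.bot {O : Type o} [Category.{v} O] {H : O → O → Type h} {K : CellFam.{o, v, h, c} O H}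
    {A B C D E F : O} {p₁ : HPath H A B} {p₂ : HPath H B E} {p : HPath H A E}
    {u : A ⟶ C} {w : B ⟶ D} {v : E ⟶ F} {q₁ : HPath H C D} {q₂ : HPath H D F} {q : HPath H C F}
    {Θ₁ : Sq K p₁ u w q₁} {Θ₂ : Sq K p₂ w v q₂} {Θ : Sq K p u v q} (t : HApp Θ₁ Θ₂ Θ) :
    q₁.append q₂ = q := by
  induction t with
  | nil => rfl
  | cons θ a h₁ h ih => rw [← ih]; rfl

/-! ### Horizontally chaotic virtual double categories -/

/-- The horizontally chaotic virtual double category on a category `C`: its vertical category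
is `C`, there is exactly one horizontal morphism between any two objects, and exactly one multicell
with any given boundary. -/
def hc (C : Type o) [Category.{v} C] : VDC.{o, v, 0, 0} where
  Obj := C
  Hor _ _ := PUnit
  Cell _ _ _ _ _ _ _ _ := PUnit
  ident _ _ _ := ⟨⟩
  comp _ _ _ _ _ _ _ _ _ _ _ _ _ _ _ _ _ _ _ := ⟨⟩
  ident_comp _ := rfl
  comp_ident _ := rfl
  assoc _ _ _ _ _ _ _ _ := rfl

/-- The virtual double functor into a horizontally chaotic virtual double category determined by
a functor on vertical categories. -/
def VFunctor.toHc {A : VDC.{o, v, h, c}} {C : Type o₁} [Category.{v₁} C] (F : A.Obj ⥤ C) :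
    VFunctor A (hc C) where
  toFunctor := F
  hor _ _ _ := ⟨⟩
  cell _ _ _ _ _ _ _ _ _ := ⟨⟩
  cell_ident _ := HEq.rfl
  cell_comp _ _ _ _ := rfl

/-! ### Elements of paths -/

/-- An indexing of the graph `H`: every vertex has a small set of indices, and every edge a family
of small sets, indexed by the indices of its source and target. -/
structure Indexing (O : Type o) (H : O → O → Type h) where
  idx : O → Type u
  Fib : ∀ ⦃X Y : O⦄, H X Y → idx X → idx Y → Type u

/-- The elements from `i` to `j` of a path `Γ₁, …, Γₙ`: sequences
`i = i₀, s₁, i₁, …, sₙ, iₙ = j` with `sₖ` in the fibre of `Γₖ` over `(iₖ₋₁, iₖ)`. -/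
inductive Elt {O : Type o} {H : O → O → Type h} (D : Indexing.{o, h, u} O H) :
    ∀ {X Y : O}, HPath H X Y → D.idx X → D.idx Y → Type (max o h u)
  | nil {X : O} (i : D.idx X) : Elt D (.nil X) i i
  | cons {X Y Z : O} {Γ : H X Y} {p : HPath H Y Z} {i : D.idx X} {j : D.idx Y} {k : D.idx Z}
      (s : D.Fib Γ i j) (t : Elt D p j k) : Elt D (.cons Γ p) i k

namespace Elt

variable {O : Type o} {H : O → O → Type h} {D : Indexing.{o, h, u} O H}

/-- The first entry and the rest of an element of a non-empty path. -/
def uncons {X Y Z : O} {Γ : H X Y} {p : HPath H Y Z} {i : D.idx X} {k : D.idx Z} :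
    Elt D (.cons Γ p) i k → Σ j : D.idx Y, D.Fib Γ i j × Elt D p j k
  | .cons x t => ⟨_, x, t⟩

/-- An element of a concatenation of two paths is cut into two elements. -/
def split : ∀ {X Y : O} (p : HPath H X Y) {Z : O} {q : HPath H Y Z} {r : HPath H X Z}
    (_ : p.append q = r) {i : D.idx X} {k : D.idx Z} (_ : Elt D r i k),
    Σ j : D.idx Y, Elt D p i j × Elt D q j k
  | _, _, .nil _, _, _, _, e, i, _, s => ⟨i, .nil i, cast (by rw [← e]; rfl) s⟩
  | _, _, .cons Γ p, _, q, _, e, i, k, s =>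
      let y := uncons (cast (by rw [← e]; rfl) s : Elt D (.cons Γ (p.append q)) i k)
      let w := split p rfl y.2.2
      ⟨w.1, .cons y.2.1 w.2.1, w.2.2⟩

/-- `Join s t r`: the element `r` is the concatenation of `s` and `t`. -/
inductive Join : ∀ {X Y Z : O} {p : HPath H X Y} {q : HPath H Y Z} {r : HPath H X Z}
    {i : D.idx X} {j : D.idx Y} {k : D.idx Z}, Elt D p i j → Elt D q j k → Elt D r i k → Prop
  | nil {X Z : O} {q : HPath H X Z} {i : D.idx X} {k : D.idx Z} (t : Elt D q i k) :
      Join (.nil i) t t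
  | cons {X Y Z W : O} {Γ : H X Y} {p : HPath H Y Z} {q : HPath H Z W} {r : HPath H Y W}
      {i : D.idx X} {j : D.idx Y} {k : D.idx Z} {l : D.idx W} {s : Elt D p j k} {t : Elt D q k l}
      {w : Elt D r j l} (x : D.Fib Γ i j) (a : Join s t w) :
      Join (.cons x s : Elt D (.cons Γ p) i k) t (.cons x w : Elt D (.cons Γ r) i l)

theorem join_split {X Y : O} (p : HPath H X Y) {Z : O} {q : HPath H Y Z} {r : HPath H X Z}
    (e : p.append q = r) {i : D.idx X} {k : D.idx Z} (s : Elt D r i k) :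
    Join (split p e s).2.1 (split p e s).2.2 s := by
  subst e
  induction p with
  | nil X => exact .nil s
  | cons Γ p ih =>
    cases s with
    | cons x t => exact .cons x (ih t)

theorem split_join {X Y Z : O} {p : HPath H X Y} {q : HPath H Y Z} {r : HPath H X Z}
    {i : D.idx X} {j : D.idx Y} {k : D.idx Z} {s : Elt D p i j} {t : Elt D q j k} {w : Elt D r i k}
    (a : Join s t w) (e : p.append q = r) : split p e w = ⟨j, s, t⟩ := by
  induction a with
  | nil t => rfl
  | cons x a ih =>
    injection e with _ _ _ _ e
    subst e
    have := ih rfl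
    exact congrArg (fun y : Σ j : D.idx _, Elt D _ _ j × Elt D _ j _ =>
      (⟨y.1, .cons x y.2.1, y.2.2⟩ : Σ j : D.idx _, Elt D _ _ j × Elt D _ j _)) this

theorem exists_join {X Y : O} (p : HPath H X Y) {Z : O} {q : HPath H Y Z} {r : HPath H X Z}
    (e : p.append q = r) {i : D.idx X} {k : D.idx Z} (s : Elt D r i k) :
    ∃ (j : D.idx Y) (s₁ : Elt D p i j) (s₂ : Elt D q j k), Join s₁ s₂ s :=
  ⟨_, _, _, join_split p e s⟩

theorem join_nil {X Y : O} {p : HPath H X Y} {i : D.idx X} {j : D.idx Y} (s : Elt D p i j) :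
    Join s (.nil j) s := by
  induction s with
  | nil i => exact .nil _
  | cons x t ih => exact .cons x ih

theorem Join.assoc {X Y Z W : O} {p : HPath H X Y} {q : HPath H Y Z} {r : HPath H Z W}
    {pq : HPath H X Z} {pqr : HPath H X W} {i : D.idx X} {j : D.idx Y} {k : D.idx Z}
    {l : D.idx W} {s : Elt D p i j} {t : Elt D q j k} {w : Elt D r k l} {st : Elt D pq i k}
    {stw : Elt D pqr i l} (a : Join s t st) (b : Join st w stw) (tw : HPath H Y W)
    (e : q.append r = tw) :
    ∃ x : Elt D tw j l, Join t w x ∧ Join s x stw := by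
  subst e
  induction a with
  | nil t => 
    have : ∀ {X Y Z : O} {p : HPath H X Y} {q : HPath H Y Z} {r : HPath H X Z}
      {i : D.idx X} {j : D.idx Y} {k : D.idx Z} {s : Elt D p i j} {t : Elt D q j k}
      {w : Elt D r i k}, Join s t w → p.append q = r := by
      intro _ _ _ _ _ _ _ _ _ _ _ _ a
      induction a with
      | nil t => rfl
      | cons x a ih => subst ih; rfl
    have e := this b
    subst e
    exact ⟨_, b, .nil _⟩
  | cons x a ih =>
    cases b with
    | cons _ b =>
      obtain ⟨y, h₁, h₂⟩ := ih b
      exact ⟨y, h₁, .cons x h₂⟩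

theorem eq_of_nil {X : O} {i j : D.idx X} (s : Elt D (.nil X) i j) : i = j := by
  cases s; rfl

theorem exists_cons {X Y Z : O} {Γ : H X Y} {p : HPath H Y Z} {i : D.idx X} {k : D.idx Z}
    (s : Elt D (.cons Γ p) i k) : ∃ (j : D.idx Y) (x : D.Fib Γ i j) (t : Elt D p j k),
      s = .cons x t := by
  cases s with
  | cons x t => exact ⟨_, x, t, rfl⟩

theorem Join.exists_cons {X Y Z W : O} {Γ : H X Y} {p : HPath H Y Z} {q : HPath H Z W}
    {r : HPath H Y W} {i : D.idx X} {j : D.idx Y} {k : D.idx Z} {l : D.idx W}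
    {x : D.Fib Γ i j} {s : Elt D p j k} {t : Elt D q k l} {w : Elt D (.cons Γ r) i l}
    (a : Join (.cons x s) t w) : ∃ w' : Elt D r j l, w = .cons x w' ∧ Join s t w' := by
  cases a with
  | cons _ a => exact ⟨_, rfl, a⟩

section Lift

variable {O' : Type o₁} {H' : O' → O' → Type h₁} {D' : Indexing.{o₁, h₁, u} O' H'} (F : O → O')
  (f : ∀ ⦃X Y : O⦄, H X Y → H' (F X) (F Y)) (a : ∀ ⦃X : O⦄, D'.idx (F X) → D.idx X)
  (b : ∀ ⦃X Y : O⦄ ⦃Γ : H X Y⦄ ⦃i : D'.idx (F X)⦄ ⦃j : D'.idx (F Y)⦄,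
    D'.Fib (f Γ) i j → D.Fib Γ (a i) (a j))

/-- An element of the image of a path determines an element of the path. -/
def lift : ∀ {X Y : O} {p : HPath H X Y} {i : D'.idx (F X)} {j : D'.idx (F Y)}
    (_ : Elt D' (p.map F f) i j), Elt D p (a i) (a j)
  | _, _, .nil X, i, j, s => cast (by rw [eq_of_nil s]) (Elt.nil (D := D) (a i))
  | _, _, .cons _ _, _, _, s => .cons (b (uncons s).2.1) (lift (uncons s).2.2)

theorem lift_join {X Y Z : O} (p : HPath H X Y) {q : HPath H Y Z} {r : HPath H X Z}
    (e : p.append q = r) {i : D'.idx (F X)} {j : D'.idx (F Y)} {k : D'.idx (F Z)}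
    {s : Elt D' (p.map F f) i j} {t : Elt D' (q.map F f) j k} {w : Elt D' (r.map F f) i k}
    (j : Join s t w) : Join (lift F f a b s) (lift F f a b t) (lift F f a b w) := by
  subst e
  induction p with
  | nil X => cases s; cases j; exact .nil _
  | cons Γ p ih =>
    change Elt D' (.cons (f Γ) (p.map F f)) _ _ at s
    change Elt D' (.cons (f Γ) ((p.append q).map F f)) _ _ at w
    obtain ⟨_, x, y, rfl⟩ := exists_cons s
    obtain ⟨w, rfl, j'⟩ := j.exists_cons
    exact .cons _ (ih j')

end Lift

end Elt

/-! ### Spans of sets -/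

/-- A span `I ← S → J` of small sets. -/
structure SpanHor (I J : Type u) where
  apex : Type u
  src : apex → I
  tgt : apex → J

/-- The set of elements of the apex of a span lying over `i` and `j`. -/
abbrev SpanHor.Fiber {I J : Type u} (S : SpanHor I J) (i : I) (j : J) : Type u :=
  {s : S.apex // S.src s = i ∧ S.tgt s = j}

/-- The elements of a path of spans are the elements of the iterated pullback of the spans. -/
def spanIdx : Indexing.{u + 1, u + 1, u} (Type u) SpanHor.{u} :=
  ⟨fun I => I, fun _ _ S i j => S.Fiber i j⟩

/-- Multimaps of spans, i.e. functions from the iterated pullback of the top spans to the apex of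
the bottom span, compatible with the two outer functions. -/
abbrev SpanCell : CellFam.{u + 1, u, u + 1, u + 1} (Type u) SpanHor.{u} :=
  fun I J _ _ p f g S => ∀ ⦃i : spanIdx.idx I⦄ ⦃j : spanIdx.idx J⦄, Elt spanIdx p i j → S.Fiber (f i) (g j)

namespace SpanVDC

/-- The function between iterated pullbacks given by a chain of multimaps of spans. -/
def run : ∀ {I J K L : Type u} {p : HPath SpanHor I J} {f : I ⟶ K} {g : J ⟶ L}
    {q : HPath SpanHor K L} (_ : Sq SpanCell p f g q) {i : spanIdx.idx I} {j : spanIdx.idx J}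
    (_ : Elt spanIdx p i j), Elt spanIdx q (f i) (g j)
  | _, _, _, _, _, _, _, _, .nil f, _, _, .nil i => .nil (D := spanIdx) (f i)
  | _, _, _, _, _, _, _, _, .cons (r := r) θ Θ h, _, _, s =>
      let w := Elt.split r h s
      .cons (D := spanIdx) (θ w.2.1) (run Θ w.2.2)

theorem run_cons {A B C D E F : Type u} {r : HPath SpanHor A B} {p : HPath SpanHor B E}
    {s : HPath SpanHor A E} {u : A ⟶ C} {w : B ⟶ D} {v : E ⟶ F} {Δ : SpanHor C D}
    {q : HPath SpanHor D F} (θ : SpanCell r u w Δ) (Θ : Sq SpanCell p w v q)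
    (h : r.append p = s) {i : spanIdx.idx A} {j : spanIdx.idx B} {k : spanIdx.idx E} {x : Elt spanIdx r i j} {y : Elt spanIdx p j k}
    {z : Elt spanIdx s i k} (a : Elt.Join x y z) :
    run (.cons θ Θ h) z = .cons (D := spanIdx) (θ x) (run Θ y) := by
  rw [run, Elt.split_join a h]

theorem run_join {A B C D E F : Type u} {p₁ : HPath SpanHor A B} {p₂ : HPath SpanHor B E}
    {p : HPath SpanHor A E}
    {u : A ⟶ C} {w : B ⟶ D} {v : E ⟶ F} {q₁ : HPath SpanHor C D} {q₂ : HPath SpanHor D F}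
    {q : HPath SpanHor C F}
    {Θ₁ : Sq SpanCell p₁ u w q₁} {Θ₂ : Sq SpanCell p₂ w v q₂} {Θ : Sq SpanCell p u v q}
    (t : HApp Θ₁ Θ₂ Θ) {i : spanIdx.idx A} {j : spanIdx.idx B} {k : spanIdx.idx E} {x : Elt spanIdx p₁ i j} {y : Elt spanIdx p₂ j k}
    {z : Elt spanIdx p i k} (a : Elt.Join x y z) : Elt.Join (run Θ₁ x) (run Θ₂ y) (run Θ z) := by
  induction t with
  | nil Θ =>
    cases x with
    | nil i => cases a; exact .nil _
  | cons θ t h₁ h ih =>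
    obtain ⟨_, x₁, x₂, b⟩ := Elt.exists_join _ h₁ x
    obtain ⟨y', b₁, b₂⟩ := b.assoc a _ t.top
    rw [run_cons θ _ h₁ b, run_cons θ _ h b₂]
    exact .cons _ (ih b₁)

/-- Composition of multimaps of spans. -/
def comp : CompOp SpanCell := fun _ _ _ _ _ _ _ _ _ _ _ _ _ _ _ Θ θ hu hv =>
  hu ▸ hv ▸ fun _ _ s => θ (run Θ s)

theorem run_vcomp {A B C D E F : Type u} {p : HPath SpanHor A B} {u : A ⟶ C} {v : B ⟶ D}
    {q : HPath SpanHor C D} {u' : C ⟶ E} {v' : D ⟶ F} {r : HPath SpanHor E F}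
    {a : A ⟶ E} {b : B ⟶ F} {Θ : Sq SpanCell p u v q} {Ξ : Sq SpanCell q u' v' r}
    {Φ : Sq SpanCell p a b r} (t : VComp comp Θ Ξ Φ) {i : spanIdx.idx A} {j : spanIdx.idx B} (s : Elt spanIdx p i j) :
    run Φ s ≍ run Ξ (run Θ s) := by
  induction t with
  | nil h => subst h; cases s; rfl
  | cons a hu hw hq hp t ih =>
    obtain ⟨_, x, y, e⟩ := Elt.exists_join _ hp s
    rw [run_cons _ _ hp e, run_cons _ _ hq (run_join a e)]
    have hb := t.right
    subst hu hw hb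
    exact heq_of_eq (congrArg _ (eq_of_heq (ih y)))

theorem run_ids (ident : ∀ ⦃A B : Type u⦄ (S : SpanHor A B), SpanCell (HPath.one S) (𝟙 A) (𝟙 B) S)
    (hid : ∀ ⦃A B : Type u⦄ (S : SpanHor A B) (i : spanIdx.idx A) (j : spanIdx.idx B) (x : spanIdx.Fib S i j),
      ident S (.cons (D := spanIdx) x (.nil j)) = x)
    {A B : Type u} {p : HPath SpanHor A B} {i : spanIdx.idx A} {j : spanIdx.idx B} (s : Elt spanIdx p i j) :
    run (Sq.ids ident p) s = s := by
  induction s with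
  | nil i => rfl
  | cons x t ih =>
    refine (run_cons _ _ _ (.cons x (.nil t))).trans ?_
    rw [hid, ih]
    rfl

end SpanVDC

/-- The identity multimap of a span. -/
def SpanVDC.ident {I J : Type u} (S : SpanHor I J) : SpanCell (HPath.one S) (𝟙 I) (𝟙 J) S
  | _, _, .cons x (.nil _) => x

/-- The virtual double category of small sets, functions, spans and multimaps of spans. -/
def SpanVDC : VDC.{u + 1, u, u + 1, u + 1} where
  Obj := Type u
  Hor := SpanHor
  Cell := SpanCell
  ident _ _ S := SpanVDC.ident S
  comp := SpanVDC.comp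
  ident_comp {A B C D p u v Γ} θ := by
    funext i j s
    exact congrArg (θ (i := i) (j := j)) (SpanVDC.run_ids _ (fun _ _ _ _ _ _ => rfl) s)
  comp_ident {A B C D p u v Γ} θ := by
    funext i j s
    change SpanVDC.ident Γ (SpanVDC.run (Sq.single θ) s) = θ s
    refine (congrArg (SpanVDC.ident Γ (i := u i) (j := v j))
      (SpanVDC.run_cons θ _ p.append_nil (Elt.join_nil s))).trans rfl
  assoc κ t h₁ h₂ h₃ h₄ h₅ h₆ := by
    have ha := t.left
    have hb := t.right
    subst ha hb h₁ h₂ h₃ h₄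
    funext i j s
    exact congrArg (κ (i := _) (j := _)) (eq_of_heq (SpanVDC.run_vcomp t s)).symm

/-- The value of a morphism of the category of small sets. -/
abbrev SpanVDC.fn {I J : Type u} (f : I ⟶ J) (i : I) : J := f i

/-- The virtual double functor from the horizontally chaotic virtual double category on the category
of small sets to spans: it is the identity on the vertical categories, and maps the unique
horizontal morphism from `I` to `J` to the span `I ← I × J → J` of the projections. -/
def chaoticSpan : VFunctor (hc (Type u)) SpanVDC.{u} where
  toFunctor := Functor.id (Type u)
  hor I J _ := ⟨I × J, Prod.fst, Prod.snd⟩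
  cell I J K L _ f g _ _ := fun i j _ =>
    ⟨(SpanVDC.fn (I := I) (J := K) f i, SpanVDC.fn (I := J) (J := L) g j), rfl, rfl⟩
  cell_ident {I J} Γ := by
    apply heq_of_eq
    funext i j s
    cases s with
    | cons x t => cases t with
      | nil j => exact Subtype.ext (Prod.ext x.2.1.symm x.2.2.symm)
  cell_comp Θ θ hu hv := by
    funext i j s
    apply Subtype.ext
    subst hu hv
    rfl

/-! ### Families -/

/-- Small families of objects of `A`. -/
structure FamObj (A : VDC.{o, v, h, c}) where
  idx : Type u
  obj : idx → A.Obj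

/-- Morphisms of families: a function between the index sets and a family of vertical morphisms. -/
@[ext]
structure FamHom {A : VDC.{o, v, h, c}} (X Y : FamObj.{o, v, h, c, u} A) where
  map : X.idx → Y.idx
  hom : ∀ i, X.obj i ⟶ Y.obj (map i)

instance {A : VDC.{o, v, h, c}} : Category (FamObj.{o, v, h, c, u} A) where
  Hom := FamHom
  id X := ⟨id, fun i => 𝟙 (X.obj i)⟩
  comp f g := ⟨fun i => g.map (f.map i), fun i => f.hom i ≫ g.hom (f.map i)⟩
  id_comp f := FamHom.ext rfl (heq_of_eq (funext fun i => Category.id_comp (f.hom i)))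
  comp_id f := FamHom.ext rfl (heq_of_eq (funext fun i => Category.comp_id (f.hom i)))
  assoc f _ _ := FamHom.ext rfl (heq_of_eq (funext fun i => Category.assoc (f.hom i) _ _))

/-- A choice of a type of horizontal morphisms between families: every horizontal morphism
`Γ : X → Y` has, for all indices `i` of `X` and `j` of `Y`, a small set `Fib Γ i j`, and a family
of horizontal morphisms from `X i` to `Y j` in `A` indexed by this set. -/
structure FamSys (A : VDC.{o, v, h, c}) where
  H : FamObj.{o, v, h, c, u} A → FamObj.{o, v, h, c, u} A → Type t
  Fib : ∀ ⦃X Y⦄, H X Y → X.idx → Y.idx → Type u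
  hor : ∀ ⦃X Y⦄ (Γ : H X Y) ⦃i j⦄, Fib Γ i j → A.Hor (X.obj i) (Y.obj j)

namespace FamSys

variable {A : VDC.{o, v, h, c}} (S : FamSys.{o, v, h, c, u, t} A)

/-- The indexing underlying a system of families. -/
def ind : Indexing.{max o (u + 1), t, u} (FamObj A) S.H := ⟨FamObj.idx, S.Fib⟩

/-- The path in `A` indexed by an element of a path of families. -/
def path : ∀ {X Y : FamObj A} {p : HPath S.H X Y} {i : S.ind.idx X} {j : S.ind.idx Y},
    Elt S.ind p i j → A.Path (X.obj i) (Y.obj j)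
  | X, _, _, _, _, .nil i => .nil (X.obj i)
  | _, _, _, _, _, .cons (Γ := Γ) x s => .cons (S.hor Γ x) (path s)

theorem path_join {X Y Z : FamObj A} {p : HPath S.H X Y} {q : HPath S.H Y Z} {r : HPath S.H X Z}
    {i : S.ind.idx X} {j : S.ind.idx Y} {k : S.ind.idx Z} {s : Elt S.ind p i j}
    {t : Elt S.ind q j k} {w : Elt S.ind r i k} (a : Elt.Join s t w) :
    (S.path s).append (S.path t) = S.path w := by
  induction a with
  | nil t => rfl
  | cons x a ih => exact congrArg (HPath.cons _) ih

/-- The multicells: a function `map` on the elements of the top path, with values in the set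
indexing the bottom family, and a multicell of `A` for every element of the top path. -/
@[ext]
structure Cell ⦃X Y Z W : FamObj A⦄ (p : HPath S.H X Y) (f : X ⟶ Z) (g : Y ⟶ W)
    (Γ : S.H Z W) where
  map : ∀ ⦃i : S.ind.idx X⦄ ⦃j : S.ind.idx Y⦄, Elt S.ind p i j → S.Fib Γ (f.map i) (g.map j)
  cell : ∀ ⦃i : S.ind.idx X⦄ ⦃j : S.ind.idx Y⦄ (s : Elt S.ind p i j),
    A.Cell (S.path s) (f.hom i) (g.hom j) (S.hor Γ (map s))

/-- The action of a chain on elements. -/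
def run : ∀ {X Y Z W : FamObj A} {p : HPath S.H X Y} {f : X ⟶ Z} {g : Y ⟶ W}
    {q : HPath S.H Z W} (_ : Sq S.Cell p f g q) {i : S.ind.idx X} {j : S.ind.idx Y}
    (_ : Elt S.ind p i j), Elt S.ind q (f.map i) (g.map j)
  | _, _, _, _, _, _, _, _, .nil f, _, _, .nil i => .nil (D := S.ind) (f.map i)
  | _, _, _, _, _, _, _, _, .cons (r := r) θ Θ h, _, _, s =>
      let w := Elt.split r h s
      .cons (D := S.ind) (θ.map w.2.1) (run Θ w.2.2)

/-- The chain in `A` which a chain of multicells assigns to an element of its top path. -/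
def runCell : ∀ {X Y Z W : FamObj A} {p : HPath S.H X Y} {f : X ⟶ Z} {g : Y ⟶ W}
    {q : HPath S.H Z W} (Θ : Sq S.Cell p f g q) {i : S.ind.idx X} {j : S.ind.idx Y}
    (s : Elt S.ind p i j), A.Chain (S.path s) (f.hom i) (g.hom j) (S.path (S.run Θ s))
  | _, _, _, _, _, _, _, _, .nil f, _, _, .nil i => .nil (f.hom i)
  | _, _, _, _, _, _, _, _, .cons (r := r) θ Θ h, _, _, s =>
      let w := Elt.split r h s
      .cons (θ.cell w.2.1) (runCell Θ w.2.2) (S.path_join (Elt.join_split r h s))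

theorem run_cons {B C D E F G : FamObj A} {r : HPath S.H B C} {p : HPath S.H C F}
    {s : HPath S.H B F} {f : B ⟶ D} {w : C ⟶ E} {g : F ⟶ G} {Δ : S.H D E}
    {q : HPath S.H E G} (θ : S.Cell r f w Δ) (Θ : Sq S.Cell p w g q)
    (h : r.append p = s) {i : S.ind.idx B} {j : S.ind.idx C} {k : S.ind.idx F}
    {x : Elt S.ind r i j} {y : Elt S.ind p j k} {z : Elt S.ind s i k} (a : Elt.Join x y z) :
    S.run (.cons θ Θ h) z = .cons (D := S.ind) (θ.map x) (S.run Θ y) := by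
  rw [run, Elt.split_join a h]

theorem runCell_cons {B C D E F G : FamObj A} {r : HPath S.H B C} {p : HPath S.H C F}
    {s : HPath S.H B F} {f : B ⟶ D} {w : C ⟶ E} {g : F ⟶ G} {Δ : S.H D E}
    {q : HPath S.H E G} (θ : S.Cell r f w Δ) (Θ : Sq S.Cell p w g q)
    (h : r.append p = s) {i : S.ind.idx B} {j : S.ind.idx C} {k : S.ind.idx F}
    {x : Elt S.ind r i j} {y : Elt S.ind p j k} {z : Elt S.ind s i k} (a : Elt.Join x y z) :
    S.runCell (.cons θ Θ h) z ≍
      (Sq.cons (θ.cell x) (S.runCell Θ y) (S.path_join a) : A.Chain _ _ _ _) := by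
  have e := Elt.split_join a h
  have key : ∀ (w' : Σ j, Elt S.ind r i j × Elt S.ind p j k) (a' : Elt.Join w'.2.1 w'.2.2 z),
      w' = ⟨j, x, y⟩ →
      (Sq.cons (θ.cell w'.2.1) (S.runCell Θ w'.2.2) (S.path_join a') : A.Chain _ _ _ _) ≍
      (Sq.cons (θ.cell x) (S.runCell Θ y) (S.path_join a) : A.Chain _ _ _ _) := by
    intro w' a' e
    subst e
    rfl
  exact key _ (Elt.join_split r h z) e

theorem run_join {B C D E F G : FamObj A} {p₁ : HPath S.H B C} {p₂ : HPath S.H C F}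
    {p : HPath S.H B F} {f : B ⟶ D} {w : C ⟶ E} {g : F ⟶ G} {q₁ : HPath S.H D E}
    {q₂ : HPath S.H E G} {q : HPath S.H D G}
    {Θ₁ : Sq S.Cell p₁ f w q₁} {Θ₂ : Sq S.Cell p₂ w g q₂} {Θ : Sq S.Cell p f g q}
    (t : HApp Θ₁ Θ₂ Θ) {i : S.ind.idx B} {j : S.ind.idx C} {k : S.ind.idx F}
    {x : Elt S.ind p₁ i j} {y : Elt S.ind p₂ j k} {z : Elt S.ind p i k} (a : Elt.Join x y z) :
    Elt.Join (S.run Θ₁ x) (S.run Θ₂ y) (S.run Θ z) ∧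
      HApp (S.runCell Θ₁ x) (S.runCell Θ₂ y) (S.runCell Θ z) := by
  induction t with
  | nil Θ =>
    cases x with
    | nil i => cases a; exact ⟨.nil _, .nil _⟩
  | @cons _ _ _ _ _ _ _ _ _ _ _ _ _ _ _ _ _ _ _ _ _ _ Θ₁ Θ₂ Θ θ t h₁ h ih =>
    obtain ⟨_, x₁, x₂, b⟩ := Elt.exists_join _ h₁ x
    obtain ⟨y', b₁, b₂⟩ := b.assoc a _ t.top
    obtain ⟨c₁, c₂⟩ := ih b₁
    have e₁ := S.runCell_cons θ Θ₁ h₁ b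
    have e₂ := S.runCell_cons θ Θ h b₂
    revert e₁ e₂
    generalize S.runCell (.cons θ Θ₁ h₁) x = R₁
    generalize S.runCell (.cons θ Θ h) z = R₂
    revert R₁ R₂
    rw [S.run_cons θ Θ₁ h₁ b, S.run_cons θ Θ h b₂]
    intro R₁ R₂ e₁ e₂
    obtain rfl := eq_of_heq e₁
    obtain rfl := eq_of_heq e₂
    exact ⟨.cons _ c₁, .cons _ c₂ _ _⟩

/-- Composition of multicells of families. -/
def comp : CompOp S.Cell := fun _ _ _ _ _ _ _ _ _ _ _ _ _ _ _ Θ θ hu hv =>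
  hu ▸ hv ▸ ⟨fun _ _ s => θ.map (S.run Θ s),
    fun _ _ s => A.comp (S.runCell Θ s) (θ.cell (S.run Θ s)) rfl rfl⟩

theorem run_vcomp {B C D E F G : FamObj A} {p : HPath S.H B C} {f : B ⟶ D} {g : C ⟶ E}
    {q : HPath S.H D E} {f' : D ⟶ F} {g' : E ⟶ G} {r : HPath S.H F G}
    {a : B ⟶ F} {b : C ⟶ G} {Θ : Sq S.Cell p f g q} {Ξ : Sq S.Cell q f' g' r}
    {Φ : Sq S.Cell p a b r} (t : VComp S.comp Θ Ξ Φ) {i : S.ind.idx B} {j : S.ind.idx C}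
    (s : Elt S.ind p i j) :
    S.run Φ s ≍ S.run Ξ (S.run Θ s) ∧
    ∃ Z : A.Chain (S.path s) (f.hom i ≫ f'.hom (f.map i)) (g.hom j ≫ g'.hom (g.map j))
        (S.path (S.run Ξ (S.run Θ s))),
      VComp A.comp (S.runCell Θ s) (S.runCell Ξ (S.run Θ s)) Z ∧ S.runCell Φ s ≍ Z := by
  induction t with
  | nil h => subst h; cases s; exact ⟨HEq.rfl, _, .nil rfl, HEq.rfl⟩
  | @cons A₁ A₂ A₃ B₁ B₂ B₃ C₁ C₂ C₃ p₁ p₂ p u w v q₁ q₂ q u' w' v' Δ r a m b Θ₁ Θ₂ Θ ξ Ξ Φ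
      ap hu hw hq hp t ih =>
    obtain ⟨_, x, y, e⟩ := Elt.exists_join _ hp s
    have hb := t.right
    subst hu hw hb
    obtain ⟨j₁, j₂⟩ := S.run_join ap e
    obtain ⟨i₁, Z, i₂, i₃⟩ := ih y
    have e₁ := S.runCell_cons (S.comp Θ₁ ξ rfl rfl) Φ hp e
    have e₂ := S.runCell_cons ξ Ξ hq j₁
    revert e₁ e₂
    generalize S.runCell (.cons (S.comp Θ₁ ξ rfl rfl) Φ hp) s = R₁
    generalize S.runCell (.cons ξ Ξ hq) (S.run Θ s) = R₂
    revert R₁ R₂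
    rw [S.run_cons _ _ hp e, S.run_cons _ _ hq j₁]
    intro R₁ R₂ e₁ e₂
    obtain rfl := eq_of_heq e₁
    obtain rfl := eq_of_heq e₂
    clear e₁ e₂
    replace i₁ := eq_of_heq i₁
    generalize S.runCell Φ y = RΦ at *
    revert RΦ
    rw [i₁]
    intro RΦ i₃
    obtain rfl := eq_of_heq i₃
    exact ⟨HEq.rfl, _, .cons j₂ rfl rfl (S.path_join j₁) (S.path_join e) i₂, HEq.rfl⟩

end FamSys

namespace FamSys

variable {A : VDC.{o, v, h, c}} (S : FamSys.{o, v, h, c, u, t} A)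

/-- The value of a multicell of families at an element, together with its boundary. -/
def val {X Y Z W : FamObj A} {p : HPath S.H X Y} {f : X ⟶ Z} {g : Y ⟶ W} {Γ : S.H Z W}
    (θ : S.Cell p f g Γ) {i : S.ind.idx X} {j : S.ind.idx Y} (s : Elt S.ind p i j) :
    Σ (i' : Z.idx) (j' : W.idx) (x : S.Fib Γ i' j') (φ : X.obj i ⟶ Z.obj i')
      (ψ : Y.obj j ⟶ W.obj j'), A.Cell (S.path s) φ ψ (S.hor Γ x) :=
  ⟨f.map i, g.map j, θ.map s, f.hom i, g.hom j, θ.cell s⟩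

variable {S} in
theorem ext_val {X Y Z W : FamObj A} {p : HPath S.H X Y} {f : X ⟶ Z} {g : Y ⟶ W} {Γ : S.H Z W}
    {θ θ' : S.Cell p f g Γ}
    (e : ∀ {i : S.ind.idx X} {j : S.ind.idx Y} (s : Elt S.ind p i j), S.val θ s = S.val θ' s) :
    θ = θ' := by
  have hm : ∀ {i : S.ind.idx X} {j : S.ind.idx Y} (s : Elt S.ind p i j),
      (⟨θ.map s, θ.cell s⟩ : Σ x, A.Cell (S.path s) (f.hom i) (g.hom j) (S.hor Γ x)) =
        ⟨θ'.map s, θ'.cell s⟩ := by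
    intro i j s
    have := e s
    simp only [val, Sigma.mk.injEq, heq_eq_eq, true_and] at this
    obtain ⟨h₁, h₂⟩ := this
    revert h₂
    generalize θ.cell s = x
    generalize θ'.cell s = y
    revert x y
    rw [h₁]
    intro x y h₂
    simp only [Sigma.mk.injEq, heq_eq_eq, true_and] at h₂
    rw [h₂]
  obtain ⟨m, k⟩ := θ
  obtain ⟨m', k'⟩ := θ'
  obtain rfl : m = m' := by
    funext i j s
    exact congrArg Sigma.fst (hm s)
  congr 1
  funext i j s
  exact eq_of_heq (Sigma.mk.inj (hm s)).2

theorem val_comp {B C D E F G : FamObj A} {p : HPath S.H B C} {f : B ⟶ D} {g : C ⟶ E}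
    {q : HPath S.H D E} {f' : D ⟶ F} {g' : E ⟶ G} {Γ : S.H F G} {a : B ⟶ F} {b : C ⟶ G}
    (Θ : Sq S.Cell p f g q) (θ : S.Cell q f' g' Γ) (hu : f ≫ f' = a) (hv : g ≫ g' = b)
    {i : S.ind.idx B} {j : S.ind.idx C} (s : Elt S.ind p i j) :
    S.val (S.comp Θ θ hu hv) s = ⟨f'.map (f.map i), g'.map (g.map j), θ.map (S.run Θ s),
      f.hom i ≫ f'.hom (f.map i), g.hom j ≫ g'.hom (g.map j),
      A.comp (S.runCell Θ s) (θ.cell (S.run Θ s)) rfl rfl⟩ := by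
  subst hu hv; rfl

theorem mk_val {X Y Z W : FamObj A} {Γ : S.H Z W} {i : X.idx} {j : Y.idx}
    {q : A.Path (X.obj i) (Y.obj j)} {i' : Z.idx} {j' : W.idx} {x : S.Fib Γ i' j'}
    {φ : X.obj i ⟶ Z.obj i'} {ψ : Y.obj j ⟶ W.obj j'} {B C : A.Obj}
    {p : A.Path B C}
    {m : X.obj i ⟶ B} {n : B ⟶ Z.obj i'} {m' : Y.obj j ⟶ C} {n' : C ⟶ W.obj j'}
    {Θ : A.Chain q m m' p} {θ : A.Cell p n n' (S.hor Γ x)} {θ' : A.Cell q φ ψ (S.hor Γ x)}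
    (hφ : m ≫ n = φ) (hψ : m' ≫ n' = ψ) (e : A.comp Θ θ hφ hψ = θ') :
    (⟨i', j', x, m ≫ n, m' ≫ n', A.comp Θ θ rfl rfl⟩ :
      Σ (i' : Z.idx) (j' : W.idx) (x : S.Fib Γ i' j') (φ : X.obj i ⟶ Z.obj i')
      (ψ : Y.obj j ⟶ W.obj j'), A.Cell q φ ψ (S.hor Γ x)) = ⟨i', j', x, φ, ψ, θ'⟩ := by
  subst hφ hψ e; rfl

/-- The identity multicells of families. -/
def ident {X Y : FamObj A} (Γ : S.H X Y) : S.Cell (HPath.one Γ) (𝟙 X) (𝟙 Y) Γ where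
  map | _, _, .cons x (.nil _) => x
  cell | _, _, .cons x (.nil _) => A.ident (S.hor Γ x)

theorem run_ids {X Y : FamObj A} {p : HPath S.H X Y} {i : S.ind.idx X} {j : S.ind.idx Y}
    (s : Elt S.ind p i j) :
    S.run (Sq.ids (K := S.Cell) (fun _ _ Γ => S.ident Γ) p) s = s ∧
      S.runCell (Sq.ids (K := S.Cell) (fun _ _ Γ => S.ident Γ) p) s ≍ A.ids (S.path s) := by
  induction s with
  | nil i => exact ⟨rfl, HEq.rfl⟩
  | @cons X Y Z Γ p i j k x t ih =>
    have e : Elt.Join (.cons x (.nil j) : Elt S.ind (HPath.one Γ) i j) t (.cons x t) :=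
      .cons x (.nil t)
    have e₁ := S.runCell_cons (S.ident Γ) (Sq.ids (K := S.Cell) (fun _ _ Γ => S.ident Γ) p) rfl e
    have e₂ := S.run_cons (S.ident Γ) (Sq.ids (K := S.Cell) (fun _ _ Γ => S.ident Γ) p) rfl e
    obtain ⟨ih₁, ih₂⟩ := ih
    revert ih₂ e₁ e₂
    generalize S.runCell (Sq.ids (K := S.Cell) (fun _ _ Γ => S.ident Γ) p) t = R
    revert R
    generalize S.run (Sq.ids (K := S.Cell) (fun _ _ Γ => S.ident Γ) p) t = r at *
    subst ih₁
    intro R e₁ e₂ ih₂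
    obtain rfl := eq_of_heq ih₂
    exact ⟨e₂, e₁⟩

/-- The virtual double category of families determined by a system of horizontal morphisms. -/
def vdc : VDC where
  Obj := FamObj.{o, v, h, c, u} A
  Hor := S.H
  Cell := S.Cell
  ident _ _ Γ := S.ident Γ
  comp := S.comp
  ident_comp {X Y Z W p f g Γ} θ := by
    apply ext_val
    intro i j s
    rw [val_comp]
    obtain ⟨h₁, h₂⟩ := S.run_ids s
    revert h₂
    generalize S.runCell (Sq.ids (K := S.Cell) (fun _ _ Γ => S.ident Γ) p) s = R
    revert R
    generalize S.run (Sq.ids (K := S.Cell) (fun _ _ Γ => S.ident Γ) p) s = r at *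
    subst h₁
    intro R h₂
    obtain rfl := eq_of_heq h₂
    exact S.mk_val _ _ (A.ident_comp (θ.cell r))
  comp_ident {X Y Z W p f g Γ} θ := by
    apply ext_val
    intro i j s
    rw [val_comp]
    have e₁ := S.run_cons θ (.nil g) p.append_nil (Elt.join_nil s)
    have e₂ := S.runCell_cons θ (.nil g) p.append_nil (Elt.join_nil s)
    unfold Sq.single
    generalize S.runCell (.cons θ (.nil g) p.append_nil) s = R at *
    revert R
    generalize S.run (.cons θ (.nil g) p.append_nil) s = r at *
    subst e₁
    intro R h₂
    obtain rfl := eq_of_heq h₂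
    exact S.mk_val _ _ (A.comp_ident (θ.cell s))
  assoc {_ _ _ _ _ _ _ _ p q r Γ u v u' v' u'' v'' a b a' b' x y Θ Ξ Φ} κ t h₁ h₂ h₃ h₄ h₅ h₆ := by
    apply ext_val
    intro i j s
    rw [val_comp, val_comp]
    obtain ⟨e₁, Z, e₂, e₃⟩ := S.run_vcomp t s
    have ha := t.left
    have hb := t.right
    subst ha hb h₁ h₂
    generalize S.runCell Φ s = R at *
    revert R
    generalize S.run Φ s = r at *
    obtain rfl := eq_of_heq e₁
    intro R e₃
    obtain rfl := eq_of_heq e₃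
    have e₄ := A.assoc (κ.cell (S.run Ξ (S.run Θ s))) e₂ rfl rfl rfl rfl (Category.assoc _ _ _)
      (Category.assoc _ _ _)
    exact S.mk_val rfl rfl e₄ |>.trans (S.mk_val (Category.assoc _ _ _) (Category.assoc _ _ _)
      rfl).symm

end FamSys

section MATFAM

variable (A : VDC.{o, v, h, c})

/-- Matrices of horizontal morphisms. -/
def matSys : FamSys.{o, v, h, c, u, max u h} A where
  H X Y := ∀ (i : X.idx) (j : Y.idx), A.Hor (X.obj i) (Y.obj j)
  Fib _ _ _ _ _ := PUnit
  hor _ _ Γ i j _ := Γ i j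

/-- The virtual double category of matrices in `A`.  Its objects are the small families of objects of
`A`, its vertical morphisms are the morphisms of families, its horizontal morphisms are matrices,
and its multicells are families of multicells of `A` indexed by sequences of indices. -/
def MatVDC : VDC := (matSys.{o, v, h, c, u} A).vdc

/-- A span between the index sets, with a family of horizontal morphisms indexed by its apex.
The family is written fibrewise: the element `s` of the apex over `i` and `j` indexes a horizontal
morphism from `X i` to `Y j`. -/
structure FamHor (X Y : FamObj.{o, v, h, c, u} A) where
  span : SpanHor.{u} X.idx Y.idx
  hor : ∀ ⦃i : X.idx⦄ ⦃j : Y.idx⦄, span.Fiber i j → A.Hor (X.obj i) (Y.obj j)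

/-- Families of horizontal morphisms indexed by spans. -/
def famSys : FamSys.{o, v, h, c, u, max (u + 1) h} A where
  H := FamHor A
  Fib _ _ Γ i j := Γ.span.Fiber i j
  hor _ _ Γ _ _ s := Γ.hor s

/-- The virtual double category of families in `A`.  Its objects are the small families of objects
of `A`, its vertical morphisms are the morphisms of families, its horizontal morphisms are spans
between index sets together with a family of horizontal morphisms of `A` indexed by the apex, and
its multicells are multimaps of spans together with a family of multicells of `A` indexed by the
iterated pullback of the top spans. -/
def FamVDC : VDC := (famSys.{o, v, h, c, u} A).vdc

/-- The index set functor. -/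
def famIdx : FamObj.{o, v, h, c, u} A ⥤ Type u where
  obj := FamObj.idx
  map f := TypeCat.ofHom f.map

/-- The virtual double functor from matrices in `A` to the horizontally chaotic virtual double
category on the category of small sets, taking index sets. -/
def matIdx : VFunctor (MatVDC.{o, v, h, c, u} A) (hc (Type u)) :=
  VFunctor.toHc (A := MatVDC.{o, v, h, c, u} A) (famIdx A)

variable {A}

variable (A) in
/-- The span of a family of horizontal morphisms. -/
def famSpanHor ⦃X Y : FamObj.{o, v, h, c, u} A⦄ (Γ : (famSys A).H X Y) :
    SpanHor ((famIdx A).obj X) ((famIdx A).obj Y) :=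
  FamHor.span Γ

/-- An element of the iterated pullback of the underlying spans is an element of a path of
families. -/
def famLift {X Y : FamObj.{o, v, h, c, u} A} {p : HPath (famSys A).H X Y}
    {i : spanIdx.idx ((famIdx A).obj X)} {j : spanIdx.idx ((famIdx A).obj Y)}
    (s : Elt spanIdx (p.map (famIdx A).obj (famSpanHor A)) i j) : Elt (famSys A).ind p i j :=
  Elt.lift (D := (famSys A).ind) (D' := spanIdx) (famIdx A).obj (famSpanHor A)
    (fun _ i => i) (fun _ _ _ _ _ x => x) s

/-- The multimap of spans underlying a multicell of families. -/
def famSpanCell ⦃X Y Z W : FamObj.{o, v, h, c, u} A⦄ ⦃p : HPath (famSys A).H X Y⦄ ⦃f : X ⟶ Z⦄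
    ⦃g : Y ⟶ W⦄ ⦃Γ : (famSys A).H Z W⦄ (θ : (famSys A).Cell p f g Γ) :
    SpanCell (p.map (famIdx A).obj (famSpanHor A)) ((famIdx A).map f) ((famIdx A).map g)
      (famSpanHor A Γ) :=
  fun _ _ s => θ.map (famLift s)

theorem famLift_run {X Y Z W : FamObj.{o, v, h, c, u} A} {p : HPath (famSys A).H X Y} {f : X ⟶ Z}
    {g : Y ⟶ W} {q : HPath (famSys A).H Z W} (Θ : Sq (famSys A).Cell p f g q)
    {i : spanIdx.idx ((famIdx A).obj X)} {j : spanIdx.idx ((famIdx A).obj Y)}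
    (s : Elt spanIdx (p.map (famIdx A).obj (famSpanHor A)) i j) :
    famLift (SpanVDC.run (Θ.map (K' := SpanCell) (famIdx A) (famSpanHor A) famSpanCell) s) =
      (famSys A).run Θ (famLift s) := by
  induction Θ with
  | nil f => cases s; rfl
  | @cons _ _ _ _ _ _ r p _ _ _ _ _ _ θ Θ h ih =>
    have h' := congrArg (HPath.map (famIdx A).obj (famSpanHor A)) h
    rw [HPath.map_append] at h'
    obtain ⟨k, s₁, s₂, a⟩ := Elt.exists_join _ h' s
    have e₁ := Elt.lift_join (D := (famSys A).ind) (D' := spanIdx) (famIdx A).obj (famSpanHor A)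
      (fun _ i => i) (fun _ _ _ _ _ x => x) r h a
    refine Eq.trans ?_ ((famSys A).run_cons θ Θ h e₁).symm
    refine (congrArg famLift (SpanVDC.run_cons (famSpanCell θ) _ _ a)).trans ?_
    exact congrArg (Elt.cons (D := (famSys A).ind) (θ.map (famLift s₁))) (ih s₂)

variable (A) in
/-- The virtual double functor from families in `A` to spans, forgetting the families. -/
def famSpan : VFunctor (FamVDC.{o, v, h, c, u} A) SpanVDC.{u} where
  toFunctor := famIdx A
  hor := famSpanHor A
  cell := famSpanCell
  cell_ident {X Y} Γ := by
    apply heq_of_eq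
    funext i j s
    obtain ⟨_, x, y, rfl⟩ := Elt.exists_cons s
    cases y
    rfl
  cell_comp {_ _ _ _ _ _ p u v q _ _ _ _ _} Θ θ hu hv := by
    subst hu hv
    funext i j s
    exact congrArg (θ.map (i := _) (j := _)) (famLift_run Θ s).symm

variable (A) in
/-- A matrix of horizontal morphisms, as a family indexed by the span of the projections. -/
def matFamHor ⦃X Y : FamObj.{o, v, h, c, u} A⦄ (Γ : (matSys A).H X Y) :
    (famSys A).H ((𝟭 (FamObj A)).obj X) ((𝟭 (FamObj A)).obj Y) :=
  (⟨⟨X.idx × Y.idx, Prod.fst, Prod.snd⟩, fun i j _ => Γ i j⟩ : FamHor A X Y)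

/-- The sequence of indices of an element of a path of matrices. -/
def matLift {X Y : FamObj.{o, v, h, c, u} A} {p : HPath (matSys A).H X Y}
    {i : (famSys A).ind.idx ((𝟭 (FamObj A)).obj X)} {j : (famSys A).ind.idx ((𝟭 (FamObj A)).obj Y)}
    (s : Elt (famSys A).ind (p.map (𝟭 (FamObj A)).obj (matFamHor A)) i j) :
    Elt (matSys A).ind p i j :=
  Elt.lift (D := (matSys A).ind) (D' := (famSys A).ind) (𝟭 (FamObj A)).obj (matFamHor A)
    (fun _ i => i) (fun _ _ _ _ _ _ => ⟨⟩) s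

theorem matLift_path {X Y : FamObj.{o, v, h, c, u} A} {p : HPath (matSys A).H X Y}
    {i : (famSys A).ind.idx ((𝟭 (FamObj A)).obj X)} {j : (famSys A).ind.idx ((𝟭 (FamObj A)).obj Y)}
    (s : Elt (famSys A).ind (p.map (𝟭 (FamObj A)).obj (matFamHor A)) i j) :
    (matSys A).path (matLift s) = (famSys A).path s := by
  induction p with
  | nil X => cases s; rfl
  | cons Γ p ih =>
    obtain ⟨_, x, y, rfl⟩ := Elt.exists_cons s
    exact congrArg (HPath.cons _) (ih y)

/-- The multicell of families given by a multicell of matrices. -/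
def matFamCell ⦃X Y Z W : FamObj.{o, v, h, c, u} A⦄ ⦃p : HPath (matSys A).H X Y⦄ ⦃f : X ⟶ Z⦄
    ⦃g : Y ⟶ W⦄ ⦃Γ : (matSys A).H Z W⦄ (θ : (matSys A).Cell p f g Γ) :
    (famSys A).Cell (p.map (𝟭 (FamObj A)).obj (matFamHor A)) ((𝟭 (FamObj A)).map f)
      ((𝟭 (FamObj A)).map g) (matFamHor A Γ) where
  map i j _ := ⟨(f.map i, g.map j), rfl, rfl⟩
  cell _ _ s := VDC.castTop (matLift_path s) (θ.cell (matLift s))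

theorem matLift_run {X Y Z W : FamObj.{o, v, h, c, u} A} {p : HPath (matSys A).H X Y} {f : X ⟶ Z}
    {g : Y ⟶ W} {q : HPath (matSys A).H Z W} (Θ : Sq (matSys A).Cell p f g q)
    {i : (famSys A).ind.idx ((𝟭 (FamObj A)).obj X)} {j : (famSys A).ind.idx ((𝟭 (FamObj A)).obj Y)}
    (s : Elt (famSys A).ind (p.map (𝟭 (FamObj A)).obj (matFamHor A)) i j) :
    matLift ((famSys A).run (Θ.map (K' := (famSys A).Cell) (𝟭 (FamObj A)) (matFamHor A)
      matFamCell) s) = (matSys A).run Θ (matLift s) ∧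
    (famSys A).runCell (Θ.map (K' := (famSys A).Cell) (𝟭 (FamObj A)) (matFamHor A)
      matFamCell) s ≍ (matSys A).runCell Θ (matLift s) := by
  induction Θ with
  | nil f => cases s; exact ⟨rfl, HEq.rfl⟩
  | @cons _ _ _ _ _ _ r p _ _ _ _ _ _ θ Θ h ih =>
    have h' := congrArg (HPath.map (𝟭 (FamObj A)).obj (matFamHor A)) h
    rw [HPath.map_append] at h'
    obtain ⟨k, s₁, s₂, a⟩ := Elt.exists_join _ h' s
    have e₁ := Elt.lift_join (D := (matSys A).ind) (D' := (famSys A).ind) (𝟭 (FamObj A)).obj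
      (matFamHor A) (fun _ i => i) (fun _ _ _ _ _ _ => ⟨⟩) r h a
    obtain ⟨ih₁, ih₂⟩ := ih s₂
    constructor
    · refine Eq.trans ?_ ((matSys A).run_cons θ Θ h e₁).symm
      refine (congrArg matLift ((famSys A).run_cons (matFamCell θ) _ _ a)).trans ?_
      exact congrArg (Elt.cons (D := (matSys A).ind) PUnit.unit) ih₁
    · refine HEq.trans ?_ ((matSys A).runCell_cons θ Θ h e₁).symm
      refine ((famSys A).runCell_cons (matFamCell θ) _ _ a).trans ?_
      refine Sq.cons_heq (K := A.Cell) (matLift_path s₁).symm (matLift_path s₂).symm ?_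
        (VDC.castTop_heq _ _) ih₂ _ _
      exact (matLift_path _).symm.trans (congrArg (matSys A).path ih₁)

variable (A) in
/-- The virtual double functor from matrices to families: it is the identity on the vertical
categories, and regards a matrix as a family indexed by the span of the projections. -/
def matFam : VFunctor (MatVDC.{o, v, h, c, u} A) (FamVDC.{o, v, h, c, u} A) where
  toFunctor := 𝟭 (FamObj A)
  hor := matFamHor A
  cell := matFamCell
  cell_ident {X Y} Γ := by
    apply heq_of_eq
    apply FamSys.ext_val
    intro i j s
    obtain ⟨_, x, y, rfl⟩ := Elt.exists_cons s
    cases y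
    obtain ⟨⟨x₁, x₂⟩, h₁, h₂⟩ := x
    change x₁ = i at h₁
    change x₂ = _ at h₂
    subst h₁ h₂
    rfl
  cell_comp {X Y Z W V T p f g q f' g' Γ a b} Θ θ hu hv := by
    subst hu hv
    apply FamSys.ext_val
    intro i j s
    obtain ⟨e₁, e₂⟩ := matLift_run Θ s
    have e₃ := matLift_path ((famSys A).run (Θ.map (K' := (famSys A).Cell) (𝟭 (FamObj A))
      (matFamHor A) matFamCell) s)
    refine Eq.trans ?_ ((famSys A).val_comp (Θ.map (K' := (famSys A).Cell) (𝟭 (FamObj A))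
      (matFamHor A) matFamCell) (matFamCell θ) rfl rfl s).symm
    refine congrArg (fun k => (⟨f'.map (f.map i), g'.map (g.map j), _, _, _, k⟩ :
      Σ (i' : V.idx) (j' : T.idx) (x : (famSys A).Fib (matFamHor A Γ) i' j')
        (φ : X.obj i ⟶ V.obj i') (ψ : Y.obj j ⟶ T.obj j'),
        A.Cell ((famSys A).path s) φ ψ ((famSys A).hor (matFamHor A Γ) x))) (eq_of_heq ?_)
    refine (VDC.castTop_heq _ _).trans ?_
    refine VDC.comp_heq (matLift_path s) ?_ e₂.symm ?_ _ _ _ _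
    · exact (congrArg (matSys A).path e₁).symm.trans e₃
    · refine HEq.trans ?_ (VDC.castTop_heq _ _).symm
      rw [e₁]

end MATFAM

/-! ### Horizontal units -/

namespace VDC

variable (A : VDC.{o, v, h, c})

/-- The chain obtained from `Θ` by adding the identity cells of the horizontal morphisms of `p₁`
on the left. -/
def pre {D E : A.Obj} : ∀ {X : A.Obj} (p₁ : A.Path X D) {p q : A.Path D E}
    (_ : A.Chain p (𝟙 D) (𝟙 E) q), A.Chain (p₁.append p) (𝟙 X) (𝟙 E) (p₁.append q)
  | _, .nil _, _, _, Θ => Θ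
  | _, .cons Γ p₁, _, _, Θ => .cons (A.ident Γ) (pre p₁ Θ) rfl

/-- The chain consisting of the identity cells of the horizontal morphisms of `p₁`, the multicell
`η`, and the identity cells of the horizontal morphisms of `p₂`. -/
abbrev insert {D : A.Obj} {U : A.Hor D D} (η : A.Cell (.nil D) (𝟙 D) (𝟙 D) U) {X Y : A.Obj}
    (p₁ : A.Path X D) (p₂ : A.Path D Y) :
    A.Chain (p₁.append p₂) (𝟙 X) (𝟙 Y) (p₁.append (.cons U p₂)) :=
  A.pre p₁ (.cons η (A.ids p₂) rfl)

/-- A nullary multicell from `D` to `U : D → D` with identity sides is opcartesian if every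
multicell extends uniquely along the insertion of `U` at an occurrence of `D` in its top path. -/
def IsOpcartesian {D : A.Obj} {U : A.Hor D D} (η : A.Cell (.nil D) (𝟙 D) (𝟙 D) U) : Prop :=
  ∀ ⦃X Y E E' : A.Obj⦄ (p₁ : A.Path X D) (p₂ : A.Path D Y) (u : X ⟶ E) (u' : Y ⟶ E')
    (Δ : A.Hor E E') (θ : A.Cell (p₁.append p₂) u u' Δ),
    ∃! θ' : A.Cell (p₁.append (.cons U p₂)) u u' Δ,
      A.comp (A.insert η p₁ p₂) θ' (Category.id_comp u) (Category.id_comp u') = θ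

end VDC

/-- Unital virtual double categories: every object has a chosen horizontal unit. -/
structure UVDC extends VDC.{o, v, h, c} where
  unit : ∀ D : Obj, Hor D D
  eta : ∀ D : Obj, Cell (.nil D) (𝟙 D) (𝟙 D) (unit D)
  opcart : ∀ D : Obj, toVDC.IsOpcartesian (eta D)

/-- Unital virtual double functors: they preserve the chosen horizontal units strictly. -/
structure UFunctor (D : UVDC.{o, v, h, c}) (E : UVDC.{o₁, v₁, h₁, c₁}) extends
    VFunctor D.toVDC E.toVDC where
  map_unit : ∀ X : D.Obj, hor (D.unit X) = E.unit (toFunctor.obj X)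
  map_eta : ∀ X : D.Obj, cell (D.eta X) ≍ E.eta (toFunctor.obj X)

/-- Composition of unital virtual double functors. -/
def UFunctor.comp {D : UVDC.{o, v, h, c}} {E : UVDC.{o₁, v₁, h₁, c₁}} {L : UVDC.{o₂, v₂, h₂, c₂}}
    (F : UFunctor D E) (G : UFunctor E L) : UFunctor D L where
  toVFunctor := F.toVFunctor.comp G.toVFunctor
  map_unit X := (congrArg (fun Γ => G.hor Γ) (F.map_unit X)).trans (G.map_unit _)
  map_eta X := by
    have key : ∀ {Z : E.Obj} {a b a' b' : Z ⟶ Z} {Γ Γ' : E.Hor Z Z} {θ : E.Cell (.nil Z) a b Γ}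
        {θ' : E.Cell (.nil Z) a' b' Γ'}, a = a' → b = b' → Γ = Γ' → θ ≍ θ' →
        G.cell θ ≍ G.cell θ' := by
      intro _ _ _ _ _ _ _ _ _ ha hb hΓ hθ
      subst ha hb hΓ hθ
      rfl
    refine HEq.trans ?_ ((key (F.toFunctor.map_id X) (F.toFunctor.map_id X)
      (F.map_unit X) (F.map_eta X)).trans (G.map_eta _))
    exact VDC.castTop_heq (HPath.map_map _ _ _ _ (.nil X)) (G.cell (F.cell (D.eta X)))

/-- The square with upper leg `P`, left leg `Q`, right leg `F` and lower leg `G` is a (strict)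
pullback in the 2-category of unital virtual double categories, unital virtual double functors and
arbitrary vertical transformations. -/
structure UVDC.IsPullback {X : UVDC.{o, v, h, c}} {Y : UVDC.{o₁, v₁, h₁, c₁}}
    {Z : UVDC.{o₂, v₂, h₂, c₂}} {W : UVDC.{o₃, v₃, h₃, c₃}} (P : UFunctor X Y) (Q : UFunctor X Z)
    (F : UFunctor Y W) (G : UFunctor Z W) : Prop where
  comm : P.comp F = Q.comp G
  lift : ∀ (T : UVDC.{o₄, v₄, h₄, c₄}) (R : UFunctor T Y) (S : UFunctor T Z),
    R.comp F = S.comp G → ∃! K : UFunctor T X, K.comp P = R ∧ K.comp Q = S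
  lift₂ : ∀ (T : UVDC.{o₄, v₄, h₄, c₄}) (K L : UFunctor T X)
    (α : VTrans (K.comp P).toVFunctor (L.comp P).toVFunctor)
    (β : VTrans (K.comp Q).toVFunctor (L.comp Q).toVFunctor),
    α.whisker F.toVFunctor ≍ β.whisker G.toVFunctor →
    ∃! γ : VTrans K.toVFunctor L.toVFunctor,
      γ.whisker P.toVFunctor = α ∧ γ.whisker Q.toVFunctor = β

/-- Horizontally chaotic virtual double categories are unital. -/
def uhc (C : Type o) [Category.{v} C] : UVDC.{o, v, 0, 0} where
  toVDC := hc C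
  unit _ := ⟨⟩
  eta _ := ⟨⟩
  opcart _ _ _ _ _ _ _ _ _ _ _ := ⟨⟨⟩, rfl, fun _ _ => rfl⟩

/-- The unital virtual double functor into a horizontally chaotic virtual double category determined
by a functor on vertical categories. -/
def UFunctor.toHc {D : UVDC.{o, v, h, c}} {C : Type o₁} [Category.{v₁} C] (F : D.Obj ⥤ C) :
    UFunctor D (uhc C) where
  toVFunctor := VFunctor.toHc F
  map_unit _ := rfl
  map_eta _ := HEq.rfl

section Toolkit

variable {O : Type o} [Category.{v} O] {H : O → O → Type h} {K : CellFam.{o, v, h, c} O H}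

/-- The chain consisting of two multicells. -/
abbrev Sq.pair {A B C D E F : O} {p : HPath H A B} {q : HPath H B C} {r : HPath H A C}
    {u : A ⟶ D} {w : B ⟶ E} {v : C ⟶ F} {Γ : H D E} {Δ : H E F} (θ : K p u w Γ) (φ : K q w v Δ)
    (h : p.append q = r := by rfl) : Sq K r u v (.cons Γ (.one Δ)) := .cons θ (.single φ) h

theorem HApp.append_nil {A B C D : O} {p : HPath H A B} {u : A ⟶ C} {v : B ⟶ D} {q : HPath H C D}
    (Θ : Sq K p u v q) : HApp Θ (.nil v) Θ := by
  induction Θ with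
  | nil u => exact .nil _
  | cons θ Θ h ih => exact .cons θ ih h h

theorem HApp.exists {A C D E F : O} {p : HPath H A E} {u : A ⟶ C} {v : E ⟶ F} {q : HPath H C F}
    (Θ : Sq K p u v q) (q₁ : HPath H C D) (q₂ : HPath H D F) (e : q₁.append q₂ = q) :
    ∃ (B : O) (p₁ : HPath H A B) (p₂ : HPath H B E) (w : B ⟶ D) (Θ₁ : Sq K p₁ u w q₁)
      (Θ₂ : Sq K p₂ w v q₂), HApp Θ₁ Θ₂ Θ := by
  subst e
  induction q₁ generalizing A with
  | nil C => exact ⟨_, _, _, _, _, _, .nil Θ⟩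
  | cons Γ q₁ ih =>
    cases Θ with
    | cons θ Θ h =>
      obtain ⟨_, _, _, _, _, _, a⟩ := ih q₂ Θ
      exact ⟨_, _, _, _, _, _, .cons θ a rfl h⟩

theorem VComp.exists (comp : CompOp K) {A B C D E F : O} {p : HPath H A B} {u : A ⟶ C} {v : B ⟶ D}
    {q : HPath H C D} {u' : C ⟶ E} {v' : D ⟶ F} {r : HPath H E F} {a : A ⟶ E} {b : B ⟶ F}
    (Θ : Sq K p u v q) (Ξ : Sq K q u' v' r) (ha : u ≫ u' = a) (hb : v ≫ v' = b) :
    ∃ Φ : Sq K p a b r, VComp comp Θ Ξ Φ := by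
  induction Ξ generalizing A with
  | nil w =>
    cases Θ
    obtain rfl := ha.symm.trans hb
    exact ⟨_, .nil ha⟩
  | cons ξ Ξ h ih =>
    obtain ⟨_, _, _, w, Θ₁, Θ₂, e⟩ := HApp.exists Θ _ _ h
    obtain ⟨Φ, t⟩ := ih (a := w ≫ _) Θ₂ rfl hb
    exact ⟨_, .cons e ha rfl h e.top t⟩

namespace VDC

variable {A : VDC.{o, v, h, c}}

theorem happ_ids {X Y Z : A.Obj} (p : A.Path X Y) (q : A.Path Y Z) (r : A.Path X Z)
    (e : p.append q = r) : HApp (A.ids p) (A.ids q) (A.ids r) := by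
  subst e
  induction p with
  | nil X => exact .nil _
  | cons Γ p ih => exact .cons _ (ih q) _ _

theorem vcomp_ids {X Y Z W : A.Obj} {p : A.Path X Y} {u : X ⟶ Z} {v : Y ⟶ W} {q : A.Path Z W}
    (Θ : A.Chain p u v q) : VComp A.comp (A.ids p) Θ Θ := by
  induction Θ with
  | nil u => exact .nil (Category.id_comp u)
  | @cons _ _ _ _ _ _ r p s u w v Δ q θ Θ h ih =>
    have := VComp.cons (comp := A.comp) (ξ := θ) (happ_ids r p s h) (Category.id_comp u)
      (Category.id_comp w) h h ih
    rwa [A.ident_comp] at this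

theorem vcomp_ids' {X Y Z W : A.Obj} {p : A.Path X Y} {u : X ⟶ Z} {v : Y ⟶ W} {q : A.Path Z W}
    (Θ : A.Chain p u v q) : VComp A.comp Θ (A.ids q) Θ := by
  induction Θ with
  | nil u => exact .nil (Category.comp_id u)
  | @cons _ _ _ _ _ _ r p s u w v Δ q θ Θ h ih =>
    have := VComp.cons (comp := A.comp) (ξ := A.ident Δ) (Θ₁ := .single θ) (Θ₂ := Θ)
      (Θ := .cons θ Θ h) (.cons θ (.nil Θ) _ _) (Category.comp_id u)
      (Category.comp_id w) rfl h ih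
    rwa [A.comp_ident] at this

theorem vcomp_single {X Y Z W V T : A.Obj} {p : A.Path X Y} {u : X ⟶ Z} {v : Y ⟶ W}
    {q : A.Path Z W} {u' : Z ⟶ V} {v' : W ⟶ T} {Γ : A.Hor V T} {a : X ⟶ V} {b : Y ⟶ T}
    (Θ : A.Chain p u v q) (θ : A.Cell q u' v' Γ) (ha : u ≫ u' = a) (hb : v ≫ v' = b) :
    VComp A.comp Θ (.single θ) (.single (A.comp Θ θ ha hb)) :=
  .cons (HApp.append_nil Θ) ha hb _ _ (.nil hb)

theorem assoc_single {X Y Z W V T V' T' : A.Obj} {p : A.Path X Y} {u : X ⟶ Z} {v : Y ⟶ W}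
    {q : A.Path Z W} {u' : Z ⟶ V} {v' : W ⟶ T} {Γ : A.Hor V T} {a : X ⟶ V} {b : Y ⟶ T}
    {u'' : V ⟶ V'} {v'' : T ⟶ T'} {Δ : A.Hor V' T'} {a' : Z ⟶ V'} {b' : W ⟶ T'}
    {x : X ⟶ V'} {y : Y ⟶ T'}
    (Θ : A.Chain p u v q) (θ : A.Cell q u' v' Γ) (κ : A.Cell (.one Γ) u'' v'' Δ)
    (h₁ : u' ≫ u'' = a') (h₂ : v' ≫ v'' = b') (h₃ : u ≫ a' = x) (h₄ : v ≫ b' = y)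
    (ha : u ≫ u' = a) (hb : v ≫ v' = b) (h₅ : a ≫ u'' = x) (h₆ : b ≫ v'' = y) :
    A.comp Θ (A.comp (.single θ) κ h₁ h₂) h₃ h₄ = A.comp (.single (A.comp Θ θ ha hb)) κ h₅ h₆ :=
  A.assoc κ (vcomp_single Θ θ ha hb) _ _ _ _ _ _

theorem assoc_nil {X Y Z W W' : A.Obj} {u : X ⟶ Y} {u' : Y ⟶ Z} {a : X ⟶ Z} {Γ : A.Hor W W'}
    {u'' : Z ⟶ W} {v'' : Z ⟶ W'} {a' : Y ⟶ W} {b' : Y ⟶ W'} {x : X ⟶ W}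
    {y : X ⟶ W'} (κ : A.Cell (.nil Z) u'' v'' Γ)
    (h₁ : u' ≫ u'' = a') (h₂ : u' ≫ v'' = b') (h₃ : u ≫ a' = x) (h₄ : u ≫ b' = y)
    (ha : u ≫ u' = a) (h₅ : a ≫ u'' = x) (h₆ : a ≫ v'' = y) :
    A.comp (.nil u) (A.comp (.nil u') κ h₁ h₂) h₃ h₄ = A.comp (.nil a) κ h₅ h₆ :=
  A.assoc κ (.nil ha) _ _ _ _ _ _

theorem vcomp_pair {X₁ X₂ X₃ Y₁ Y₂ Y₃ Z₁ Z₂ Z₃ : A.Obj} {p₁ : A.Path X₁ X₂} {p₂ : A.Path X₂ X₃}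
    {p : A.Path X₁ X₃} {u : X₁ ⟶ Y₁} {w : X₂ ⟶ Y₂} {v : X₃ ⟶ Y₃} {q₁ : A.Path Y₁ Y₂}
    {q₂ : A.Path Y₂ Y₃} {q : A.Path Y₁ Y₃} {u' : Y₁ ⟶ Z₁} {w' : Y₂ ⟶ Z₂} {v' : Y₃ ⟶ Z₃}
    {Γ : A.Hor Z₁ Z₂} {Δ : A.Hor Z₂ Z₃} {a : X₁ ⟶ Z₁} {m : X₂ ⟶ Z₂} {b : X₃ ⟶ Z₃}
    {Θ₁ : A.Chain p₁ u w q₁} {Θ₂ : A.Chain p₂ w v q₂} {Θ : A.Chain p u v q}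
    (θ : A.Cell q₁ u' w' Γ) (φ : A.Cell q₂ w' v' Δ) (e : HApp Θ₁ Θ₂ Θ) (ha : u ≫ u' = a)
    (hm : w ≫ w' = m) (hb : v ≫ v' = b) (hq : q₁.append q₂ = q) (hp : p₁.append p₂ = p) :
    VComp A.comp Θ (.cons θ (.single φ) hq)
      (.cons (A.comp Θ₁ θ ha hm) (.single (A.comp Θ₂ φ hm hb)) hp) :=
  .cons e ha hm _ _ (vcomp_single Θ₂ φ hm hb)

end VDC

end Toolkit

/-! ### Monads and bimodules -/

/-- Monads in a virtual double category: a horizontal endomorphism with a unit and a multiplication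
subject to the unit and associativity laws. -/
structure HMonad (A : VDC.{o, v, h, c}) where
  obj : A.Obj
  hor : A.Hor obj obj
  unit : A.Cell (.nil obj) (𝟙 obj) (𝟙 obj) hor
  mul : A.Cell (.cons hor (.one hor)) (𝟙 obj) (𝟙 obj) hor
  unit_mul : A.comp (.pair (r := .one hor) unit (A.ident hor)) mul
        (Category.id_comp _) (Category.id_comp _) =
    A.ident hor
  mul_unit : A.comp (.pair (r := .one hor) (A.ident hor) unit) mul
        (Category.id_comp _) (Category.id_comp _) =
    A.ident hor
  assoc : A.comp (.pair (r := .cons hor (.cons hor (.one hor))) mul (A.ident hor)) mul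
        (Category.id_comp _) (Category.id_comp _) =
    A.comp (.pair (r := .cons hor (.cons hor (.one hor))) (A.ident hor) mul) mul
          (Category.id_comp _) (Category.id_comp _)

/-- Morphisms of monads. -/
@[ext]
structure HMonadHom {A : VDC.{o, v, h, c}} (S T : HMonad A) where
  hom : S.obj ⟶ T.obj
  cell : A.Cell (.one S.hor) hom hom T.hor
  map_unit : A.comp (.nil hom) T.unit (Category.comp_id _) (Category.comp_id _) =
    A.comp (.single S.unit) cell (Category.id_comp _) (Category.id_comp _)
  map_mul : A.comp (.pair (r := .cons S.hor (.one S.hor)) cell cell) T.mul (Category.comp_id _) (Category.comp_id _) =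
    A.comp (.single S.mul) cell (Category.id_comp _) (Category.id_comp _)

namespace HMonadHom

variable {A : VDC.{o, v, h, c}}

/-- The identity morphism of a monad. -/
def id (S : HMonad A) : HMonadHom S S where
  hom := 𝟙 S.obj
  cell := A.ident S.hor
  map_unit := (A.ident_comp S.unit).trans (A.comp_ident S.unit).symm
  map_mul := (A.ident_comp S.mul).trans (A.comp_ident S.mul).symm

/-- Composition of morphisms of monads. -/
def comp {S T U : HMonad A} (f : HMonadHom S T) (g : HMonadHom T U) : HMonadHom S U where
  hom := f.hom ≫ g.hom
  cell := A.comp (.single f.cell) g.cell rfl rfl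
  map_unit := by
    rw [VDC.assoc_single (ha := Category.id_comp _) (hb := Category.id_comp _) (h₅ := rfl)
      (h₆ := rfl), ← f.map_unit, ← VDC.assoc_single (h₁ := Category.id_comp _)
      (h₂ := Category.id_comp _) (h₃ := rfl) (h₄ := rfl), ← g.map_unit,
      VDC.assoc_nil (ha := rfl) (h₅ := Category.comp_id _) (h₆ := Category.comp_id _)]
  map_mul := by
    rw [VDC.assoc_single (ha := Category.id_comp _) (hb := Category.id_comp _) (h₅ := rfl)
      (h₆ := rfl), ← f.map_mul, ← VDC.assoc_single (h₁ := Category.id_comp _)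
      (h₂ := Category.id_comp _) (h₃ := rfl) (h₄ := rfl), ← g.map_mul]
    refine (A.assoc U.mul ?_ _ _ _ _ _ _).symm
    exact VDC.vcomp_pair _ _ (.cons _ (.nil _) _ _) rfl rfl rfl _ _

end HMonadHom

instance {A : VDC.{o, v, h, c}} : Category (HMonad A) where
  Hom := HMonadHom
  id := HMonadHom.id
  comp := HMonadHom.comp
  id_comp f := by
    apply HMonadHom.ext (Category.id_comp f.hom)
    refine HEq.trans ?_ (heq_of_eq (A.ident_comp f.cell))
    change A.comp (.single (A.ident _)) f.cell rfl rfl ≍ _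
    exact VDC.comp_heq rfl rfl HEq.rfl HEq.rfl _ _ _ _
  comp_id f := by
    apply HMonadHom.ext (Category.comp_id f.hom)
    refine HEq.trans ?_ (heq_of_eq (A.comp_ident f.cell))
    change A.comp (.single f.cell) (A.ident _) rfl rfl ≍ _
    exact VDC.comp_heq rfl rfl HEq.rfl HEq.rfl _ _ _ _
  assoc f g k := by
    apply HMonadHom.ext (Category.assoc f.hom g.hom k.hom)
    refine HEq.trans ?_ (heq_of_eq (VDC.assoc_single (A := A) _ _ k.cell _ _ _ _ rfl rfl
      (Category.assoc _ _ _) (Category.assoc _ _ _)).symm)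
    exact VDC.comp_heq rfl rfl HEq.rfl HEq.rfl _ _ _ _

/-- Bimodules between monads. -/
structure HBimod {A : VDC.{o, v, h, c}} (S T : HMonad A) where
  hor : A.Hor S.obj T.obj
  lact : A.Cell (.cons S.hor (.one hor)) (𝟙 S.obj) (𝟙 T.obj) hor
  ract : A.Cell (.cons hor (.one T.hor)) (𝟙 S.obj) (𝟙 T.obj) hor
  unit_lact : A.comp (.pair (r := .one hor) S.unit (A.ident hor)) lact
        (Category.id_comp _) (Category.id_comp _) =
    A.ident hor
  ract_unit : A.comp (.pair (r := .one hor) (A.ident hor) T.unit) ract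
        (Category.id_comp _) (Category.id_comp _) =
    A.ident hor
  mul_lact : A.comp (.pair (r := .cons S.hor (.cons S.hor (.one hor))) S.mul (A.ident hor)) lact
        (Category.id_comp _) (Category.id_comp _) =
    A.comp (.pair (r := .cons S.hor (.cons S.hor (.one hor))) (A.ident S.hor) lact) lact
          (Category.id_comp _) (Category.id_comp _)
  ract_mul : A.comp (.pair (r := .cons hor (.cons T.hor (.one T.hor))) ract (A.ident T.hor)) ract
        (Category.id_comp _) (Category.id_comp _) =
    A.comp (.pair (r := .cons hor (.cons T.hor (.one T.hor))) (A.ident hor) T.mul) ract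
          (Category.id_comp _) (Category.id_comp _)
  lact_ract : A.comp (.pair (r := .cons S.hor (.cons hor (.one T.hor))) lact (A.ident T.hor)) ract
        (Category.id_comp _) (Category.id_comp _) =
    A.comp (.pair (r := .cons S.hor (.cons hor (.one T.hor))) (A.ident S.hor) ract) lact
          (Category.id_comp _) (Category.id_comp _)

section Mod

variable {A : VDC.{o, v, h, c}}

/-- Paths of bimodules. -/
abbrev BPath (S T : HMonad A) := HPath (HBimod (A := A)) S T

/-- The functor sending monads to their underlying objects. -/
@[simps]
def HMonad.forget (A : VDC.{o, v, h, c}) : HMonad A ⥤ A.Obj where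
  obj := HMonad.obj
  map f := f.hom

/-- The path of underlying horizontal morphisms. -/
abbrev und {S T : HMonad A} (p : BPath S T) : A.Path S.obj T.obj :=
  p.map (HMonad.forget A).obj (fun _ _ Γ => Γ.hor)

/-- `InnerAct σ τ`: on a path `Δ₁, …, Δₙ` of bimodules, `σ` acts on some `Δᵢ` from the right and `τ`
acts on `Δᵢ₊₁` from the left, and both are identities elsewhere; their common top path has the
monad between `Δᵢ` and `Δᵢ₊₁` inserted. -/
inductive InnerAct : ∀ {S T : HMonad A} {p : BPath S T} {s : A.Path S.obj T.obj},
    A.Chain s (𝟙 S.obj) (𝟙 T.obj) (und p) → A.Chain s (𝟙 S.obj) (𝟙 T.obj) (und p) → Prop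
  | here {S T U V : HMonad A} (Γ : HBimod S T) (Δ : HBimod T U) (p : BPath U V) :
      InnerAct (p := .cons Γ (.cons Δ p)) (s := .cons Γ.hor (.cons T.hor (.cons Δ.hor (und p))))
        (.cons Γ.ract (.cons (A.ident Δ.hor) (A.ids (und p)) rfl) rfl)
        (.cons (A.ident Γ.hor) (.cons Δ.lact (A.ids (und p)) rfl) rfl)
  | there {S T U : HMonad A} (Γ : HBimod S T) {p : BPath T U} {s : A.Path T.obj U.obj}
      {σ τ : A.Chain s (𝟙 T.obj) (𝟙 U.obj) (und p)} (i : InnerAct σ τ) :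
      InnerAct (p := .cons Γ p) (s := .cons Γ.hor s)
        (.cons (A.ident Γ.hor) σ rfl) (.cons (A.ident Γ.hor) τ rfl)

/-- `RightAct σ`: `σ` acts on the last bimodule of a nonempty path from the right, and is the identity
elsewhere; its top path has a monad added at the right end. -/
inductive RightAct : ∀ {S T : HMonad A} {p : BPath S T} {s : A.Path S.obj T.obj},
    A.Chain s (𝟙 S.obj) (𝟙 T.obj) (und p) → Prop
  | here {S T : HMonad A} (Γ : HBimod S T) :
      RightAct (p := .one Γ) (s := .cons Γ.hor (.one T.hor)) (.single Γ.ract)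
  | there {S T U : HMonad A} (Γ : HBimod S T) {p : BPath T U} {s : A.Path T.obj U.obj}
      {σ : A.Chain s (𝟙 T.obj) (𝟙 U.obj) (und p)} (i : RightAct σ) :
      RightAct (p := .cons Γ p) (s := .cons Γ.hor s) (.cons (A.ident Γ.hor) σ rfl)

/-- The compatibility of a multicell with the outer actions. -/
def OuterLaw : ∀ {S S' T T' : HMonad A} (p : BPath S S') (u : S ⟶ T) (v : S' ⟶ T')
    (Γ : HBimod T T'), A.Cell (und p) u.hom v.hom Γ.hor → Prop
  | _, _, _, _, .nil S, u, v, Γ, θ =>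
    A.comp (.pair (r := .one S.hor) u.cell θ) Γ.lact (Category.comp_id _) (Category.comp_id _) =
      A.comp (.pair (r := .one S.hor) θ v.cell) Γ.ract (Category.comp_id _) (Category.comp_id _)
  | S, S', _, _, .cons Δ p, u, v, Γ, θ =>
    A.comp (.cons (s := .cons S.hor (.cons Δ.hor (und p))) Δ.lact (A.ids (und p)) rfl) θ
        (Category.id_comp _) (Category.id_comp _) =
      A.comp (.pair (r := .cons S.hor (.cons Δ.hor (und p))) u.cell θ) Γ.lact
        (Category.comp_id _) (Category.comp_id _) ∧
    ∀ (s : A.Path S.obj S'.obj)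
      (σ : A.Chain s (𝟙 S.obj) (𝟙 S'.obj) (und (.cons Δ p)))
      (e : (und (.cons Δ p)).append (.one S'.hor) = s), RightAct (p := .cons Δ p) σ →
      A.comp σ θ (Category.id_comp _) (Category.id_comp _) =
        A.comp (.pair θ v.cell e) Γ.ract (Category.comp_id _) (Category.comp_id _)

/-- Multicells between bimodules: the multicells which are compatible with the inner and
the outer actions. -/
@[ext]
structure ModCell {S S' T T' : HMonad A} (p : BPath S S') (u : S ⟶ T) (v : S' ⟶ T')
    (Γ : HBimod T T') where
  cell : A.Cell (und p) u.hom v.hom Γ.hor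
  inner : ∀ (s : A.Path S.obj S'.obj) (σ τ : A.Chain s (𝟙 S.obj) (𝟙 S'.obj) (und p)),
    InnerAct (p := p) σ τ → A.comp σ cell (Category.id_comp _) (Category.id_comp _) =
      A.comp τ cell (Category.id_comp _) (Category.id_comp _)
  outer : OuterLaw p u v Γ cell

/-- The underlying chain of a chain of multicells between bimodules. -/
abbrev undChain {S S' T T' : HMonad A} {p : BPath S S'} {u : S ⟶ T} {v : S' ⟶ T'} {q : BPath T T'}
    (Θ : Sq (fun _ _ _ _ => ModCell (A := A)) p u v q) :
    A.Chain (und p) u.hom v.hom (und q) :=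
  Θ.map (K' := A.Cell) (HMonad.forget A) (fun _ _ Γ => Γ.hor) (fun _ _ _ _ _ _ _ _ θ => θ.cell)

/-- `Slide X Y`: the chains `X` and `Y` above a path of bimodules differ by the two ways of acting
by a cell into an inner monad. -/
def Slide {S T : HMonad A} {q : BPath S T} {X Y : A.Obj} {s : A.Path X Y} {u : X ⟶ S.obj}
    {v : Y ⟶ T.obj} (Θ Ξ : A.Chain s u v (und q)) : Prop :=
  ∃ (w : A.Path S.obj T.obj) (W : A.Chain s u v w)
    (σ τ : A.Chain w (𝟙 S.obj) (𝟙 T.obj) (und q)),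
    InnerAct (p := q) σ τ ∧ VComp A.comp W σ Θ ∧ VComp A.comp W τ Ξ

/-- The equivalence relation generated by `Slide`. -/
abbrev Slides {S T : HMonad A} (q : BPath S T) {X Y : A.Obj} {s : A.Path X Y} {u : X ⟶ S.obj}
    {v : Y ⟶ T.obj} : A.Chain s u v (und q) → A.Chain s u v (und q) → Prop :=
  Relation.EqvGen (Slide (q := q))

theorem Slides.comp_eq {S T S' T' : HMonad A} {q : BPath S T} {X Y : A.Obj} {s : A.Path X Y}
    {u : X ⟶ S.obj} {v : Y ⟶ T.obj} {Θ Ξ : A.Chain s u v (und q)} (i : Slides q Θ Ξ)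
    {u' : S ⟶ S'} {v' : T ⟶ T'} {Γ : HBimod S' T'} (θ : ModCell q u' v' Γ) :
    A.comp Θ θ.cell rfl rfl = A.comp Ξ θ.cell rfl rfl := by
  induction i with
  | rel Θ Ξ i =>
    obtain ⟨w, W, σ, τ, i, e₁, e₂⟩ := i
    rw [← A.assoc θ.cell e₁ (Category.id_comp _) (Category.id_comp _) rfl rfl,
      ← A.assoc θ.cell e₂ (Category.id_comp _) (Category.id_comp _) rfl rfl, θ.inner w σ τ i]
  | refl => rfl
  | symm _ _ _ ih => exact ih.symm
  | trans _ _ _ _ _ ih₁ ih₂ => exact ih₁.trans ih₂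

theorem Slides.cons {S T U : HMonad A} {Γ : HBimod S T} {q : BPath T U} {X Y Z : A.Obj}
    {r : A.Path X Y} {s : A.Path Y Z} {s' : A.Path X Z} {u : X ⟶ S.obj} {w : Y ⟶ T.obj}
    {v : Z ⟶ U.obj} (x : A.Cell r u w Γ.hor) {Θ Ξ : A.Chain s w v (und q)} (i : Slides q Θ Ξ)
    (e : r.append s = s') :
    Slides (.cons Γ q) (Sq.cons x Θ e) (Sq.cons x Ξ e) := by
  induction i with
  | rel Θ Ξ i =>
    obtain ⟨t, W, σ, τ, i, e₁, e₂⟩ := i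
    refine .rel _ _ ⟨.cons Γ.hor t, .cons x W e, _, _, InnerAct.there Γ i, ?_, ?_⟩
    · have := VComp.cons (comp := A.comp) (ξ := A.ident Γ.hor) (Θ₁ := .single x) (Θ₂ := W)
        (Θ := .cons x W e) (.cons x (.nil W) _ _) (Category.comp_id u)
        (Category.comp_id w) rfl e e₁
      rwa [A.comp_ident] at this
    · have := VComp.cons (comp := A.comp) (ξ := A.ident Γ.hor) (Θ₁ := .single x) (Θ₂ := W)
        (Θ := .cons x W e) (.cons x (.nil W) _ _) (Category.comp_id u)
        (Category.comp_id w) rfl e e₂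
      rwa [A.comp_ident] at this
  | refl => exact .refl _
  | symm _ _ _ ih => exact .symm _ _ ih
  | trans _ _ _ _ _ ih₁ ih₂ => exact .trans _ _ _ ih₁ ih₂

theorem Slides.here {S T U V : HMonad A} {Γ : HBimod S T} {Δ : HBimod T U} {q : BPath U V}
    {X Y Z W N : A.Obj}
    {r : A.Path X Y} {m : A.Path Y Z} {t : A.Path Z W} {s : A.Path W N}
    {rm : A.Path X Z} {mt : A.Path Y W} {ts : A.Path Z N} {mts : A.Path Y N} {f : A.Path X N}
    {u : X ⟶ S.obj} {w : Y ⟶ T.obj} {w' : Z ⟶ T.obj} {v : W ⟶ U.obj} {z : N ⟶ V.obj}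
    (x : A.Cell r u w Γ.hor) (ω : A.Cell m w w' T.hor) (y : A.Cell t w' v Δ.hor)
    (Θ : A.Chain s v z (und q)) (e₁ : r.append m = rm) (e₂ : m.append t = mt)
    (e₃ : t.append s = ts) (e₄ : m.append ts = mts) (e₅ : rm.append ts = f) (e₆ : mt.append s = mts)
    (e₇ : r.append mts = f) :
    Slides (.cons Γ (.cons Δ q))
      (Sq.cons (A.comp (.pair x ω e₁) Γ.ract (Category.comp_id _) (Category.comp_id _))
        (.cons y Θ e₃) e₅)
      (Sq.cons x (.cons (A.comp (.pair ω y e₂) Δ.lact (Category.comp_id _) (Category.comp_id _))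
        Θ e₆) e₇) := by
  refine .rel _ _ ⟨_, .cons x (.cons ω (.cons y Θ e₃) e₄) e₇, _, _, .here Γ Δ q, ?_, ?_⟩
  · refine .cons (Θ₁ := .pair x ω e₁) (Θ₂ := .cons y Θ e₃)
      (.cons _ (.cons _ (.nil _) _ _) _ _) _ _ _ _ ?_
    exact VDC.vcomp_ids' _
  · have := VComp.cons (comp := A.comp) (ξ := A.ident Γ.hor) (Θ₁ := .single x)
      (Θ₂ := .cons ω (.cons y Θ e₃) e₄) (Ξ := .cons Δ.lact (A.ids (und q)) rfl)
      (Φ := .cons (A.comp (.pair ω y e₂) Δ.lact (Category.comp_id _) (Category.comp_id _)) Θ e₆)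
      (Θ := .cons x (.cons ω (.cons y Θ e₃) e₄) e₇) (.cons x (.nil _) _ _) (Category.comp_id u)
      (Category.comp_id w) rfl e₇
      (.cons (.cons _ (.cons _ (.nil _) _ _) _ _) _ _ _ _ (VDC.vcomp_ids' _))
    rwa [A.comp_ident] at this

end Mod

section Mod

variable {A : VDC.{o, v, h, c}}

/-- The chain obtained by letting a cell into the monad act on the first multicell of a chain. -/
inductive LAct {S T U : HMonad A} {Γ : HBimod S T} {q : BPath T U} {X' X Y : A.Obj}
    {m : A.Path X' X} {u' : X' ⟶ S.obj} {u : X ⟶ S.obj}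
    {v : Y ⟶ U.obj} (ω : A.Cell m u' u S.hor) :
    ∀ {s : A.Path X Y} {t : A.Path X' Y}, A.Chain s u v (und (.cons Γ q)) →
      A.Chain t u' v (und (.cons Γ q)) → Prop
  | mk {Z : A.Obj} {r : A.Path X Z} {p : A.Path Z Y} {mr : A.Path X' Z} {s : A.Path X Y}
      {t : A.Path X' Y} {w : Z ⟶ T.obj} (x : A.Cell r u w Γ.hor) (Θ : A.Chain p w v (und q))
      (e : r.append p = s) (e₁ : m.append r = mr) (e₂ : mr.append p = t) :
      LAct ω (.cons x Θ e)
        (.cons (A.comp (.pair ω x e₁) Γ.lact (Category.comp_id _) (Category.comp_id _)) Θ e₂)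

/-- The chain obtained by letting a cell into the monad act on the last multicell of a chain. -/
inductive RAct : ∀ {S U : HMonad A} {q : BPath S U} {X Y Y' : A.Obj} {m : A.Path Y Y'}
    {u : X ⟶ S.obj} {v : Y ⟶ U.obj} {v' : Y' ⟶ U.obj} {s : A.Path X Y} {t : A.Path X Y'},
    A.Cell m v v' U.hor → A.Chain s u v (und q) → A.Chain t u v' (und q) → Prop
  | last {S U : HMonad A} {Γ : HBimod S U} {X Y Y' : A.Obj} {m : A.Path Y Y'}
      {u : X ⟶ S.obj} {v : Y ⟶ U.obj} {v' : Y' ⟶ U.obj} {s : A.Path X Y} {s' : A.Path X Y}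
      {t t' : A.Path X Y'} (ω : A.Cell m v v' U.hor) (x : A.Cell s u v Γ.hor)
      (e : s.append (.nil Y) = s') (e₁ : s.append m = t) (e₂ : t.append (.nil Y') = t') :
      RAct (q := .one Γ) ω (.cons x (.nil v) e)
        (.cons (A.comp (.pair x ω e₁) Γ.ract (Category.comp_id _) (Category.comp_id _))
          (.nil v') e₂)
  | cons {S T U : HMonad A} {Γ : HBimod S T} {q : BPath T U} {X Z Y Y' : A.Obj} {m : A.Path Y Y'}
      {u : X ⟶ S.obj} {w : Z ⟶ T.obj} {v : Y ⟶ U.obj} {v' : Y' ⟶ U.obj} {r : A.Path X Z}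
      {s : A.Path Z Y} {t : A.Path Z Y'} {s' : A.Path X Y} {t' : A.Path X Y'}
      {ω : A.Cell m v v' U.hor} (x : A.Cell r u w Γ.hor) {Θ : A.Chain s w v (und q)}
      {Ξ : A.Chain t w v' (und q)} (i : RAct ω Θ Ξ) (e : r.append s = s') (e' : r.append t = t') :
      RAct (q := .cons Γ q) ω (.cons x Θ e) (.cons x Ξ e')

theorem LAct.vcomp {S T U : HMonad A} {Γ : HBimod S T} {q : BPath T U} {X' X Y : A.Obj}
    {m : A.Path X' X} {u' : X' ⟶ S.obj} {u : X ⟶ S.obj} {v : Y ⟶ U.obj} {ω : A.Cell m u' u S.hor}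
    {s : A.Path X Y} {t : A.Path X' Y} {Θ : A.Chain s u v (und (.cons Γ q))}
    {Ξ : A.Chain t u' v (und (.cons Γ q))} (i : LAct ω Θ Ξ) (e : m.append s = t) :
    VComp A.comp (.cons ω Θ e)
      (Sq.cons (s := .cons S.hor (.cons Γ.hor (und q))) Γ.lact (A.ids (und q)) rfl) Ξ := by
  cases i with
  | mk x Θ e e₁ e₂ =>
    exact .cons (.cons _ (.cons _ (.nil _) _ _) _ _) _ _ _ _ (VDC.vcomp_ids' _)

theorem RAct.vcomp {S U : HMonad A} {q : BPath S U} {X Y Y' : A.Obj} {m : A.Path Y Y'}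
    {u : X ⟶ S.obj} {v : Y ⟶ U.obj} {v' : Y' ⟶ U.obj} {s : A.Path X Y} {t : A.Path X Y'}
    {ω : A.Cell m v v' U.hor} {Θ : A.Chain s u v (und q)} {Ξ : A.Chain t u v' (und q)}
    (i : RAct ω Θ Ξ) :
    ∃ (σ : A.Chain ((und q).append (.one U.hor)) (𝟙 S.obj) (𝟙 U.obj) (und q))
      (W : A.Chain t u v' ((und q).append (.one U.hor))), RightAct (p := q) σ ∧
      HApp Θ (.single ω) W ∧ VComp A.comp W σ Ξ := by
  induction i with
  | last ω x e e₁ e₂ =>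
    refine ⟨_, .pair x ω ?_, .here _, .cons _ (.nil _) _ _,
      .cons (.cons _ (.cons _ (.nil _) _ _) _ _) _ _ _ _ (.nil (Category.comp_id _))⟩
    rw [e₁, ← e₂, HPath.append_nil]
  | @cons _ _ _ Γ _ _ _ _ _ _ u w _ _ _ _ _ _ _ ω x Θ Ξ i e e' ih =>
    obtain ⟨σ, W, hσ, hW, hv⟩ := ih
    refine ⟨_, .cons x W e', .there _ hσ, .cons _ hW _ _, ?_⟩
    have := VComp.cons (comp := A.comp) (ξ := A.ident Γ.hor) (Θ₁ := .single x) (Θ₂ := W)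
        (Θ := .cons x W e') (.cons x (.nil W) _ _) (Category.comp_id u)
        (Category.comp_id w) rfl e' hv
    rwa [A.comp_ident] at this

theorem ModCell.outer_nil {S T T' : HMonad A} {u : S ⟶ T} {v : S ⟶ T'} {Γ : HBimod T T'}
    (θ : ModCell (.nil S) u v Γ) :
    A.comp (.pair (r := .one S.hor) u.cell θ.cell) Γ.lact
        (Category.comp_id _) (Category.comp_id _) =
      A.comp (.pair (r := .one S.hor) θ.cell v.cell) Γ.ract
        (Category.comp_id _) (Category.comp_id _) := θ.outer

theorem ModCell.outer_left {S S₁ S' T T' : HMonad A} {Δ : HBimod S S₁} {p : BPath S₁ S'}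
    {u : S ⟶ T} {v : S' ⟶ T'} {Γ : HBimod T T'} (θ : ModCell (.cons Δ p) u v Γ) :
    A.comp (.cons (s := .cons S.hor (.cons Δ.hor (und p))) Δ.lact (A.ids (und p)) rfl) θ.cell
        (Category.id_comp _) (Category.id_comp _) =
      A.comp (.pair (r := .cons S.hor (.cons Δ.hor (und p))) u.cell θ.cell) Γ.lact
        (Category.comp_id _) (Category.comp_id _) := θ.outer.1

theorem ModCell.outer_right {S S' T T' : HMonad A} {p : BPath S S'}
    {u : S ⟶ T} {v : S' ⟶ T'} {Γ : HBimod T T'} (θ : ModCell p u v Γ)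
    {s : A.Path S.obj S'.obj} {σ : A.Chain s (𝟙 S.obj) (𝟙 S'.obj) (und p)}
    (hσ : RightAct (p := p) σ) (e : (und p).append (.one S'.hor) = s) :
      A.comp σ θ.cell (Category.id_comp _) (Category.id_comp _) =
        A.comp (.pair θ.cell v.cell e) Γ.ract (Category.comp_id _) (Category.comp_id _) := by
  cases p with
  | nil => cases hσ
  | cons Δ p => exact θ.outer.2 s σ e hσ

theorem Slides.head {S T U : HMonad A} {Γ : HBimod S T} {q : BPath T U} {X Y Z : A.Obj}
    {r : A.Path X Y} {s : A.Path Y Z} {s' : A.Path X Z} {u : X ⟶ S.obj} {w : Y ⟶ T.obj}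
    {v : Z ⟶ U.obj} {x y : A.Cell r u w Γ.hor} (i : x = y) (Θ : A.Chain s w v (und q))
    (e : r.append s = s') : Slides (.cons Γ q) (Sq.cons x Θ e) (Sq.cons y Θ e) := by
  subst i
  exact .refl _

theorem slides_nil {S T T' U : HMonad A} {u : S ⟶ T} {v : S ⟶ U} {Γ : HBimod T T'}
    {q : BPath T' U} (Θ : Sq (fun _ _ _ _ => ModCell (A := A)) (.nil S) u v (.cons Γ q)) :
    ∃ L R : A.Chain (.one S.hor) u.hom v.hom (und (.cons Γ q)),
      LAct u.cell (undChain Θ) L ∧ RAct (q := .cons Γ q) v.cell (undChain Θ) R ∧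
      Slides (.cons Γ q) L R := by
  induction q generalizing T S with
  | nil T' =>
    cases Θ with
    | @cons _ _ _ _ _ _ r p s u w v Δ q θ Θ h =>
    cases Θ
    cases r with
    | cons Γ p => cases h
    | nil S =>
      exact ⟨_, _, .mk (q := .nil _) (r := .nil S.obj) (p := .nil S.obj) (s := .nil S.obj)
        θ.cell (Sq.nil v.hom) rfl rfl rfl, .last (s := .nil S.obj) v.cell θ.cell rfl rfl rfl,
        Slides.head (q := .nil _) θ.outer_nil (Sq.nil v.hom) rfl⟩
  | cons Δ q ih =>
    cases Θ with
    | @cons _ _ _ _ _ _ r p s u w v _ _ θ Θ h =>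
    cases r with
    | cons Γ p => cases h
    | nil S =>
      obtain rfl : p = .nil S := h
      obtain ⟨L, R, hL, hR, i⟩ := ih Θ
      refine ⟨_, _, .mk (r := .nil S.obj) (p := .nil S.obj) (s := .nil S.obj) θ.cell (undChain Θ)
        rfl rfl rfl, .cons (r := .nil S.obj) θ.cell hR rfl rfl, ?_⟩
      refine .trans _ _ _ (Slides.head θ.outer_nil _ rfl)
        (.trans _ _ _ ?_ (Slides.cons (r := .nil S.obj) θ.cell i rfl))
      generalize undChain Θ = Ξ at hL
      cases hL with
      | @mk _ r' p' mr' _ _ w x Ξ e e₁ e₂ =>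
        exact Slides.here _ _ _ _ _ _ _ rfl _ _ _

theorem VDC.happ_lact {S T U V : HMonad A} (Δ : HBimod S T) (r : BPath T U) (p : BPath U V) :
    HApp (K := A.Cell) (p := .cons S.hor (.cons Δ.hor (und (r.append p))))
      (.cons (s := .cons S.hor (.cons Δ.hor (und r))) Δ.lact (A.ids (und r)) rfl)
      (A.ids (und p)) (.cons Δ.lact (A.ids (und (r.append p))) rfl) :=
  .cons _ (VDC.happ_ids _ _ _ (HPath.map_append _ _ _ _).symm) _ _

theorem exists_lact_here {S S' S'' T T' U U' : HMonad A} {Δ : HBimod S S'} {r : BPath S' S''}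
    {p : BPath S'' U'} {u : S ⟶ T} {w : S'' ⟶ T'} {v : U' ⟶ U} {Γ : HBimod T T'} {q : BPath T' U}
    (θ : ModCell (.cons Δ r) u w Γ) (Θ : Sq (fun _ _ _ _ => ModCell (A := A)) p w v q) :
    ∃ Φ L : A.Chain (.cons S.hor (.cons Δ.hor (und (r.append p)))) u.hom v.hom (und (.cons Γ q)),
      VComp A.comp (Sq.cons (s := .cons S.hor (.cons Δ.hor (und (r.append p)))) Δ.lact
        (A.ids (und (r.append p))) rfl)
        (undChain (.cons (s := .cons Δ (r.append p)) θ Θ rfl)) Φ ∧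
      LAct u.cell (undChain (.cons (s := .cons Δ (r.append p)) θ Θ rfl)) L ∧
      Slides (.cons Γ q) Φ L := by
  have e : (und r).append (und p) = und (r.append p) := (HPath.map_append _ _ _ _).symm
  have e₁ : (und (.cons Δ r)).append (und p) = und (.cons Δ (r.append p)) := congrArg _ e
  have e₂ : (HPath.cons S.hor (.cons Δ.hor (und r))).append (und p) =
      .cons S.hor (.cons Δ.hor (und (r.append p))) := congrArg _ e₁
  exact ⟨_, _, .cons (VDC.happ_lact Δ r p) (Category.id_comp u.hom)
    (Category.id_comp w.hom) e₁ e₂ (VDC.vcomp_ids (undChain Θ)),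
    .mk (m := .one S.hor) (r := und (.cons Δ r)) θ.cell (undChain Θ) e₁ rfl e₂,
    Slides.head (r := .cons S.hor (.cons Δ.hor (und r))) θ.outer_left (undChain Θ) e₂⟩

theorem exists_lact {S S' T T' U U' : HMonad A} {Δ : HBimod S S'} {p : BPath S' U'} {u : S ⟶ T}
    {v : U' ⟶ U} {Γ : HBimod T T'}
    {q : BPath T' U} (Θ : Sq (fun _ _ _ _ => ModCell (A := A)) (.cons Δ p) u v (.cons Γ q)) :
    ∃ Φ L : A.Chain (.cons S.hor (.cons Δ.hor (und p))) u.hom v.hom (und (.cons Γ q)),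
      VComp A.comp (Sq.cons (s := .cons S.hor (.cons Δ.hor (und p))) Δ.lact (A.ids (und p)) rfl)
        (undChain Θ) Φ ∧ LAct u.cell (undChain Θ) L ∧ Slides (.cons Γ q) Φ L := by
  induction q generalizing S T with
  | nil T' =>
    cases Θ with
    | @cons _ _ _ _ _ _ r p' s u w v _ _ θ Θ h =>
    cases Θ
    cases r with
    | nil S => cases h
    | cons Δ' r =>
      cases h
      exact exists_lact_here θ (.nil v)
  | cons Γ' q ih =>
    cases Θ with
    | @cons _ _ _ _ _ _ r p' s u w v _ _ θ Θ h =>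
    cases r with
    | nil S =>
      obtain rfl : p' = .cons Δ p := h
      obtain ⟨Φ, L, hΦ, hL, i⟩ := ih Θ
      refine ⟨.cons (r := .nil S.obj) θ.cell Φ rfl, _, ?_, .mk (r := .nil S.obj) (s := .cons Δ.hor (und p)) θ.cell (undChain Θ)
        rfl rfl rfl, ?_⟩
      · have := VComp.cons (comp := A.comp) (p₁ := .nil S.obj) (q₁ := .nil S.obj) (.nil _)
          (Category.id_comp u.hom) (Category.id_comp w.hom) rfl rfl hΦ (ξ := θ.cell)
        rw [show A.comp (.nil (𝟙 S.obj)) θ.cell _ _ = θ.cell from A.ident_comp θ.cell] at this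
        exact this
      · refine .trans _ _ _ (Slides.cons (r := .nil S.obj) θ.cell i rfl)
          (.symm _ _ (.trans _ _ _ (Slides.head θ.outer_nil _ rfl) ?_))
        generalize undChain Θ = Ξ at hL
        cases hL with
        | @mk _ r' p' mr' _ _ w x Ξ e e₁ e₂ =>
          exact Slides.here _ _ _ _ _ _ _ rfl _ _ _
    | cons Δ' r =>
      cases h
      exact exists_lact_here θ Θ

theorem RightAct.top {S T : HMonad A} {p : BPath S T} {s : A.Path S.obj T.obj}
    {σ : A.Chain s (𝟙 S.obj) (𝟙 T.obj) (und p)} (i : RightAct (p := p) σ) :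
    (und p).append (.one T.hor) = s := by
  induction i with
  | here Γ => rfl
  | there Γ i ih => exact congrArg (HPath.cons Γ.hor) ih

theorem RightAct.split {S T T' U : HMonad A} (r : BPath S T) (Δ : HBimod T T') (p : BPath T' U)
    {s : A.Path S.obj U.obj}
    {σ : A.Chain s (𝟙 S.obj) (𝟙 U.obj) (und (r.append (.cons Δ p)))}
    (i : RightAct (p := r.append (.cons Δ p)) σ) :
    ∃ (t : A.Path T.obj U.obj) (τ : A.Chain t (𝟙 T.obj) (𝟙 U.obj) (und (.cons Δ p))),
      RightAct (p := .cons Δ p) τ ∧ HApp (A.ids (und r)) τ σ := by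
  induction r with
  | nil => exact ⟨_, _, i, .nil _⟩
  | cons Γ r ih =>
    cases r with
    | nil =>
      cases i with
      | there Γ i =>
        obtain ⟨t, τ, hτ, e⟩ := ih _ i
        exact ⟨t, τ, hτ, .cons _ e _ _⟩
    | cons Γ' r =>
      cases i with
      | there Γ i =>
        obtain ⟨t, τ, hτ, e⟩ := ih _ i
        exact ⟨t, τ, hτ, .cons _ e _ _⟩

theorem exists_ract {S S' T T' : HMonad A} {p : BPath S S'} {u : S ⟶ T} {v : S' ⟶ T'}
    {q : BPath T T'} (Θ : Sq (fun _ _ _ _ => ModCell (A := A)) p u v q) {s : A.Path S.obj S'.obj}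
    (σ : A.Chain s (𝟙 S.obj) (𝟙 S'.obj) (und p)) (hσ : RightAct (p := p) σ) :
    ∃ Φ R : A.Chain s u.hom v.hom (und q), VComp A.comp σ (undChain Θ) Φ ∧
      RAct (q := q) v.cell (undChain Θ) R ∧ Slides q Φ R := by
  induction Θ with
  | nil => cases hσ
  | @cons S S₁ T T₁ S' T' r p p' u w v Γ q θ Θ h ih =>
    cases p with
    | nil =>
      obtain rfl : r = p' := (HPath.append_nil r).symm.trans h
      cases q with
      | nil =>
        cases Θ
        exact ⟨_, _, .cons (HApp.append_nil σ) (Category.id_comp u.hom) (Category.id_comp w.hom)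
            (HPath.append_nil _) (HPath.append_nil _) (.nil (Category.id_comp w.hom)),
          .last w.cell θ.cell (HPath.append_nil _) hσ.top (HPath.append_nil _),
          Slides.head (q := .nil _) (θ.outer_right hσ _) (Sq.nil w.hom) _⟩
      | cons Δ q =>
        obtain ⟨L, R, hL, hR, i⟩ := slides_nil Θ
        refine ⟨_, _, .cons (HApp.append_nil σ) (Category.id_comp u.hom) (Category.id_comp w.hom)
            (HPath.append_nil _) (HPath.append_nil _) (VDC.vcomp_ids (undChain Θ)),
          .cons θ.cell hR (HPath.append_nil _) hσ.top, ?_⟩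
        refine .trans _ _ _ (Slides.head (θ.outer_right hσ hσ.top) (undChain Θ)
          (HPath.append_nil _)) (.trans _ _ _ ?_ (Slides.cons θ.cell i hσ.top))
        generalize undChain Θ = Ξ at hL
        cases hL with
        | mk x Ξ e e₁ e₂ =>
          exact Slides.here _ _ _ _ _ _ _ rfl _ _ _
    | cons Δ p =>
      subst h
      obtain ⟨t, τ, hτ, e⟩ := hσ.split
      obtain ⟨Φ, R, hΦ, hR, i⟩ := ih τ hτ
      have e₁ : (und r).append t = s := e.top
      have e₂ : (und r).append (und (.cons Δ p)) = und (r.append (.cons Δ p)) := e.bot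
      refine ⟨.cons θ.cell Φ e₁, .cons θ.cell R e₁, ?_, .cons θ.cell hR e₂ e₁,
        Slides.cons θ.cell i e₁⟩
      have := VComp.cons e (Category.id_comp u.hom) (Category.id_comp w.hom) e₂ e₁ hΦ
        (ξ := θ.cell) (comp := A.comp)
      rwa [A.ident_comp] at this

/-- The position of an inner action on a concatenation of two paths. -/
inductive InnerSplit {S T : HMonad A} (r : BPath S T) : ∀ {U : HMonad A} (p : BPath T U)
    {s : A.Path S.obj U.obj}, A.Chain s (𝟙 S.obj) (𝟙 U.obj) (und (r.append p)) →
    A.Chain s (𝟙 S.obj) (𝟙 U.obj) (und (r.append p)) → Prop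
  | left {U : HMonad A} (p : BPath T U) {s : A.Path S.obj U.obj} {t : A.Path S.obj T.obj}
      {σ τ : A.Chain s (𝟙 S.obj) (𝟙 U.obj) (und (r.append p))}
      {σ' τ' : A.Chain t (𝟙 S.obj) (𝟙 T.obj) (und r)} (i : InnerAct (p := r) σ' τ')
      (e₁ : HApp σ' (A.ids (und p)) σ) (e₂ : HApp τ' (A.ids (und p)) τ) : InnerSplit r p σ τ
  | right {U : HMonad A} (p : BPath T U) {s : A.Path S.obj U.obj} {t : A.Path T.obj U.obj}
      {σ τ : A.Chain s (𝟙 S.obj) (𝟙 U.obj) (und (r.append p))}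
      {σ' τ' : A.Chain t (𝟙 T.obj) (𝟙 U.obj) (und p)} (i : InnerAct (p := p) σ' τ')
      (e₁ : HApp (A.ids (und r)) σ' σ) (e₂ : HApp (A.ids (und r)) τ' τ) : InnerSplit r p σ τ
  | mid {T' U : HMonad A} (Δ : HBimod T T') (p : BPath T' U) {s : A.Path S.obj U.obj}
      {t : A.Path S.obj T.obj}
      {σ τ : A.Chain s (𝟙 S.obj) (𝟙 U.obj) (und (r.append (.cons Δ p)))}
      {σ' : A.Chain t (𝟙 S.obj) (𝟙 T.obj) (und r)} (i : RightAct (p := r) σ')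
      (e₁ : HApp σ' (A.ids (und (.cons Δ p))) σ)
      (e₂ : HApp (A.ids (und r))
        (.cons (s := .cons T.hor (.cons Δ.hor (und p))) Δ.lact (A.ids (und p)) rfl) τ) :
      InnerSplit r (.cons Δ p) σ τ

theorem InnerAct.split {S T U : HMonad A} (r : BPath S T) (p : BPath T U)
    {s : A.Path S.obj U.obj}
    {σ τ : A.Chain s (𝟙 S.obj) (𝟙 U.obj) (und (r.append p))}
    (i : InnerAct (p := r.append p) σ τ) : InnerSplit r p σ τ := by
  induction r with
  | nil => exact .right p i (.nil _) (.nil _)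
  | cons Γ r ih =>
    cases r with
    | nil =>
      cases p with
      | nil =>
        cases i with
        | there Γ i => cases i
      | cons Δ p =>
        cases i with
        | here => exact .mid Δ p (.here Γ) (.cons _ (.nil _) _ _) (.cons _ (.nil _) _ _)
        | there Γ i => exact .right _ i (.cons _ (.nil _) _ _) (.cons _ (.nil _) _ _)
    | cons Γ' r =>
      cases i with
      | here =>
        have e : (und r).append (und p) = und (r.append p) := (HPath.map_append _ _ _ _).symm
        exact .left p (.here Γ Γ' r) (.cons _ (.cons _ (VDC.happ_ids _ _ _ e) _ _) _ _)
          (.cons _ (.cons _ (VDC.happ_ids _ _ _ e) _ _) _ _)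
      | there Γ i =>
        cases ih p i with
        | left _ i e₁ e₂ => exact .left _ (.there Γ i) (.cons _ e₁ _ _) (.cons _ e₂ _ _)
        | right _ i e₁ e₂ => exact .right _ i (.cons _ e₁ _ _) (.cons _ e₂ _ _)
        | mid Δ p k e₁ e₂ => exact .mid Δ p (.there Γ k) (.cons _ e₁ _ _) (.cons _ e₂ _ _)

theorem exists_inner {S S' T T' : HMonad A} {p : BPath S S'} {u : S ⟶ T} {v : S' ⟶ T'}
    {q : BPath T T'} (Θ : Sq (fun _ _ _ _ => ModCell (A := A)) p u v q) {s : A.Path S.obj S'.obj}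
    (σ τ : A.Chain s (𝟙 S.obj) (𝟙 S'.obj) (und p)) (i : InnerAct (p := p) σ τ) :
    ∃ Φ Ψ : A.Chain s u.hom v.hom (und q), VComp A.comp σ (undChain Θ) Φ ∧
      VComp A.comp τ (undChain Θ) Ψ ∧ Slides q Φ Ψ := by
  induction Θ with
  | nil => cases i
  | @cons S S₁ T T₁ S' T' r p p' u w v Γ q θ Θ h ih =>
    subst h
    have e₀ : (und r).append (und p) = und (r.append p) := (HPath.map_append _ _ _ _).symm
    cases i.split with
    | left _ i e₁ e₂ =>
      exact ⟨_, _, .cons e₁ (Category.id_comp u.hom) (Category.id_comp w.hom) e₀ e₁.top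
          (VDC.vcomp_ids (undChain Θ)), .cons e₂ (Category.id_comp u.hom)
          (Category.id_comp w.hom) e₀ e₂.top (VDC.vcomp_ids (undChain Θ)),
        Slides.head (θ.inner _ _ _ i) (undChain Θ) e₁.top⟩
    | right _ i e₁ e₂ =>
      obtain ⟨Φ, Ψ, hΦ, hΨ, j⟩ := ih _ _ i
      refine ⟨.cons θ.cell Φ e₁.top, .cons θ.cell Ψ e₂.top, ?_, ?_, Slides.cons θ.cell j e₁.top⟩
      · have := VComp.cons e₁ (Category.id_comp u.hom) (Category.id_comp w.hom) e₀ e₁.top hΦ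
          (ξ := θ.cell) (comp := A.comp)
        rwa [A.ident_comp] at this
      · have := VComp.cons e₂ (Category.id_comp u.hom) (Category.id_comp w.hom) e₀ e₂.top hΨ
          (ξ := θ.cell) (comp := A.comp)
        rwa [A.ident_comp] at this
    | mid Δ p k e₁ e₂ =>
      cases q with
      | nil => cases Θ
      | cons Δ' q =>
        obtain ⟨Φ, L, hΦ, hL, j⟩ := exists_lact Θ
        refine ⟨_, .cons θ.cell Φ e₂.top, .cons e₁ (Category.id_comp u.hom)
          (Category.id_comp w.hom) e₀ e₁.top (VDC.vcomp_ids (undChain Θ)), ?_, ?_⟩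
        · have := VComp.cons e₂ (Category.id_comp u.hom) (Category.id_comp w.hom) e₀ e₂.top hΦ
            (ξ := θ.cell) (comp := A.comp)
          rwa [A.ident_comp] at this
        · refine .trans _ _ _ (Slides.head (θ.outer_right k k.top) (undChain Θ) e₁.top)
            (.trans _ _ _ ?_ (.symm _ _ (Slides.cons θ.cell j e₂.top)))
          generalize undChain Θ = Ξ at hL
          cases hL with
          | mk x Ξ e e₁ e₂ =>
            exact Slides.here _ _ _ _ _ _ _ rfl _ _ _

end Mod

section Mod

variable {A : VDC.{o, v, h, c}}

/-- The family of multicells between bimodules. -/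
abbrev ModFam (A : VDC.{o, v, h, c}) :
    CellFam.{max o h c, max v c, max h c, c} (HMonad A) (HBimod (A := A)) :=
  fun _ _ _ _ p u v Γ => ModCell p u v Γ

theorem lact_comp {S S' T T' U U' : HMonad A} {p : BPath S S'} {q : BPath T T'} (u : S ⟶ T)
    {v : S' ⟶ T'} (u' : T ⟶ U) {v' : T' ⟶ U'} {Γ : HBimod U U'}
    (Θ : Sq (ModFam A) p u v q) (θ : A.Cell (und q) u'.hom v'.hom Γ.hor) :
    A.comp (.pair (r := .cons S.hor (und p)) (u ≫ u').cell
      (A.comp (undChain Θ) θ rfl rfl : A.Cell (und p) (u ≫ u').hom (v ≫ v').hom Γ.hor)) Γ.lact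
      (Category.comp_id _) (Category.comp_id _) =
    A.comp (.cons (s := .cons S.hor (und p)) u.cell (undChain Θ) rfl)
      (A.comp (.pair (r := .cons T.hor (und q)) u'.cell θ) Γ.lact (Category.comp_id _)
        (Category.comp_id _)) rfl rfl := by
  refine (A.assoc Γ.lact ?_ _ _ _ _ _ _).symm
  exact VDC.vcomp_pair _ _ (.cons _ (.nil _) _ _) rfl rfl rfl _ _

theorem ract_comp {S S' T T' U U' : HMonad A} {p : BPath S S'} {q : BPath T T'} {u : S ⟶ T}
    (v : S' ⟶ T') {u' : T ⟶ U} (v' : T' ⟶ U') {Γ : HBimod U U'}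
    (Θ : Sq (ModFam A) p u v q) (θ : A.Cell (und q) u'.hom v'.hom Γ.hor)
    {s : A.Path S.obj S'.obj} {t : A.Path T.obj T'.obj}
    {W : A.Chain s u.hom v.hom t} (e : HApp (undChain Θ) (.single v.cell) W)
    (hs : (und p).append (.one S'.hor) = s) (ht : (und q).append (.one T'.hor) = t) :
    A.comp (.pair (A.comp (undChain Θ) θ rfl rfl : A.Cell (und p) (u ≫ u').hom (v ≫ v').hom Γ.hor)
      (v ≫ v').cell hs) Γ.ract (Category.comp_id _) (Category.comp_id _) =
    A.comp W (A.comp (.pair θ v'.cell ht) Γ.ract (Category.comp_id _)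
        (Category.comp_id _)) rfl rfl := by
  refine (A.assoc Γ.ract ?_ _ _ _ _ _ _).symm
  exact VDC.vcomp_pair _ _ e rfl rfl rfl _ _

theorem ModCell.lact_eq {S S' S₁ T T' U U' : HMonad A} {p : BPath S S'} {Δ : HBimod T S₁}
    {q : BPath S₁ T'} {u : S ⟶ T}
    {v : S' ⟶ T'} {u' : T ⟶ U} {v' : T' ⟶ U'} {Γ : HBimod U U'}
    {Θ : Sq (ModFam A) p u v (.cons Δ q)} (θ : ModCell (.cons Δ q) u' v' Γ)
    {L : A.Chain (.cons S.hor (und p)) u.hom v.hom (und (.cons Δ q))}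
    (hL : LAct u.cell (undChain Θ) L) :
    A.comp (.pair (r := .cons S.hor (und p)) (u ≫ u').cell
      (A.comp (undChain Θ) θ.cell rfl rfl : A.Cell (und p) (u ≫ u').hom (v ≫ v').hom Γ.hor)) Γ.lact
      (Category.comp_id _) (Category.comp_id _) = A.comp L θ.cell rfl rfl := by
  rw [lact_comp]
  refine (congrArg (fun x => A.comp _ x rfl rfl) θ.outer_left.symm).trans ?_
  exact A.assoc θ.cell (hL.vcomp rfl) _ _ _ _ _ _

theorem ModCell.ract_eq {S S' T T' U U' : HMonad A} {p : BPath S S'}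
    {q : BPath T T'} {u : S ⟶ T}
    {v : S' ⟶ T'} {u' : T ⟶ U} {v' : T' ⟶ U'} {Γ : HBimod U U'}
    {Θ : Sq (ModFam A) p u v q} (θ : ModCell q u' v' Γ) {s : A.Path S.obj S'.obj}
    {R : A.Chain s u.hom v.hom (und q)} (hR : RAct (q := q) v.cell (undChain Θ) R)
    (hs : (und p).append (.one S'.hor) = s) :
    A.comp (.pair (A.comp (undChain Θ) θ.cell rfl rfl :
        A.Cell (und p) (u ≫ u').hom (v ≫ v').hom Γ.hor)
      (v ≫ v').cell hs) Γ.ract (Category.comp_id _) (Category.comp_id _) =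
      A.comp R θ.cell rfl rfl := by
  obtain ⟨σ, W, hσ, hW, hv⟩ := hR.vcomp
  rw [ract_comp v v' Θ θ.cell hW hs rfl]
  refine (congrArg (fun x => A.comp _ x rfl rfl) (θ.outer_right hσ rfl).symm).trans ?_
  exact A.assoc θ.cell hv _ _ _ _ _ _

/-- Composition of multicells between bimodules. -/
def ModCell.comp : CompOp (ModFam A) := fun S S' T T' U U' p u v q u' v' Γ a b Θ θ hu hv =>
  have hu : u.hom ≫ u'.hom = a.hom := congrArg HMonadHom.hom hu
  have hv : v.hom ≫ v'.hom = b.hom := congrArg HMonadHom.hom hv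
  { cell := A.comp (undChain Θ) θ.cell hu hv
    inner := by
      intro s σ τ i
      obtain ⟨Φ, Ψ, hΦ, hΨ, j⟩ := exists_inner Θ σ τ i
      rw [A.assoc θ.cell hΦ _ _ _ _ hu hv, A.assoc θ.cell hΨ _ _ _ _ hu hv]
      have := Slides.comp_eq j θ
      subst a b
      exact this
    outer := by
      subst a b
      cases p with
      | nil =>
        cases q with
        | nil =>
          cases Θ
          refine (lact_comp u u' (.nil u) θ.cell).trans (Eq.trans ?_
            (ract_comp u v' (.nil u) θ.cell (.nil _) rfl rfl).symm)
          exact congrArg (fun x => A.comp (.single u.cell) x rfl rfl) θ.outer_nil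
        | cons Δ q =>
          obtain ⟨L, R, hL, hR, i⟩ := slides_nil Θ
          exact (θ.lact_eq hL).trans ((Slides.comp_eq i θ).trans (θ.ract_eq hR rfl).symm)
      | cons Δ p =>
        refine ⟨?_, ?_⟩
        · cases q with
          | nil => cases Θ
          | cons Δ' q =>
            obtain ⟨Φ, L, hΦ, hL, i⟩ := exists_lact Θ
            exact (A.assoc θ.cell hΦ _ _ _ _ _ _).trans
              ((Slides.comp_eq i θ).trans (θ.lact_eq hL).symm)
        · intro s σ e hσ
          obtain ⟨Φ, R, hΦ, hR, i⟩ := exists_ract Θ σ hσ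
          exact (A.assoc θ.cell hΦ _ _ _ _ _ _).trans
            ((Slides.comp_eq i θ).trans (θ.ract_eq hR e).symm) }

end Mod

section Mod

variable {A : VDC.{o, v, h, c}}

/-- The identity multicell of a bimodule. -/
def HBimod.ident ⦃S T : HMonad A⦄ (Γ : HBimod S T) : ModFam A (.one Γ) (𝟙 S) (𝟙 T) Γ where
  cell := A.ident Γ.hor
  inner s σ τ i := by
    cases i with
    | there _ i => cases i
  outer := by
    refine ⟨(A.comp_ident Γ.lact).trans (A.ident_comp Γ.lact).symm, ?_⟩
    intro s σ e hσ
    cases hσ with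
    | here => exact (A.comp_ident Γ.ract).trans (A.ident_comp Γ.ract).symm
    | there _ i => cases i

theorem undChain_ids {S T : HMonad A} (p : BPath S T) :
    undChain (Sq.ids (K := ModFam A) HBimod.ident p) = A.ids (und p) := by
  induction p with
  | nil => rfl
  | cons Γ p ih => exact congrArg (fun x => Sq.cons (A.ident Γ.hor) x rfl) ih

theorem undChain_happ {S T U S' T' U' : HMonad A} {p₁ : BPath S T} {p₂ : BPath T U}
    {p : BPath S U} {u : S ⟶ S'} {w : T ⟶ T'} {v : U ⟶ U'} {q₁ : BPath S' T'} {q₂ : BPath T' U'}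
    {q : BPath S' U'} {Θ₁ : Sq (ModFam A) p₁ u w q₁} {Θ₂ : Sq (ModFam A) p₂ w v q₂}
    {Θ : Sq (ModFam A) p u v q} (e : HApp Θ₁ Θ₂ Θ) :
    HApp (undChain Θ₁) (undChain Θ₂) (undChain Θ) := by
  induction e with
  | nil => exact .nil _
  | cons θ a h₁ h ih => exact .cons _ ih _ _

theorem undChain_vcomp {S T S' T' S'' T'' : HMonad A} {p : BPath S T} {u : S ⟶ S'}
    {v : T ⟶ T'} {q : BPath S' T'} {u' : S' ⟶ S''} {v' : T' ⟶ T''} {r : BPath S'' T''}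
    {a : S ⟶ S''} {b : T ⟶ T''} {Θ : Sq (ModFam A) p u v q} {Ξ : Sq (ModFam A) q u' v' r}
    {Φ : Sq (ModFam A) p a b r} (e : VComp ModCell.comp Θ Ξ Φ) :
    VComp A.comp (undChain Θ) (undChain Ξ) (undChain Φ) := by
  induction e with
  | nil h => exact .nil (congrArg HMonadHom.hom h)
  | cons happ hu hw hq hp t ih =>
    exact .cons (undChain_happ happ) (congrArg HMonadHom.hom hu) (congrArg HMonadHom.hom hw)
      (by subst hq; exact (HPath.map_append _ _ _ _).symm)
      (by subst hp; exact (HPath.map_append _ _ _ _).symm) ih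

variable (A) in
/-- The virtual double category of monads and bimodules. -/
def BimodVDC : VDC.{max o h c, max v c, max h c, c} where
  Obj := HMonad A
  Hor := HBimod
  Cell := ModFam A
  ident := HBimod.ident
  comp := ModCell.comp
  ident_comp {_ _ _ _ p u v _} θ := by
    exact ModCell.ext ((congrArg (fun x => A.comp x θ.cell (Category.id_comp u.hom)
      (Category.id_comp v.hom)) (undChain_ids p)).trans (A.ident_comp θ.cell))
  comp_ident θ := ModCell.ext (A.comp_ident θ.cell)
  assoc κ t _ _ _ _ _ _ := ModCell.ext (A.assoc κ.cell (undChain_vcomp t) _ _ _ _ _ _)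

/-- A monad, regarded as a bimodule. -/
abbrev HMonad.bimod (T : HMonad A) : HBimod T T where
  hor := T.hor
  lact := T.mul
  ract := T.mul
  unit_lact := T.unit_mul
  ract_unit := T.mul_unit
  mul_lact := T.assoc
  ract_mul := T.assoc
  lact_ract := T.assoc

/-- The unit of a monad, as a multicell between bimodules. -/
def HMonad.eta (T : HMonad A) : ModCell (.nil T) (𝟙 T) (𝟙 T) T.bimod where
  cell := T.unit
  inner s σ τ i := by cases i
  outer := T.mul_unit.trans T.unit_mul.symm

/-- The cell of a morphism of monads, as a multicell between bimodules. -/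
def HMonadHom.mcell {S T : HMonad A} (u : S ⟶ T) : ModCell (.one S.bimod) u u T.bimod where
  cell := u.cell
  inner s σ τ i := by
    cases i with
    | there _ i => cases i
  outer := by
    refine ⟨u.map_mul.symm, ?_⟩
    intro s σ e hσ
    cases hσ with
    | here => exact u.map_mul.symm
    | there _ i => cases i

/-- The left action, as a multicell between bimodules. -/
def HBimod.lcell {S T : HMonad A} (Γ : HBimod S T) :
    ModCell (.cons S.bimod (.one Γ)) (𝟙 S) (𝟙 T) Γ where
  cell := Γ.lact
  inner s σ τ i := by
    cases i with
    | here => exact Γ.mul_lact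
    | there _ i =>
      cases i with
      | there _ i => cases i
  outer := by
    refine ⟨Γ.mul_lact, ?_⟩
    intro s σ e hσ
    cases hσ with
    | there _ i =>
      cases i with
      | here => exact Γ.lact_ract.symm
      | there _ i => cases i

/-- The right action, as a multicell between bimodules. -/
def HBimod.rcell {S T : HMonad A} (Γ : HBimod S T) :
    ModCell (.cons Γ (.one T.bimod)) (𝟙 S) (𝟙 T) Γ where
  cell := Γ.ract
  inner s σ τ i := by
    cases i with
    | here => exact Γ.ract_mul
    | there _ i =>
      cases i with
      | there _ i => cases i
  outer := by
    refine ⟨Γ.lact_ract, ?_⟩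
    intro s σ e hσ
    cases hσ with
    | there _ i =>
      cases i with
      | here => exact Γ.ract_mul.symm
      | there _ i => cases i

end Mod

namespace VDC

variable {A : VDC.{o, v, h, c}}

theorem pre_ids {X Y Z : A.Obj} (p : A.Path X Y) (q : A.Path Y Z) :
    A.pre p (A.ids q) = A.ids (p.append q) := by
  induction p with
  | nil => rfl
  | cons Γ p ih => exact congrArg (fun x => Sq.cons (A.ident Γ) x rfl) (ih q)

theorem comp_pre_ids {X Y Z V W : A.Obj} (p : A.Path X Y) {q : A.Path Y Z} {u : X ⟶ V} {v : Z ⟶ W}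
    {Γ : A.Hor V W} (θ : A.Cell (p.append q) u v Γ) :
    A.comp (A.pre p (A.ids q)) θ (Category.id_comp _) (Category.id_comp _) = θ := by
  rw [pre_ids]
  exact A.ident_comp θ

theorem vcomp_pre {X D E : A.Obj} (p₁ : A.Path X D) {p q r : A.Path D E}
    {Θ : A.Chain p (𝟙 D) (𝟙 E) q} {Ξ : A.Chain q (𝟙 D) (𝟙 E) r} {Φ : A.Chain p (𝟙 D) (𝟙 E) r}
    (e : VComp A.comp Θ Ξ Φ) : VComp A.comp (A.pre p₁ Θ) (A.pre p₁ Ξ) (A.pre p₁ Φ) := by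
  induction p₁ with
  | nil => exact e
  | cons Γ p₁ ih =>
    have := VComp.cons (comp := A.comp) (ξ := A.ident Γ) (Θ₁ := .single (A.ident Γ))
      (Θ := A.pre (.cons Γ p₁) Θ) (.cons _ (.nil _) rfl rfl) (Category.comp_id _)
      (Category.comp_id _) rfl rfl (ih e)
    rwa [A.comp_ident] at this

theorem happ_pre {X D E E' : A.Obj} (p₁ : A.Path X D) {p q : A.Path D E} {p' q' : A.Path E E'}
    {p'' q'' : A.Path D E'} {Θ : A.Chain p (𝟙 D) (𝟙 E) q} {Ξ : A.Chain p' (𝟙 E) (𝟙 E') q'}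
    {Φ : A.Chain p'' (𝟙 D) (𝟙 E') q''} (e : HApp Θ Ξ Φ) :
    HApp (A.pre p₁ Θ) Ξ (A.pre p₁ Φ) := by
  induction p₁ with
  | nil => exact e
  | cons Γ p₁ ih => exact .cons _ (ih e) _ _

theorem happ_pre_nil {X D E : A.Obj} (p₁ : A.Path X D) {p q : A.Path D E}
    (Θ : A.Chain p (𝟙 D) (𝟙 E) q) : HApp (A.ids (p₁.append (.nil D))) Θ (A.pre p₁ Θ) := by
  induction p₁ with
  | nil => exact .nil _
  | cons Γ p₁ ih => exact .cons _ (ih Θ) _ _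

theorem opcart_cons {D E X Y Z W : A.Obj} {U : A.Hor D D} (η : A.Cell (.nil D) (𝟙 D) (𝟙 D) U)
    {Δ : A.Hor D E} (l : A.Cell (.cons U (.one Δ)) (𝟙 D) (𝟙 E) Δ)
    (r : A.Cell (.cons U (.one U)) (𝟙 D) (𝟙 D) U)
    (hl : A.comp (.pair (r := .one Δ) η (A.ident Δ)) l (Category.id_comp _) (Category.id_comp _) =
      A.ident Δ)
    (hr : A.comp (.pair (r := .one U) η (A.ident U)) r (Category.id_comp _) (Category.id_comp _) =
      A.ident U)
    (p₁ : A.Path X D) (p : A.Path E Y) (u : X ⟶ Z) (v : Y ⟶ W) (Γ : A.Hor Z W)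
    (hy : ∀ y : A.Cell (p₁.append (.cons U (.cons Δ p))) u v Γ,
      A.comp (A.pre p₁ (.cons (s := .cons U (.cons U (.cons Δ p))) r (A.ids (.cons Δ p)) rfl)) y
        (Category.id_comp _) (Category.id_comp _) =
      A.comp (A.pre p₁ (.cons (s := .cons U (.cons U (.cons Δ p))) (A.ident U)
        (.cons (s := .cons U (.cons Δ p)) l (A.ids p) rfl) rfl)) y
        (Category.id_comp _) (Category.id_comp _))
    (θ : A.Cell (p₁.append (.cons Δ p)) u v Γ) :
    ∃! θ' : A.Cell (p₁.append (.cons U (.cons Δ p))) u v Γ,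
      A.comp (A.insert η p₁ (.cons Δ p)) θ' (Category.id_comp u) (Category.id_comp v) = θ := by
  refine ⟨A.comp (A.pre p₁ (.cons (s := .cons U (.cons Δ p)) l (A.ids p) rfl)) θ
    (Category.id_comp u) (Category.id_comp v), ?_, ?_⟩
  · have e : VComp A.comp (.cons η (A.ids (.cons Δ p)) rfl)
        (.cons (s := .cons U (.cons Δ p)) l (A.ids p) rfl) (A.ids (.cons Δ p)) := by
      have := VComp.cons (comp := A.comp) (ξ := l)
        (Θ₁ := .pair (r := .one Δ) η (A.ident Δ)) (Θ₂ := A.ids p)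
        (Θ := .cons η (A.ids (.cons Δ p)) rfl) (.cons _ (.cons _ (.nil _) rfl rfl) rfl rfl)
        (Category.id_comp _) (Category.id_comp _) rfl rfl (vcomp_ids (A.ids p))
      rw [hl] at this
      exact this
    exact (A.assoc θ (vcomp_pre p₁ e) _ _ _ _ (Category.id_comp _) (Category.id_comp _)).trans
      ((comp_pre_ids p₁ θ))
  · intro y h
    subst h
    have e₁ : VComp A.comp (.cons (s := .cons U (.cons Δ p)) l (A.ids p) rfl)
        (.cons η (A.ids (.cons Δ p)) rfl)
        (.cons (s := .cons U (.cons Δ p)) η (.cons (s := .cons U (.cons Δ p)) l (A.ids p) rfl)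
          rfl) := by
      have := VComp.cons (comp := A.comp) (ξ := η) (Θ₁ := .nil (𝟙 D))
        (p₁ := .nil D) (q₁ := .nil D) (p := .cons U (.cons Δ p))
        (Θ := .cons (s := .cons U (.cons Δ p)) l (A.ids p) rfl) (.nil _)
        (Category.id_comp _) (Category.id_comp _) rfl rfl (vcomp_ids' _)
      rwa [show A.comp (.nil (𝟙 D)) η _ _ = η from A.ident_comp η] at this
    have e₂ : VComp A.comp (.cons (s := .cons U (.cons Δ p)) η (A.ids (.cons U (.cons Δ p))) rfl)
        (.cons (s := .cons U (.cons U (.cons Δ p))) r (A.ids (.cons Δ p)) rfl)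
        (A.ids (.cons U (.cons Δ p))) := by
      have := VComp.cons (comp := A.comp) (ξ := r)
        (Θ₁ := .pair (r := .one U) η (A.ident U)) (Θ₂ := A.ids (.cons Δ p))
        (Θ := .cons η (A.ids (.cons U (.cons Δ p))) rfl) (.cons _ (.cons _ (.nil _) rfl rfl) rfl rfl)
        (Category.id_comp _) (Category.id_comp _) rfl rfl (vcomp_ids (A.ids (.cons Δ p)))
      rw [hr] at this
      exact this
    have e₃ : VComp A.comp (.cons (s := .cons U (.cons Δ p)) η (A.ids (.cons U (.cons Δ p))) rfl)
        (.cons (s := .cons U (.cons U (.cons Δ p))) (A.ident U)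
          (.cons (s := .cons U (.cons Δ p)) l (A.ids p) rfl) rfl)
        (.cons (s := .cons U (.cons Δ p)) η (.cons (s := .cons U (.cons Δ p)) l (A.ids p) rfl)
          rfl) := by
      have := VComp.cons (comp := A.comp) (ξ := A.ident U) (Θ₁ := .single η)
        (Θ := .cons η (A.ids (.cons U (.cons Δ p))) rfl) (.cons _ (.nil _) rfl rfl)
        (Category.id_comp _) (Category.id_comp _) rfl rfl
        (vcomp_ids (.cons (s := .cons U (.cons Δ p)) l (A.ids p) rfl))
      rwa [A.comp_ident] at this
    have e₄ := (comp_pre_ids (q := .cons U (.cons Δ p)) p₁ y).symm.trans (A.assoc y (vcomp_pre p₁ e₂)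
      (Category.id_comp _) (Category.id_comp _) (Category.id_comp _) (Category.id_comp _)
      (Category.id_comp _) (Category.id_comp _)).symm
    refine e₄.trans ?_
    rw [hy y]
    exact (A.assoc y (vcomp_pre p₁ e₃) _ _ _ _ (Category.id_comp _) (Category.id_comp _)).trans
      (A.assoc y (vcomp_pre p₁ e₁) _ _ _ _ (Category.id_comp _) (Category.id_comp _)).symm

theorem opcart_nil {D X Z W : A.Obj} {U : A.Hor D D} {V : A.Hor W W}
    (η : A.Cell (.nil D) (𝟙 D) (𝟙 D) U) (η' : A.Cell (.nil W) (𝟙 W) (𝟙 W) V)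
    (r : A.Cell (.cons U (.one U)) (𝟙 D) (𝟙 D) U)
    {Γ : A.Hor Z W} (r' : A.Cell (.cons Γ (.one V)) (𝟙 Z) (𝟙 W) Γ)
    (hr : A.comp (.pair (r := .one U) η (A.ident U)) r (Category.id_comp _) (Category.id_comp _) =
      A.ident U)
    (hr' : A.comp (.pair (r := .one Γ) (A.ident Γ) η') r' (Category.id_comp _)
      (Category.id_comp _) = A.ident Γ)
    (p₁ : A.Path X D) (u : X ⟶ Z) (v : D ⟶ W) (ω : A.Cell (.one U) v v V)
    (hω : A.comp (.nil v) η' (Category.comp_id _) (Category.comp_id _) =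
      A.comp (.single η) ω (Category.id_comp _) (Category.id_comp _))
    (hy : ∀ y : A.Cell (p₁.append (.one U)) u v Γ,
      A.comp (A.pre p₁ (.single r)) y (Category.id_comp _) (Category.id_comp _) =
      A.comp (.pair y ω ((HPath.append_assoc _ _ _).trans rfl)) r' (Category.comp_id _)
        (Category.comp_id _))
    (θ : A.Cell (p₁.append (.nil D)) u v Γ) :
    ∃! θ' : A.Cell (p₁.append (.one U)) u v Γ,
      A.comp (A.insert η p₁ (.nil D)) θ' (Category.id_comp u) (Category.id_comp v) = θ := by
  refine ⟨A.comp (.pair θ ω (by rw [HPath.append_nil])) r' (Category.comp_id _)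
    (Category.comp_id _), ?_, ?_⟩
  · refine (A.assoc r' (vcomp_pair θ ω (happ_pre_nil p₁ _) (Category.id_comp _)
      (Category.id_comp _) (Category.id_comp _) _ (HPath.append_nil _)) _ _ _ _
        (Category.comp_id _) (Category.comp_id _)).trans ?_
    have e := congrArg (fun x => A.comp (.pair (A.comp (A.ids (p₁.append (.nil D))) θ
      (Category.id_comp u) (Category.id_comp v)) x (HPath.append_nil _)) r' (Category.comp_id _)
      (Category.comp_id _)) hω.symm
    refine e.trans ?_
    rw [A.ident_comp]
    refine Eq.trans ?_ (A.comp_ident θ)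
    rw [← hr']
    refine (A.assoc r' ?_ _ _ _ _ _ _).symm
    have := VComp.cons (comp := A.comp) (ξ := A.ident Γ) (Θ₁ := .single θ) (Θ := .single θ)
      (.cons _ (.nil _) (HPath.append_nil _) (HPath.append_nil _)) (Category.comp_id _)
      (Category.comp_id _) rfl (HPath.append_nil _)
      (vcomp_single (.nil v) η' (Category.comp_id _) (Category.comp_id _))
    rwa [A.comp_ident] at this
  · intro y h
    subst h
    have e₁ := vcomp_pair (A := A) y ω (happ_pre p₁ (.cons η (.nil (.single (A.ident U))) rfl rfl))
      (Category.id_comp _) (Category.id_comp _) (Category.id_comp _)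
      ((HPath.append_assoc p₁ (.one U) (.one U)).trans rfl)
      ((HPath.append_assoc p₁ (.nil D) (.one U)).trans rfl)
    have e₂ : VComp A.comp (.cons η (.single (A.ident U)) rfl) (.single r) (A.ids (.one U)) := by
      have := vcomp_single (.pair (r := .one U) η (A.ident U)) r (Category.id_comp _)
        (Category.id_comp _)
      rwa [hr] at this
    have e₃ : A.comp (.single (A.ident U)) ω (Category.id_comp _) (Category.id_comp _) = ω :=
      A.ident_comp ω
    rw [e₃] at e₁
    refine ((comp_pre_ids (q := .one U) p₁ y).symm.trans (A.assoc y (vcomp_pre p₁ e₂)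
      (Category.id_comp _) (Category.id_comp _) (Category.id_comp _) (Category.id_comp _)
      (Category.id_comp _) (Category.id_comp _)).symm).trans ?_
    rw [hy]
    exact A.assoc r' e₁ _ _ _ _ _ _

end VDC

section Mod

variable {A : VDC.{o, v, h, c}}

theorem inner_pre {R S T U V : HMonad A} (p : BPath R S) (Γ : HBimod S T) (Δ : HBimod T U)
    (q : BPath U V) :
    InnerAct (A := A) (p := p.append (.cons Γ (.cons Δ q)))
      (undChain ((BimodVDC A).pre p (q := .cons Γ (.cons Δ q)) (.cons (s := .cons Γ (.cons T.bimod (.cons Δ q))) Γ.rcell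
        (Sq.ids HBimod.ident (.cons Δ q)) rfl)))
      (undChain ((BimodVDC A).pre p (q := .cons Γ (.cons Δ q)) (.cons (HBimod.ident Γ)
        (.cons (s := .cons T.bimod (.cons Δ q)) Δ.lcell (Sq.ids HBimod.ident q) rfl) rfl))) := by
  induction p with
  | nil =>
    have := InnerAct.here Γ Δ q
    rw [← undChain_ids q] at this
    exact this
  | cons Γ' p ih => exact .there Γ' (ih Γ)

theorem rightAct_pre {R S T : HMonad A} (p : BPath R S) (Γ : HBimod S T) :
    RightAct (A := A) (p := p.append (.one Γ))
      (undChain ((BimodVDC A).pre p (.single Γ.rcell))) := by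
  induction p with
  | nil => exact .here Γ
  | cons Γ' p ih => exact .there Γ' (ih Γ)

theorem eta_lcell {S T : HMonad A} (Δ : HBimod S T) :
    (BimodVDC A).comp (.pair (r := .one Δ) S.eta (HBimod.ident Δ)) Δ.lcell (Category.id_comp _)
      (Category.id_comp _) = HBimod.ident Δ := ModCell.ext Δ.unit_lact

theorem eta_rcell {S T : HMonad A} (Δ : HBimod S T) :
    (BimodVDC A).comp (.pair (r := .one Δ) (HBimod.ident Δ) T.eta) Δ.rcell (Category.id_comp _)
      (Category.id_comp _) = HBimod.ident Δ := ModCell.ext Δ.ract_unit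

theorem eta_mcell {S T : HMonad A} (u : S ⟶ T) :
    (BimodVDC A).comp (.nil u) T.eta (Category.comp_id _) (Category.comp_id _) =
    (BimodVDC A).comp (.single S.eta) u.mcell (Category.id_comp _) (Category.id_comp _) :=
  ModCell.ext u.map_unit

theorem eta_rcell' (T : HMonad A) :
    (BimodVDC A).comp (.pair (r := .one T.bimod) T.eta (HBimod.ident T.bimod)) T.bimod.rcell
      (Category.id_comp _) (Category.id_comp _) = HBimod.ident T.bimod := ModCell.ext T.unit_mul

variable (A) in
/-- The unital virtual double category of monads and bimodules; the horizontal unit of a monad is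
the monad itself, regarded as a bimodule. -/
def ModVDC : UVDC.{max o h c, max v c, max h c, c} where
  toVDC := BimodVDC A
  unit T := T.bimod
  eta T := T.eta
  opcart T := by
    intro R V R' V' p₁ p₂ u u' Γ θ
    cases p₂ with
    | nil =>
      refine VDC.opcart_nil (A := BimodVDC A) T.eta V'.eta T.bimod.rcell Γ.rcell (eta_rcell' T)
        (eta_rcell Γ) p₁ u u' u'.mcell (eta_mcell u') ?_ θ
      intro y
      apply ModCell.ext
      exact y.outer_right (rightAct_pre p₁ T.bimod) _
    | cons Δ p =>
      refine VDC.opcart_cons (A := BimodVDC A) T.eta Δ.lcell T.bimod.rcell (eta_lcell Δ)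
        (eta_rcell' T) p₁ p u u' Γ ?_ θ
      intro y
      apply ModCell.ext
      exact y.inner _ _ _ (inner_pre p₁ T.bimod Δ p)

end Mod

theorem RightAct.one_elim {A : VDC.{o, v, h, c}} {S T : HMonad A} {Γ : HBimod S T}
    {motive : ∀ s : A.Path S.obj T.obj, A.Chain s (𝟙 S.obj) (𝟙 T.obj) (und (.one Γ)) → Prop}
    {s : A.Path S.obj T.obj} {σ : A.Chain s (𝟙 S.obj) (𝟙 T.obj) (und (.one Γ))}
    (i : RightAct (p := .one Γ) σ) (m : motive _ (.single Γ.ract)) : motive s σ := by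
  cases i with
  | here => exact m
  | there _ i => cases i

theorem RightAct.cons_inv {A : VDC.{o, v, h, c}} {S T U V : HMonad A} {Γ : HBimod S T}
    {Δ : HBimod T U} {p : BPath U V}
    {motive : ∀ s : A.Path S.obj V.obj,
      A.Chain s (𝟙 S.obj) (𝟙 V.obj) (und (.cons Γ (.cons Δ p))) → Prop}
    {s : A.Path S.obj V.obj} {σ : A.Chain s (𝟙 S.obj) (𝟙 V.obj) (und (.cons Γ (.cons Δ p)))}
    (i : RightAct (p := .cons Γ (.cons Δ p)) σ)
    (m : ∀ (s : A.Path T.obj V.obj) (σ : A.Chain s (𝟙 T.obj) (𝟙 V.obj) (und (.cons Δ p))),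
      RightAct (p := .cons Δ p) σ → motive _ (.cons (A.ident Γ.hor) σ rfl)) : motive s σ := by
  cases i with
  | there _ i => exact m _ _ i

namespace VFunctor

variable {A : VDC.{o, v, h, c}} {B : VDC.{o₁, v₁, h₁, c₁}} (F : VFunctor A B)

/-- `F.CellRel θ θ'`: the multicell `θ'` is the image of `θ`, up to equality of boundaries. -/
inductive CellRel {X Y Z W : A.Obj} {p : A.Path X Y} {u : X ⟶ Z} {v : Y ⟶ W} {Γ : A.Hor Z W}
    (θ : A.Cell p u v Γ) : ∀ {p' : B.Path (F.toFunctor.obj X) (F.toFunctor.obj Y)}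
      {u' : F.toFunctor.obj X ⟶ F.toFunctor.obj Z} {v' : F.toFunctor.obj Y ⟶ F.toFunctor.obj W}
      {Γ' : B.Hor (F.toFunctor.obj Z) (F.toFunctor.obj W)}, B.Cell p' u' v' Γ' → Prop
  | mk : CellRel θ (F.cell θ)

/-- `F.ChainRel Θ Θ'`: the chain `Θ'` is the image of `Θ`, up to equality of boundaries. -/
inductive ChainRel {X Y Z W : A.Obj} {p : A.Path X Y} {u : X ⟶ Z} {v : Y ⟶ W} {q : A.Path Z W}
    (Θ : A.Chain p u v q) : ∀ {p' : B.Path (F.toFunctor.obj X) (F.toFunctor.obj Y)}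
      {u' : F.toFunctor.obj X ⟶ F.toFunctor.obj Z} {v' : F.toFunctor.obj Y ⟶ F.toFunctor.obj W}
      {q' : B.Path (F.toFunctor.obj Z) (F.toFunctor.obj W)}, B.Chain p' u' v' q' → Prop
  | mk : ChainRel Θ (F.chain Θ)

variable {F}

theorem CellRel.heq {X Y Z W : A.Obj} {p : A.Path X Y} {u : X ⟶ Z} {v : Y ⟶ W} {Γ : A.Hor Z W}
    {θ : A.Cell p u v Γ} {p' : B.Path (F.toFunctor.obj X) (F.toFunctor.obj Y)}
    {u' : F.toFunctor.obj X ⟶ F.toFunctor.obj Z} {v' : F.toFunctor.obj Y ⟶ F.toFunctor.obj W}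
    {Γ' : B.Hor (F.toFunctor.obj Z) (F.toFunctor.obj W)}
    {θ' : B.Cell p' u' v' Γ'} (i : F.CellRel θ θ') : θ' ≍ F.cell θ := by
  cases i; rfl

theorem CellRel.of_heq {X Y Z W : A.Obj} {p : A.Path X Y} {u : X ⟶ Z} {v : Y ⟶ W}
    {Γ : A.Hor Z W} {θ : A.Cell p u v Γ} {p' : B.Path (F.toFunctor.obj X) (F.toFunctor.obj Y)}
    {u' : F.toFunctor.obj X ⟶ F.toFunctor.obj Z} {v' : F.toFunctor.obj Y ⟶ F.toFunctor.obj W}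
    {Γ' : B.Hor (F.toFunctor.obj Z) (F.toFunctor.obj W)}
    {θ' : B.Cell p' u' v' Γ'} (hp : F.path p = p') (hu : F.toFunctor.map u = u')
    (hv : F.toFunctor.map v = v') (hΓ : F.hor Γ = Γ') (i : F.cell θ ≍ θ') : F.CellRel θ θ' := by
  subst hp hu hv hΓ i; exact .mk

theorem CellRel.eq {X Y Z W : A.Obj} {p₁ p₂ : A.Path X Y} {u₁ u₂ : X ⟶ Z} {v₁ v₂ : Y ⟶ W}
    {Γ : A.Hor Z W} {θ₁ : A.Cell p₁ u₁ v₁ Γ} {θ₂ : A.Cell p₂ u₂ v₂ Γ}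
    {p' : B.Path (F.toFunctor.obj X) (F.toFunctor.obj Y)}
    {u' : F.toFunctor.obj X ⟶ F.toFunctor.obj Z} {v' : F.toFunctor.obj Y ⟶ F.toFunctor.obj W}
    {Γ' : B.Hor (F.toFunctor.obj Z) (F.toFunctor.obj W)}
    {θ₁' θ₂' : B.Cell p' u' v' Γ'} (i₁ : F.CellRel θ₁ θ₁') (i₂ : F.CellRel θ₂ θ₂')
    (hp : p₁ = p₂) (hu : u₁ = u₂) (hv : v₁ = v₂) (e : θ₁ ≍ θ₂) : θ₁' = θ₂' := by
  subst hp hu hv e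
  exact eq_of_heq (i₁.heq.trans i₂.heq.symm)

theorem CellRel.ident {X Y : A.Obj} (Γ : A.Hor X Y) :
    F.CellRel (A.ident Γ) (B.ident (F.hor Γ)) :=
  .of_heq rfl (F.toFunctor.map_id _) (F.toFunctor.map_id _) rfl (F.cell_ident Γ)

theorem ChainRel.nil {X Y : A.Obj} {u : X ⟶ Y} {u' : F.toFunctor.obj X ⟶ F.toFunctor.obj Y}
    (e : F.toFunctor.map u = u') : F.ChainRel (.nil u) (.nil u') := by
  subst e; exact .mk

theorem ChainRel.cons {X Y Z W V T : A.Obj} {r : A.Path X Y} {p : A.Path Y V} {s : A.Path X V}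
    {u : X ⟶ Z} {w : Y ⟶ W} {v : V ⟶ T} {Δ : A.Hor Z W} {q : A.Path W T}
    {θ : A.Cell r u w Δ} {Θ : A.Chain p w v q}
    {r' : B.Path (F.toFunctor.obj X) (F.toFunctor.obj Y)}
    {p' : B.Path (F.toFunctor.obj Y) (F.toFunctor.obj V)}
    {s' : B.Path (F.toFunctor.obj X) (F.toFunctor.obj V)}
    {u' : F.toFunctor.obj X ⟶ F.toFunctor.obj Z} {w' : F.toFunctor.obj Y ⟶ F.toFunctor.obj W}
    {v' : F.toFunctor.obj V ⟶ F.toFunctor.obj T}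
    {q' : B.Path (F.toFunctor.obj W) (F.toFunctor.obj T)}
    {Δ' : B.Hor (F.toFunctor.obj Z) (F.toFunctor.obj W)}
    {θ' : B.Cell r' u' w' Δ'} {Θ' : B.Chain p' w' v' q'} (i : F.CellRel θ θ')
    (j : F.ChainRel Θ Θ') (h : r.append p = s) (h' : r'.append p' = s') :
    F.ChainRel (.cons θ Θ h) (.cons θ' Θ' h') := by
  cases i
  cases j
  subst h
  obtain rfl : s' = F.path (r.append p) := h'.symm.trans (HPath.map_append _ _ _ _).symm
  exact .mk

theorem ChainRel.ids {X Y : A.Obj} (p : A.Path X Y) :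
    F.ChainRel (A.ids p) (B.ids (F.path p)) := by
  induction p with
  | nil X => exact .nil (F.toFunctor.map_id X)
  | cons Γ p ih => exact .cons (.ident Γ) ih _ _

theorem ChainRel.single {X Y Z W : A.Obj} {p : A.Path X Y} {u : X ⟶ Z} {v : Y ⟶ W} {Γ : A.Hor Z W}
    {θ : A.Cell p u v Γ} {p' : B.Path (F.toFunctor.obj X) (F.toFunctor.obj Y)}
    {u' : F.toFunctor.obj X ⟶ F.toFunctor.obj Z} {v' : F.toFunctor.obj Y ⟶ F.toFunctor.obj W}
    {Γ' : B.Hor (F.toFunctor.obj Z) (F.toFunctor.obj W)}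
    {θ' : B.Cell p' u' v' Γ'} (i : F.CellRel θ θ') (e : F.toFunctor.map v = v') :
    F.ChainRel (.single θ) (.single θ') := .cons i (.nil e) _ _

theorem ChainRel.pair {X Y Z X' Y' Z' : A.Obj} {p : A.Path X Y} {q : A.Path Y Z} {r : A.Path X Z}
    {u : X ⟶ X'} {w : Y ⟶ Y'} {v : Z ⟶ Z'} {Γ : A.Hor X' Y'} {Δ : A.Hor Y' Z'}
    {θ : A.Cell p u w Γ} {φ : A.Cell q w v Δ} (h : p.append q = r)
    {p' : B.Path (F.toFunctor.obj X) (F.toFunctor.obj Y)}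
    {q' : B.Path (F.toFunctor.obj Y) (F.toFunctor.obj Z)}
    {r' : B.Path (F.toFunctor.obj X) (F.toFunctor.obj Z)}
    {u' : F.toFunctor.obj X ⟶ F.toFunctor.obj X'} {w' : F.toFunctor.obj Y ⟶ F.toFunctor.obj Y'}
    {v' : F.toFunctor.obj Z ⟶ F.toFunctor.obj Z'}
    {Γ' : B.Hor (F.toFunctor.obj X') (F.toFunctor.obj Y')}
    {Δ' : B.Hor (F.toFunctor.obj Y') (F.toFunctor.obj Z')}
    {θ' : B.Cell p' u' w' Γ'} {φ' : B.Cell q' w' v' Δ'} (h' : p'.append q' = r')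
    (i : F.CellRel θ θ') (j : F.CellRel φ φ') (e : F.toFunctor.map v = v') :
    F.ChainRel (.pair θ φ h) (.pair θ' φ' h') :=
  .cons i (.single j e) _ _

theorem CellRel.comp {X Y Z W V T : A.Obj} {p : A.Path X Y} {u : X ⟶ Z} {v : Y ⟶ W}
    {q : A.Path Z W} {u' : Z ⟶ V} {v' : W ⟶ T} {Γ : A.Hor V T} {a : X ⟶ V} {b : Y ⟶ T}
    {Θ : A.Chain p u v q} {θ : A.Cell q u' v' Γ} (hu : u ≫ u' = a) (hv : v ≫ v' = b)
    {p₁ : B.Path (F.toFunctor.obj X) (F.toFunctor.obj Y)}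
    {q₁ : B.Path (F.toFunctor.obj Z) (F.toFunctor.obj W)}
    {u₁ : F.toFunctor.obj X ⟶ F.toFunctor.obj Z} {v₁ : F.toFunctor.obj Y ⟶ F.toFunctor.obj W}
    {u₁' : F.toFunctor.obj Z ⟶ F.toFunctor.obj V} {v₁' : F.toFunctor.obj W ⟶ F.toFunctor.obj T}
    {a₁ : F.toFunctor.obj X ⟶ F.toFunctor.obj V} {b₁ : F.toFunctor.obj Y ⟶ F.toFunctor.obj T}
    {Θ₁ : B.Chain p₁ u₁ v₁ q₁} {Γ₁ : B.Hor (F.toFunctor.obj V) (F.toFunctor.obj T)}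
    {θ₁ : B.Cell q₁ u₁' v₁' Γ₁} (hu₁ : u₁ ≫ u₁' = a₁)
    (hv₁ : v₁ ≫ v₁' = b₁) (i : F.ChainRel Θ Θ₁) (j : F.CellRel θ θ₁) :
    F.CellRel (A.comp Θ θ hu hv) (B.comp Θ₁ θ₁ hu₁ hv₁) := by
  cases i
  cases j
  obtain rfl : a₁ = F.toFunctor.map a := by rw [← hu₁, ← hu, Functor.map_comp]
  obtain rfl : b₁ = F.toFunctor.map b := by rw [← hv₁, ← hv, Functor.map_comp]
  have := F.cell_comp Θ θ hu hv
  exact this ▸ .mk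

variable (F)

/-- The image of a multicell, with given boundary. -/
def cellAt {X Y Z W : A.Obj} {p : A.Path X Y} {u : X ⟶ Z} {v : Y ⟶ W} {Γ : A.Hor Z W}
    (θ : A.Cell p u v Γ) {p' : B.Path (F.toFunctor.obj X) (F.toFunctor.obj Y)}
    {u' : F.toFunctor.obj X ⟶ F.toFunctor.obj Z} {v' : F.toFunctor.obj Y ⟶ F.toFunctor.obj W}
    (hp : F.path p = p') (hu : F.toFunctor.map u = u') (hv : F.toFunctor.map v = v') :
    B.Cell p' u' v' (F.hor Γ) := hp ▸ hu ▸ hv ▸ F.cell θ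

variable {F}

theorem CellRel.cellAt {X Y Z W : A.Obj} {p : A.Path X Y} {u : X ⟶ Z} {v : Y ⟶ W}
    {Γ : A.Hor Z W} (θ : A.Cell p u v Γ)
    {p' : B.Path (F.toFunctor.obj X) (F.toFunctor.obj Y)}
    {u' : F.toFunctor.obj X ⟶ F.toFunctor.obj Z} {v' : F.toFunctor.obj Y ⟶ F.toFunctor.obj W}
    (hp : F.path p = p') (hu : F.toFunctor.map u = u') (hv : F.toFunctor.map v = v') :
    F.CellRel θ (F.cellAt θ hp hu hv) := by
  subst hp hu hv; exact .mk

variable (F)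

/-- The image of a monad. -/
def mapMonad (T : HMonad A) : HMonad B where
  obj := F.toFunctor.obj T.obj
  hor := F.hor T.hor
  unit := F.cellAt T.unit rfl (F.toFunctor.map_id _) (F.toFunctor.map_id _)
  mul := F.cellAt T.mul rfl (F.toFunctor.map_id _) (F.toFunctor.map_id _)
  unit_mul := CellRel.eq (.comp _ _ _ _ (.pair _ _ (.cellAt _ rfl _ _) (.ident _)
    (F.toFunctor.map_id _)) (.cellAt _ rfl _ _)) (.ident _) rfl rfl rfl (heq_of_eq T.unit_mul)
  mul_unit := CellRel.eq (.comp _ _ _ _ (.pair _ _ (.ident _) (.cellAt _ rfl _ _)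
    (F.toFunctor.map_id _)) (.cellAt _ rfl _ _)) (.ident _) rfl rfl rfl (heq_of_eq T.mul_unit)
  assoc := CellRel.eq (.comp _ _ _ _ (.pair _ _ (.cellAt _ rfl _ _) (.ident _)
    (F.toFunctor.map_id _)) (.cellAt _ rfl _ _)) (.comp _ _ _ _ (.pair _ _ (.ident _)
    (.cellAt _ rfl _ _) (F.toFunctor.map_id _)) (.cellAt _ rfl _ _)) rfl rfl rfl (heq_of_eq T.assoc)

/-- The image of a morphism of monads. -/
def mapMonadHom {S T : HMonad A} (f : S ⟶ T) : F.mapMonad S ⟶ F.mapMonad T where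
  hom := F.toFunctor.map f.hom
  cell := F.cell f.cell
  map_unit := CellRel.eq (.comp (Category.comp_id _) (Category.comp_id _) _ _ (.nil rfl)
    (.cellAt T.unit rfl _ _)) (.comp (Category.id_comp _) (Category.id_comp _) _ _
      (.single (.cellAt S.unit rfl _ _) (F.toFunctor.map_id _)) .mk) rfl rfl rfl
      (heq_of_eq f.map_unit)
  map_mul := CellRel.eq (.comp (Category.comp_id _) (Category.comp_id _) _ _
    (.pair rfl _ .mk .mk rfl)
    (.cellAt T.mul rfl _ _)) (.comp (Category.id_comp _) (Category.id_comp _) _ _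
      (.single (.cellAt S.mul rfl _ _) (F.toFunctor.map_id _)) .mk) rfl rfl rfl
      (heq_of_eq f.map_mul)

/-- The image of a bimodule. -/
def mapBimod {S T : HMonad A} (Γ : HBimod S T) : HBimod (F.mapMonad S) (F.mapMonad T) where
  hor := F.hor Γ.hor
  lact := F.cellAt Γ.lact rfl (F.toFunctor.map_id _) (F.toFunctor.map_id _)
  ract := F.cellAt Γ.ract rfl (F.toFunctor.map_id _) (F.toFunctor.map_id _)
  unit_lact := CellRel.eq (.comp _ _ _ _ (.pair _ _ (.cellAt _ rfl _ _) (.ident _)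
    (F.toFunctor.map_id _)) (.cellAt _ rfl _ _)) (.ident _) rfl rfl rfl (heq_of_eq Γ.unit_lact)
  ract_unit := CellRel.eq (.comp _ _ _ _ (.pair _ _ (.ident _) (.cellAt _ rfl _ _)
    (F.toFunctor.map_id _)) (.cellAt _ rfl _ _)) (.ident _) rfl rfl rfl (heq_of_eq Γ.ract_unit)
  mul_lact := CellRel.eq (.comp _ _ _ _ (.pair _ _ (.cellAt _ rfl _ _) (.ident _)
    (F.toFunctor.map_id _)) (.cellAt _ rfl _ _)) (.comp _ _ _ _ (.pair _ _ (.ident _)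
    (.cellAt _ rfl _ _) (F.toFunctor.map_id _)) (.cellAt _ rfl _ _)) rfl rfl rfl (heq_of_eq Γ.mul_lact)
  ract_mul := CellRel.eq (.comp _ _ _ _ (.pair _ _ (.cellAt _ rfl _ _) (.ident _)
    (F.toFunctor.map_id _)) (.cellAt _ rfl _ _)) (.comp _ _ _ _ (.pair _ _ (.ident _)
    (.cellAt _ rfl _ _) (F.toFunctor.map_id _)) (.cellAt _ rfl _ _)) rfl rfl rfl (heq_of_eq Γ.ract_mul)
  lact_ract := CellRel.eq (.comp _ _ _ _ (.pair _ _ (.cellAt _ rfl _ _) (.ident _)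
    (F.toFunctor.map_id _)) (.cellAt _ rfl _ _)) (.comp _ _ _ _ (.pair _ _ (.ident _)
    (.cellAt _ rfl _ _) (F.toFunctor.map_id _)) (.cellAt _ rfl _ _)) rfl rfl rfl (heq_of_eq Γ.lact_ract)

/-- The image of a path of bimodules. -/
abbrev mapBPath {S T : HMonad A} (p : BPath S T) : BPath (F.mapMonad S) (F.mapMonad T) :=
  p.map F.mapMonad (fun _ _ Γ => F.mapBimod Γ)

theorem path_und {S T : HMonad A} (p : BPath S T) : F.path (und p) = und (F.mapBPath p) := by
  induction p with
  | nil => rfl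
  | cons Γ p ih => exact congrArg (HPath.cons (F.hor Γ.hor)) ih

theorem chainRel_ids {S T : HMonad A} (p : BPath S T) :
    F.ChainRel (A.ids (und p)) (B.ids (und (F.mapBPath p))) := by
  induction p with
  | nil S => exact .nil (F.toFunctor.map_id _)
  | cons Γ p ih => exact .cons (.ident Γ.hor) ih rfl rfl

theorem exists_innerAct {S T : HMonad A} (p : BPath S T)
    {s' : B.Path (F.mapMonad S).obj (F.mapMonad T).obj}
    {σ' τ' : B.Chain s' (𝟙 (F.mapMonad S).obj) (𝟙 (F.mapMonad T).obj) (und (F.mapBPath p))}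
    (i : InnerAct (p := F.mapBPath p) σ' τ') :
    ∃ (s : A.Path S.obj T.obj) (σ τ : A.Chain s (𝟙 S.obj) (𝟙 T.obj) (und p)),
      InnerAct (p := p) σ τ ∧ F.ChainRel σ σ' ∧ F.ChainRel τ τ' := by
  induction p with
  | nil => cases i
  | cons Γ p ih =>
    cases p with
    | nil =>
      cases i with
      | there _ i => cases i
    | cons Δ p =>
      cases i with
      | here =>
        refine ⟨_, _, _, .here Γ Δ p, ?_, ?_⟩
        · exact .cons (.cellAt Γ.ract rfl _ _) (.cons (.ident Δ.hor) (F.chainRel_ids p) rfl rfl)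
            rfl rfl
        · exact .cons (.ident Γ.hor) (.cons (.cellAt Δ.lact rfl _ _) (F.chainRel_ids p) rfl rfl)
            rfl rfl
      | there _ i =>
        obtain ⟨s, σ, τ, k, hσ, hτ⟩ := ih i
        exact ⟨_, _, _, .there Γ k, .cons (.ident Γ.hor) hσ rfl rfl,
          .cons (.ident Γ.hor) hτ rfl rfl⟩

theorem exists_rightAct {S T : HMonad A} (p : BPath S T)
    {s' : B.Path (F.mapMonad S).obj (F.mapMonad T).obj}
    {σ' : B.Chain s' (𝟙 (F.mapMonad S).obj) (𝟙 (F.mapMonad T).obj) (und (F.mapBPath p))}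
    (i : RightAct (p := F.mapBPath p) σ') :
    ∃ (s : A.Path S.obj T.obj) (σ : A.Chain s (𝟙 S.obj) (𝟙 T.obj) (und p)),
      RightAct (p := p) σ ∧ F.ChainRel σ σ' := by
  induction p with
  | nil => cases i
  | cons Γ p ih =>
    cases p with
    | nil =>
      exact i.one_elim (motive := fun _ σ' => ∃ (s : A.Path _ _) (σ : A.Chain s _ _ _),
          RightAct (p := .one Γ) σ ∧ F.ChainRel σ σ')
        ⟨_, _, .here Γ, .single (.cellAt Γ.ract rfl _ _) (F.toFunctor.map_id _)⟩
    | cons Δ p =>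
      refine i.cons_inv (motive := fun _ σ' => ∃ (s : A.Path _ _) (σ : A.Chain s _ _ _),
          RightAct (p := .cons Γ (.cons Δ p)) σ ∧ F.ChainRel σ σ') ?_
      · intro s' σ' i
        obtain ⟨s, σ, k, hσ⟩ := ih i
        exact ⟨_, _, .there Γ k, .cons (.ident Γ.hor) hσ rfl rfl⟩

/-- The image of a multicell between bimodules. -/
def mapModCell ⦃S S' T T' : HMonad A⦄ ⦃p : BPath S S'⦄ ⦃u : S ⟶ T⦄ ⦃v : S' ⟶ T'⦄
    ⦃Γ : HBimod T T'⦄ (θ : ModCell p u v Γ) :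
    ModCell (F.mapBPath p) (F.mapMonadHom u) (F.mapMonadHom v) (F.mapBimod Γ) where
  cell := F.cellAt θ.cell (F.path_und p) rfl rfl
  inner s σ τ i := by
    obtain ⟨s, σ, τ, k, hσ, hτ⟩ := F.exists_innerAct p i
    exact CellRel.eq (.comp (Category.id_comp _) (Category.id_comp _) _ _ hσ (.cellAt _ _ _ _))
      (.comp (Category.id_comp _) (Category.id_comp _) _ _ hτ (.cellAt _ _ _ _)) rfl rfl rfl
      (heq_of_eq (θ.inner _ _ _ k))
  outer := by
    cases p with
    | nil =>
      exact CellRel.eq (.comp (Category.comp_id _) (Category.comp_id _) _ _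
        (.pair rfl _ .mk (.cellAt _ _ _ _) rfl)
        (.cellAt Γ.lact rfl _ _)) (.comp (Category.comp_id _) (Category.comp_id _) _ _
          (.pair rfl _ (.cellAt _ _ _ _) .mk rfl) (.cellAt Γ.ract rfl _ _)) rfl rfl rfl
        (heq_of_eq θ.outer_nil)
    | cons Δ p =>
      refine ⟨?_, ?_⟩
      · exact CellRel.eq (.comp (Category.id_comp _) (Category.id_comp _) _ _
          (.cons (.cellAt Δ.lact rfl _ _) (F.chainRel_ids p) rfl _) (.cellAt _ _ _ _))
          (.comp (Category.comp_id _) (Category.comp_id _) _ _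
          (.pair rfl _ .mk (.cellAt _ _ _ _) rfl) (.cellAt Γ.lact rfl _ _)) rfl rfl rfl
          (heq_of_eq θ.outer_left)
      · intro s σ e hσ
        obtain ⟨s, σ, k, hσ⟩ := F.exists_rightAct (.cons Δ p) hσ
        exact CellRel.eq (.comp (Category.id_comp _) (Category.id_comp _) _ _
          hσ (.cellAt _ _ _ _))
          (.comp (Category.comp_id _) (Category.comp_id _) _ _
          (.pair k.top _ (.cellAt _ _ _ _) .mk rfl) (.cellAt Γ.ract rfl _ _)) rfl rfl rfl
          (heq_of_eq (θ.outer_right k k.top))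

theorem cellRel_mapModCell ⦃S S' T T' : HMonad A⦄ ⦃p : BPath S S'⦄ ⦃u : S ⟶ T⦄ ⦃v : S' ⟶ T'⦄
    ⦃Γ : HBimod T T'⦄ (θ : ModCell p u v Γ) : F.CellRel θ.cell (F.mapModCell θ).cell :=
  .cellAt θ.cell (F.path_und p) rfl rfl

end VFunctor

theorem ModCell.heq {A : VDC.{o, v, h, c}} {S S' T T' : HMonad A} {p : BPath S S'} {u u' : S ⟶ T}
    {v v' : S' ⟶ T'} {Γ Γ' : HBimod T T'} {θ : ModCell p u v Γ} {θ' : ModCell p u' v' Γ'}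
    (hu : u = u') (hv : v = v') (hΓ : Γ = Γ') (e : θ.cell ≍ θ'.cell) : θ ≍ θ' := by
  subst hu hv hΓ
  exact heq_of_eq (ModCell.ext (eq_of_heq e))

/-- The action of a virtual double functor on monads. -/
@[simps]
def VFunctor.mapHMonad {A : VDC.{o, v, h, c}} {B : VDC.{o₁, v₁, h₁, c₁}} (F : VFunctor A B) :
    HMonad A ⥤ HMonad B where
  obj := F.mapMonad
  map f := F.mapMonadHom f
  map_id T := HMonadHom.ext (F.toFunctor.map_id _) (F.cell_ident T.hor)
  map_comp f g := HMonadHom.ext (F.toFunctor.map_comp _ _) (by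
    change F.cell (A.comp (.single f.cell) g.cell rfl rfl) ≍ B.comp (.single (F.cell f.cell)) (F.cell g.cell) rfl rfl
    exact (VFunctor.CellRel.comp rfl rfl rfl rfl (.single .mk rfl) .mk).heq.symm)

theorem VFunctor.chainRel_undChain {A : VDC.{o, v, h, c}} {B : VDC.{o₁, v₁, h₁, c₁}}
    (F : VFunctor A B) {S S' T T' : HMonad A} {p : BPath S S'} {u : S ⟶ T} {v : S' ⟶ T'}
    {q : BPath T T'} (Θ : Sq (ModFam A) p u v q) :
    F.ChainRel (undChain Θ) (undChain (Sq.map (K' := ModFam B) F.mapHMonad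
      (fun _ _ Γ => F.mapBimod Γ) F.mapModCell Θ)) := by
  induction Θ with
  | nil u => exact .nil rfl
  | cons θ Θ e ih => exact .cons (.cellAt θ.cell (F.path_und _) rfl rfl) ih _ _

/-- The unital virtual double functor between virtual double categories of monads and bimodules
induced by a virtual double functor. -/
def ModVDC.map {A : VDC.{o, v, h, c}} {B : VDC.{o₁, v₁, h₁, c₁}} (F : VFunctor A B) :
    UFunctor (ModVDC A) (ModVDC B) where
  toFunctor := F.mapHMonad
  hor _ _ Γ := F.mapBimod Γ
  cell := F.mapModCell
  cell_ident Γ := by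
    refine ModCell.heq (F.mapHMonad.map_id _) (F.mapHMonad.map_id _) rfl ?_
    exact F.cell_ident Γ.hor
  cell_comp Θ θ hu hv := by
    apply ModCell.ext
    exact VFunctor.CellRel.eq (F.cellRel_mapModCell _) (.comp (congrArg HMonadHom.hom hu)
      (congrArg HMonadHom.hom hv) _ _ (F.chainRel_undChain Θ)
      (F.cellRel_mapModCell θ)) rfl rfl rfl HEq.rfl
  map_unit T := rfl
  map_eta T := by
    refine ModCell.heq (F.mapHMonad.map_id _) (F.mapHMonad.map_id _) rfl ?_
    exact (F.cellRel_mapModCell T.eta).heq.trans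
      (VFunctor.CellRel.cellAt (F := F) T.unit rfl (F.toFunctor.map_id _)
        (F.toFunctor.map_id _)).heq.symm

/-- The inclusion of a horizontally chaotic virtual double category into its unital virtual double
category of monads and bimodules: it sends an object to its unit, with the unique monad structure,
and similarly for the rest of the data. -/
def uhcInc (C : Type o) [Category.{v} C] : UFunctor (uhc C) (ModVDC (hc C)) where
  toFunctor :=
    { obj X := ⟨X, ⟨⟩, ⟨⟩, ⟨⟩, rfl, rfl, rfl⟩
      map f := ⟨f, ⟨⟩, rfl, rfl⟩
      map_id _ := rfl
      map_comp _ _ := rfl }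
  hor _ _ _ := ⟨⟨⟩, ⟨⟩, ⟨⟩, rfl, rfl, rfl, rfl, rfl⟩
  cell _ _ _ _ p _ _ _ _ := ⟨⟨⟩, fun _ _ _ _ => rfl, by
    cases p with
    | nil => exact rfl
    | cons => exact ⟨rfl, fun _ _ _ _ => rfl⟩⟩
  cell_ident _ := HEq.rfl
  cell_comp _ _ _ _ := rfl
  map_unit _ := rfl
  map_eta _ := HEq.rfl

/-- The unital virtual double functor from the horizontally chaotic virtual double category on the
category of small sets to the virtual double category of monads and bimodules in spans, i.e. of
internal categories in sets and internal profunctors. -/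
def chaoticProf : UFunctor (uhc (Type u)) (ModVDC SpanVDC.{u}) :=
  (uhcInc (Type u)).comp (ModVDC.map chaoticSpan.{u})

/-- The unital virtual double category of small categories enriched in `A` and profunctors. -/
abbrev ProfVDC (A : VDC.{o, v, h, c}) : UVDC := ModVDC (MatVDC.{o, v, h, c, u} A)

/-- The unital virtual double functor sending an enriched category to its set of objects. -/
def profObj (A : VDC.{o, v, h, c}) : UFunctor (ProfVDC.{o, v, h, c, u} A) (uhc (Type u)) :=
  UFunctor.toHc (HMonad.forget (MatVDC.{o, v, h, c, u} A) ⋙ famIdx A)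

/-! ### Two-categories -/

/-- The data of a 2-category with a given underlying category: 2-cells with vertical composition and
whiskering.  The equations between 2-cells whose boundaries agree only up to the laws of the
underlying category are heterogeneous equations. -/
structure TwoCatData (B : Type o) [Category.{v} B] where
  Hom₂ : ∀ {a b : B}, (a ⟶ b) → (a ⟶ b) → Type w
  id₂ : ∀ {a b : B} (f : a ⟶ b), Hom₂ f f
  vcomp : ∀ {a b : B} {f g k : a ⟶ b}, Hom₂ f g → Hom₂ g k → Hom₂ f k
  left : ∀ {a b d : B} (f : a ⟶ b) {g g' : b ⟶ d}, Hom₂ g g' → Hom₂ (f ≫ g) (f ≫ g')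
  right : ∀ {a b d : B} {f f' : a ⟶ b}, Hom₂ f f' → ∀ g : b ⟶ d, Hom₂ (f ≫ g) (f' ≫ g)
  id_vcomp : ∀ {a b : B} {f g : a ⟶ b} (α : Hom₂ f g), vcomp (id₂ f) α = α
  vcomp_id : ∀ {a b : B} {f g : a ⟶ b} (α : Hom₂ f g), vcomp α (id₂ g) = α
  vassoc : ∀ {a b : B} {f g k l : a ⟶ b} (α : Hom₂ f g) (β : Hom₂ g k) (γ : Hom₂ k l),
    vcomp (vcomp α β) γ = vcomp α (vcomp β γ)
  left_id : ∀ {a b d : B} (f : a ⟶ b) (g : b ⟶ d), left f (id₂ g) = id₂ (f ≫ g)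
  left_vcomp : ∀ {a b d : B} (f : a ⟶ b) {g k l : b ⟶ d} (α : Hom₂ g k) (β : Hom₂ k l),
    left f (vcomp α β) = vcomp (left f α) (left f β)
  id_right : ∀ {a b d : B} (f : a ⟶ b) (g : b ⟶ d), right (id₂ f) g = id₂ (f ≫ g)
  vcomp_right : ∀ {a b d : B} {f k l : a ⟶ b} (α : Hom₂ f k) (β : Hom₂ k l) (g : b ⟶ d),
    right (vcomp α β) g = vcomp (right α g) (right β g)
  id_left : ∀ {a b : B} {f g : a ⟶ b} (α : Hom₂ f g), left (𝟙 a) α ≍ α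
  comp_left : ∀ {a b d e : B} (f : a ⟶ b) (g : b ⟶ d) {k l : d ⟶ e} (α : Hom₂ k l),
    left (f ≫ g) α ≍ left f (left g α)
  right_id : ∀ {a b : B} {f g : a ⟶ b} (α : Hom₂ f g), right α (𝟙 b) ≍ α
  right_comp : ∀ {a b d e : B} {f f' : a ⟶ b} (α : Hom₂ f f') (g : b ⟶ d) (k : d ⟶ e),
    right α (g ≫ k) ≍ right (right α g) k
  left_right : ∀ {a b d e : B} (f : a ⟶ b) {g g' : b ⟶ d} (α : Hom₂ g g') (k : d ⟶ e),
    right (left f α) k ≍ left f (right α k)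
  exchange : ∀ {a b d : B} {f f' : a ⟶ b} {g g' : b ⟶ d} (α : Hom₂ f f') (β : Hom₂ g g'),
    vcomp (left f β) (right α g') = vcomp (right α g) (left f' β)

namespace TwoCatData

variable {B : Type o} [Category.{v} B] (T : TwoCatData.{o, v, w} B)

/-- The category of morphisms from `a` to `b`. -/
abbrev homCat (a b : B) : Category (a ⟶ b) where
  Hom f g := T.Hom₂ f g
  id f := T.id₂ f
  comp α β := T.vcomp α β
  id_comp := T.id_vcomp
  comp_id := T.vcomp_id
  assoc := T.vassoc

theorem conj {a b : B} {f g f' g' : a ⟶ b} {α : T.Hom₂ f g} {β : T.Hom₂ f' g'} (hf : f = f')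
    (hg : g' = g) (e : α ≍ β) : letI := T.homCat a b;
    α = T.vcomp (eqToHom hf : T.Hom₂ f f') (T.vcomp β (eqToHom hg : T.Hom₂ g' g)) := by
  subst hf hg e
  exact ((T.id_vcomp _).trans (T.vcomp_id _)).symm

/-- The bicategory given by the data of a 2-category. -/
abbrev bicategory : Bicategory.{w, v} B :=
  letI := T.homCat
  { (inferInstance : CategoryStruct B) with
    homCategory a b := T.homCat a b
    whiskerLeft f _ _ α := T.left f α
    whiskerRight α g := T.right α g
    associator f g k := eqToIso (Category.assoc f g k)
    leftUnitor f := eqToIso (Category.id_comp f)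
    rightUnitor f := eqToIso (Category.comp_id f)
    whiskerLeft_id := T.left_id
    whiskerLeft_comp := T.left_vcomp
    id_whiskerRight := T.id_right
    comp_whiskerRight := T.vcomp_right
    id_whiskerLeft α := T.conj (by simp) (by simp) (T.id_left α)
    comp_whiskerLeft f g _ _ α := T.conj (by simp) (by simp) (T.comp_left f g α)
    whiskerRight_id α := T.conj (by simp) (by simp) (T.right_id α)
    whiskerRight_comp α g k := T.conj (by simp) (by simp) (T.right_comp α g k)
    whisker_assoc f _ _ α k := T.conj (by simp) (by simp) (T.left_right f α k)
    whisker_exchange := T.exchange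
    pentagon f g k l := by
      have hL : ∀ {a b d : B} (f : a ⟶ b) {g g' : b ⟶ d} (e : g = g'),
          T.left f (eqToHom e) = eqToHom (congrArg (f ≫ ·) e) := by
        intro _ _ _ f g _ e
        subst e
        exact T.left_id f g
      have hR : ∀ {a b d : B} {f f' : a ⟶ b} (e : f = f') (g : b ⟶ d),
          T.right (eqToHom e) g = eqToHom (congrArg (· ≫ g) e) := by
        intro _ _ _ f _ e g
        subst e
        exact T.id_right f g
      simp [hL, hR]
    triangle f g := by
      have hL : ∀ {a b d : B} (f : a ⟶ b) {g g' : b ⟶ d} (e : g = g'),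
          T.left f (eqToHom e) = eqToHom (congrArg (f ≫ ·) e) := by
        intro _ _ _ f g _ e
        subst e
        exact T.left_id f g
      have hR : ∀ {a b d : B} {f f' : a ⟶ b} (e : f = f') (g : b ⟶ d),
          T.right (eqToHom e) g = eqToHom (congrArg (· ≫ g) e) := by
        intro _ _ _ f _ e g
        subst e
        exact T.id_right f g
      simp [hL, hR] }

theorem strict : letI := bicategory T; Bicategory.Strict B :=
  letI := bicategory T
  { id_comp := Category.id_comp
    comp_id := Category.comp_id
    assoc := Category.assoc
    leftUnitor_eqToIso _ := rfl
    rightUnitor_eqToIso _ := rfl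
    associator_eqToIso _ _ _ := rfl }

end TwoCatData

section TwoCat

open Bicategory

/-- Construction of a strict 2-functor between 2-categories. -/
def TwoCatData.functor {B : Type o₁} [Bicategory.{w₁, v₁} B] [Strict B] {C : Type o₂}
    [Bicategory.{w₂, v₂} C] [Strict C] (obj : B → C)
    (map : ∀ {a b : B}, (a ⟶ b) → (obj a ⟶ obj b))
    (map₂ : ∀ {a b : B} {f g : a ⟶ b}, (f ⟶ g) → (map f ⟶ map g))
    (map₂_id : ∀ {a b : B} (f : a ⟶ b), map₂ (𝟙 f) = 𝟙 (map f))
    (map₂_comp : ∀ {a b : B} {f g k : a ⟶ b} (α : f ⟶ g) (β : g ⟶ k),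
      map₂ (α ≫ β) = map₂ α ≫ map₂ β)
    (map_id : ∀ a : B, map (𝟙 a) = 𝟙 (obj a))
    (map_comp : ∀ {a b d : B} (f : a ⟶ b) (g : b ⟶ d), map (f ≫ g) = map f ≫ map g)
    (map₂_left : ∀ {a b d : B} (f : a ⟶ b) {g g' : b ⟶ d} (α : g ⟶ g'),
      map₂ (f ◁ α) ≍ map f ◁ map₂ α)
    (map₂_right : ∀ {a b d : B} {f f' : a ⟶ b} (α : f ⟶ f') (g : b ⟶ d),
      map₂ (α ▷ g) ≍ map₂ α ▷ map g) : StrictPseudofunctor B C :=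
  .mk''
    { obj := obj
      map := map
      map₂ := map₂
      map₂_id := map₂_id
      map₂_comp := map₂_comp
      map_id := map_id
      map_comp := map_comp
      map₂_whisker_left f _ _ α :=
        (conj_eqToHom_iff_heq _ _ (map_comp f _) (map_comp f _)).2 (map₂_left f α)
      map₂_whisker_right α g :=
        (conj_eqToHom_iff_heq _ _ (map_comp _ g) (map_comp _ g)).2 (map₂_right α g) }

/-- Strict 2-natural transformations between strict 2-functors. -/
@[ext]
structure TwoNatTrans {B : Type o₁} [Bicategory.{w₁, v₁} B] {C : Type o₂} [Bicategory.{w₂, v₂} C]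
    (F G : StrictPseudofunctor B C) where
  app : ∀ a : B, F.obj a ⟶ G.obj a
  naturality : ∀ {a b : B} (f : a ⟶ b), F.map f ≫ app b = app a ≫ G.map f
  naturality₂ : ∀ {a b : B} {f g : a ⟶ b} (α : f ⟶ g),
    F.map₂ α ▷ app b ≍ app a ◁ G.map₂ α

/-- The composite of a strict 2-natural transformation with a strict 2-functor out of the common
codomain. -/
def TwoNatTrans.whisker {B : Type o₁} [Bicategory.{w₁, v₁} B] {C : Type o₂}
    [Bicategory.{w₂, v₂} C] {D : Type o₃} [Bicategory.{w₃, v₃} D] {F G : StrictPseudofunctor B C}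
    (α : TwoNatTrans F G) (P : StrictPseudofunctor C D) :
    TwoNatTrans (F.comp P) (G.comp P) where
  app a := P.map (α.app a)
  naturality f := ((P.map_comp _ _).symm.trans (congrArg (fun x => P.map x)
    (α.naturality f))).trans (P.map_comp _ _)
  naturality₂ {a b f g} β := by
    have hP : ∀ {x y : C} {k l k' l' : x ⟶ y} {θ : k ⟶ l} {θ' : k' ⟶ l'}, k = k' → l = l' →
        θ ≍ θ' → P.map₂ θ ≍ P.map₂ θ' := by
      intro _ _ _ _ _ _ _ _ h₁ h₂ h
      subst h₁ h₂ h
      rfl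
    have hl := P.map₂_whisker_left (α.app a) (G.map₂ β)
    have hr := P.map₂_whisker_right (F.map₂ β) (α.app b)
    rw [P.mapComp_eq_eqToIso, P.mapComp_eq_eqToIso, eqToIso.hom, eqToIso.inv] at hl hr
    have hl := (conj_eqToHom_iff_heq _ _ _ (P.map_comp _ _)).1 hl
    have hr := (conj_eqToHom_iff_heq _ _ _ (P.map_comp _ _)).1 hr
    exact hr.symm.trans ((hP (α.naturality f) (α.naturality g) (α.naturality₂ β)).trans hl)

/-- The square with upper leg `P`, left leg `Q`, right leg `F` and lower leg `G` is a (strict)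
pullback in the 2-category of 2-categories, 2-functors and 2-natural transformations. -/
structure IsTwoCatPullback {X : Type o} [Bicategory.{w, v} X] {Y : Type o₁} [Bicategory.{w₁, v₁} Y]
    {Z : Type o₂} [Bicategory.{w₂, v₂} Z] {W : Type o₃} [Bicategory.{w₃, v₃} W]
    (P : StrictPseudofunctor X Y) (Q : StrictPseudofunctor X Z) (F : StrictPseudofunctor Y W)
    (G : StrictPseudofunctor Z W) : Prop where
  comm : P.comp F = Q.comp G
  lift : ∀ (T : Type o₄) [Bicategory.{w₄, v₄} T] [Strict T] (R : StrictPseudofunctor T Y)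
    (S : StrictPseudofunctor T Z), R.comp F = S.comp G →
    ∃! K : StrictPseudofunctor T X, K.comp P = R ∧ K.comp Q = S
  lift₂ : ∀ (T : Type o₄) [Bicategory.{w₄, v₄} T] [Strict T] (K L : StrictPseudofunctor T X)
    (α : TwoNatTrans (K.comp P) (L.comp P)) (β : TwoNatTrans (K.comp Q) (L.comp Q)),
    α.whisker F ≍ β.whisker G → ∃! γ : TwoNatTrans K L, γ.whisker P = α ∧ γ.whisker Q = β

end TwoCat

/-! ### The 2-category of objects, vertical morphisms and cells between units -/

namespace UVDC

variable {D : UVDC.{o, v, h, c}}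

theorem ext_head {X Y Z W : D.Obj} {p : D.Path X Y} {u : X ⟶ Z} {v : Y ⟶ W} {Γ : D.Hor Z W}
    {θ φ : D.Cell (.cons (D.unit X) p) u v Γ}
    (e : D.comp (.cons (D.eta X) (D.ids p) rfl) θ (Category.id_comp u) (Category.id_comp v) =
      D.comp (.cons (D.eta X) (D.ids p) rfl) φ (Category.id_comp u) (Category.id_comp v)) :
    θ = φ :=
  (D.opcart X (.nil X) p u v Γ _).unique e rfl

/-- The restriction of a multicell along the unit. -/
abbrev flat {X Z W : D.Obj} {u : X ⟶ Z} {v : X ⟶ W} {Γ : D.Hor Z W}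
    (θ : D.Cell (.one (D.unit X)) u v Γ) : D.Cell (.nil X) u v Γ :=
  D.comp (.single (D.eta X)) θ (Category.id_comp u) (Category.id_comp v)

theorem flat_inj {X Z W : D.Obj} {u : X ⟶ Z} {v : X ⟶ W} {Γ : D.Hor Z W}
    {θ φ : D.Cell (.one (D.unit X)) u v Γ} (e : flat θ = flat φ) : θ = φ := ext_head e

theorem flat_heq {X Z W : D.Obj} {u u' : X ⟶ Z} {v v' : X ⟶ W} {Γ : D.Hor Z W}
    {θ : D.Cell (.one (D.unit X)) u v Γ} {φ : D.Cell (.one (D.unit X)) u' v' Γ} (hu : u = u')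
    (hv : v = v') (e : flat θ ≍ flat φ) : θ ≍ φ := by
  subst hu hv
  exact heq_of_eq (flat_inj (eq_of_heq e))

variable (D) in
/-- The cell between units given by a vertical morphism. -/
noncomputable def om {X Y : D.Obj} (u : X ⟶ Y) : D.Cell (.one (D.unit X)) u u (D.unit Y) :=
  (D.opcart X (.nil X) (.nil X) u u (D.unit Y)
    (D.comp (.nil u) (D.eta Y) (Category.comp_id u) (Category.comp_id u))).choose

theorem flat_om {X Y : D.Obj} (u : X ⟶ Y) :
    flat (D.om u) = D.comp (.nil u) (D.eta Y) (Category.comp_id u) (Category.comp_id u) :=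
  (D.opcart X (.nil X) (.nil X) u u (D.unit Y)
    (D.comp (.nil u) (D.eta Y) (Category.comp_id u) (Category.comp_id u))).choose_spec.1

variable (D) in
/-- The multiplication of a unit. -/
noncomputable def mu (X : D.Obj) :
    D.Cell (.cons (D.unit X) (.one (D.unit X))) (𝟙 X) (𝟙 X) (D.unit X) :=
  (D.opcart X (.nil X) (.one (D.unit X)) (𝟙 X) (𝟙 X) (D.unit X) (D.ident (D.unit X))).choose

theorem eta_mu (X : D.Obj) : D.comp (.pair (r := .one (D.unit X)) (D.eta X) (D.ident (D.unit X)))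
    (D.mu X) (Category.id_comp _) (Category.id_comp _) = D.ident (D.unit X) :=
  (D.opcart X (.nil X) (.one (D.unit X)) (𝟙 X) (𝟙 X) (D.unit X)
    (D.ident (D.unit X))).choose_spec.1

theorem nil_comp {X Z W : D.Obj} {u : X ⟶ Z} {v : X ⟶ W} {Γ : D.Hor Z W}
    (θ : D.Cell (.nil X) u v Γ) :
    D.comp (.nil (𝟙 X)) θ (Category.id_comp u) (Category.id_comp v) = θ := D.ident_comp θ

theorem single_comp {X Y Z W : D.Obj} {Δ : D.Hor X Y} {u : X ⟶ Z} {v : Y ⟶ W} {Γ : D.Hor Z W}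
    (θ : D.Cell (.one Δ) u v Γ) :
    D.comp (.single (D.ident Δ)) θ (Category.id_comp u) (Category.id_comp v) = θ := D.ident_comp θ

/-- Cells followed by the multiplication on the left unit. -/
theorem unit_mul {X Y Z : D.Obj} {p : D.Path X Y} {u : X ⟶ Z} {v : Y ⟶ Z}
    (θ : D.Cell p u v (D.unit Z)) :
    D.comp (.pair (r := p) (D.comp (.nil u) (D.eta Z) (Category.comp_id u) (Category.comp_id u)) θ)
      (D.mu Z) (Category.comp_id u) (Category.comp_id v) = θ := by
  refine Eq.trans ?_ (D.comp_ident θ)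
  rw [← eta_mu]
  refine (D.assoc (D.mu Z) ?_ _ _ _ _ _ _).symm
  have := VDC.vcomp_pair (A := D.toVDC) (D.eta Z) (D.ident (D.unit Z)) (HApp.nil (.single θ))
    (Category.comp_id u) (Category.comp_id u) (Category.comp_id v) (q := .one (D.unit Z)) rfl rfl
  rwa [D.comp_ident] at this

theorem mu_eta (X : D.Obj) : D.comp (.pair (r := .one (D.unit X)) (D.ident (D.unit X)) (D.eta X))
    (D.mu X) (Category.id_comp _) (Category.id_comp _) = D.ident (D.unit X) := by
  apply flat_inj
  refine Eq.trans ?_ (D.comp_ident (D.eta X)).symm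
  have e := VDC.vcomp_pair (A := D.toVDC) (D.ident (D.unit X)) (D.eta X)
    (HApp.append_nil (.single (D.eta X)))
    (Category.comp_id _) (Category.comp_id _) (Category.comp_id _) (q := .one (D.unit X)) rfl rfl
  rw [D.comp_ident, nil_comp] at e
  refine (D.assoc (D.mu X) e _ _ _ _ (Category.comp_id _) (Category.comp_id _)).trans ?_
  have := unit_mul (D.eta X)
  rwa [nil_comp] at this

theorem mul_unit {X Y Z : D.Obj} {p : D.Path X Y} {u : X ⟶ Z} {v : Y ⟶ Z}
    (θ : D.Cell p u v (D.unit Z)) :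
    D.comp (.pair (r := p) θ (D.comp (.nil v) (D.eta Z) (Category.comp_id v) (Category.comp_id v))
      p.append_nil) (D.mu Z) (Category.comp_id u) (Category.comp_id v) = θ := by
  refine Eq.trans ?_ (D.comp_ident θ)
  rw [← mu_eta]
  refine (D.assoc (D.mu Z) ?_ _ _ _ _ _ _).symm
  have := VDC.vcomp_pair (A := D.toVDC) (D.ident (D.unit Z)) (D.eta Z)
    (HApp.append_nil (.single θ))
    (Category.comp_id u) (Category.comp_id v) (Category.comp_id v) (q := .one (D.unit Z)) rfl
    p.append_nil
  rwa [D.comp_ident] at this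

theorem mu_assoc (X : D.Obj) :
    D.comp (.pair (r := .cons (D.unit X) (.cons (D.unit X) (.one (D.unit X)))) (D.mu X)
      (D.ident (D.unit X))) (D.mu X) (Category.id_comp _) (Category.id_comp _) =
    D.comp (.pair (r := .cons (D.unit X) (.cons (D.unit X) (.one (D.unit X))))
      (D.ident (D.unit X)) (D.mu X)) (D.mu X) (Category.id_comp _) (Category.id_comp _) := by
  apply ext_head
  have e₁ := VDC.vcomp_pair (A := D.toVDC) (D.mu X) (D.ident (D.unit X))
    (Θ := .cons (D.eta X) (D.ids (.cons (D.unit X) (.one (D.unit X)))) rfl)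
    (Θ₁ := .pair (r := .one (D.unit X)) (D.eta X) (D.ident (D.unit X)))
    (Θ₂ := .single (D.ident (D.unit X)))
    (.cons _ (.cons _ (.nil _) rfl rfl) rfl rfl)
    (Category.comp_id _) (Category.comp_id _) (Category.comp_id _)
    (q := .cons (D.unit X) (.cons (D.unit X) (.one (D.unit X)))) rfl rfl
  rw [eta_mu, single_comp] at e₁
  have e₂ := VDC.vcomp_pair (A := D.toVDC) (D.ident (D.unit X)) (D.mu X)
    (Θ := .cons (D.eta X) (D.ids (.cons (D.unit X) (.one (D.unit X)))) rfl)
    (Θ₁ := .single (D.eta X))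
    (Θ₂ := D.ids (.cons (D.unit X) (.one (D.unit X))))
    (.cons _ (.nil _) rfl rfl)
    (Category.comp_id _) (Category.comp_id _) (Category.comp_id _)
    (q := .cons (D.unit X) (.cons (D.unit X) (.one (D.unit X)))) rfl rfl
  rw [D.comp_ident, D.ident_comp] at e₂
  refine (D.assoc (D.mu X) e₁ _ _ _ _ (Category.comp_id _) (Category.comp_id _)).trans
    (Eq.trans ?_ (D.assoc (D.mu X) e₂ _ _ _ _ (Category.comp_id _) (Category.comp_id _)).symm)
  have := unit_mul (D.mu X)
  rw [nil_comp] at this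
  exact (D.ident_comp (D.mu X)).trans this.symm

theorem mu_om {X Y : D.Obj} (u : X ⟶ Y) :
    D.comp (.single (D.mu X)) (D.om u) (Category.id_comp _) (Category.id_comp _) =
    D.comp (.pair (r := .cons (D.unit X) (.one (D.unit X))) (D.om u) (D.om u)) (D.mu Y)
      (Category.comp_id _) (Category.comp_id _) := by
  apply ext_head
  have e₁ := VDC.vcomp_single (A := D.toVDC)
    (.pair (r := .one (D.unit X)) (D.eta X) (D.ident (D.unit X))) (D.mu X)
    (Category.id_comp _) (Category.id_comp _)
  rw [eta_mu] at e₁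
  have e₂ := VDC.vcomp_pair (A := D.toVDC) (D.om u) (D.om u)
    (Θ := .pair (r := .one (D.unit X)) (D.eta X) (D.ident (D.unit X)))
    (Θ₁ := .single (D.eta X))
    (Θ₂ := .single (D.ident (D.unit X)))
    (.cons _ (.nil _) rfl rfl)
    (Category.id_comp _) (Category.id_comp _) (Category.id_comp _)
    (q := .cons (D.unit X) (.one (D.unit X))) rfl rfl
  rw [show D.comp (.single (D.eta X)) (D.om u) _ _ = _ from flat_om u, single_comp] at e₂
  refine (D.assoc (D.om u) e₁ _ _ _ _ (Category.id_comp _) (Category.id_comp _)).trans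
    (Eq.trans ?_ (D.assoc (D.mu Y) e₂ _ _ _ _ (Category.comp_id _) (Category.comp_id _)).symm)
  exact (single_comp (D.om u)).trans (unit_mul (D.om u)).symm

theorem om_id (X : D.Obj) : D.om (𝟙 X) = D.ident (D.unit X) := by
  apply flat_inj
  rw [flat_om]
  exact (nil_comp (D.eta X)).trans (D.comp_ident (D.eta X)).symm

theorem om_comp {X Y Z : D.Obj} (u : X ⟶ Y) (w : Y ⟶ Z) :
    D.om (u ≫ w) = D.comp (.single (D.om u)) (D.om w) rfl rfl := by
  apply flat_inj
  rw [flat_om]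
  refine Eq.trans ?_ (VDC.assoc_single (.single (D.eta X)) (D.om u) (D.om w) rfl rfl (Category.id_comp _)
    (Category.id_comp _) (Category.id_comp _) (Category.id_comp _) rfl rfl).symm
  rw [show D.comp (.single (D.eta X)) (D.om u) _ _ = _ from flat_om u,
    ← VDC.assoc_single (.nil u) (D.eta Y) (D.om w) (Category.id_comp _) (Category.id_comp _) rfl rfl,
    show D.comp (.single (D.eta Y)) (D.om w) _ _ = _ from flat_om w]
  exact (VDC.assoc_nil (D.eta Z) _ _ _ _ rfl _ _).symm

/-- Vertical composition of nullary cells into units. -/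
noncomputable abbrev nmul {X Y Z T : D.Obj} {p : D.Path X Y} {q : D.Path Y Z} {r : D.Path X Z}
    {u : X ⟶ T} {w : Y ⟶ T} {v : Z ⟶ T} (α : D.Cell p u w (D.unit T)) (β : D.Cell q w v (D.unit T))
    (e : p.append q = r := by rfl) : D.Cell r u v (D.unit T) :=
  D.comp (.pair α β e) (D.mu T) (Category.comp_id u) (Category.comp_id v)

/-- The vertical composite of cells between units. -/
noncomputable def vmul {X Y : D.Obj} {u w v : X ⟶ Y}
    (θ : D.Cell (.one (D.unit X)) u w (D.unit Y)) (φ : D.Cell (.one (D.unit X)) w v (D.unit Y)) :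
    D.Cell (.one (D.unit X)) u v (D.unit Y) := nmul θ (flat φ)

theorem flat_vmul {X Y : D.Obj} {u w v : X ⟶ Y}
    (θ : D.Cell (.one (D.unit X)) u w (D.unit Y)) (φ : D.Cell (.one (D.unit X)) w v (D.unit Y)) :
    flat (vmul θ φ) = nmul (flat θ) (flat φ) := by
  have e := VDC.vcomp_pair (A := D.toVDC) θ (flat φ)
    (HApp.append_nil (.single (D.eta X)))
    (Category.id_comp _) (Category.id_comp _) (Category.id_comp _) (q := .one (D.unit X)) rfl rfl
  rw [nil_comp] at e
  exact D.assoc (D.mu Y) e _ _ _ _ _ _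

theorem nmul_assoc {X Y : D.Obj} {u w w' v : X ⟶ Y}
    (α : D.Cell (.nil X) u w (D.unit Y)) (β : D.Cell (.nil X) w w' (D.unit Y))
    (γ : D.Cell (.nil X) w' v (D.unit Y)) :
    nmul (nmul α β) γ = nmul α (nmul β γ) := by
  have e₁ := VDC.vcomp_pair (A := D.toVDC) (D.mu Y) (D.ident (D.unit Y))
    (Θ := .cons α (.pair (r := .nil X) β γ) (rfl : (HPath.nil X).append (.nil X) = .nil X))
    (Θ₁ := .pair (r := .nil X) α β) (Θ₂ := .single γ)
    (.cons _ (.cons _ (.nil _) rfl rfl) rfl rfl)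
    (Category.comp_id _) (Category.comp_id _) (Category.comp_id _)
    (q := .cons (D.unit Y) (.cons (D.unit Y) (.one (D.unit Y)))) rfl rfl
  rw [D.comp_ident] at e₁
  have e₂ := VDC.vcomp_pair (A := D.toVDC) (D.ident (D.unit Y)) (D.mu Y)
    (Θ := .cons α (.pair (r := .nil X) β γ) (rfl : (HPath.nil X).append (.nil X) = .nil X))
    (Θ₁ := .single α) (Θ₂ := .pair (r := .nil X) β γ)
    (.cons _ (.nil _) rfl rfl)
    (Category.comp_id _) (Category.comp_id _) (Category.comp_id _)
    (q := .cons (D.unit Y) (.cons (D.unit Y) (.one (D.unit Y)))) rfl rfl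
  rw [D.comp_ident] at e₂
  refine (D.assoc (D.mu Y) e₁ (Category.comp_id _) (Category.comp_id _) (Category.comp_id _)
    (Category.comp_id _) _ _).symm.trans ?_
  rw [mu_assoc]
  exact D.assoc (D.mu Y) e₂ _ _ _ _ _ _

/-- Whiskering of a cell between units with a vertical morphism on the left. -/
noncomputable def lwhisk {X Y Z : D.Obj} (f : X ⟶ Y) {u v : Y ⟶ Z}
    (θ : D.Cell (.one (D.unit Y)) u v (D.unit Z)) :
    D.Cell (.one (D.unit X)) (f ≫ u) (f ≫ v) (D.unit Z) :=
  D.comp (.single (D.om f)) θ rfl rfl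

/-- Whiskering of a cell between units with a vertical morphism on the right. -/
noncomputable def rwhisk {X Y Z : D.Obj} {u v : X ⟶ Y}
    (θ : D.Cell (.one (D.unit X)) u v (D.unit Y)) (f : Y ⟶ Z) :
    D.Cell (.one (D.unit X)) (u ≫ f) (v ≫ f) (D.unit Z) :=
  D.comp (.single θ) (D.om f) rfl rfl

theorem flat_lwhisk {X Y Z : D.Obj} (f : X ⟶ Y) {u v : Y ⟶ Z}
    (θ : D.Cell (.one (D.unit Y)) u v (D.unit Z)) :
    flat (lwhisk f θ) = D.comp (.nil f) (flat θ) rfl rfl := by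
  refine (VDC.assoc_single (.single (D.eta X)) (D.om f) θ rfl rfl (Category.id_comp _)
    (Category.id_comp _) (Category.id_comp _) (Category.id_comp _) rfl rfl).trans ?_
  rw [show D.comp (.single (D.eta X)) (D.om f) _ _ = _ from flat_om f]
  exact (VDC.assoc_single _ _ _ _ _ _ _ _ _ _ _).symm

theorem flat_rwhisk {X Y Z : D.Obj} {u v : X ⟶ Y}
    (θ : D.Cell (.one (D.unit X)) u v (D.unit Y)) (f : Y ⟶ Z) :
    flat (rwhisk θ f) = D.comp (.single (flat θ)) (D.om f) rfl rfl :=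
  VDC.assoc_single (.single (D.eta X)) θ (D.om f) rfl rfl (Category.id_comp _)
    (Category.id_comp _) (Category.id_comp _) (Category.id_comp _) rfl rfl

theorem nil_nmul {X Y Z : D.Obj} (f : X ⟶ Y) {u w v : Y ⟶ Z} (α : D.Cell (.nil Y) u w (D.unit Z))
    (β : D.Cell (.nil Y) w v (D.unit Z)) :
    D.comp (.nil f) (nmul α β) rfl rfl =
      nmul (D.comp (.nil f) α rfl rfl) (D.comp (.nil f) β rfl rfl) :=
  D.assoc (D.mu Z) (VDC.vcomp_pair α β (.nil (.nil f)) rfl rfl rfl rfl rfl) _ _ _ _ _ _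

theorem nmul_om {X Y Z : D.Obj} {u w v : X ⟶ Y} (α : D.Cell (.nil X) u w (D.unit Y))
    (β : D.Cell (.nil X) w v (D.unit Y)) (f : Y ⟶ Z) :
    D.comp (.single (nmul α β)) (D.om f) rfl rfl =
      nmul (D.comp (.single α) (D.om f) rfl rfl) (D.comp (.single β) (D.om f) rfl rfl) := by
  refine (VDC.assoc_single (.pair (r := .nil X) α β) (D.mu Y) (D.om f) (Category.id_comp _)
    (Category.id_comp _) rfl rfl _ _ _ _).symm.trans ?_
  rw [mu_om]
  exact D.assoc (D.mu Z) (VDC.vcomp_pair (D.om f) (D.om f) (.cons _ (.nil _) rfl rfl) rfl rfl rfl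
    rfl rfl) _ _ _ _ _ _

theorem om_exchange {X Y : D.Obj} {u v : X ⟶ Y} (β : D.Cell (.nil X) u v (D.unit Y)) :
    nmul (r := .one (D.unit X)) β (D.om v) = nmul (r := .one (D.unit X)) (D.om u) β := by
  apply flat_inj
  have e₁ := VDC.vcomp_pair (A := D.toVDC) β (D.om v) (.nil (.single (D.eta X)))
    (Category.id_comp _) (Category.id_comp _) (Category.id_comp _) (q := .one (D.unit X)) rfl rfl
  have e₂ := VDC.vcomp_pair (A := D.toVDC) (D.om u) β (HApp.append_nil (.single (D.eta X)))
    (Category.id_comp _) (Category.id_comp _) (Category.id_comp _) (q := .one (D.unit X)) rfl rfl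
  rw [nil_comp, show D.comp (.single (D.eta X)) (D.om v) _ _ = _ from flat_om v] at e₁
  rw [nil_comp, show D.comp (.single (D.eta X)) (D.om u) _ _ = _ from flat_om u] at e₂
  exact (D.assoc (D.mu Y) e₁ _ _ _ _ _ _).trans ((mul_unit β).trans ((unit_mul β).symm.trans
    (D.assoc (D.mu Y) e₂ _ _ _ _ _ _).symm))

end UVDC

namespace UVDC

/-- The 2-category of objects, vertical morphisms and cells between horizontal units of a unital
virtual double category: its 2-cells from `u` to `v` are the cells with left side `u`, right side
`v`, and with horizontal units as top and bottom. -/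
noncomputable def twoCatData (D : UVDC.{o, v, h, c}) : TwoCatData.{o, v, c} D.Obj where
  Hom₂ {X Y} u v := D.Cell (.one (D.unit X)) u v (D.unit Y)
  id₂ u := D.om u
  vcomp θ φ := vmul θ φ
  left f _ _ θ := lwhisk f θ
  right θ f := rwhisk θ f
  id_vcomp θ := flat_inj (by rw [flat_vmul, flat_om]; exact unit_mul _)
  vcomp_id θ := flat_inj (by rw [flat_vmul, flat_om]; exact mul_unit _)
  vassoc α β γ := flat_inj (by simp only [flat_vmul]; exact nmul_assoc _ _ _)
  left_id f g := flat_inj (by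
    rw [flat_lwhisk, flat_om, flat_om]; exact VDC.assoc_nil _ _ _ _ _ rfl _ _)
  left_vcomp f _ _ _ α β := flat_inj (by
    simp only [flat_lwhisk, flat_vmul]; exact nil_nmul _ _ _)
  id_right f g := flat_inj (by
    rw [flat_rwhisk, flat_om, flat_om]
    refine (VDC.assoc_single (.nil f) (D.eta _) (D.om g) (Category.id_comp _) (Category.id_comp _)
      rfl rfl _ _ _ _).symm.trans ?_
    rw [show D.comp (.single (D.eta _)) (D.om g) _ _ = _ from flat_om g]
    exact VDC.assoc_nil _ _ _ _ _ rfl _ _)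
  vcomp_right α β g := flat_inj (by
    simp only [flat_rwhisk, flat_vmul]; exact nmul_om _ _ _)
  id_left α := flat_heq (Category.id_comp _) (Category.id_comp _) (by
    rw [flat_lwhisk]
    refine (VDC.comp_heq rfl rfl HEq.rfl HEq.rfl _ _ (Category.id_comp _)
      (Category.id_comp _)).trans (heq_of_eq (nil_comp (flat α))))
  comp_left f g _ _ α := flat_heq (Category.assoc _ _ _) (Category.assoc _ _ _) (by
    simp only [flat_lwhisk]
    refine HEq.trans ?_ (heq_of_eq (VDC.assoc_nil (flat α) rfl rfl rfl rfl rfl (Category.assoc _ _ _)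
      (Category.assoc _ _ _)).symm)
    exact VDC.comp_heq rfl rfl HEq.rfl HEq.rfl _ _ _ _)
  right_id {_ b _ _} α := flat_heq (Category.comp_id _) (Category.comp_id _) (by
    rw [flat_rwhisk, om_id]
    refine (VDC.comp_heq rfl rfl HEq.rfl HEq.rfl _ _ (Category.comp_id _)
      (Category.comp_id _)).trans (heq_of_eq (D.comp_ident (flat α))))
  right_comp α g k := flat_heq (Category.assoc _ _ _).symm (Category.assoc _ _ _).symm (by
    simp only [flat_rwhisk]
    rw [om_comp]
    refine HEq.trans (heq_of_eq (VDC.assoc_single _ _ _ _ _ _ _ rfl rfl (Category.assoc _ _ _)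
      (Category.assoc _ _ _))) ?_
    exact VDC.comp_heq rfl rfl HEq.rfl HEq.rfl _ _ _ _)
  left_right f _ _ α k := flat_heq (Category.assoc _ _ _) (Category.assoc _ _ _) (by
    simp only [flat_rwhisk, flat_lwhisk]
    refine HEq.trans ?_ (heq_of_eq (VDC.assoc_single _ _ _ _ _ _ _ rfl rfl (Category.assoc _ _ _)
      (Category.assoc _ _ _)).symm)
    exact VDC.comp_heq rfl rfl HEq.rfl HEq.rfl _ _ _ _)
  exchange {_ _ _ f f' g g'} α β := flat_inj (by
    simp only [flat_vmul, flat_rwhisk, flat_lwhisk]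
    have e₁ := VDC.vcomp_pair (A := D.toVDC) (flat β) (D.om g')
      (HApp.nil (.single (flat α)))
      rfl rfl rfl (q := .one (D.unit _)) rfl rfl
    have e₂ := VDC.vcomp_pair (A := D.toVDC) (D.om g) (flat β)
      (HApp.append_nil (.single (flat α)))
      rfl rfl rfl (q := .one (D.unit _)) rfl rfl
    refine (D.assoc (D.mu _) e₁ (Category.comp_id _) (Category.comp_id _) rfl rfl _ _).symm.trans ?_
    refine Eq.trans ?_ (D.assoc (D.mu _) e₂ (Category.comp_id _) (Category.comp_id _) rfl rfl _ _)
    exact congrArg (fun x => D.comp (.single (flat α)) x rfl rfl) (om_exchange (flat β)))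

end UVDC

/-- The objects of a unital virtual double category, regarded as the objects of the 2-category of
vertical morphisms and cells between horizontal units. -/
def VCat (D : UVDC.{o, v, h, c}) : Type o := D.Obj

namespace VCat

noncomputable instance (D : UVDC.{o, v, h, c}) : Bicategory.{c, v} (VCat D) :=
  D.twoCatData.bicategory

instance (D : UVDC.{o, v, h, c}) : Bicategory.Strict (VCat D) := D.twoCatData.strict

end VCat

namespace UFunctor

variable {D : UVDC.{o, v, h, c}} {E : UVDC.{o₁, v₁, h₁, c₁}} (F : UFunctor D E)

theorem cellRel_eta (X : D.Obj) :
    F.CellRel (D.eta X) (E.eta (F.toFunctor.obj X)) :=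
  .of_heq rfl (F.toFunctor.map_id _) (F.toFunctor.map_id _) (F.map_unit X) (F.map_eta X)

/-- The image of a multicell with a unit as its bottom, with given boundary. -/
def cellAt {X Y Z : D.Obj} {p : D.Path X Y} {u : X ⟶ Z} {v : Y ⟶ Z}
    (θ : D.Cell p u v (D.unit Z)) {p' : E.Path (F.toFunctor.obj X) (F.toFunctor.obj Y)}
    (hp : F.path p = p') :
    E.Cell p' (F.toFunctor.map u) (F.toFunctor.map v) (E.unit (F.toFunctor.obj Z)) :=
  hp ▸ F.map_unit Z ▸ F.cell θ

theorem cellRel_cellAt {X Y Z : D.Obj} {p : D.Path X Y} {u : X ⟶ Z} {v : Y ⟶ Z}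
    (θ : D.Cell p u v (D.unit Z)) {p' : E.Path (F.toFunctor.obj X) (F.toFunctor.obj Y)}
    (hp : F.path p = p') : F.CellRel θ (F.cellAt θ hp) := by
  refine .of_heq hp rfl rfl (F.map_unit Z) ?_
  subst hp
  exact (eqRec_heq _ _).symm

theorem path_unit (X : D.Obj) : F.path (.one (D.unit X)) = .one (E.unit (F.toFunctor.obj X)) :=
  congrArg HPath.one (F.map_unit X)

theorem cellRel_ident (X : D.Obj) :
    F.CellRel (D.ident (D.unit X)) (E.ident (E.unit (F.toFunctor.obj X))) := by
  have key : ∀ {Γ' : E.Hor (F.toFunctor.obj X) (F.toFunctor.obj X)}, F.hor (D.unit X) = Γ' →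
      F.CellRel (D.ident (D.unit X)) (E.ident Γ') := by
    intro _ e
    subst e
    exact .ident _
  exact key (F.map_unit X)

theorem cellRel_flat {X Z W : D.Obj} {u : X ⟶ Z} {v : X ⟶ W} {Γ : D.Hor Z W}
    {θ : D.Cell (.one (D.unit X)) u v Γ}
    {u' : F.toFunctor.obj X ⟶ F.toFunctor.obj Z} {v' : F.toFunctor.obj X ⟶ F.toFunctor.obj W}
    {Γ' : E.Hor (F.toFunctor.obj Z) (F.toFunctor.obj W)}
    {θ' : E.Cell (.one (E.unit (F.toFunctor.obj X))) u' v' Γ'} (i : F.CellRel θ θ') :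
    F.CellRel (UVDC.flat θ) (UVDC.flat θ') :=
  .comp _ _ _ _ (.single (F.cellRel_eta X) (F.toFunctor.map_id _)) i

theorem cellRel_om {X Y : D.Obj} (u : X ⟶ Y) :
    F.CellRel (D.om u) (E.om (F.toFunctor.map u)) := by
  have e : F.cellAt (D.om u) (F.path_unit X) = E.om (F.toFunctor.map u) := by
    apply UVDC.flat_inj
    refine VFunctor.CellRel.eq (F.cellRel_flat (F.cellRel_cellAt _ _)) ?_ rfl rfl rfl
      (heq_of_eq (UVDC.flat_om u))
    rw [UVDC.flat_om]
    exact .comp _ _ _ _ (.nil rfl) (F.cellRel_eta Y)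
  exact e ▸ F.cellRel_cellAt _ _

theorem cellRel_mu (X : D.Obj) : F.CellRel (D.mu X) (E.mu (F.toFunctor.obj X)) := by
  have hp : F.path (.cons (D.unit X) (.one (D.unit X))) =
      .cons (E.unit (F.toFunctor.obj X)) (.one (E.unit (F.toFunctor.obj X))) :=
    congrArg (fun U => HPath.cons U (.one U)) (F.map_unit X)
  have e : ∀ θ' : E.Cell (.cons (E.unit (F.toFunctor.obj X)) (.one (E.unit (F.toFunctor.obj X))))
      (𝟙 _) (𝟙 _) (E.unit (F.toFunctor.obj X)), F.CellRel (D.mu X) θ' →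
      θ' = E.mu (F.toFunctor.obj X) := by
    intro θ' i
    apply UVDC.ext_head
    refine Eq.trans ?_ (UVDC.eta_mu _).symm
    exact VFunctor.CellRel.eq (.comp (Category.id_comp _) (Category.id_comp _) _ _
      (.pair rfl _ (F.cellRel_eta X) (F.cellRel_ident X) (F.toFunctor.map_id _)) i)
      (F.cellRel_ident X) rfl rfl rfl (heq_of_eq (UVDC.eta_mu X))
  have key : ∀ {u' v' : F.toFunctor.obj X ⟶ F.toFunctor.obj X}, F.toFunctor.map (𝟙 X) = u' →
      F.toFunctor.map (𝟙 X) = v' → ∃ θ' : E.Cell (.cons (E.unit (F.toFunctor.obj X))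
        (.one (E.unit (F.toFunctor.obj X)))) u' v' (E.unit (F.toFunctor.obj X)),
        F.CellRel (D.mu X) θ' := by
    intro _ _ h₁ h₂
    subst h₁ h₂
    exact ⟨_, F.cellRel_cellAt (D.mu X) hp⟩
  obtain ⟨θ', i⟩ := key (F.toFunctor.map_id X) (F.toFunctor.map_id X)
  exact e θ' i ▸ i

theorem cellRel_vmul {X Y : D.Obj} {u w v : X ⟶ Y}
    {θ : D.Cell (.one (D.unit X)) u w (D.unit Y)} {φ : D.Cell (.one (D.unit X)) w v (D.unit Y)}
    {u' w' v' : F.toFunctor.obj X ⟶ F.toFunctor.obj Y}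
    {θ' : E.Cell (.one (E.unit (F.toFunctor.obj X))) u' w' (E.unit (F.toFunctor.obj Y))}
    {φ' : E.Cell (.one (E.unit (F.toFunctor.obj X))) w' v' (E.unit (F.toFunctor.obj Y))}
    (hv : F.toFunctor.map v = v') (i : F.CellRel θ θ') (j : F.CellRel φ φ') :
    F.CellRel (UVDC.vmul θ φ) (UVDC.vmul θ' φ') :=
  .comp _ _ _ _ (.pair rfl _ i (F.cellRel_flat j) hv) (F.cellRel_mu Y)

end UFunctor

/-- The 2-functor induced by a unital virtual double functor. -/
noncomputable def VCat.map {D : UVDC.{o, v, h, c}} {E : UVDC.{o₁, v₁, h₁, c₁}} (F : UFunctor D E) :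
    StrictPseudofunctor (VCat D) (VCat E) :=
  TwoCatData.functor (B := VCat D) (C := VCat E)
    (fun X : D.Obj => (F.toFunctor.obj X : E.Obj))
    (fun {X Y : D.Obj} (u : X ⟶ Y) => F.toFunctor.map u)
    (fun {X Y : D.Obj} {u v : X ⟶ Y} (θ : D.Cell (.one (D.unit X)) u v (D.unit Y)) =>
      F.cellAt θ (F.path_unit X))
    (fun u => VFunctor.CellRel.eq (F.cellRel_cellAt _ _) (F.cellRel_om u) rfl rfl rfl HEq.rfl)
    (fun α β => VFunctor.CellRel.eq (F.cellRel_cellAt _ _) (F.cellRel_vmul rfl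
      (F.cellRel_cellAt α _) (F.cellRel_cellAt β _)) rfl rfl rfl HEq.rfl)
    (fun X => F.toFunctor.map_id X)
    (fun f g => F.toFunctor.map_comp f g)
    (fun f _ _ α => (F.cellRel_cellAt _ _).heq.trans (VFunctor.CellRel.comp rfl rfl rfl rfl
      (.single (F.cellRel_om f) rfl) (F.cellRel_cellAt α _)).heq.symm)
    (fun α g => (F.cellRel_cellAt _ _).heq.trans (VFunctor.CellRel.comp rfl rfl rfl rfl
      (.single (F.cellRel_cellAt α _) rfl) (F.cellRel_om g)).heq.symm)

/-! ### Enriched categories -/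

/-- Small categories enriched in a virtual double category. -/
structure ACat (A : VDC.{o, v, h, c}) where
  ob : Type u
  extent : ob → A.Obj
  hom : ∀ x y : ob, A.Hor (extent x) (extent y)
  unit : ∀ x : ob, A.Cell (.nil (extent x)) (𝟙 (extent x)) (𝟙 (extent x)) (hom x x)
  mul : ∀ x y z : ob, A.Cell (.cons (hom x y) (.one (hom y z))) (𝟙 (extent x)) (𝟙 (extent z))
    (hom x z)
  unit_mul : ∀ x y : ob, A.comp (.pair (r := .one (hom x y)) (unit x) (A.ident (hom x y)))
    (mul x x y) (Category.id_comp _) (Category.id_comp _) = A.ident (hom x y)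
  mul_unit : ∀ x y : ob, A.comp (.pair (r := .one (hom x y)) (A.ident (hom x y)) (unit y))
    (mul x y y) (Category.id_comp _) (Category.id_comp _) = A.ident (hom x y)
  assoc : ∀ x y z t : ob,
    A.comp (.pair (r := .cons (hom x y) (.cons (hom y z) (.one (hom z t)))) (mul x y z)
        (A.ident (hom z t))) (mul x z t) (Category.id_comp _) (Category.id_comp _) =
      A.comp (.pair (r := .cons (hom x y) (.cons (hom y z) (.one (hom z t)))) (A.ident (hom x y))
        (mul y z t)) (mul x y t) (Category.id_comp _) (Category.id_comp _)

/-- Enriched functors. -/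
structure AFunctor {A : VDC.{o, v, h, c}} (C D : ACat.{o, v, h, c, u} A) where
  obj : C.ob → D.ob
  vert : ∀ x : C.ob, C.extent x ⟶ D.extent (obj x)
  cell : ∀ x y : C.ob, A.Cell (.one (C.hom x y)) (vert x) (vert y) (D.hom (obj x) (obj y))
  map_unit : ∀ x : C.ob, A.comp (.single (C.unit x)) (cell x x) (Category.id_comp _)
      (Category.id_comp _) =
    A.comp (.nil (vert x)) (D.unit (obj x)) (Category.comp_id _) (Category.comp_id _)
  map_mul : ∀ x y z : C.ob, A.comp (.single (C.mul x y z)) (cell x z) (Category.id_comp _)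
      (Category.id_comp _) =
    A.comp (.pair (r := .cons (C.hom x y) (.one (C.hom y z))) (cell x y) (cell y z))
      (D.mul (obj x) (obj y) (obj z)) (Category.comp_id _) (Category.comp_id _)

/-- Enriched natural transformations. -/
@[ext]
structure ANatTrans {A : VDC.{o, v, h, c}} {C D : ACat.{o, v, h, c, u} A} (f g : AFunctor C D) where
  app : ∀ x : C.ob, A.Cell (.nil (C.extent x)) (f.vert x) (g.vert x) (D.hom (f.obj x) (g.obj x))
  naturality : ∀ x y : C.ob,
    A.comp (.pair (r := .one (C.hom x y)) (app x) (g.cell x y))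
      (D.mul (f.obj x) (g.obj x) (g.obj y)) (Category.comp_id _) (Category.comp_id _) =
    A.comp (.pair (r := .one (C.hom x y)) (f.cell x y) (app y))
      (D.mul (f.obj x) (f.obj y) (g.obj y)) (Category.comp_id _) (Category.comp_id _)

namespace ACat

variable {A : VDC.{o, v, h, c}} (D : ACat.{o, v, h, c, u} A)

/-- The product of two multicells into composable hom-morphisms of an enriched category. -/
abbrev nm {X Y Z : A.Obj} {x y z : D.ob} {p : A.Path X Y} {q : A.Path Y Z} {r : A.Path X Z}
    {a : X ⟶ D.extent x} {b : Y ⟶ D.extent y} {d : Z ⟶ D.extent z}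
    (θ : A.Cell p a b (D.hom x y)) (φ : A.Cell q b d (D.hom y z)) (e : p.append q = r := by rfl) :
    A.Cell r a d (D.hom x z) :=
  A.comp (.pair θ φ e) (D.mul x y z) (Category.comp_id _) (Category.comp_id _)

theorem nm_assoc {X Y Z W : A.Obj} {x y z t : D.ob} {p : A.Path X Y} {q : A.Path Y Z}
    {r : A.Path Z W} {pq : A.Path X Z} {qr : A.Path Y W} {s : A.Path X W}
    {a : X ⟶ D.extent x} {b : Y ⟶ D.extent y} {d : Z ⟶ D.extent z} {e : W ⟶ D.extent t}
    (θ : A.Cell p a b (D.hom x y)) (φ : A.Cell q b d (D.hom y z)) (κ : A.Cell r d e (D.hom z t))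
    (e₁ : p.append q = pq) (e₂ : pq.append r = s) (e₃ : q.append r = qr) (e₄ : p.append qr = s) :
    D.nm (D.nm θ φ e₁) κ e₂ = D.nm θ (D.nm φ κ e₃) e₄ := by
  have i₁ := VDC.vcomp_pair (A := A) (D.mul x y z) (A.ident (D.hom z t))
    (Θ := .cons θ (.pair φ κ e₃) e₄) (Θ₁ := .pair θ φ e₁) (Θ₂ := .single κ)
    (.cons _ (.cons _ (.nil _) _ _) _ _)
    (Category.comp_id _) (Category.comp_id _) (Category.comp_id _)
    (q := .cons (D.hom x y) (.cons (D.hom y z) (.one (D.hom z t)))) rfl e₂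
  rw [A.comp_ident] at i₁
  have i₂ := VDC.vcomp_pair (A := A) (A.ident (D.hom x y)) (D.mul y z t)
    (Θ := .cons θ (.pair φ κ e₃) e₄) (Θ₁ := .single θ) (Θ₂ := .pair φ κ e₃)
    (.cons _ (.nil _) _ _)
    (Category.comp_id _) (Category.comp_id _) (Category.comp_id _)
    (q := .cons (D.hom x y) (.cons (D.hom y z) (.one (D.hom z t)))) rfl e₄
  rw [A.comp_ident] at i₂
  refine (A.assoc (D.mul x z t) i₁ (Category.comp_id _) (Category.comp_id _) (Category.comp_id _)
    (Category.comp_id _) _ _).symm.trans ?_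
  rw [D.assoc]
  exact A.assoc (D.mul x y t) i₂ _ _ _ _ _ _

theorem unit_nm {X Y : A.Obj} {x y : D.ob} {p : A.Path X Y} {a : X ⟶ D.extent x}
    {b : Y ⟶ D.extent y} (θ : A.Cell p a b (D.hom x y)) :
    D.nm (r := p) (A.comp (.nil a) (D.unit x) (Category.comp_id _) (Category.comp_id _)) θ = θ := by
  refine Eq.trans ?_ (A.comp_ident θ)
  rw [← D.unit_mul]
  refine (A.assoc (D.mul x x y) ?_ _ _ _ _ _ _).symm
  have := VDC.vcomp_pair (A := A) (D.unit x) (A.ident (D.hom x y)) (HApp.nil (.single θ))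
    (Category.comp_id _) (Category.comp_id _) (Category.comp_id _) (q := .one (D.hom x y)) rfl rfl
  rwa [A.comp_ident] at this

theorem nm_unit {X Y : A.Obj} {x y : D.ob} {p : A.Path X Y} {a : X ⟶ D.extent x}
    {b : Y ⟶ D.extent y} (θ : A.Cell p a b (D.hom x y)) :
    D.nm θ (A.comp (.nil b) (D.unit y) (Category.comp_id _) (Category.comp_id _)) p.append_nil =
      θ := by
  refine Eq.trans ?_ (A.comp_ident θ)
  rw [← D.mul_unit]
  refine (A.assoc (D.mul x y y) ?_ _ _ _ _ _ _).symm
  have := VDC.vcomp_pair (A := A) (A.ident (D.hom x y)) (D.unit y) (HApp.append_nil (.single θ))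
    (Category.comp_id _) (Category.comp_id _) (Category.comp_id _) (q := .one (D.hom x y)) rfl
    p.append_nil
  rwa [A.comp_ident] at this

theorem comp_nm {X₁ X₂ X₃ X Y Z : A.Obj} {x y z : D.ob} {p₁ : A.Path X₁ X₂} {p₂ : A.Path X₂ X₃}
    {p₃ : A.Path X₁ X₃} {p : A.Path X Y} {q : A.Path Y Z} {r : A.Path X Z}
    {a : X ⟶ D.extent x} {b : Y ⟶ D.extent y} {d : Z ⟶ D.extent z} {a' : X₁ ⟶ X} {b' : X₂ ⟶ Y}
    {d' : X₃ ⟶ Z} {Θ₁ : A.Chain p₁ a' b' p} {Θ₂ : A.Chain p₂ b' d' q} {Θ : A.Chain p₃ a' d' r}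
    (i : HApp Θ₁ Θ₂ Θ) (θ : A.Cell p a b (D.hom x y)) (φ : A.Cell q b d (D.hom y z)) :
    A.comp Θ (D.nm θ φ i.bot) rfl rfl =
      D.nm (A.comp Θ₁ θ rfl rfl) (A.comp Θ₂ φ rfl rfl) i.top :=
  A.assoc (D.mul x y z) (VDC.vcomp_pair θ φ i rfl rfl rfl i.bot i.top) _ _ _ _ _ _

theorem nm_comp {C D : ACat.{o, v, h, c, u} A} (f : AFunctor C D) {X Y Z : A.Obj} {x y z : C.ob}
    {p : A.Path X Y} {q : A.Path Y Z} {r : A.Path X Z}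
    {a : X ⟶ C.extent x} {b : Y ⟶ C.extent y} {d : Z ⟶ C.extent z}
    (θ : A.Cell p a b (C.hom x y)) (φ : A.Cell q b d (C.hom y z)) (e : p.append q = r) :
    A.comp (.single (C.nm θ φ e)) (f.cell x z) rfl rfl =
      D.nm (A.comp (.single θ) (f.cell x y) rfl rfl) (A.comp (.single φ) (f.cell y z) rfl rfl)
        e := by
  refine (VDC.assoc_single (.pair θ φ e) (C.mul x y z) (f.cell x z) (Category.id_comp _)
    (Category.id_comp _) rfl rfl _ _ _ _).symm.trans ?_
  rw [f.map_mul]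
  exact A.assoc (D.mul _ _ _) (VDC.vcomp_pair (f.cell x y) (f.cell y z) (.cons _ (.nil _) _ _) rfl
    rfl rfl rfl e) _ _ _ _ _ _

end ACat

namespace AFunctor

variable {A : VDC.{o, v, h, c}}

theorem ext' {C D : ACat.{o, v, h, c, u} A} {f g : AFunctor C D} (h₁ : ∀ x, f.obj x = g.obj x)
    (h₂ : ∀ x, f.vert x ≍ g.vert x) (h₃ : ∀ x y, f.cell x y ≍ g.cell x y) : f = g := by
  cases f with
  | mk fo fv fc _ _ =>
  cases g with
  | mk go gv gc _ _ =>
  obtain rfl : fo = go := funext h₁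
  obtain rfl : fv = gv := funext fun x => eq_of_heq (h₂ x)
  obtain rfl : fc = gc := funext fun x => funext fun y => eq_of_heq (h₃ x y)
  rfl

/-- The identity enriched functor. -/
def id (C : ACat.{o, v, h, c, u} A) : AFunctor C C where
  obj x := x
  vert _ := 𝟙 _
  cell _ _ := A.ident _
  map_unit x := (A.comp_ident (C.unit x)).trans (A.ident_comp (C.unit x)).symm
  map_mul x y z := (A.comp_ident (C.mul x y z)).trans (A.ident_comp (C.mul x y z)).symm

/-- Composition of enriched functors. -/
def comp {C D E : ACat.{o, v, h, c, u} A} (f : AFunctor C D) (g : AFunctor D E) : AFunctor C E where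
  obj x := g.obj (f.obj x)
  vert x := f.vert x ≫ g.vert (f.obj x)
  cell x y := A.comp (.single (f.cell x y)) (g.cell (f.obj x) (f.obj y)) rfl rfl
  map_unit x := by
    rw [VDC.assoc_single (ha := Category.id_comp _) (hb := Category.id_comp _) (h₅ := rfl)
      (h₆ := rfl), f.map_unit, ← VDC.assoc_single (h₁ := Category.id_comp _)
      (h₂ := Category.id_comp _) (h₃ := rfl) (h₄ := rfl), g.map_unit,
      VDC.assoc_nil (ha := rfl) (h₅ := Category.comp_id _) (h₆ := Category.comp_id _)]
  map_mul x y z := by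
    rw [VDC.assoc_single (ha := Category.id_comp _) (hb := Category.id_comp _) (h₅ := rfl)
      (h₆ := rfl), f.map_mul]
    exact ACat.nm_comp g (f.cell x y) (f.cell y z) rfl

end AFunctor

/-- The category of small enriched categories and enriched functors. -/
abbrev ACat.category (A : VDC.{o, v, h, c}) : Category (ACat.{o, v, h, c, u} A) where
  Hom := AFunctor
  id := AFunctor.id
  comp := AFunctor.comp
  id_comp f := AFunctor.ext' (fun _ => rfl) (fun x => heq_of_eq (Category.id_comp (f.vert x)))
    (fun x y => HEq.trans (VDC.comp_heq rfl rfl HEq.rfl HEq.rfl _ _ _ _)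
      (heq_of_eq (A.ident_comp (f.cell x y))))
  comp_id f := AFunctor.ext' (fun _ => rfl) (fun x => heq_of_eq (Category.comp_id (f.vert x)))
    (fun x y => HEq.trans (VDC.comp_heq rfl rfl HEq.rfl HEq.rfl _ _ _ _)
      (heq_of_eq (A.comp_ident (f.cell x y))))
  assoc f g k := AFunctor.ext' (fun _ => rfl) (fun _ => heq_of_eq (Category.assoc _ _ _))
    (fun x y => HEq.trans (VDC.comp_heq rfl rfl HEq.rfl HEq.rfl _ _ _ _)
      (heq_of_eq (VDC.assoc_single (.single (f.cell x y)) (g.cell _ _) (k.cell _ _) rfl rfl rfl rfl rfl rfl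
        (Category.assoc _ _ _) (Category.assoc _ _ _)).symm))

namespace ANatTrans

variable {A : VDC.{o, v, h, c}}

theorem heq {C D : ACat.{o, v, h, c, u} A} {f f' g g' : AFunctor C D} {α : ANatTrans f g}
    {β : ANatTrans f' g'} (hf : f = f') (hg : g = g') (e : ∀ x, α.app x ≍ β.app x) : α ≍ β := by
  subst hf hg
  exact heq_of_eq (ANatTrans.ext (funext fun x => eq_of_heq (e x)))

/-- The identity natural transformation. -/
def id {C D : ACat.{o, v, h, c, u} A} (f : AFunctor C D) : ANatTrans f f where
  app x := A.comp (.nil (f.vert x)) (D.unit (f.obj x)) (Category.comp_id _) (Category.comp_id _)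
  naturality x y := (D.unit_nm (f.cell x y)).trans (D.nm_unit (f.cell x y)).symm

/-- Vertical composition of natural transformations. -/
def vcomp {C D : ACat.{o, v, h, c, u} A} {f g k : AFunctor C D} (α : ANatTrans f g)
    (β : ANatTrans g k) : ANatTrans f k where
  app x := A.comp (.pair (r := .nil (C.extent x)) (α.app x) (β.app x))
    (D.mul (f.obj x) (g.obj x) (k.obj x)) (Category.comp_id _) (Category.comp_id _)
  naturality x y := by
    refine (D.nm_assoc (α.app x) (β.app x) (k.cell x y) rfl rfl rfl rfl).trans ?_
    refine (congrArg (fun t => D.nm (α.app x) t) (β.naturality x y)).trans ?_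
    refine (D.nm_assoc (α.app x) (g.cell x y) (β.app y) rfl rfl rfl rfl).symm.trans ?_
    refine (congrArg (fun t => D.nm t (β.app y)) (α.naturality x y)).trans ?_
    exact D.nm_assoc (f.cell x y) (α.app y) (β.app y) rfl rfl rfl rfl

/-- Whiskering with an enriched functor on the left. -/
def left {C D E : ACat.{o, v, h, c, u} A} (f : AFunctor C D) {g g' : AFunctor D E}
    (β : ANatTrans g g') : ANatTrans (f.comp g) (f.comp g') where
  app x := A.comp (.nil (f.vert x)) (β.app (f.obj x)) rfl rfl
  naturality x y := by
    refine (E.comp_nm (HApp.nil (.single (f.cell x y))) (β.app (f.obj x))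
      (g'.cell (f.obj x) (f.obj y))).symm.trans ?_
    refine (congrArg (fun t => A.comp (.single (f.cell x y)) t rfl rfl)
      (β.naturality (f.obj x) (f.obj y))).trans ?_
    exact E.comp_nm (HApp.append_nil (.single (f.cell x y))) (g.cell (f.obj x) (f.obj y))
      (β.app (f.obj y))

/-- Whiskering with an enriched functor on the right. -/
def right {C D E : ACat.{o, v, h, c, u} A} {f f' : AFunctor C D} (α : ANatTrans f f')
    (g : AFunctor D E) : ANatTrans (f.comp g) (f'.comp g) where
  app x := A.comp (.single (α.app x)) (g.cell (f.obj x) (f'.obj x)) rfl rfl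
  naturality x y := by
    refine (ACat.nm_comp g (α.app x) (f'.cell x y) rfl).symm.trans ?_
    refine (congrArg (fun t => A.comp (.single t) (g.cell (f.obj x) (f'.obj y)) rfl rfl)
      (α.naturality x y)).trans ?_
    exact ACat.nm_comp g (f.cell x y) (α.app y) rfl

end ANatTrans

/-- The 2-category of small enriched categories, enriched functors and enriched natural
transformations. -/
def ACat.twoCatData (A : VDC.{o, v, h, c}) :
    letI := ACat.category.{o, v, h, c, u} A
    TwoCatData.{max o h c (u + 1), max v c u, max c u} (ACat.{o, v, h, c, u} A) :=
  letI := ACat.category.{o, v, h, c, u} A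
  { Hom₂ f g := ANatTrans f g
    id₂ f := ANatTrans.id f
    vcomp α β := ANatTrans.vcomp α β
    left f _ _ β := ANatTrans.left f β
    right α g := ANatTrans.right α g
    id_vcomp {_ D _ _} α := ANatTrans.ext (funext fun x => D.unit_nm (α.app x))
    vcomp_id {_ D _ _} α := ANatTrans.ext (funext fun x => D.nm_unit (α.app x))
    vassoc {_ D _ _ _ _} α β γ := ANatTrans.ext (funext fun x =>
      D.nm_assoc (α.app x) (β.app x) (γ.app x) rfl rfl rfl rfl)
    left_id {_ _ D} f g := ANatTrans.ext (funext fun x => VDC.assoc_nil (D.unit _) _ _ _ _ rfl _ _)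
    left_vcomp {_ _ D} f _ _ _ α β := ANatTrans.ext (funext fun x =>
      D.comp_nm (HApp.nil (.nil (f.vert x))) (α.app (f.obj x)) (β.app (f.obj x)))
    id_right {_ C D} f g := ANatTrans.ext (funext fun x => by
      refine (VDC.assoc_single (.nil (f.vert x)) (C.unit _) (g.cell _ _) (Category.id_comp _)
        (Category.id_comp _) rfl rfl _ _ _ _).symm.trans ?_
      rw [g.map_unit]
      exact VDC.assoc_nil _ _ _ _ _ rfl _ _)
    vcomp_right α β g := ANatTrans.ext (funext fun x =>
      ACat.nm_comp g (α.app x) (β.app x) rfl)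
    id_left {_ _ f g} α := ANatTrans.heq (Category.id_comp f) (Category.id_comp g) (fun x =>
      HEq.trans (VDC.comp_heq rfl rfl HEq.rfl HEq.rfl _ _ _ _)
        (heq_of_eq (A.ident_comp (α.app x))))
    comp_left f g k l α := ANatTrans.heq (Category.assoc f g k) (Category.assoc f g l) (fun x =>
      HEq.trans (VDC.comp_heq rfl rfl HEq.rfl HEq.rfl _ _ _ _)
        (heq_of_eq (VDC.assoc_nil (u := f.vert x) (u' := g.vert (f.obj x))
          (α.app (g.obj (f.obj x))) rfl rfl rfl rfl rfl
          (Category.assoc _ _ _) (Category.assoc _ _ _)).symm))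
    right_id {_ _ f g} α := ANatTrans.heq (Category.comp_id f) (Category.comp_id g) (fun x =>
      HEq.trans (VDC.comp_heq rfl rfl HEq.rfl HEq.rfl _ _ _ _)
        (heq_of_eq (A.comp_ident (α.app x))))
    right_comp {_ _ _ _ f f'} α g k := ANatTrans.heq (Category.assoc f g k).symm
      (Category.assoc f' g k).symm
      (fun x => HEq.trans (heq_of_eq (VDC.assoc_single (.single (α.app x)) (g.cell _ _)
        (k.cell _ _) rfl rfl rfl rfl rfl rfl
        (Category.assoc _ _ _) (Category.assoc _ _ _)))
        (VDC.comp_heq rfl rfl HEq.rfl HEq.rfl _ _ _ _))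
    left_right f g g' α k := ANatTrans.heq (Category.assoc f g k) (Category.assoc f g' k) (fun x =>
      HEq.trans (VDC.comp_heq rfl rfl HEq.rfl HEq.rfl _ _ _ _)
        (heq_of_eq (VDC.assoc_single (.nil (f.vert x)) (α.app _) (k.cell _ _) rfl rfl rfl rfl rfl
          rfl (Category.assoc _ _ _) (Category.assoc _ _ _)).symm))
    exchange {_ _ E f f' g g'} α β := ANatTrans.ext (funext fun x => by
      refine (E.comp_nm (HApp.nil (.single (α.app x))) (β.app (f.obj x))
        (g'.cell (f.obj x) (f'.obj x))).symm.trans ?_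
      refine (congrArg (fun t => A.comp (.single (α.app x)) t rfl rfl)
        (β.naturality (f.obj x) (f'.obj x))).trans ?_
      exact E.comp_nm (HApp.append_nil (.single (α.app x))) (g.cell (f.obj x) (f'.obj x))
        (β.app (f'.obj x))) }

instance (A : VDC.{o, v, h, c}) : Bicategory (ACat.{o, v, h, c, u} A) :=
  letI := ACat.category.{o, v, h, c, u} A
  (ACat.twoCatData A).bicategory

instance (A : VDC.{o, v, h, c}) : Bicategory.Strict (ACat.{o, v, h, c, u} A) :=
  letI := ACat.category.{o, v, h, c, u} A
  (ACat.twoCatData A).strict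

/-- Small sets, regarded as the objects of the locally chaotic 2-category of sets. -/
def SetLc : Type (u + 1) := Type u

/-- The locally chaotic 2-category on the category of small sets: there is exactly one 2-cell between
any two parallel functions. -/
def SetLc.twoCatData : TwoCatData.{u + 1, u, 0} (Type u) where
  Hom₂ _ _ := PUnit
  id₂ _ := ⟨⟩
  vcomp _ _ := ⟨⟩
  left _ _ _ _ := ⟨⟩
  right _ _ := ⟨⟩
  id_vcomp _ := rfl
  vcomp_id _ := rfl
  vassoc _ _ _ := rfl
  left_id _ _ := rfl
  left_vcomp _ _ _ _ _ _ := rfl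
  id_right _ _ := rfl
  vcomp_right _ _ _ := rfl
  id_left _ := HEq.rfl
  comp_left _ _ _ _ _ := HEq.rfl
  right_id _ := HEq.rfl
  right_comp _ _ _ := HEq.rfl
  left_right _ _ _ _ _ := HEq.rfl
  exchange _ _ := rfl

instance : Bicategory SetLc.{u} := SetLc.twoCatData.{u}.bicategory

instance : Bicategory.Strict SetLc.{u} := SetLc.twoCatData.{u}.strict

/-- The 2-functor sending an enriched category to its set of objects. -/
def ACat.obFunctor (A : VDC.{o, v, h, c}) :
    StrictPseudofunctor (ACat.{o, v, h, c, u} A) SetLc.{u} :=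
  TwoCatData.functor (B := ACat.{o, v, h, c, u} A) (C := SetLc.{u}) (fun C => C.ob)
    (fun {C D : ACat.{o, v, h, c, u} A} (f : AFunctor C D) =>
      (TypeCat.ofHom f.obj : (C.ob : Type u) ⟶ D.ob))
    (fun _ => PUnit.unit) (fun _ => rfl) (fun _ _ => rfl) (fun _ => rfl) (fun _ _ => rfl)
    (fun _ _ _ _ => HEq.rfl) (fun _ _ => HEq.rfl)

/-- The locally chaotic 2-category on the category of small sets, as the 2-category of cells between
units in the horizontally chaotic virtual double category. -/
noncomputable def SetLc.toVCat : StrictPseudofunctor SetLc.{u} (VCat (uhc (Type u))) :=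
  TwoCatData.functor (B := SetLc.{u}) (C := VCat (uhc (Type u))) (fun I => I)
    (fun {I J : Type u} (f : I ⟶ J) => f)
    (fun _ => PUnit.unit) (fun _ => rfl) (fun _ _ => rfl) (fun _ => rfl) (fun _ _ => rfl)
    (fun _ _ _ _ => HEq.rfl) (fun _ _ => HEq.rfl)

/-- The 2-functor from the locally chaotic 2-category of sets to the 2-category of internal
categories in sets: it maps a set `I` to the chaotic category `I ← I × I → I`. -/
noncomputable def chaoticCat : StrictPseudofunctor SetLc.{u} (VCat (ModVDC SpanVDC.{u})) :=
  SetLc.toVCat.comp (VCat.map chaoticProf)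

/-! ### Equality of virtual double functors and transformations -/

/-! Pullbacks whose lower left corner is chaotic can be recognised element by element.
`VDC.IsHcPullback` asks for a commuting square in which an object of the upper right corner and an
object of `C` with the same image come from exactly one object of the upper left corner, and
similarly for vertical morphisms between given objects. A horizontal morphism between given objects
must come from exactly one morphism upstairs as soon as its image is the value of the lower leg. On
multicells with a given boundary the upper leg must simply be bijective: the lower left corner
carries no horizontal information, and in the squares at hand the part of a multicell that lives
over spans is forced. Given these bijections, functors and transformations out of a test object are
lifted piece by piece, and every law holds because it holds after both projections
(`exists_functor`, `functor_inj`, `trans_existsUnique`).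

The square of matrices satisfies the criterion because an element of `I × J` is determined by its
two projections (`SpanHor.fiber_prod_ext`). Hence a family indexed by the span of projections is a
matrix, an element of an iterated pullback of such spans is a sequence of indices, and the multimap
of spans underlying a multicell with a matrix as its bottom is unique. This is
`matFam_isHcPullback`.

The criterion is inherited by monads and bimodules (`VDC.IsHcPullback.mod`). A monad, a monad
morphism, a bimodule or an equivariant multicell consists of an underlying object, vertical morphism
or horizontal morphism and of some multicells, subject to equations between composites of
multicells. The multicells lift because the upper leg is surjective on them, and the equations
descend because it is injective on them; compatibility over the lower leg concerns only the
underlying objects and morphisms. The corner remains chaotic, since `Mod` of a functor into a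
chaotic virtual double category factors through `uhcInc` (`ModVDC.map_toHc`). Preservation of the
chosen units by a lifted functor is again a consequence of injectivity (`isPullback_uvdc`).

For enriched categories, opcartesianness of the units identifies a 2-cell between monad morphisms
with a nullary multicell satisfying a single naturality law (`VCat.nullCell`,
`VCat.exists_nullCell`). Reading multicells of matrices entry by entry turns the laws of a monad, of
a morphism and of a 2-cell into those of an enriched category, functor and natural transformation.
So `ACat.monadFunctor` is bijective on objects, 1-cells and 2-cells, hence invertible, and the
square of 2-categories inherits an elementwise criterion from the square of profunctors, because the
cells of `VCat` are particular vertical morphisms and multicells.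

For spans in place of matrices, the same description of 2-cells shows that monads are categories
whose hom-sets are the fibres of a span; this gives `HMonad.toCat`. A chaotic span has one-element
fibres, whence full faithfulness of the chaotic inclusion and the description of its image.

All equalities of functors are strict, so components with merely provably equal boundaries are
compared heterogeneously. The recurring technique is to derive all componentwise equations first and
then to substitute boundaries in their order of dependence. -/

theorem HPath.map_heq {O : Type o} {H : O → O → Type h} {O' : Type o₁} {H' : O' → O' → Type h₁}
    {F G : O → O'} {f : ∀ ⦃A B : O⦄, H A B → H' (F A) (F B)}
    {g : ∀ ⦃A B : O⦄, H A B → H' (G A) (G B)} (e : ∀ X, F X = G X)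
    (k : ∀ ⦃A B : O⦄ (Γ : H A B), f Γ ≍ g Γ) {A B : O} (p : HPath H A B) :
    p.map F f ≍ p.map G g := by
  obtain rfl : F = G := funext e
  obtain rfl : f = g := funext fun _ => funext fun _ => funext fun Γ => eq_of_heq (k Γ)
  rfl

namespace VFunctor

variable {A : VDC.{o, v, h, c}} {B : VDC.{o₁, v₁, h₁, c₁}} {C : VDC.{o₂, v₂, h₂, c₂}}
  {D : VDC.{o₃, v₃, h₃, c₃}}

/-- The laws are propositions, so only the four kinds of data matter. The hypotheses are used in the
order objects, vertical morphisms, horizontal morphisms, multicells: each identification makes the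
next heterogeneous equation homogeneous. -/
theorem ext_heq {M N : VFunctor A B} (ho : ∀ X, M.toFunctor.obj X = N.toFunctor.obj X)
    (hm : ∀ ⦃X Y⦄ (f : X ⟶ Y), M.toFunctor.map f ≍ N.toFunctor.map f)
    (hh : ∀ ⦃X Y⦄ (Γ : A.Hor X Y), M.hor Γ ≍ N.hor Γ)
    (hc : ∀ ⦃X Y Z W : A.Obj⦄ ⦃p : A.Path X Y⦄ ⦃u : X ⟶ Z⦄ ⦃v : Y ⟶ W⦄ ⦃Γ : A.Hor Z W⦄
      (θ : A.Cell p u v Γ), M.cell θ ≍ N.cell θ) : M = N := by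
  obtain ⟨F, f, k, _, _⟩ := M
  obtain ⟨G, g, l, _, _⟩ := N
  obtain rfl : F = G := by
    obtain ⟨a, b, _, _⟩ := F
    obtain ⟨a', b', _, _⟩ := G
    obtain rfl : a = a' := funext ho
    obtain rfl : @b = @b' := funext fun _ => funext fun _ => funext fun f => eq_of_heq (hm f)
    rfl
  obtain rfl : f = g := funext fun _ => funext fun _ => funext fun Γ => eq_of_heq (hh Γ)
  obtain rfl : k = l := by
    funext X Y Z W p u v Γ θ
    exact eq_of_heq (hc θ)
  rfl

theorem obj_congr {M N : VFunctor A B} (e : M = N) (X : A.Obj) :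
    M.toFunctor.obj X = N.toFunctor.obj X := by rw [e]

theorem map_congr {M N : VFunctor A B} (e : M = N) {X Y : A.Obj} (f : X ⟶ Y) :
    M.toFunctor.map f ≍ N.toFunctor.map f := by rw [e]

theorem hor_congr {M N : VFunctor A B} (e : M = N) {X Y : A.Obj} (Γ : A.Hor X Y) :
    M.hor Γ ≍ N.hor Γ := by rw [e]

theorem cell_congr {M N : VFunctor A B} (e : M = N) {X Y Z W : A.Obj} {p : A.Path X Y}
    {u : X ⟶ Z} {v : Y ⟶ W} {Γ : A.Hor Z W} (θ : A.Cell p u v Γ) : M.cell θ ≍ N.cell θ := by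
  rw [e]

/-- Removes the transport along `HPath.map_map` that is built into the composition of virtual double
functors. -/
theorem comp_cell_heq (F : VFunctor A B) (G : VFunctor B C) {X Y Z W : A.Obj} {p : A.Path X Y}
    {u : X ⟶ Z} {v : Y ⟶ W} {Γ : A.Hor Z W} (θ : A.Cell p u v Γ) :
    (F.comp G).cell θ ≍ G.cell (F.cell θ) := VDC.castTop_heq _ _

/-- Only the multicells need an argument: both bracketings apply `F`, `G` and `H` in turn and differ
by transports of the top path. -/
theorem comp_assoc (F : VFunctor A B) (G : VFunctor B C) (H : VFunctor C D) :
    (F.comp G).comp H = F.comp (G.comp H) := by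
  refine ext_heq (fun _ => rfl) (fun _ _ _ => HEq.rfl) (fun _ _ _ => HEq.rfl) ?_
  intro X Y Z W p u v Γ θ
  refine (comp_cell_heq _ _ _).trans ?_
  refine HEq.trans ?_ (comp_cell_heq _ _ _).symm
  refine HEq.trans ?_ (comp_cell_heq _ _ _).symm
  have e := HPath.map_map F.toFunctor.obj F.hor G.toFunctor.obj G.hor p
  exact H.cell_heq e.symm rfl rfl (comp_cell_heq F G θ)

/-- The image of a chain under the composite of raw data with a virtual double functor. -/
theorem chain_map (G : VFunctor B C) (F : A.Obj ⥤ B.Obj)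
    (f : ∀ ⦃X Y : A.Obj⦄, A.Hor X Y → B.Hor (F.obj X) (F.obj Y))
    (m : ∀ ⦃X Y Z W : A.Obj⦄ ⦃p : A.Path X Y⦄ ⦃u : X ⟶ Z⦄ ⦃v : Y ⟶ W⦄ ⦃Γ : A.Hor Z W⦄,
      A.Cell p u v Γ → B.Cell (p.map F.obj f) (F.map u) (F.map v) (f Γ))
    (k : ∀ ⦃X Y Z W : A.Obj⦄ ⦃p : A.Path X Y⦄ ⦃u : X ⟶ Z⦄ ⦃v : Y ⟶ W⦄ ⦃Γ : A.Hor Z W⦄,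
      A.Cell p u v Γ → C.Cell (p.map (F ⋙ G.toFunctor).obj fun _ _ Γ => G.hor (f Γ))
        ((F ⋙ G.toFunctor).map u) ((F ⋙ G.toFunctor).map v) (G.hor (f Γ)))
    (hk : ∀ ⦃X Y Z W : A.Obj⦄ ⦃p : A.Path X Y⦄ ⦃u : X ⟶ Z⦄ ⦃v : Y ⟶ W⦄ ⦃Γ : A.Hor Z W⦄
      (θ : A.Cell p u v Γ), G.cell (m θ) ≍ k θ)
    {X Y Z W : A.Obj} {p : A.Path X Y} {u : X ⟶ Z} {v : Y ⟶ W} {q : A.Path Z W}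
    (Θ : A.Chain p u v q) : G.chain (Θ.map (K' := B.Cell) F f m) ≍
      Θ.map (K' := C.Cell) (F ⋙ G.toFunctor) (fun _ _ Γ => G.hor (f Γ)) k := by
  induction Θ with
  | nil u => rfl
  | cons θ Θ e ih =>
    exact Sq.cons_heq (K := C.Cell) (HPath.map_map _ _ _ _ _) (HPath.map_map _ _ _ _ _)
      (HPath.map_map _ _ _ _ _) (hk θ) ih _ _

end VFunctor

namespace VTrans

variable {A : VDC.{o, v, h, c}} {B : VDC.{o₁, v₁, h₁, c₁}}

theorem app_heq {F G F' G' : VFunctor A B} (hF : F = F') (hG : G = G') {α : VTrans F G}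
    {β : VTrans F' G'} (e : α ≍ β) (X : A.Obj) : α.app.app X ≍ β.app.app X := by
  subst hF hG e; rfl

/-- The components at horizontal morphisms have the components at objects as their sides, so they
are compared heterogeneously until the latter have been identified. -/
theorem ext_app {F G : VFunctor A B} {α β : VTrans F G} (h₁ : ∀ X, α.app.app X = β.app.app X)
    (h₂ : ∀ ⦃X Y⦄ (Γ : A.Hor X Y), α.cellApp Γ ≍ β.cellApp Γ) : α = β := by
  obtain ⟨a, k, _⟩ := α
  obtain ⟨b, l, _⟩ := β
  obtain rfl : a = b := by ext X; exact h₁ X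
  obtain rfl : k = l := funext fun _ => funext fun _ => funext fun Γ => eq_of_heq (h₂ Γ)
  rfl

end VTrans

/-! ### An elementwise criterion for pullbacks over horizontally chaotic categories -/

/-- Elementwise conditions under which a square with a horizontally chaotic lower left corner is a
pullback; the upper leg is bijective on multicells with given boundary. -/
structure VDC.IsHcPullback {X : VDC.{o, v, h, c}} {Y : VDC.{o₁, v₁, h₁, c₁}} {C : Type o₂}
    [Category.{v₂} C] {W : VDC.{o₃, v₃, h₃, c₃}} (P : VFunctor X Y) (q : X.Obj ⥤ C)
    (F : VFunctor Y W) (G : VFunctor (hc C) W) : Prop where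
  comm : P.comp F = (VFunctor.toHc q).comp G
  obj_surj : ∀ (y : Y.Obj) (z : C), F.toFunctor.obj y = G.toFunctor.obj z →
    ∃ x, P.toFunctor.obj x = y ∧ q.obj x = z
  obj_inj : ∀ x x' : X.Obj, P.toFunctor.obj x = P.toFunctor.obj x' → q.obj x = q.obj x' → x = x'
  map_surj : ∀ {x x' : X.Obj} (a : P.toFunctor.obj x ⟶ P.toFunctor.obj x') (b : q.obj x ⟶ q.obj x'),
    F.toFunctor.map a ≍ G.toFunctor.map (X := q.obj x) (Y := q.obj x') b →
    ∃ f : x ⟶ x', P.toFunctor.map f = a ∧ q.map f = b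
  map_inj : ∀ {x x' : X.Obj} (f g : x ⟶ x'), P.toFunctor.map f = P.toFunctor.map g →
    q.map f = q.map g → f = g
  hor_surj : ∀ {x x' : X.Obj} (Γ : Y.Hor (P.toFunctor.obj x) (P.toFunctor.obj x')),
    F.hor Γ ≍ G.hor (X := q.obj x) (Y := q.obj x') PUnit.unit → ∃ Δ : X.Hor x x', P.hor Δ = Γ
  hor_inj : ∀ {x x' : X.Obj}, Function.Injective (fun Δ : X.Hor x x' => P.hor Δ)
  cell_surj : ∀ {x y z w : X.Obj} {p : X.Path x y} {f : x ⟶ z} {g : y ⟶ w} {Γ : X.Hor z w}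
    (θ : Y.Cell (P.path p) (P.toFunctor.map f) (P.toFunctor.map g) (P.hor Γ)),
    ∃ κ : X.Cell p f g Γ, P.cell κ = θ
  cell_inj : ∀ {x y z w : X.Obj} {p : X.Path x y} {f : x ⟶ z} {g : y ⟶ w} {Γ : X.Hor z w}
    (κ κ' : X.Cell p f g Γ), P.cell κ = P.cell κ' → κ = κ'

/-- A virtual double functor into a horizontally chaotic virtual double category is determined by
its underlying functor. -/
theorem VFunctor.ext_hc {A : VDC.{o, v, h, c}} {C : Type o₁} [Category.{v₁} C]
    {M N : VFunctor A (hc C)} (ho : ∀ X, M.toFunctor.obj X = N.toFunctor.obj X)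
    (hm : ∀ ⦃X Y⦄ (f : X ⟶ Y), M.toFunctor.map f ≍ N.toFunctor.map f) : M = N :=
  VFunctor.ext_heq ho hm (fun _ _ _ => HEq.rfl) (fun _ _ _ _ _ _ _ _ _ => HEq.rfl)

/-- A vertical transformation between virtual double functors into a horizontally chaotic virtual
double category is determined by its components at objects. -/
theorem VTrans.ext_hc {A : VDC.{o, v, h, c}} {C : Type o₁} [Category.{v₁} C]
    {M N : VFunctor A (hc C)} {α β : VTrans M N} (e : ∀ X, α.app.app X = β.app.app X) : α = β :=
  VTrans.ext_app e (fun _ _ _ => HEq.rfl)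

namespace VDC.IsHcPullback

variable {X : VDC.{o, v, h, c}} {Y : VDC.{o₁, v₁, h₁, c₁}} {C : Type o₂}
  [Category.{v₂} C] {W : VDC.{o₃, v₃, h₃, c₃}} {P : VFunctor X Y} {q : X.Obj ⥤ C}
  {F : VFunctor Y W} {G : VFunctor (hc C) W}

/-- Injectivity for multicells whose boundaries agree only by an equation, such as the preservation
of identities by a functor. -/
theorem cell_heq_inj (i : IsHcPullback P q F G) {x y z w : X.Obj} {p p' : X.Path x y}
    {f f' : x ⟶ z} {g g' : y ⟶ w} {Γ Γ' : X.Hor z w} {κ : X.Cell p f g Γ}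
    {κ' : X.Cell p' f' g' Γ'} (hp : p = p') (hf : f = f') (hg : g = g') (hΓ : Γ = Γ')
    (e : P.cell κ ≍ P.cell κ') : κ ≍ κ' := by
  subst hp hf hg hΓ
  exact heq_of_eq (i.cell_inj _ _ (eq_of_heq e))

/-- Uniqueness in the universal property: the four injectivity conditions are applied in turn, each
one after the boundaries it concerns have been identified. -/
theorem functor_inj (i : IsHcPullback P q F G) {T : VDC.{o₄, v₄, h₄, c₄}} {K L : VFunctor T X}
    (e₁ : K.comp P = L.comp P)
    (e₂ : K.comp (VFunctor.toHc q) = L.comp (VFunctor.toHc q)) : K = L := by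
  have ho := fun t => i.obj_inj _ _ (VFunctor.obj_congr e₁ t) (VFunctor.obj_congr e₂ t)
  have hm₁ := fun (s t : T.Obj) (f : s ⟶ t) => VFunctor.map_congr e₁ f
  have hm₂ := fun (s t : T.Obj) (f : s ⟶ t) => VFunctor.map_congr e₂ f
  have hh := fun (s t : T.Obj) (f : T.Hor s t) => VFunctor.hor_congr e₁ f
  have hc : ∀ ⦃r s t w : T.Obj⦄ ⦃p : T.Path r s⦄ ⦃f : r ⟶ t⦄ ⦃g : s ⟶ w⦄ ⦃Γ : T.Hor t w⦄
      (θ : T.Cell p f g Γ), P.cell (K.cell θ) ≍ P.cell (L.cell θ) := fun _ _ _ _ _ _ _ _ θ =>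
    (VFunctor.comp_cell_heq _ _ _).symm.trans
      ((VFunctor.cell_congr e₁ θ).trans (VFunctor.comp_cell_heq _ _ _))
  -- The two equations of functors are now replaced by their components, so that `K` and `L` can be
  -- taken apart and their data substituted one after the other.
  clear e₁ e₂
  obtain ⟨⟨a, m, _, _⟩, k, n, _, _⟩ := K
  obtain ⟨⟨a', m', _, _⟩, k', n', _, _⟩ := L
  obtain rfl : a = a' := funext ho
  obtain rfl : @m = @m' := by
    funext s t f
    exact i.map_inj _ _ (eq_of_heq (hm₁ s t f)) (eq_of_heq (hm₂ s t f))
  obtain rfl : k = k' := by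
    funext s t f
    exact i.hor_inj (eq_of_heq (hh s t f))
  obtain rfl : n = n' := by
    funext _ _ _ _ _ _ _ _ θ
    exact i.cell_inj _ _ (eq_of_heq (hc θ))
  rfl

/-- Surjectivity on multicells for a boundary that is only provably the image of the given one.
Recording the outcome by `CellRel` instead of by an equation with transports lets the calculus of
`CellRel` be applied to it. -/
theorem exists_cell (i : IsHcPullback P q F G) {x y z w : X.Obj} {p : X.Path x y}
    {f : x ⟶ z} {g : y ⟶ w} {Γ : X.Hor z w} {p' : Y.Path (P.toFunctor.obj x) (P.toFunctor.obj y)}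
    {f' : P.toFunctor.obj x ⟶ P.toFunctor.obj z} {g' : P.toFunctor.obj y ⟶ P.toFunctor.obj w}
    {Γ' : Y.Hor (P.toFunctor.obj z) (P.toFunctor.obj w)} (hp : P.path p = p')
    (hf : P.toFunctor.map f = f') (hg : P.toFunctor.map g = g') (hΓ : P.hor Γ = Γ')
    (θ : Y.Cell p' f' g' Γ') : ∃ κ : X.Cell p f g Γ, P.CellRel κ θ := by
  subst hp hf hg hΓ
  obtain ⟨κ, rfl⟩ := i.cell_surj θ
  exact ⟨κ, .mk⟩

/-- Existence in the universal property. The lifts are chosen independently for every piece of data;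
functoriality of the choices needs no care, because it is an equation that holds after `P` and `q`
and these are jointly injective. -/
theorem exists_functor (i : IsHcPullback P q F G) {T : VDC.{o₄, v₄, h₄, c₄}} (R : VFunctor T Y)
    (S : VFunctor T (hc C)) (e : R.comp F = S.comp G) :
    ∃ K : VFunctor T X, K.comp P = R ∧ K.comp (VFunctor.toHc q) = S := by
  have ho : ∀ t, ∃ x, P.toFunctor.obj x = R.toFunctor.obj t ∧ q.obj x = S.toFunctor.obj t :=
    fun t => i.obj_surj _ (S.toFunctor.obj t) (VFunctor.obj_congr e t)
  have hm := fun (s t : T.Obj) (f : s ⟶ t) => VFunctor.map_congr e f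
  have hh := fun (s t : T.Obj) (f : T.Hor s t) => VFunctor.hor_congr e f
  clear e
  choose ko hP hq using ho
  obtain ⟨⟨a, m, hi, hc⟩, k, n, ni, nc⟩ := R
  obtain ⟨⟨a', m', hi', hc'⟩, k', n', ni', nc'⟩ := S
  -- The object parts of `R` and `S` are replaced by the images of the chosen lifts. The remaining
  -- data of `R` and `S` then have boundaries of the exact form required by the surjectivity
  -- conditions.
  obtain rfl : a = fun t => P.toFunctor.obj (ko t) := funext fun t => (hP t).symm
  obtain rfl : a' = fun t => q.obj (ko t) := funext fun t => (hq t).symm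
  choose km hkm hkm' using fun (s t : T.Obj) (f : s ⟶ t) =>
    i.map_surj (m f) (m' f) (hm s t f)
  obtain rfl : @m = fun s t f => P.toFunctor.map (km s t f) := by
    funext s t f; exact (hkm s t f).symm
  obtain rfl : @m' = fun s t f => q.map (km s t f) := by
    funext s t f; exact (hkm' s t f).symm
  choose kh hkh using fun (s t : T.Obj) (f : T.Hor s t) => i.hor_surj (k f) (hh s t f)
  obtain rfl : k = fun s t f => P.hor (kh s t f) := by
    funext s t f; exact (hkh s t f).symm
  let K : T.Obj ⥤ X.Obj :=
    { obj := ko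
      map := fun {s t} f => km s t f
      map_id := fun t => i.map_inj _ _ ((hi t).trans (P.toFunctor.map_id _).symm)
        ((hi' t).trans (q.map_id _).symm)
      map_comp := fun f g => i.map_inj _ _ ((hc f g).trans (P.toFunctor.map_comp _ _).symm)
        ((hc' f g).trans (q.map_comp _ _).symm) }
  have hcell : ∀ (r s t w : T.Obj) (p : T.Path r s) (f : r ⟶ t) (g : s ⟶ w) (Γ : T.Hor t w)
      (θ : T.Cell p f g Γ), ∃ κ : X.Cell (p.map K.obj kh) (K.map f) (K.map g) (kh _ _ Γ),
        P.CellRel κ (n θ) := fun r s t w p f g Γ θ =>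
    i.exists_cell (HPath.map_map ko kh P.toFunctor.obj P.hor p) rfl rfl rfl (n θ)
  choose kc hkc using hcell
  refine ⟨⟨K, kh, fun _ _ _ _ _ _ _ _ θ => kc _ _ _ _ _ _ _ _ θ, ?_, ?_⟩, ?_, ?_⟩
  · intro s t Γ
    refine i.cell_heq_inj rfl (K.map_id _) (K.map_id _) rfl ?_
    exact (hkc _ _ _ _ _ _ _ _ _).heq.symm.trans ((ni Γ).trans (P.cell_ident _).symm)
  · intro x y z w s t p f g q' f' g' Γ a b Θ θ hu hv
    apply i.cell_inj
    apply eq_of_heq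
    refine (hkc _ _ _ _ _ _ _ _ _).heq.symm.trans ((heq_of_eq (nc Θ θ hu hv)).trans ?_)
    rw [P.cell_comp]
    -- Both sides are composites in `Y`; by `chain_map` the image under `P` of the lifted chain is
    -- the chain of images under `R`.
    exact VDC.comp_heq (HPath.map_map _ _ _ _ _).symm (HPath.map_map _ _ _ _ _).symm
      (VFunctor.chain_map P K kh _ n (fun _ _ _ _ _ _ _ _ θ =>
        (hkc _ _ _ _ _ _ _ _ θ).heq.symm) Θ).symm (hkc _ _ _ _ _ _ _ _ θ).heq _ _ _ _
  · refine VFunctor.ext_heq (fun _ => rfl) (fun _ _ _ => HEq.rfl) (fun _ _ _ => HEq.rfl) ?_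
    intro _ _ _ _ _ _ _ _ θ
    exact (VFunctor.comp_cell_heq _ _ _).trans (hkc _ _ _ _ _ _ _ _ θ).heq.symm
  · exact VFunctor.ext_hc (fun _ => rfl) (fun _ _ _ => HEq.rfl)

/-- The 2-dimensional universal property. Components at objects lift the pairs formed by `α` and
`β`, and components at horizontal morphisms lift those of `α`; naturality at multicells is tested
after `P`, where it is the naturality of `α`. -/
theorem trans_existsUnique (i : IsHcPullback P q F G) {T : VDC.{o₄, v₄, h₄, c₄}}
    (K L : VFunctor T X) (α : VTrans (K.comp P) (L.comp P))
    (β : VTrans (K.comp (VFunctor.toHc q)) (L.comp (VFunctor.toHc q)))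
    (e : α.whisker F ≍ β.whisker G) :
    ∃! γ : VTrans K L, γ.whisker P = α ∧ γ.whisker (VFunctor.toHc q) = β := by
  -- The two whiskered transformations have the same boundaries only up to commutativity of the
  -- square. These equations allow their components to be extracted from the heterogeneous equation
  -- `e`.
  have hF : ∀ M : VFunctor T X, (M.comp P).comp F = (M.comp (VFunctor.toHc q)).comp G := by
    intro M
    rw [VFunctor.comp_assoc, VFunctor.comp_assoc, i.comm]
  choose ka hka hka' using fun t : T.Obj => i.map_surj (α.app.app t) (β.app.app t)
    (VTrans.app_heq (hF K) (hF L) e t)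
  have hcell : ∀ (s t : T.Obj) (Γ : T.Hor s t),
      ∃ κ : X.Cell (.one (K.hor Γ)) (ka s) (ka t) (L.hor Γ), P.CellRel κ (α.cellApp Γ) :=
    fun s t Γ => i.exists_cell (p := .one (K.hor Γ)) (Γ := L.hor Γ) rfl (hka s) (hka t) rfl
      (α.cellApp Γ)
  choose kc hkc using hcell
  let κ : K.toFunctor ⟶ L.toFunctor :=
    { app := ka
      naturality := fun s t f => i.map_inj _ _
        (by rw [P.toFunctor.map_comp, P.toFunctor.map_comp, hka, hka]; exact α.app.naturality f)
        (by rw [q.map_comp, q.map_comp, hka', hka']; exact β.app.naturality f) }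
  -- The naturality law involves the chain of components along a path, so the lifted chain must be
  -- recognised as the one belonging to `α`.
  have hchain : ∀ {s t : T.Obj} (p : T.Path s t),
      P.chain (VTrans.chainOf κ (fun _ _ Γ => kc _ _ Γ) p) ≍
        VTrans.chainOf α.app α.cellApp p := by
    intro s t p
    induction p with
    | nil t =>
      have key : ∀ {u₁ u₂ : P.toFunctor.obj (K.toFunctor.obj t) ⟶ P.toFunctor.obj (L.toFunctor.obj t)},
          u₁ = u₂ → (Sq.nil u₁ : Sq Y.Cell _ _ _ _) ≍ (Sq.nil u₂ : Sq Y.Cell _ _ _ _) := by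
        intro _ _ e
        subst e
        rfl
      exact key (hka t)
    | @cons s t w Γ p ih =>
      -- `Sq.cons_heq` requires the same vertical sides. Here the sides are the images of the lifted
      -- components and the components of `α`, which agree only through `hka`, so a congruence with
      -- varying sides is needed.
      have key : ∀ {u₁ u₂ : P.toFunctor.obj (K.toFunctor.obj s) ⟶ P.toFunctor.obj (L.toFunctor.obj s)}
          {w₁ w₂ : P.toFunctor.obj (K.toFunctor.obj t) ⟶ P.toFunctor.obj (L.toFunctor.obj t)}
          {v₁ v₂ : P.toFunctor.obj (K.toFunctor.obj w) ⟶ P.toFunctor.obj (L.toFunctor.obj w)}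
          {p₁ p₂ q₁ q₂ s₁ s₂} {θ₁ : Y.Cell (.one (P.hor (K.hor Γ))) u₁ w₁ (P.hor (L.hor Γ))}
          {θ₂ : Y.Cell (.one (P.hor (K.hor Γ))) u₂ w₂ (P.hor (L.hor Γ))}
          {Θ₁ : Y.Chain p₁ w₁ v₁ q₁} {Θ₂ : Y.Chain p₂ w₂ v₂ q₂}
          (h₁ : (HPath.one (P.hor (K.hor Γ))).append p₁ = s₁)
          (h₂ : (HPath.one (P.hor (K.hor Γ))).append p₂ = s₂), u₁ = u₂ → w₁ = w₂ → v₁ = v₂ →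
          p₁ = p₂ → q₁ = q₂ → θ₁ ≍ θ₂ → Θ₁ ≍ Θ₂ → Sq.cons θ₁ Θ₁ h₁ ≍ Sq.cons θ₂ Θ₂ h₂ := by
        intro _ _ _ _ _ _ _ _ _ _ _ _ _ _ _ _ h₁ h₂ a b c d e f g
        subst a b c d e f g h₁ h₂
        rfl
      exact key _ _ (hka s) (hka t) (hka w) (HPath.map_map _ _ _ _ _) (HPath.map_map _ _ _ _ _)
        (hkc _ _ Γ).heq.symm ih
  refine ⟨⟨κ, fun _ _ Γ => kc _ _ Γ, ?_⟩, ⟨?_, ?_⟩, ?_⟩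
  · intro x y z w p f g Γ θ
    apply i.cell_inj
    apply eq_of_heq
    have e₀ := α.naturality θ
    -- The congruence of composition with varying vertical sides, needed for the same reason as in
    -- the case of chains.
    have key : ∀ {x y z w s t : Y.Obj} {p p' : Y.Path x y} {f₁ f₂ : x ⟶ z} {g₁ g₂ : y ⟶ w}
        {q₁ q₂ : Y.Path z w} {f₁' f₂' : z ⟶ s} {g₁' g₂' : w ⟶ t} {Δ : Y.Hor s t}
        {a₁ a₂ : x ⟶ s} {b₁ b₂ : y ⟶ t} {Θ₁ : Y.Chain p f₁ g₁ q₁} {Θ₂ : Y.Chain p' f₂ g₂ q₂}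
        {θ₁ : Y.Cell q₁ f₁' g₁' Δ} {θ₂ : Y.Cell q₂ f₂' g₂' Δ} (h₁ : f₁ ≫ f₁' = a₁)
        (h₁' : g₁ ≫ g₁' = b₁) (h₂ : f₂ ≫ f₂' = a₂) (h₂' : g₂ ≫ g₂' = b₂), p = p' → f₁ = f₂ →
        g₁ = g₂ → q₁ = q₂ → f₁' = f₂' → g₁' = g₂' → Θ₁ ≍ Θ₂ → θ₁ ≍ θ₂ →
        Y.comp Θ₁ θ₁ h₁ h₁' ≍ Y.comp Θ₂ θ₂ h₂ h₂' := by
      intro _ _ _ _ _ _ _ _ _ _ _ _ _ _ _ _ _ _ _ _ _ _ _ _ _ _ _ h₁ h₁' h₂ h₂' a b c d e f g h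
      subst a b c d e f g h h₁ h₁' h₂ h₂'
      rfl
    rw [P.cell_comp, P.cell_comp]
    refine HEq.trans ?_ ((heq_of_eq e₀).trans ?_)
    · refine key _ _ _ _ (HPath.map_map _ _ _ _ _) rfl rfl rfl (hka _) (hka _) ?_
        (hkc _ _ Γ).heq.symm
      exact Sq.cons_heq (K := Y.Cell) (HPath.map_map _ _ _ _ p) rfl rfl
        (VFunctor.comp_cell_heq _ _ _).symm HEq.rfl _ _
    · refine (key _ _ _ _ (HPath.map_map _ _ _ _ _) (hka _) (hka _) (HPath.map_map _ _ _ _ _)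
        rfl rfl (hchain p) (VFunctor.comp_cell_heq _ _ _).symm).symm
  · exact VTrans.ext_app hka (fun _ _ Γ => (hkc _ _ Γ).heq.symm)
  · exact VTrans.ext_hc hka'
  -- A competitor has the same components at objects by joint injectivity of `P` and `q`. Its
  -- components at horizontal morphisms then agree because `P` is injective on multicells with a
  -- given boundary.
  · rintro γ ⟨h₁, h₂⟩
    have ha : ∀ t, γ.app.app t = ka t := fun t => i.map_inj _ _
      ((eq_of_heq (VTrans.app_heq rfl rfl (heq_of_eq h₁) t)).trans (hka t).symm)
      ((eq_of_heq (VTrans.app_heq rfl rfl (heq_of_eq h₂) t)).trans (hka' t).symm)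
    refine VTrans.ext_app ha fun s t Γ => ?_
    refine i.cell_heq_inj rfl (ha s) (ha t) rfl ?_
    refine HEq.trans ?_ (hkc _ _ Γ).heq
    subst h₁
    rfl

theorem isPullback (i : IsHcPullback P q F G) :
    VDC.IsPullback.{_, _, _, _, _, _, _, _, _, _, _, _, _, _, _, _, o₄, v₄, h₄, c₄} P
      (VFunctor.toHc q) F G where
  comm := i.comm
  lift T R S e := by
    obtain ⟨K, h₁, h₂⟩ := i.exists_functor R S e
    exact ⟨K, ⟨h₁, h₂⟩, fun L hL => i.functor_inj (hL.1.trans h₁.symm) (hL.2.trans h₂.symm)⟩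
  lift₂ T K L α β e := i.trans_existsUnique K L α β e

end VDC.IsHcPullback

/-! ### The square of matrices -/

/-- A pair is determined by its coordinates. This is the only property of the spans of projections
that enters, for matrices as well as for chaotic categories. -/
theorem SpanHor.fiber_prod_ext {I J : Type u} {i : I} {j : J}
    (x y : (⟨I × J, Prod.fst, Prod.snd⟩ : SpanHor I J).Fiber i j) : x = y :=
  Subtype.ext (Prod.ext (x.2.1.trans y.2.1.symm) (x.2.2.trans y.2.2.symm))

section Matrices

variable {A : VDC.{o, v, h, c}}

/-- A sequence of indices, as an element of the corresponding path of families. -/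
def matDrop {X Y : FamObj.{o, v, h, c, u} A} {p : HPath (matSys A).H X Y}
    {i : (matSys A).ind.idx X} {j : (matSys A).ind.idx Y} :
    Elt (matSys A).ind p i j →
      Elt (famSys A).ind (p.map (𝟭 (FamObj A)).obj (matFamHor A)) i j
  | .nil i => .nil (D := (famSys A).ind) i
  | .cons (i := i) (j := j) _ t => .cons (D := (famSys A).ind) ⟨(i, j), rfl, rfl⟩ (matDrop t)

/-- With the converse below, this identifies sequences of indices with elements of the iterated
pullback of spans of projections, so that multicells of matrices and multicells of the associated
families are indexed by the same sets. -/
theorem matLift_matDrop {X Y : FamObj.{o, v, h, c, u} A} {p : HPath (matSys A).H X Y}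
    {i : (matSys A).ind.idx X} {j : (matSys A).ind.idx Y} (s : Elt (matSys A).ind p i j) :
    matLift (matDrop s) = s := by
  induction s with
  | nil i => rfl
  | cons x t ih => exact congrArg (Elt.cons (D := (matSys A).ind) PUnit.unit) ih

theorem matDrop_matLift {X Y : FamObj.{o, v, h, c, u} A} {p : HPath (matSys A).H X Y}
    {i : (famSys A).ind.idx ((𝟭 (FamObj A)).obj X)} {j : (famSys A).ind.idx ((𝟭 (FamObj A)).obj Y)}
    (s : Elt (famSys A).ind (p.map (𝟭 (FamObj A)).obj (matFamHor A)) i j) :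
    matDrop (matLift s) = s := by
  induction p with
  | nil X => cases s; rfl
  | cons Γ p ih =>
    obtain ⟨_, x, y, rfl⟩ := Elt.exists_cons s
    have e := ih y
    -- An entry of the path is a pair lying over two prescribed indices. Eliminating the two fibre
    -- equations makes it the pair which `matDrop` inserts.
    obtain ⟨⟨x₁, x₂⟩, h₁, h₂⟩ := x
    change x₁ = i at h₁
    change x₂ = _ at h₂
    subst h₁ h₂
    exact congrArg (Elt.cons (D := (famSys A).ind) _) e

theorem matDrop_path {X Y : FamObj.{o, v, h, c, u} A} {p : HPath (matSys A).H X Y}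
    {i : (matSys A).ind.idx X} {j : (matSys A).ind.idx Y} (s : Elt (matSys A).ind p i j) :
    (famSys A).path (matDrop s) = (matSys A).path s :=
  (matLift_path (matDrop s)).symm.trans (congrArg (matSys A).path (matLift_matDrop s))

/-- The underlying multimap of `θ` takes values in fibres of a span of projections, so it is forced;
the multicells of `A` are reindexed along the bijection between sequences of indices and elements of
the pullback. -/
theorem matFamCell_surjective ⦃X Y Z W : FamObj.{o, v, h, c, u} A⦄ ⦃p : HPath (matSys A).H X Y⦄
    ⦃f : X ⟶ Z⦄ ⦃g : Y ⟶ W⦄ ⦃Γ : (matSys A).H Z W⦄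
    (θ : (famSys A).Cell (p.map (𝟭 (FamObj A)).obj (matFamHor A)) ((𝟭 (FamObj A)).map f)
      ((𝟭 (FamObj A)).map g) (matFamHor A Γ)) :
    ∃ κ : (matSys A).Cell p f g Γ, matFamCell κ = θ := by
  refine ⟨⟨fun _ _ _ => ⟨⟩, fun i j s => VDC.castTop (matDrop_path s) (θ.cell (matDrop s))⟩, ?_⟩
  obtain ⟨m, k⟩ := θ
  obtain rfl : m = fun i j _ => ⟨(f.map i, g.map j), rfl, rfl⟩ := by
    funext i j s
    exact SpanHor.fiber_prod_ext _ _
  refine FamSys.Cell.ext rfl (heq_of_eq ?_)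
  funext i j s
  apply eq_of_heq
  refine (VDC.castTop_heq _ _).trans ((VDC.castTop_heq _ _).trans ?_)
  exact congr_arg_heq (fun t => k t) (matDrop_matLift s)

/-- The multicell of `A` at a sequence `s` is recovered from the multicell of families by evaluating
it at `matDrop s`. -/
theorem matFamCell_injective ⦃X Y Z W : FamObj.{o, v, h, c, u} A⦄ ⦃p : HPath (matSys A).H X Y⦄
    ⦃f : X ⟶ Z⦄ ⦃g : Y ⟶ W⦄ ⦃Γ : (matSys A).H Z W⦄ {κ κ' : (matSys A).Cell p f g Γ}
    (e : matFamCell κ = matFamCell κ') : κ = κ' := by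
  obtain ⟨m, k⟩ := κ
  obtain ⟨m', k'⟩ := κ'
  refine FamSys.Cell.ext (S := matSys A) (funext fun _ => funext fun _ => funext fun _ => rfl)
    (heq_of_eq ?_)
  funext i j s
  -- Stated for an arbitrary `t` equal to the transported value, so that the equation `e₄` can be
  -- supplied directly in place of a rewriting of dependent types.
  have e₁ : ∀ t, VDC.castTop (matLift_path (matDrop s)) (k (matLift (matDrop s))) = t →
      t ≍ k s := by
    rintro _ rfl
    refine (VDC.castTop_heq _ _).trans ?_
    exact congr_arg_heq (fun t => k t) (matLift_matDrop s)
  have e₂ : VDC.castTop (matLift_path (matDrop s)) (k' (matLift (matDrop s))) ≍ k' s := by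
    refine (VDC.castTop_heq _ _).trans ?_
    exact congr_arg_heq (fun t => k' t) (matLift_matDrop s)
  have e₃ := eq_of_heq (FamSys.Cell.mk.inj e).2
  have e₄ := congrFun (congrFun (congrFun e₃ i) j) (matDrop s)
  exact eq_of_heq ((e₁ _ e₄).symm.trans e₂)

/-- The upper leg is the identity on the vertical category, so the conditions there are immediate. A
family of horizontal morphisms lies over the lower leg exactly when its span is the span of
projections, and such a family is a matrix; multicells are covered by the two preceding lemmas. -/
theorem matFam_isHcPullback (A : VDC.{o, v, h, c}) :
    VDC.IsHcPullback (matFam.{o, v, h, c, u} A) (famIdx A) (famSpan A) chaoticSpan where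
  comm := by
    refine VFunctor.ext_heq (fun _ => rfl) (fun _ _ _ => HEq.rfl) (fun _ _ _ => HEq.rfl) ?_
    intro X Y Z W p u v Γ θ
    apply heq_of_eq
    funext i j s
    exact SpanHor.fiber_prod_ext _ _
  obj_surj y z e := ⟨y, rfl, e⟩
  obj_inj x x' e _ := e
  map_surj a b e := ⟨a, rfl, eq_of_heq e⟩
  map_inj f g e _ := e
  hor_surj {X Y} Γ e := by
    obtain ⟨s, k⟩ := (Γ : FamHor A X Y)
    have e : s = (⟨X.idx × Y.idx, Prod.fst, Prod.snd⟩ : SpanHor X.idx Y.idx) := eq_of_heq e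
    subst e
    refine ⟨fun i j => k ⟨(i, j), rfl, rfl⟩, ?_⟩
    -- The matrix was obtained by evaluating the family at the canonical element `(i, j)` of the
    -- fibre; the fibre has no other element.
    refine congrArg (FamHor.mk (X := X) (Y := Y) _) ?_
    funext i j x
    exact congrArg (fun x => k x) (SpanHor.fiber_prod_ext _ _)
  hor_inj {X Y} Γ Γ' e := by
    have e := eq_of_heq (FamHor.mk.inj (e : (FamHor.mk _ _ : FamHor A X Y) = FamHor.mk _ _)).2
    funext i j
    exact congrFun (congrFun (congrFun e i) j) ⟨(i, j), rfl, rfl⟩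
  cell_surj θ := matFamCell_surjective θ
  cell_inj _ _ e := matFamCell_injective e

end Matrices

/-! ### Functoriality of monads and bimodules -/

section ModExt

variable {A : VDC.{o, v, h, c}}

/-- The data are identified in their order of dependence and the laws are proof irrelevant; the
extensionality lemmas for the other structures on monads work in the same way. -/
theorem HMonad.ext_heq {M N : HMonad A} (ho : M.obj = N.obj) (hh : M.hor ≍ N.hor)
    (hu : M.unit ≍ N.unit) (hm : M.mul ≍ N.mul) : M = N := by
  obtain ⟨a, k, η, μ, _, _, _⟩ := M
  obtain ⟨a', k', η', μ', _, _, _⟩ := N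
  obtain rfl : a = a' := ho
  obtain rfl := eq_of_heq hh
  obtain rfl := eq_of_heq hu
  obtain rfl := eq_of_heq hm
  rfl

theorem HMonad.hor_heq {M N : HMonad A} (e : M = N) : M.hor ≍ N.hor := by rw [e]

theorem HMonad.unit_heq {M N : HMonad A} (e : M = N) : M.unit ≍ N.unit := by rw [e]

theorem HMonad.mul_heq {M N : HMonad A} (e : M = N) : M.mul ≍ N.mul := by rw [e]

theorem HMonadHom.ext_heq {S T S' T' : HMonad A} {f : HMonadHom S T} {g : HMonadHom S' T'}
    (hS : S = S') (hT : T = T') (e : f.hom ≍ g.hom) (e' : f.cell ≍ g.cell) : f ≍ g := by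
  subst hS hT
  exact heq_of_eq (HMonadHom.ext (eq_of_heq e) e')

theorem HMonadHom.hom_heq {S T S' T' : HMonad A} {f : HMonadHom S T} {g : HMonadHom S' T'}
    (hS : S = S') (hT : T = T') (e : f ≍ g) : f.hom ≍ g.hom := by
  subst hS hT e; rfl

theorem HMonadHom.cell_heq {S T S' T' : HMonad A} {f : HMonadHom S T} {g : HMonadHom S' T'}
    (hS : S = S') (hT : T = T') (e : f ≍ g) : f.cell ≍ g.cell := by
  subst hS hT e; rfl

theorem HBimod.ext_heq {S T S' T' : HMonad A} {Γ : HBimod S T} {Δ : HBimod S' T'}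
    (hS : S = S') (hT : T = T') (e : Γ.hor ≍ Δ.hor) (l : Γ.lact ≍ Δ.lact) (r : Γ.ract ≍ Δ.ract) :
    Γ ≍ Δ := by
  subst hS hT
  obtain ⟨a, k, η, _, _, _, _, _⟩ := Γ
  obtain ⟨a', k', η', _, _, _, _, _⟩ := Δ
  obtain rfl := eq_of_heq e
  obtain rfl := eq_of_heq l
  obtain rfl := eq_of_heq r
  rfl

theorem HBimod.hor_heq {S T S' T' : HMonad A} {Γ : HBimod S T} {Δ : HBimod S' T'}
    (hS : S = S') (hT : T = T') (e : Γ ≍ Δ) : Γ.hor ≍ Δ.hor := by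
  subst hS hT e; rfl

/-- Once the whole boundary is identified, an equivariant multicell is its underlying multicell,
since equivariance is a property. -/
theorem ModCell.ext_heq {S S' T T' R R' V V' : HMonad A} {p : BPath S S'} {p' : BPath R R'}
    {u : S ⟶ T} {v : S' ⟶ T'} {u' : R ⟶ V} {v' : R' ⟶ V'} {Γ : HBimod T T'} {Γ' : HBimod V V'}
    {θ : ModCell p u v Γ} {θ' : ModCell p' u' v' Γ'} (hS : S = R) (hS' : S' = R') (hT : T = V)
    (hT' : T' = V') (hp : p ≍ p') (hu : u ≍ u') (hv : v ≍ v') (hΓ : Γ ≍ Γ')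
    (e : θ.cell ≍ θ'.cell) : θ ≍ θ' := by
  subst hS hS' hT hT' hp hu hv hΓ
  exact heq_of_eq (ModCell.ext (eq_of_heq e))

end ModExt

namespace VFunctor

variable {A : VDC.{o, v, h, c}} {B : VDC.{o₁, v₁, h₁, c₁}} {C : VDC.{o₂, v₂, h₂, c₂}}

theorem cellAt_heq (F : VFunctor A B) {X Y Z W : A.Obj} {p : A.Path X Y} {u : X ⟶ Z} {v : Y ⟶ W}
    {Γ : A.Hor Z W} (θ : A.Cell p u v Γ) {p' : B.Path (F.toFunctor.obj X) (F.toFunctor.obj Y)}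
    {u' : F.toFunctor.obj X ⟶ F.toFunctor.obj Z} {v' : F.toFunctor.obj Y ⟶ F.toFunctor.obj W}
    (hp : F.path p = p') (hu : F.toFunctor.map u = u') (hv : F.toFunctor.map v = v') :
    F.cellAt θ hp hu hv ≍ F.cell θ := (CellRel.cellAt θ hp hu hv).heq

/-- The image under a composite, transported once, and the image formed in two steps, transported
twice, are the same multicell up to its boundary. -/
theorem comp_cellAt_heq (F : VFunctor A B) (G : VFunctor B C) {X Y Z W : A.Obj} {p : A.Path X Y}
    {u : X ⟶ Z} {v : Y ⟶ W} {Γ : A.Hor Z W} (θ : A.Cell p u v Γ)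
    {p' : B.Path (F.toFunctor.obj X) (F.toFunctor.obj Y)}
    {u' : F.toFunctor.obj X ⟶ F.toFunctor.obj Z} {v' : F.toFunctor.obj Y ⟶ F.toFunctor.obj W}
    (hp : F.path p = p') (hu : F.toFunctor.map u = u') (hv : F.toFunctor.map v = v')
    {p₁ p₂ : C.Path (G.toFunctor.obj (F.toFunctor.obj X)) (G.toFunctor.obj (F.toFunctor.obj Y))}
    {u₁ u₂ : G.toFunctor.obj (F.toFunctor.obj X) ⟶ G.toFunctor.obj (F.toFunctor.obj Z)}
    {v₁ v₂ : G.toFunctor.obj (F.toFunctor.obj Y) ⟶ G.toFunctor.obj (F.toFunctor.obj W)}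
    (hp₁ : (F.comp G).path p = p₁) (hu₁ : (F.comp G).toFunctor.map u = u₁)
    (hv₁ : (F.comp G).toFunctor.map v = v₁) (hp₂ : G.path p' = p₂) (hu₂ : G.toFunctor.map u' = u₂)
    (hv₂ : G.toFunctor.map v' = v₂) :
    (F.comp G).cellAt θ hp₁ hu₁ hv₁ ≍ G.cellAt (F.cellAt θ hp hu hv) hp₂ hu₂ hv₂ := by
  refine ((F.comp G).cellAt_heq θ _ _ _).trans ((comp_cell_heq F G θ).trans ?_)
  refine HEq.trans ?_ (G.cellAt_heq _ _ _ _).symm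
  exact G.cell_heq hp hu hv (F.cellAt_heq θ _ _ _).symm

/-- The case of identity sides, which is the one that occurs for units, multiplications and actions.
-/
theorem comp_cellAt_id_heq (F : VFunctor A B) (G : VFunctor B C) {X Y : A.Obj} {p : A.Path X Y}
    {Γ : A.Hor X Y} (θ : A.Cell p (𝟙 X) (𝟙 Y) Γ)
    {p₁ p₂ : C.Path (G.toFunctor.obj (F.toFunctor.obj X)) (G.toFunctor.obj (F.toFunctor.obj Y))}
    (hp₁ : (F.comp G).path p = p₁) (hp₂ : G.path (F.path p) = p₂) :
    (F.comp G).cellAt θ hp₁ ((F.comp G).toFunctor.map_id X) ((F.comp G).toFunctor.map_id Y) ≍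
      G.cellAt (F.cellAt θ rfl (F.toFunctor.map_id X) (F.toFunctor.map_id Y)) hp₂
        (G.toFunctor.map_id _) (G.toFunctor.map_id _) :=
  comp_cellAt_heq F G θ _ _ _ _ _ _ _ _ _

theorem mapMonad_comp (F : VFunctor A B) (G : VFunctor B C) (M : HMonad A) :
    (F.comp G).mapMonad M = G.mapMonad (F.mapMonad M) :=
  HMonad.ext_heq rfl HEq.rfl (comp_cellAt_id_heq F G M.unit rfl rfl)
    (comp_cellAt_id_heq F G M.mul rfl rfl)

end VFunctor

/-- The underlying horizontal morphisms agree definitionally. The structure cells differ only by the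
transports that make their sides identities, so all components agree by the lemmas on `cellAt`. -/
theorem ModVDC.map_comp {A : VDC.{o, v, h, c}} {B : VDC.{o₁, v₁, h₁, c₁}}
    {C : VDC.{o₂, v₂, h₂, c₂}} (F : VFunctor A B) (G : VFunctor B C) :
    (ModVDC.map (F.comp G)).toVFunctor =
      (ModVDC.map F).toVFunctor.comp (ModVDC.map G).toVFunctor := by
  have ho := VFunctor.mapMonad_comp F G
  have hm : ∀ {S T : HMonad A} (f : S ⟶ T),
      (F.comp G).mapMonadHom f ≍ G.mapMonadHom (F.mapMonadHom f) := fun f =>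
    HMonadHom.ext_heq (ho _) (ho _) HEq.rfl (VFunctor.comp_cell_heq F G f.cell)
  have hh : ∀ {S T : HMonad A} (Γ : HBimod S T),
      (F.comp G).mapBimod Γ ≍ G.mapBimod (F.mapBimod Γ) := fun Γ =>
    HBimod.ext_heq (ho _) (ho _) HEq.rfl (VFunctor.comp_cellAt_id_heq F G Γ.lact rfl rfl)
      (VFunctor.comp_cellAt_id_heq F G Γ.ract rfl rfl)
  refine VFunctor.ext_heq ho (fun _ _ => hm) (fun _ _ => hh) ?_
  intro X Y Z W p u v Γ θ
  refine HEq.trans ?_ (VFunctor.comp_cell_heq _ _ _).symm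
  refine ModCell.ext_heq (ho _) (ho _) (ho _) (ho _) ?_ (hm _) (hm _) (hh _) ?_
  · exact (HPath.map_heq (H' := HBimod (A := C)) ho (fun _ _ => hh) p).trans
      (heq_of_eq (HPath.map_map _ _ _ _ p).symm)
  · exact VFunctor.comp_cellAt_heq F G θ.cell (F.path_und p) rfl rfl ((F.comp G).path_und p) rfl rfl
      (G.path_und _) rfl rfl

/-- Over a chaotic virtual double category a monad, a bimodule or a multicell consists of its
boundary and data in `PUnit`. Passing to monads therefore adds nothing to the chaotic corner, and
the left leg on monads is again given by a functor on vertical categories. -/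
theorem ModVDC.map_toHc {A : VDC.{o, v, h, c}} {C : Type o₁} [Category.{v₁} C] (q : A.Obj ⥤ C) :
    (ModVDC.map (VFunctor.toHc q)).toVFunctor =
      (VFunctor.toHc (HMonad.forget A ⋙ q) :
        VFunctor (ModVDC A).toVDC (hc C)).comp (uhcInc C).toVFunctor := by
  refine VFunctor.ext_heq (fun _ => rfl) (fun _ _ _ => HEq.rfl) (fun _ _ _ => HEq.rfl) ?_
  intro X Y Z W p u v Γ θ
  refine HEq.trans ?_ (VFunctor.comp_cell_heq _ _ _).symm
  have e := HPath.map_map (VFunctor.toHc (A := (ModVDC A).toVDC) (HMonad.forget A ⋙ q)).toFunctor.obj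
    (VFunctor.toHc (A := (ModVDC A).toVDC) (HMonad.forget A ⋙ q)).hor (uhcInc C).toFunctor.obj
    (uhcInc C).hor p
  exact ModCell.ext_heq rfl rfl rfl rfl (heq_of_eq e.symm) HEq.rfl HEq.rfl HEq.rfl HEq.rfl

/-! ### Images of the chains of actions -/

namespace VFunctor

variable {A : VDC.{o, v, h, c}} {B : VDC.{o₁, v₁, h₁, c₁}} (F : VFunctor A B)

/-- The counterpart of `exists_innerAct`: the law to be verified for a lifted multicell concerns
actions upstairs, and the known law of its image concerns actions downstairs, so action chains must
be transported forwards. -/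
theorem innerAct_map {S T : HMonad A} {p : BPath S T} {s : A.Path S.obj T.obj}
    {σ τ : A.Chain s (𝟙 S.obj) (𝟙 T.obj) (und p)} (i : InnerAct (p := p) σ τ) :
    ∃ (s' : B.Path (F.mapMonad S).obj (F.mapMonad T).obj)
      (σ' τ' : B.Chain s' (𝟙 (F.mapMonad S).obj) (𝟙 (F.mapMonad T).obj) (und (F.mapBPath p))),
      InnerAct (p := F.mapBPath p) σ' τ' ∧ F.ChainRel σ σ' ∧ F.ChainRel τ τ' := by
  induction i with
  | here Γ Δ p =>
    refine ⟨_, _, _, .here (F.mapBimod Γ) (F.mapBimod Δ) (F.mapBPath p), ?_, ?_⟩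
    · exact .cons (.cellAt Γ.ract rfl _ _) (.cons (.ident Δ.hor) (F.chainRel_ids p) rfl rfl)
        rfl rfl
    · exact .cons (.ident Γ.hor) (.cons (.cellAt Δ.lact rfl _ _) (F.chainRel_ids p) rfl rfl)
        rfl rfl
  | there Γ i ih =>
    obtain ⟨s, σ, τ, k, hσ, hτ⟩ := ih
    exact ⟨_, _, _, .there (F.mapBimod Γ) k, .cons (.ident Γ.hor) hσ rfl rfl,
      .cons (.ident Γ.hor) hτ rfl rfl⟩

/-- The analogue for the right outer action, whose chain is likewise built from identity cells and
one action cell. -/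
theorem rightAct_map {S T : HMonad A} {p : BPath S T} {s : A.Path S.obj T.obj}
    {σ : A.Chain s (𝟙 S.obj) (𝟙 T.obj) (und p)} (i : RightAct (p := p) σ) :
    ∃ (s' : B.Path (F.mapMonad S).obj (F.mapMonad T).obj)
      (σ' : B.Chain s' (𝟙 (F.mapMonad S).obj) (𝟙 (F.mapMonad T).obj) (und (F.mapBPath p))),
      RightAct (p := F.mapBPath p) σ' ∧ F.ChainRel σ σ' := by
  induction i with
  | here Γ =>
    exact ⟨_, _, .here (F.mapBimod Γ), .single (.cellAt Γ.ract rfl _ _) (F.toFunctor.map_id _)⟩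
  | there Γ i ih =>
    obtain ⟨s, σ, k, hσ⟩ := ih
    exact ⟨_, _, .there (F.mapBimod Γ) k, .cons (.ident Γ.hor) hσ rfl rfl⟩

theorem mapMonad_unit_heq (M : HMonad A) : (F.mapMonad M).unit ≍ F.cell M.unit :=
  F.cellAt_heq M.unit rfl (F.toFunctor.map_id _) (F.toFunctor.map_id _)

theorem mapMonad_mul_heq (M : HMonad A) : (F.mapMonad M).mul ≍ F.cell M.mul :=
  F.cellAt_heq M.mul rfl (F.toFunctor.map_id _) (F.toFunctor.map_id _)

theorem mapBimod_lact_heq {M N : HMonad A} (Γ : HBimod M N) :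
    (F.mapBimod Γ).lact ≍ F.cell Γ.lact :=
  F.cellAt_heq Γ.lact rfl (F.toFunctor.map_id _) (F.toFunctor.map_id _)

theorem mapBimod_ract_heq {M N : HMonad A} (Γ : HBimod M N) :
    (F.mapBimod Γ).ract ≍ F.cell Γ.ract :=
  F.cellAt_heq Γ.ract rfl (F.toFunctor.map_id _) (F.toFunctor.map_id _)

end VFunctor

/-! ### Monads and bimodules over an elementwise pullback -/

namespace VDC.IsHcPullback

variable {X : VDC.{o, v, h, c}} {Y : VDC.{o₁, v₁, h₁, c₁}} {C : Type o₂}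
  [Category.{v₂} C] {W : VDC.{o₃, v₃, h₃, c₃}} {P : VFunctor X Y} {q : X.Obj ⥤ C}
  {F : VFunctor Y W} {G : VFunctor (hc C) W}

open VFunctor

/-- The device by which laws descend: if both sides of an equation in `X` are related to the sides
of a known equation in `Y`, the equation holds in `X`. The relations are assembled from the rules
for composites, pairs and identities, following the shape of the law. -/
theorem cellRel_inj (i : IsHcPullback P q F G) {x y z w : X.Obj} {p : X.Path x y}
    {f : x ⟶ z} {g : y ⟶ w} {Γ : X.Hor z w} {κ κ' : X.Cell p f g Γ}
    {p' : Y.Path (P.toFunctor.obj x) (P.toFunctor.obj y)}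
    {f' : P.toFunctor.obj x ⟶ P.toFunctor.obj z} {g' : P.toFunctor.obj y ⟶ P.toFunctor.obj w}
    {Γ' : Y.Hor (P.toFunctor.obj z) (P.toFunctor.obj w)} {θ θ' : Y.Cell p' f' g' Γ'}
    (a : P.CellRel κ θ) (b : P.CellRel κ' θ') (e : θ = θ') : κ = κ' := by
  subst e
  exact i.cell_inj _ _ (eq_of_heq (a.heq.symm.trans b.heq))

/-- Over the lower leg only the object and the horizontal morphism of the monad are constrained.
Those two are lifted by means of the constraint; the unit and the multiplication lift because `P` is
surjective on multicells. -/
theorem exists_monad (i : IsHcPullback P q F G) (M : HMonad Y) (z : C)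
    (e : F.mapMonad M = (((uhcInc C).comp (ModVDC.map G)).toFunctor.obj z : HMonad W)) :
    ∃ N : HMonad X, P.mapMonad N = M ∧ q.obj N.obj = z := by
  have eo := congrArg HMonad.obj e
  have eh := HMonad.hor_heq e
  clear e
  obtain ⟨m, k, η, μ, l₁, l₂, l₃⟩ := M
  obtain ⟨x, rfl, rfl⟩ := i.obj_surj m z eo
  obtain ⟨Δ, rfl⟩ := i.hor_surj k eh
  have hi : ∀ y, P.toFunctor.map (𝟙 y) = 𝟙 (P.toFunctor.obj y) := P.toFunctor.map_id
  obtain ⟨η', hη⟩ := i.exists_cell (p := .nil x) (Γ := Δ) rfl (hi x) (hi x) rfl η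
  obtain ⟨μ', hμ⟩ := i.exists_cell (p := .cons Δ (.one Δ)) (Γ := Δ) rfl (hi x) (hi x) rfl μ
  refine ⟨⟨x, Δ, η', μ', ?_, ?_, ?_⟩, ?_, rfl⟩
  · exact i.cellRel_inj (.comp _ _ _ _ (.pair _ _ hη (.ident _) (hi x)) hμ) (.ident _) l₁
  · exact i.cellRel_inj (.comp _ _ _ _ (.pair _ _ (.ident _) hη (hi x)) hμ) (.ident _) l₂
  · exact i.cellRel_inj (.comp _ _ _ _ (.pair _ _ hμ (.ident _) (hi x)) hμ)
      (.comp _ _ _ _ (.pair _ _ (.ident _) hμ (hi x)) hμ) l₃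
  · exact HMonad.ext_heq rfl HEq.rfl ((P.mapMonad_unit_heq _).trans hη.heq.symm)
      ((P.mapMonad_mul_heq _).trans hμ.heq.symm)

/-- The functor `q` is needed for the underlying objects alone; over equal objects `P` already
separates horizontal morphisms and multicells. -/
theorem monad_inj (i : IsHcPullback P q F G) {M N : HMonad X}
    (e : P.mapMonad M = P.mapMonad N) (e' : q.obj M.obj = q.obj N.obj) : M = N := by
  have eo := i.obj_inj _ _ (congrArg HMonad.obj e) e'
  have eh := HMonad.hor_heq e
  have eu := (P.mapMonad_unit_heq M).symm.trans ((HMonad.unit_heq e).trans (P.mapMonad_unit_heq N))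
  have em := (P.mapMonad_mul_heq M).symm.trans ((HMonad.mul_heq e).trans (P.mapMonad_mul_heq N))
  clear e e'
  obtain ⟨a, k, η, μ, _, _, _⟩ := M
  obtain ⟨a', k', η', μ', _, _, _⟩ := N
  obtain rfl : a = a' := eo
  obtain rfl : k = k' := i.hor_inj (eq_of_heq eh)
  obtain rfl : η = η' := i.cell_inj _ _ (eq_of_heq eu)
  obtain rfl : μ = μ' := i.cell_inj _ _ (eq_of_heq em)
  rfl

/-- The underlying vertical morphism is lifted from the compatible pair and then the cell is lifted
over it; the two laws descend by `cellRel_inj`. -/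
theorem exists_monadHom (i : IsHcPullback P q F G) {M N : HMonad X}
    (a : P.mapMonad M ⟶ P.mapMonad N) (b : q.obj M.obj ⟶ q.obj N.obj)
    (e : F.toFunctor.map a.hom ≍ G.toFunctor.map (X := q.obj M.obj) (Y := q.obj N.obj) b) :
    ∃ f : M ⟶ N, P.mapMonadHom f = a ∧ q.map f.hom = b := by
  obtain ⟨a₁, a₂, l₁, l₂⟩ := (a : HMonadHom _ _)
  have hi : ∀ y, P.toFunctor.map (𝟙 y) = 𝟙 (P.toFunctor.obj y) := P.toFunctor.map_id
  obtain ⟨f, hf, rfl⟩ := i.map_surj _ b e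
  change P.toFunctor.map f = a₁ at hf
  subst hf
  obtain ⟨k, hk⟩ := i.exists_cell (p := .one M.hor) (f := f) (g := f) (Γ := N.hor) rfl rfl rfl rfl a₂
  refine ⟨(⟨f, k, ?_, ?_⟩ : HMonadHom M N), ?_, rfl⟩
  · exact i.cellRel_inj (.comp _ _ (Category.comp_id _) (Category.comp_id _) (.nil rfl)
      (.cellAt N.unit rfl (hi _) (hi _))) (.comp _ _ (Category.id_comp _) (Category.id_comp _)
      (.single (.cellAt M.unit rfl (hi _) (hi _)) (hi _)) hk) l₁
  · exact i.cellRel_inj (.comp _ _ (Category.comp_id _) (Category.comp_id _)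
      (.pair rfl rfl hk hk rfl) (.cellAt N.mul rfl (hi _) (hi _)))
      (.comp _ _ (Category.id_comp _) (Category.id_comp _)
      (.single (.cellAt M.mul rfl (hi _) (hi _)) (hi _)) hk) l₂
  · exact HMonadHom.ext rfl hk.heq.symm

theorem monadHom_inj (i : IsHcPullback P q F G) {M N : HMonad X} (f g : M ⟶ N)
    (e : P.mapMonadHom f = P.mapMonadHom g) (e' : q.map f.hom = q.map g.hom) : f = g := by
  have eh := i.map_inj _ _ (congrArg HMonadHom.hom e) e'
  have ec := HMonadHom.cell_heq rfl rfl (heq_of_eq e)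
  obtain ⟨a₁, a₂, l₁, l₂⟩ := (f : HMonadHom _ _)
  obtain ⟨b₁, b₂, l₁, l₂⟩ := (g : HMonadHom _ _)
  obtain rfl : a₁ = b₁ := eh
  obtain rfl : a₂ = b₂ := i.cell_inj _ _ (eq_of_heq ec)
  rfl

/-- The constraint concerns the underlying horizontal morphism. Both actions are then lifts of
multicells, and each of the five laws is the image law read through `cellRel_inj`. -/
theorem exists_bimod (i : IsHcPullback P q F G) {M N : HMonad X}
    (Γ : HBimod (P.mapMonad M) (P.mapMonad N))
    (e : F.hor Γ.hor ≍ G.hor (X := q.obj M.obj) (Y := q.obj N.obj) PUnit.unit) :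
    ∃ Δ : HBimod M N, P.mapBimod Δ = Γ := by
  have hi : ∀ y, P.toFunctor.map (𝟙 y) = 𝟙 (P.toFunctor.obj y) := P.toFunctor.map_id
  obtain ⟨k, l, r, h₁, h₂, h₃, h₄, h₅⟩ := Γ
  obtain ⟨Δ, rfl⟩ := i.hor_surj k e
  obtain ⟨l', hl⟩ := i.exists_cell (p := .cons M.hor (.one Δ)) (Γ := Δ) rfl (hi _) (hi _) rfl l
  obtain ⟨r', hr⟩ := i.exists_cell (p := .cons Δ (.one N.hor)) (Γ := Δ) rfl (hi _) (hi _) rfl r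
  refine ⟨⟨Δ, l', r', ?_, ?_, ?_, ?_, ?_⟩, ?_⟩
  · exact i.cellRel_inj (.comp _ _ _ _ (.pair _ _ (.cellAt _ rfl (hi _) (hi _)) (.ident _) (hi _))
      hl) (.ident _) h₁
  · exact i.cellRel_inj (.comp _ _ _ _ (.pair _ _ (.ident _) (.cellAt _ rfl (hi _) (hi _)) (hi _))
      hr) (.ident _) h₂
  · exact i.cellRel_inj (.comp _ _ _ _ (.pair _ _ (.cellAt _ rfl (hi _) (hi _)) (.ident _) (hi _))
      hl) (.comp _ _ _ _ (.pair _ _ (.ident _) hl (hi _)) hl) h₃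
  · exact i.cellRel_inj (.comp _ _ _ _ (.pair _ _ hr (.ident _) (hi _)) hr)
      (.comp _ _ _ _ (.pair _ _ (.ident _) (.cellAt _ rfl (hi _) (hi _)) (hi _)) hr) h₄
  · exact i.cellRel_inj (.comp _ _ _ _ (.pair _ _ hl (.ident _) (hi _)) hr)
      (.comp _ _ _ _ (.pair _ _ (.ident _) hr (hi _)) hl) h₅
  · exact eq_of_heq (HBimod.ext_heq rfl rfl HEq.rfl ((P.mapBimod_lact_heq _).trans hl.heq.symm)
      ((P.mapBimod_ract_heq _).trans hr.heq.symm))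

theorem bimod_inj (i : IsHcPullback P q F G) {M N : HMonad X} (Γ Δ : HBimod M N)
    (e : P.mapBimod Γ = P.mapBimod Δ) : Γ = Δ := by
  have key : ∀ {Γ' Δ' : HBimod (P.mapMonad M) (P.mapMonad N)}, Γ' = Δ' →
      Γ'.hor = Δ'.hor ∧ Γ'.lact ≍ Δ'.lact ∧ Γ'.ract ≍ Δ'.ract := by
    rintro _ _ rfl
    exact ⟨rfl, HEq.rfl, HEq.rfl⟩
  obtain ⟨eh, el, er⟩ := key e
  have el := (P.mapBimod_lact_heq Γ).symm.trans (el.trans (P.mapBimod_lact_heq Δ))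
  have er := (P.mapBimod_ract_heq Γ).symm.trans (er.trans (P.mapBimod_ract_heq Δ))
  clear e
  obtain ⟨k, l, r, _, _, _, _, _⟩ := Γ
  obtain ⟨k', l', r', _, _, _, _, _⟩ := Δ
  obtain rfl : k = k' := i.hor_inj eh
  obtain rfl : l = l' := i.cell_inj _ _ (eq_of_heq el)
  obtain rfl : r = r' := i.cell_inj _ _ (eq_of_heq er)
  rfl

/-- The underlying multicell has a lift; what has to be seen is that the lift is again equivariant.
-/
theorem exists_modCell (i : IsHcPullback P q F G) {S S' T T' : HMonad X} {p : BPath S S'}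
    {u : S ⟶ T} {v : S' ⟶ T'} {Γ : HBimod T T'}
    (θ : ModCell (P.mapBPath p) (P.mapMonadHom u) (P.mapMonadHom v) (P.mapBimod Γ)) :
    ∃ κ : ModCell p u v Γ, P.mapModCell κ = θ := by
  have hi : ∀ y, P.toFunctor.map (𝟙 y) = 𝟙 (P.toFunctor.obj y) := P.toFunctor.map_id
  obtain ⟨κ, hκ⟩ := i.exists_cell (p := und p) (f := u.hom) (g := v.hom) (Γ := Γ.hor)
    (P.path_und p) rfl rfl rfl θ.cell
  refine ⟨⟨κ, ?_, ?_⟩, ?_⟩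
  · intro s σ τ k
    -- The two ways of acting upstairs are related to two ways of acting downstairs, and `θ` does
    -- not distinguish the latter.
    obtain ⟨s', σ', τ', k', hσ, hτ⟩ := P.innerAct_map k
    exact i.cellRel_inj (.comp _ _ (Category.id_comp _) (Category.id_comp _) hσ hκ)
      (.comp _ _ (Category.id_comp _) (Category.id_comp _) hτ hκ) (θ.inner _ _ _ k')
  -- The outer law has two forms: over an empty path the same monad acts through both sides, whereas
  -- over a nonempty path the left and the right action are separate conditions.
  · cases p with
    | nil =>
      exact i.cellRel_inj (.comp _ _ (Category.comp_id _) (Category.comp_id _)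
        (.pair rfl rfl .mk hκ rfl) (.cellAt Γ.lact rfl (hi _) (hi _)))
        (.comp _ _ (Category.comp_id _) (Category.comp_id _)
          (.pair (φ := v.cell) (φ' := (P.mapMonadHom v).cell) rfl rfl hκ
            (show P.CellRel v.cell (P.mapMonadHom v).cell from .mk) rfl)
          (.cellAt Γ.ract rfl (hi _) (hi _))) θ.outer_nil
    | cons Δ p =>
      refine ⟨?_, ?_⟩
      · exact i.cellRel_inj (.comp _ _ (Category.id_comp _) (Category.id_comp _)
          (.cons (.cellAt Δ.lact rfl (hi _) (hi _)) (P.chainRel_ids p) rfl rfl) hκ)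
          (.comp _ _ (Category.comp_id _) (Category.comp_id _)
          (.pair rfl rfl .mk hκ rfl) (.cellAt Γ.lact rfl (hi _) (hi _))) θ.outer_left
      · intro s σ e k
        obtain ⟨s', σ', k', hσ⟩ := P.rightAct_map k
        exact i.cellRel_inj (.comp _ _ (Category.id_comp _) (Category.id_comp _) hσ hκ)
          (.comp _ _ (Category.comp_id _) (Category.comp_id _)
          (.pair e k'.top hκ .mk rfl) (.cellAt Γ.ract rfl (hi _) (hi _)))
          (θ.outer_right k' k'.top)
  · exact ModCell.ext (eq_of_heq ((P.cellRel_mapModCell _).heq.trans hκ.heq.symm))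

theorem modCell_inj (i : IsHcPullback P q F G) {S S' T T' : HMonad X} {p : BPath S S'}
    {u : S ⟶ T} {v : S' ⟶ T'} {Γ : HBimod T T'} {κ κ' : ModCell p u v Γ}
    (e : P.mapModCell κ = P.mapModCell κ') : κ = κ' :=
  ModCell.ext (i.cellRel_inj (P.cellRel_mapModCell κ) (P.cellRel_mapModCell κ')
    (congrArg ModCell.cell e))

/-- `Mod` is applied to the commuting square, and the chaotic corner is then factored through its
inclusion into monads. -/
theorem mod_comm (i : IsHcPullback P q F G) :
    (ModVDC.map P).toVFunctor.comp (ModVDC.map F).toVFunctor =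
      (VFunctor.toHc (HMonad.forget X ⋙ q) : VFunctor (ModVDC X).toVDC (hc C)).comp
        ((uhcInc C).comp (ModVDC.map G)).toVFunctor := by
  rw [← ModVDC.map_comp, i.comm, ModVDC.map_comp, ModVDC.map_toHc]
  exact VFunctor.comp_assoc _ _ _

/-- Passing to monads and bimodules preserves the elementwise pullbacks. -/
theorem mod (i : IsHcPullback P q F G) :
    IsHcPullback (ModVDC.map P).toVFunctor (HMonad.forget X ⋙ q) (ModVDC.map F).toVFunctor
      ((uhcInc C).comp (ModVDC.map G)).toVFunctor where
  comm := i.mod_comm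
  obj_surj M z e := i.exists_monad M z e
  obj_inj _ _ e e' := i.monad_inj e e'
  map_surj a b e := i.exists_monadHom a b
    -- The compatibility is an equation between monad morphisms whose ends are equal only because
    -- the square of monads commutes; its underlying vertical part is what the lifting lemma needs.
    -- The case of horizontal morphisms is similar.
    (HMonadHom.hom_heq (VFunctor.obj_congr i.mod_comm _) (VFunctor.obj_congr i.mod_comm _) e)
  map_inj f g e e' := i.monadHom_inj f g e e'
  hor_surj {M N} Γ e := i.exists_bimod Γ
    (HBimod.hor_heq (VFunctor.obj_congr i.mod_comm M) (VFunctor.obj_congr i.mod_comm N) e)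
  hor_inj {_ _} Γ Δ e := i.bimod_inj Γ Δ e
  cell_surj θ := i.exists_modCell θ
  cell_inj _ _ e := i.modCell_inj e

end VDC.IsHcPullback

/-! ### Pullbacks of unital virtual double categories -/

/-- Preservation of the units is a property, so unital functors may be compared as virtual double
functors. -/
theorem UFunctor.ext_toVFunctor {D : UVDC.{o, v, h, c}} {E : UVDC.{o₁, v₁, h₁, c₁}}
    {F G : UFunctor D E} (e : F.toVFunctor = G.toVFunctor) : F = G := by
  cases F
  cases G
  cases e
  rfl

/-- The lift is the one found for virtual double functors. It preserves the chosen units because its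
composite with `P` does, because `P` does, and because `P` is injective on horizontal morphisms and
multicells. As transformations between unital functors are arbitrary, their universal property needs
nothing further. -/
theorem VDC.IsHcPullback.isPullback_uvdc {X : UVDC.{o, v, h, c}} {Y : UVDC.{o₁, v₁, h₁, c₁}}
    {C : Type o₂} [Category.{v₂} C] {W : UVDC.{o₃, v₃, h₃, c₃}} {P : UFunctor X Y}
    {q : X.Obj ⥤ C} {F : UFunctor Y W} {G : UFunctor (uhc C) W}
    (i : VDC.IsHcPullback P.toVFunctor q F.toVFunctor G.toVFunctor) :
    UVDC.IsPullback.{_, _, _, _, _, _, _, _, _, _, _, _, _, _, _, _, o₄, v₄, h₄, c₄} P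
      (UFunctor.toHc q) F G where
  comm := UFunctor.ext_toVFunctor i.comm
  lift T R S e := by
    obtain ⟨K, h₁, h₂⟩ := i.exists_functor R.toVFunctor S.toVFunctor
      (congrArg UFunctor.toVFunctor e)
    have hu : ∀ t : T.Obj, K.hor (T.unit t) = X.unit (K.toFunctor.obj t) := by
      intro t
      apply i.hor_inj
      refine Eq.trans ?_ (P.map_unit _).symm
      -- Taking `R` apart exposes its underlying functor, which can then be replaced by `K.comp P`;
      -- its preservation of units becomes a statement about `P` applied to `K`.
      obtain ⟨R, hR, _⟩ := R
      subst h₁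
      exact hR t
    have he : ∀ t : T.Obj, K.cell (T.eta t) ≍ X.eta (K.toFunctor.obj t) := by
      intro t
      refine i.cell_heq_inj rfl (K.toFunctor.map_id t) (K.toFunctor.map_id t) (hu t) ?_
      refine HEq.trans ?_ (P.map_eta _).symm
      obtain ⟨R, _, hR⟩ := R
      subst h₁
      exact (VFunctor.comp_cell_heq _ _ _).symm.trans (hR t)
    refine ⟨⟨K, hu, he⟩, ⟨UFunctor.ext_toVFunctor h₁, UFunctor.ext_toVFunctor h₂⟩, ?_⟩
    rintro L ⟨l₁, l₂⟩
    exact UFunctor.ext_toVFunctor (i.functor_inj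
      ((congrArg UFunctor.toVFunctor l₁).trans h₁.symm)
      ((congrArg UFunctor.toVFunctor l₂).trans h₂.symm))
  lift₂ T K L α β e := i.trans_existsUnique K.toVFunctor L.toVFunctor α β e

theorem prof_isHcPullback (A : VDC.{o, v, h, c}) :
    VDC.IsHcPullback (ModVDC.map (matFam.{o, v, h, c, u} A)).toVFunctor
      (HMonad.forget (MatVDC.{o, v, h, c, u} A) ⋙ famIdx A) (ModVDC.map (famSpan A)).toVFunctor
      chaoticProf.toVFunctor := (matFam_isHcPullback A).mod

/-! ### Strict 2-functors -/

section TwoCat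

open Bicategory

namespace CategoryTheory.Bicategory

variable {B : Type o} [Bicategory.{w, v} B]

theorem id_heq {a a' : B} (ha : a = a') : 𝟙 a ≍ 𝟙 a' := by subst ha; rfl

theorem comp_heq {a b d a' b' d' : B} {f : a ⟶ b} {g : b ⟶ d} {f' : a' ⟶ b'} {g' : b' ⟶ d'}
    (ha : a = a') (hb : b = b') (hd : d = d') (hf : f ≍ f') (hg : g ≍ g') :
    f ≫ g ≍ f' ≫ g' := by
  subst ha hb hd hf hg; rfl

theorem id₂_heq {a b a' b' : B} {f : a ⟶ b} {f' : a' ⟶ b'} (ha : a = a') (hb : b = b')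
    (hf : f ≍ f') : 𝟙 f ≍ 𝟙 f' := by
  subst ha hb hf; rfl

theorem comp₂_heq {a b a' b' : B} {f g k : a ⟶ b} {f' g' k' : a' ⟶ b'} {α : f ⟶ g} {β : g ⟶ k}
    {α' : f' ⟶ g'} {β' : g' ⟶ k'} (ha : a = a') (hb : b = b') (hf : f ≍ f') (hg : g ≍ g')
    (hk : k ≍ k') (hα : α ≍ α') (hβ : β ≍ β') : α ≫ β ≍ α' ≫ β' := by
  subst ha hb hf hg hk hα hβ; rfl

theorem whiskerLeft_heq {a b d a' b' d' : B} {f : a ⟶ b} {f' : a' ⟶ b'} {g k : b ⟶ d}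
    {g' k' : b' ⟶ d'} {α : g ⟶ k} {α' : g' ⟶ k'} (ha : a = a') (hb : b = b') (hd : d = d')
    (hf : f ≍ f') (hg : g ≍ g') (hk : k ≍ k') (hα : α ≍ α') : f ◁ α ≍ f' ◁ α' := by
  subst ha hb hd hf hg hk hα; rfl

theorem whiskerRight_heq {a b d a' b' d' : B} {f : b ⟶ d} {f' : b' ⟶ d'} {g k : a ⟶ b}
    {g' k' : a' ⟶ b'} {α : g ⟶ k} {α' : g' ⟶ k'} (ha : a = a') (hb : b = b') (hd : d = d')
    (hf : f ≍ f') (hg : g ≍ g') (hk : k ≍ k') (hα : α ≍ α') : α ▷ f ≍ α' ▷ f' := by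
  subst ha hb hd hf hg hk hα; rfl

end CategoryTheory.Bicategory

namespace CategoryTheory.StrictPseudofunctor

variable {B : Type o} [Bicategory.{w, v} B] {C : Type o₁} [Bicategory.{w₁, v₁} C]
  {D : Type o₂} [Bicategory.{w₂, v₂} D] {E : Type o₃} [Bicategory.{w₃, v₃} E]

/-- A strict 2-functor is determined by its action on cells, since its coherence isomorphisms are
required to be the ones given by equalities. -/
theorem ext_heq {F G : StrictPseudofunctor B C} (ho : ∀ a, F.obj a = G.obj a)
    (hm : ∀ {a b : B} (f : a ⟶ b), F.map f ≍ G.map f)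
    (hc : ∀ {a b : B} {f g : a ⟶ b} (α : f ⟶ g), F.map₂ α ≍ G.map₂ α) : F = G := by
  obtain ⟨⟨⟨⟨⟨⟨fo, fm⟩, fc⟩, _, _⟩, fi, fk, _, _, _, _, _⟩, hfi, hfi'⟩, hfk, hfk'⟩ := F
  obtain ⟨⟨⟨⟨⟨⟨go, gm⟩, gc⟩, _, _⟩, gi, gk, _, _, _, _, _⟩, hgi, hgi'⟩, hgk, hgk'⟩ := G
  obtain rfl : fo = go := funext ho
  obtain rfl : @fm = @gm := by
    funext a b f
    exact eq_of_heq (hm f)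
  obtain rfl : @fc = @gc := by
    funext a b f g α
    exact eq_of_heq (hc α)
  obtain rfl : @fi = @gi := by
    funext a
    exact (hfi' a).trans (hgi' a).symm
  obtain rfl : @fk = @gk := by
    funext _ _ _ f g
    exact (hfk' f g).trans (hgk' f g).symm
  rfl

theorem obj_congr {F G : StrictPseudofunctor B C} (e : F = G) (a : B) : F.obj a = G.obj a := by
  subst e; rfl

theorem map_congr {F G : StrictPseudofunctor B C} (e : F = G) {a b : B} (f : a ⟶ b) :
    F.map f ≍ G.map f := by
  subst e; rfl

theorem map₂_congr {F G : StrictPseudofunctor B C} (e : F = G) {a b : B} {f g : a ⟶ b}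
    (α : f ⟶ g) : F.map₂ α ≍ G.map₂ α := by
  subst e; rfl

theorem comp_assoc (F : StrictPseudofunctor B C) (G : StrictPseudofunctor C D)
    (H : StrictPseudofunctor D E) : (F.comp G).comp H = F.comp (G.comp H) :=
  ext_heq (fun _ => rfl) (fun _ => HEq.rfl) (fun _ => HEq.rfl)

/-- Strictness turns the coherence isomorphisms in the whiskering law into `eqToHom`s, and
conjugation by these is the same as heterogeneous equality. -/
theorem map₂_left (F : StrictPseudofunctor B C) {a b d : B} (f : a ⟶ b) {g g' : b ⟶ d}
    (α : g ⟶ g') : F.map₂ (f ◁ α) ≍ F.map f ◁ F.map₂ α := by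
  have h := F.map₂_whisker_left f α
  rw [F.mapComp_eq_eqToIso, F.mapComp_eq_eqToIso, eqToIso.hom, eqToIso.inv] at h
  exact (conj_eqToHom_iff_heq _ _ _ (F.map_comp _ _)).1 h

theorem map₂_right (F : StrictPseudofunctor B C) {a b d : B} {f f' : a ⟶ b} (α : f ⟶ f')
    (g : b ⟶ d) : F.map₂ (α ▷ g) ≍ F.map₂ α ▷ F.map g := by
  have h := F.map₂_whisker_right α g
  rw [F.mapComp_eq_eqToIso, F.mapComp_eq_eqToIso, eqToIso.hom, eqToIso.inv] at h
  exact (conj_eqToHom_iff_heq _ _ _ (F.map_comp _ _)).1 h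

/-- `F.Lifts R obj map map₂`: the action of `F` on the raw data `obj`, `map`, `map₂` is `R`. -/
structure Lifts (F : StrictPseudofunctor C D) (R : StrictPseudofunctor B D) (obj : B → C)
    (map : ∀ {a b : B}, (a ⟶ b) → (obj a ⟶ obj b))
    (map₂ : ∀ {a b : B} {f g : a ⟶ b}, (f ⟶ g) → (map f ⟶ map g)) : Prop where
  obj : ∀ a, F.obj (obj a) = R.obj a
  map : ∀ {a b : B} (f : a ⟶ b), F.map (map f) ≍ R.map f
  map₂ : ∀ {a b : B} {f g : a ⟶ b} (α : f ⟶ g), F.map₂ (map₂ α) ≍ R.map₂ α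

namespace Lifts

variable {F : StrictPseudofunctor C D} {R : StrictPseudofunctor B D} {obj : B → C}
  {map : ∀ {a b : B}, (a ⟶ b) → (obj a ⟶ obj b)}
  {map₂ : ∀ {a b : B} {f g : a ⟶ b}, (f ⟶ g) → (map f ⟶ map g)}

/-- This and the following lemmas show that raw data lifting a 2-functor satisfy the laws of a
2-functor after `F` is applied. When two such `F` are jointly injective, the laws hold for the raw
data themselves. -/
theorem map_id (l : F.Lifts R obj @map @map₂) (a : B) : F.map (map (𝟙 a)) = F.map (𝟙 (obj a)) :=
  eq_of_heq ((l.map (𝟙 a)).trans ((heq_of_eq (R.map_id a)).trans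
    ((Bicategory.id_heq (l.obj a).symm).trans (heq_of_eq (F.map_id (obj a)).symm))))

theorem map_comp (l : F.Lifts R obj @map @map₂) {a b d : B} (f : a ⟶ b) (g : b ⟶ d) :
    F.map (map (f ≫ g)) = F.map (map f ≫ map g) :=
  eq_of_heq ((l.map (f ≫ g)).trans ((heq_of_eq (R.map_comp f g)).trans
    ((Bicategory.comp_heq (l.obj _).symm (l.obj _).symm (l.obj _).symm (l.map f).symm
      (l.map g).symm).trans (heq_of_eq (F.map_comp (map f) (map g)).symm))))

theorem map₂_id (l : F.Lifts R obj @map @map₂) {a b : B} (f : a ⟶ b) : F.map₂ (map₂ (𝟙 f)) = F.map₂ (𝟙 (map f)) :=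
  eq_of_heq ((l.map₂ (𝟙 f)).trans ((heq_of_eq (R.map₂_id f)).trans
    ((Bicategory.id₂_heq (l.obj _).symm (l.obj _).symm (l.map f).symm).trans
      (heq_of_eq (F.map₂_id (map f)).symm))))

theorem map₂_comp (l : F.Lifts R obj @map @map₂) {a b : B} {f g k : a ⟶ b} (α : f ⟶ g) (β : g ⟶ k) :
    F.map₂ (map₂ (α ≫ β)) = F.map₂ (map₂ α ≫ map₂ β) :=
  eq_of_heq ((l.map₂ (α ≫ β)).trans ((heq_of_eq (R.map₂_comp α β)).trans
    ((Bicategory.comp₂_heq (l.obj _).symm (l.obj _).symm (l.map _).symm (l.map _).symm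
      (l.map _).symm (l.map₂ α).symm (l.map₂ β).symm).trans
        (heq_of_eq (F.map₂_comp (map₂ α) (map₂ β)).symm))))

theorem map₂_left (l : F.Lifts R obj @map @map₂) {a b d : B} (f : a ⟶ b) {g g' : b ⟶ d} (α : g ⟶ g') :
    F.map₂ (map₂ (f ◁ α)) ≍ F.map₂ (map f ◁ map₂ α) :=
  (l.map₂ (f ◁ α)).trans ((R.map₂_left f α).trans
    ((Bicategory.whiskerLeft_heq (l.obj _).symm (l.obj _).symm (l.obj _).symm (l.map _).symm
      (l.map _).symm (l.map _).symm (l.map₂ α).symm).trans (F.map₂_left (map f) (map₂ α)).symm))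

theorem map₂_right (l : F.Lifts R obj @map @map₂) {a b d : B} {f f' : a ⟶ b} (α : f ⟶ f') (g : b ⟶ d) :
    F.map₂ (map₂ (α ▷ g)) ≍ F.map₂ (map₂ α ▷ map g) :=
  (l.map₂ (α ▷ g)).trans ((R.map₂_right α g).trans
    ((Bicategory.whiskerRight_heq (l.obj _).symm (l.obj _).symm (l.obj _).symm (l.map _).symm
      (l.map _).symm (l.map _).symm (l.map₂ α).symm).trans (F.map₂_right (map₂ α) (map g)).symm))

end Lifts

end CategoryTheory.StrictPseudofunctor

theorem TwoNatTrans.app_heq {B : Type o} [Bicategory.{w, v} B] {C : Type o₁}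
    [Bicategory.{w₁, v₁} C] {F G F' G' : StrictPseudofunctor B C} (hF : F = F') (hG : G = G')
    {α : TwoNatTrans F G} {β : TwoNatTrans F' G'} (e : α ≍ β) (a : B) : α.app a ≍ β.app a := by
  subst hF hG e; rfl

/-! ### An elementwise criterion for pullbacks of 2-categories -/

/-- Elementwise conditions under which a square of 2-categories is a pullback. -/
structure IsTwoCatPullbackElementwise {X : Type o} [Bicategory.{w, v} X] {Y : Type o₁}
    [Bicategory.{w₁, v₁} Y] {Z : Type o₂} [Bicategory.{w₂, v₂} Z] {W : Type o₃}
    [Bicategory.{w₃, v₃} W] (P : StrictPseudofunctor X Y) (Q : StrictPseudofunctor X Z)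
    (F : StrictPseudofunctor Y W) (G : StrictPseudofunctor Z W) : Prop where
  comm : P.comp F = Q.comp G
  obj_surj : ∀ (y : Y) (z : Z), F.obj y = G.obj z → ∃ x, P.obj x = y ∧ Q.obj x = z
  obj_inj : ∀ x x' : X, P.obj x = P.obj x' → Q.obj x = Q.obj x' → x = x'
  map_surj : ∀ {x x' : X} (a : P.obj x ⟶ P.obj x') (b : Q.obj x ⟶ Q.obj x'),
    F.map a ≍ G.map b → ∃ f : x ⟶ x', P.map f = a ∧ Q.map f = b
  map_inj : ∀ {x x' : X} (f g : x ⟶ x'), P.map f = P.map g → Q.map f = Q.map g → f = g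
  map₂_surj : ∀ {x x' : X} {f g : x ⟶ x'} (a : P.map f ⟶ P.map g) (b : Q.map f ⟶ Q.map g),
    F.map₂ a ≍ G.map₂ b → ∃ α : f ⟶ g, P.map₂ α = a ∧ Q.map₂ α = b
  map₂_inj : ∀ {x x' : X} {f g : x ⟶ x'} (α β : f ⟶ g), P.map₂ α = P.map₂ β →
    Q.map₂ α = Q.map₂ β → α = β

namespace IsTwoCatPullbackElementwise

variable {X : Type o} [Bicategory.{w, v} X] {Y : Type o₁} [Bicategory.{w₁, v₁} Y]
    {Z : Type o₂} [Bicategory.{w₂, v₂} Z] {W : Type o₃} [Bicategory.{w₃, v₃} W]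
    {P : StrictPseudofunctor X Y} {Q : StrictPseudofunctor X Z} {F : StrictPseudofunctor Y W}
    {G : StrictPseudofunctor Z W}

/-- The chosen lifts of objects have the prescribed images only up to an equation, so surjectivity
on 1-cells is restated for boundaries given by equations; the next lemma does the same for 2-cells.
-/
theorem exists_map (i : IsTwoCatPullbackElementwise P Q F G) {x x' : X} {y y' : Y} {z z' : Z}
    {a : y ⟶ y'} {b : z ⟶ z'} (h₁ : P.obj x = y) (h₂ : P.obj x' = y') (h₃ : Q.obj x = z)
    (h₄ : Q.obj x' = z') (e : F.map a ≍ G.map b) :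
    ∃ f : x ⟶ x', P.map f ≍ a ∧ Q.map f ≍ b := by
  subst h₁ h₂ h₃ h₄
  obtain ⟨f, rfl, rfl⟩ := i.map_surj a b e
  exact ⟨f, HEq.rfl, HEq.rfl⟩

theorem exists_map₂ (i : IsTwoCatPullbackElementwise P Q F G) {x x' : X} {f g : x ⟶ x'}
    {y y' : Y} {z z' : Z} {k l : y ⟶ y'} {m n : z ⟶ z'} {a : k ⟶ l} {b : m ⟶ n}
    (h₁ : P.obj x = y) (h₂ : P.obj x' = y') (h₃ : Q.obj x = z) (h₄ : Q.obj x' = z')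
    (h₅ : P.map f ≍ k) (h₆ : P.map g ≍ l) (h₇ : Q.map f ≍ m) (h₈ : Q.map g ≍ n)
    (e : F.map₂ a ≍ G.map₂ b) : ∃ α : f ⟶ g, P.map₂ α ≍ a ∧ Q.map₂ α ≍ b := by
  subst h₁ h₂ h₃ h₄ h₅ h₆ h₇ h₈
  obtain ⟨f, rfl, rfl⟩ := i.map₂_surj a b e
  exact ⟨f, HEq.rfl, HEq.rfl⟩

theorem map₂_heq (i : IsTwoCatPullbackElementwise P Q F G) {x x' : X} {f g f' g' : x ⟶ x'}
    {α : f ⟶ g} {β : f' ⟶ g'} (hf : f = f') (hg : g = g') (e₁ : P.map₂ α ≍ P.map₂ β)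
    (e₂ : Q.map₂ α ≍ Q.map₂ β) : α ≍ β := by
  subst hf hg
  exact heq_of_eq (i.map₂_inj _ _ (eq_of_heq e₁) (eq_of_heq e₂))

/-- Joint injectivity is applied to objects, 1-cells and 2-cells in turn; the auxiliary statements
restate it for cells whose boundaries are equal by the previous stages. -/
theorem functor_inj (i : IsTwoCatPullbackElementwise P Q F G) {T : Type o₄}
    [Bicategory.{w₄, v₄} T] {K L : StrictPseudofunctor T X} (e₁ : K.comp P = L.comp P)
    (e₂ : K.comp Q = L.comp Q) : K = L := by
  have ho : ∀ t, K.obj t = L.obj t := fun t => i.obj_inj _ _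
    (StrictPseudofunctor.obj_congr e₁ t) (StrictPseudofunctor.obj_congr e₂ t)
  have hm : ∀ {s t : T} (f : s ⟶ t), K.map f ≍ L.map f := by
    intro s t f
    have key : ∀ {x y x' y' : X} {k : x ⟶ y} {l : x' ⟶ y'}, x = x' → y = y' →
        P.map k ≍ P.map l → Q.map k ≍ Q.map l → k ≍ l := by
      rintro x y _ _ k l rfl rfl h h'
      exact heq_of_eq (i.map_inj _ _ (eq_of_heq h) (eq_of_heq h'))
    exact key (ho s) (ho t) (StrictPseudofunctor.map_congr e₁ f)
      (StrictPseudofunctor.map_congr e₂ f)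
  refine StrictPseudofunctor.ext_heq ho hm ?_
  intro s t f g α
  have key : ∀ {x y x' y' : X} {k l : x ⟶ y} {k' l' : x' ⟶ y'} {α : k ⟶ l} {β : k' ⟶ l'},
      x = x' → y = y' → k ≍ k' → l ≍ l' → P.map₂ α ≍ P.map₂ β → Q.map₂ α ≍ Q.map₂ β → α ≍ β := by
    rintro x y _ _ k l _ _ α β rfl rfl h h' e e'
    exact i.map₂_heq (eq_of_heq h) (eq_of_heq h') e e'
  exact key (ho s) (ho t) (hm f) (hm g) (StrictPseudofunctor.map₂_congr e₁ α)
    (StrictPseudofunctor.map₂_congr e₂ α)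

/-- Arbitrary compatible lifts of the cells form raw data over both `R` and `S`. By `Lifts` each law
holds after `P` and after `Q`, hence it holds; the resulting equations of 1-cells make the
whiskering laws meaningful as heterogeneous equations. -/
theorem exists_functor (i : IsTwoCatPullbackElementwise P Q F G) [Strict X] {T : Type o₄}
    [Bicategory.{w₄, v₄} T] [Strict T] (R : StrictPseudofunctor T Y) (S : StrictPseudofunctor T Z)
    (e : R.comp F = S.comp G) : ∃ K : StrictPseudofunctor T X, K.comp P = R ∧ K.comp Q = S := by
  choose ko h₁ h₂ using fun t => i.obj_surj (R.obj t) (S.obj t)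
    (StrictPseudofunctor.obj_congr e t)
  choose km h₃ h₄ using fun (s t : T) (f : s ⟶ t) => i.exists_map (h₁ s) (h₁ t) (h₂ s) (h₂ t)
    (StrictPseudofunctor.map_congr e f)
  choose kc h₅ h₆ using fun (s t : T) (f g : s ⟶ t) (α : f ⟶ g) =>
    i.exists_map₂ (h₁ s) (h₁ t) (h₂ s) (h₂ t) (h₃ s t f) (h₃ s t g) (h₄ s t f) (h₄ s t g)
      (StrictPseudofunctor.map₂_congr e α)
  have l : P.Lifts R ko (fun {s t} f => km s t f) (fun {s t f g} α => kc s t f g α) :=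
    ⟨h₁, fun {s t} f => h₃ s t f, fun {s t f g} α => h₅ s t f g α⟩
  have l' : Q.Lifts S ko (fun {s t} f => km s t f) (fun {s t f g} α => kc s t f g α) :=
    ⟨h₂, fun {s t} f => h₄ s t f, fun {s t f g} α => h₆ s t f g α⟩
  have hi : ∀ a, km a a (𝟙 a) = 𝟙 (ko a) := fun a => i.map_inj _ _ (l.map_id a) (l'.map_id a)
  have hk : ∀ {a b d} (f : a ⟶ b) (g : b ⟶ d), km a d (f ≫ g) = km a b f ≫ km b d g :=
    fun f g => i.map_inj _ _ (l.map_comp f g) (l'.map_comp f g)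
  refine ⟨TwoCatData.functor ko (fun {s t} f => km s t f) (fun {s t f g} α => kc s t f g α)
    (fun f => i.map₂_inj _ _ (l.map₂_id f) (l'.map₂_id f))
    (fun α β => i.map₂_inj _ _ (l.map₂_comp α β) (l'.map₂_comp α β)) hi hk
    (fun f _ _ α => i.map₂_heq (hk _ _) (hk _ _) (l.map₂_left f α) (l'.map₂_left f α))
    (fun α f => i.map₂_heq (hk _ _) (hk _ _) (l.map₂_right α f) (l'.map₂_right α f)), ?_, ?_⟩
  · exact StrictPseudofunctor.ext_heq l.obj l.map l.map₂
  · exact StrictPseudofunctor.ext_heq l'.obj l'.map l'.map₂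

/-- A strict 2-natural transformation is given by its 1-cells, so only these are lifted. Naturality
for 1-cells and for 2-cells holds after `P` and after `Q`, where it is that of `α` and of `β`. -/
theorem trans_existsUnique (i : IsTwoCatPullbackElementwise P Q F G) {T : Type o₄}
    [Bicategory.{w₄, v₄} T] (K L : StrictPseudofunctor T X)
    (α : TwoNatTrans (K.comp P) (L.comp P)) (β : TwoNatTrans (K.comp Q) (L.comp Q))
    (e : α.whisker F ≍ β.whisker G) :
    ∃! γ : TwoNatTrans K L, γ.whisker P = α ∧ γ.whisker Q = β := by
  -- Commutativity of the square identifies the boundaries of the two whiskered transformations,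
  -- whose components can then be compared.
  have hF : ∀ M : StrictPseudofunctor T X, (M.comp P).comp F = (M.comp Q).comp G := by
    intro M
    rw [StrictPseudofunctor.comp_assoc, StrictPseudofunctor.comp_assoc, i.comm]
  choose γ h₁ h₂ using fun t => i.map_surj (α.app t) (β.app t)
    (TwoNatTrans.app_heq (hF K) (hF L) e t)
  have hn : ∀ {s t : T} (f : s ⟶ t), K.map f ≫ γ t = γ s ≫ L.map f := by
    intro s t f
    refine i.map_inj _ _ ?_ ?_
    · rw [P.map_comp, P.map_comp, h₁, h₁]
      exact α.naturality f
    · rw [Q.map_comp, Q.map_comp, h₂, h₂]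
      exact β.naturality f
  refine ⟨⟨γ, hn, ?_⟩, ⟨TwoNatTrans.ext (funext h₁), TwoNatTrans.ext (funext h₂)⟩, ?_⟩
  · intro s t f g θ
    refine i.map₂_heq (hn f) (hn g) ?_ ?_
    · refine (P.map₂_right _ _).trans (HEq.trans ?_ (P.map₂_left _ _).symm)
      rw [h₁, h₁]
      exact α.naturality₂ θ
    · refine (Q.map₂_right _ _).trans (HEq.trans ?_ (Q.map₂_left _ _).symm)
      rw [h₂, h₂]
      exact β.naturality₂ θ
  · rintro δ ⟨rfl, rfl⟩
    exact TwoNatTrans.ext (funext fun t => i.map_inj _ _ (h₁ t).symm (h₂ t).symm)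

theorem isTwoCatPullback (i : IsTwoCatPullbackElementwise P Q F G) [Strict X] :
    IsTwoCatPullback.{_, _, _, _, _, _, _, _, o₄, v₄, _, _, _, _, w₄} P Q F G where
  comm := i.comm
  lift T _ _ R S e := by
    obtain ⟨K, rfl, rfl⟩ := i.exists_functor R S e
    exact ⟨K, ⟨rfl, rfl⟩, fun L hL => i.functor_inj hL.1 hL.2⟩
  lift₂ T _ _ K L α β e := i.trans_existsUnique K L α β e

end IsTwoCatPullbackElementwise

/-- A strict 2-functor which is bijective on objects, 1-cells and 2-cells is invertible. -/
theorem CategoryTheory.StrictPseudofunctor.exists_inverse {X : Type o} [Bicategory.{w, v} X] [Strict X]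
    {Y : Type o₁} [Bicategory.{w₁, v₁} Y] [Strict Y] (e : StrictPseudofunctor X Y)
    (ho : Function.Bijective e.obj)
    (hm : ∀ x x' : X, Function.Bijective (fun f : x ⟶ x' => e.map f))
    (hc : ∀ (x x' : X) (f g : x ⟶ x'), Function.Bijective (fun α : f ⟶ g => e.map₂ α)) :
    ∃ e' : StrictPseudofunctor Y X, e.comp e' = .id X ∧ e'.comp e = .id Y := by
  -- Bijectivity of `e` says that the square with two sides `e` and two identities satisfies the
  -- elementwise criterion. The inverse is the functor that this criterion induces from the pair of
  -- identities.
  have i : IsTwoCatPullbackElementwise e e (.id Y) (.id Y) :=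
    { comm := rfl
      obj_surj := by
        rintro y z rfl
        obtain ⟨x, rfl⟩ := ho.2 y
        exact ⟨x, rfl, rfl⟩
      obj_inj x x' h _ := ho.1 h
      map_surj := by
        intro x x' a b h
        obtain rfl := eq_of_heq h
        obtain ⟨f, rfl⟩ := (hm x x').2 a
        exact ⟨f, rfl, rfl⟩
      map_inj f g h _ := (hm _ _).1 h
      map₂_surj := by
        intro x x' f g a b h
        obtain rfl := eq_of_heq h
        obtain ⟨α, rfl⟩ := (hc x x' f g).2 a
        exact ⟨α, rfl, rfl⟩
      map₂_inj α β h _ := (hc _ _ _ _).1 h }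
  obtain ⟨e', h, _⟩ := i.exists_functor (.id Y) (.id Y) rfl
  -- The other composite is an identity because it becomes one after `e`, which is cancellable by
  -- uniqueness of lifts.
  have h' : (e.comp e').comp e = (StrictPseudofunctor.id X).comp e := by
    rw [StrictPseudofunctor.comp_assoc, h]
    exact StrictPseudofunctor.ext_heq (fun _ => rfl) (fun _ => HEq.rfl) (fun _ => HEq.rfl)
  exact ⟨e', i.functor_inj h' h', h⟩

end TwoCat

/-! ### Two-cells between morphisms of monads -/

namespace ModVDC

variable {A : VDC.{o, v, h, c}}

/-- The multiplication of a unit was obtained abstractly from opcartesianness. It is the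
multiplication of the monad, because both restrict along the unit of `T` to the identity. -/
theorem mu_eq (T : HMonad A) : (ModVDC A).mu T = T.bimod.lcell :=
  UVDC.ext_head (D := ModVDC A)
    ((UVDC.eta_mu (D := ModVDC A) T).trans (eta_lcell T.bimod).symm)

/-- Both cells restrict along the unit of `S` to the unit of `T` composed with `f`, and restriction
along an opcartesian cell is injective. -/
theorem om_eq {S T : HMonad A} (f : S ⟶ T) : (ModVDC A).om (X := S) (Y := T) f = f.mcell :=
  UVDC.flat_inj (D := ModVDC A) ((UVDC.flat_om (D := ModVDC A) f).trans (eta_mcell f))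

end ModVDC

namespace VCat

open Bicategory

variable {A : VDC.{o, v, h, c}}

/-- The nullary multicell given by a 2-cell between morphisms of monads. -/
noncomputable def nullCell {S T : VCat (ModVDC A)} {f g : S ⟶ T} (α : f ⟶ g) :
    A.Cell (.nil (HMonad.obj S)) (HMonadHom.hom f) (HMonadHom.hom g) (HMonad.hor T) :=
  ModCell.cell (UVDC.flat (D := ModVDC A) (X := S) α)

/-- A multicell out of a unit is determined by its restriction along the opcartesian unit cell. -/
theorem nullCell_inj {S T : VCat (ModVDC A)} {f g : S ⟶ T} {α β : f ⟶ g}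
    (e : nullCell α = nullCell β) : α = β :=
  UVDC.flat_inj (D := ModVDC A) (ModCell.ext e)

theorem nullCell_id {S T : VCat (ModVDC A)} (f : S ⟶ T) :
    nullCell (𝟙 f) = A.comp (.nil (HMonadHom.hom f)) (HMonad.unit T) (Category.comp_id _)
      (Category.comp_id _) :=
  congrArg ModCell.cell (UVDC.flat_om (D := ModVDC A) f)

theorem nullCell_comp {S T : VCat (ModVDC A)} {f g k : S ⟶ T} (α : f ⟶ g) (β : g ⟶ k) :
    nullCell (α ≫ β) = A.comp (.pair (r := .nil (HMonad.obj S)) (nullCell α) (nullCell β))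
      (HMonad.mul T) (Category.comp_id _) (Category.comp_id _) := by
  refine (congrArg ModCell.cell (UVDC.flat_vmul (D := ModVDC A) (X := S) α β)).trans ?_
  -- The abstract multiplication in the composite of 2-cells is exchanged for that of the monad.
  exact congrArg (fun m => ModCell.cell ((ModVDC A).comp (.pair (r := .nil (S : HMonad A))
    (UVDC.flat (D := ModVDC A) (X := S) α) (UVDC.flat (D := ModVDC A) (X := S) β)) m
    (Category.comp_id _) (Category.comp_id _))) (ModVDC.mu_eq (A := A) T)

theorem nullCell_whiskerLeft {S T R : VCat (ModVDC A)} (f : S ⟶ T) {g k : T ⟶ R} (α : g ⟶ k) :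
    nullCell (f ◁ α) = A.comp (.nil (HMonadHom.hom f)) (nullCell α) rfl rfl :=
  congrArg ModCell.cell (UVDC.flat_lwhisk (D := ModVDC A) f α)

theorem nullCell_whiskerRight {S T R : VCat (ModVDC A)} {f g : S ⟶ T} (α : f ⟶ g) (k : T ⟶ R) :
    nullCell (α ▷ k) = A.comp (.single (nullCell α)) (HMonadHom.cell k) rfl rfl := by
  refine (congrArg ModCell.cell (UVDC.flat_rwhisk (D := ModVDC A) (X := S) α k)).trans ?_
  exact congrArg (fun m => ModCell.cell ((ModVDC A).comp (.single
    (UVDC.flat (D := ModVDC A) (X := S) α)) m rfl rfl)) (ModVDC.om_eq (A := A) k)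

/-- For an empty top path the outer law of an equivariant multicell equates the left and the right
action through the two sides. With the target monad as bottom bimodule this is naturality. -/
theorem nullCell_naturality {S T : VCat (ModVDC A)} {f g : S ⟶ T} (α : f ⟶ g) :
    A.comp (.pair (r := .one (HMonad.hor S)) (HMonadHom.cell f) (nullCell α)) (HMonad.mul T)
        (Category.comp_id _) (Category.comp_id _) =
      A.comp (.pair (r := .one (HMonad.hor S)) (nullCell α) (HMonadHom.cell g)) (HMonad.mul T)
        (Category.comp_id _) (Category.comp_id _) :=
  ModCell.outer_nil (UVDC.flat (D := ModVDC A) (X := S) α)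

/-- Naturality is the only condition on a nullary multicell into a monad, as there are no inner
actions on an empty path. The equivariant multicell so obtained extends over the unit bimodule by
opcartesianness. -/
theorem exists_nullCell {S T : VCat (ModVDC A)} {f g : S ⟶ T}
    (θ : A.Cell (.nil (HMonad.obj S)) (HMonadHom.hom f) (HMonadHom.hom g) (HMonad.hor T))
    (e : A.comp (.pair (r := .one (HMonad.hor S)) (HMonadHom.cell f) θ) (HMonad.mul T)
        (Category.comp_id _) (Category.comp_id _) =
      A.comp (.pair (r := .one (HMonad.hor S)) θ (HMonadHom.cell g)) (HMonad.mul T)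
        (Category.comp_id _) (Category.comp_id _)) : ∃ α : f ⟶ g, nullCell α = θ := by
  obtain ⟨α, hα, _⟩ := (ModVDC A).opcart S (.nil (S : HMonad A)) (.nil (S : HMonad A)) f g
    (HMonad.bimod T) (ModCell.mk θ (fun _ _ _ i => by cases i) e)
  exact ⟨α, congrArg ModCell.cell hα⟩

end VCat

/-! ### Multicells of matrices -/

section Matrices

variable {A : VDC.{o, v, h, c}}

/-- Multicells of matrices are determined by their multicells in `A`. -/
theorem matCell_ext {X Y Z W : FamObj.{o, v, h, c, u} A} {p : HPath (matSys A).H X Y} {f : X ⟶ Z}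
    {g : Y ⟶ W} {Γ : (matSys A).H Z W} {θ θ' : (matSys A).Cell p f g Γ}
    (e : ∀ ⦃i : (matSys A).ind.idx X⦄ ⦃j : (matSys A).ind.idx Y⦄ (s : Elt (matSys A).ind p i j),
      θ.cell s = θ'.cell s) : θ = θ' := by
  obtain ⟨m, k⟩ := θ
  obtain ⟨m', k'⟩ := θ'
  obtain rfl : m = m' := funext fun i => funext fun j => funext fun s => PUnit.ext _ _
  congr 1
  funext i j s
  exact e s

/-- Heterogeneous because the sides of the composite are prescribed up to equations in the category
of families, whereas the right side has literal composites in `A` as its sides. -/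
theorem matCell_comp {B C D E F G : FamObj.{o, v, h, c, u} A} {p : HPath (matSys A).H B C}
    {f : B ⟶ D} {g : C ⟶ E} {q : HPath (matSys A).H D E} {f' : D ⟶ F} {g' : E ⟶ G}
    {Γ : (matSys A).H F G} {a : B ⟶ F} {b : C ⟶ G}
    (Θ : Sq (matSys A).Cell p f g q) (θ : (matSys A).Cell q f' g' Γ) (hu : f ≫ f' = a)
    (hv : g ≫ g' = b) {i : (matSys A).ind.idx B} {j : (matSys A).ind.idx C}
    (s : Elt (matSys A).ind p i j) :
    ((matSys A).comp Θ θ hu hv).cell s ≍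
      A.comp ((matSys A).runCell Θ s) (θ.cell ((matSys A).run Θ s)) rfl rfl := by
  subst hu hv; rfl

end Matrices

/-! ### Multicells of matrices with short top paths -/

namespace MatCell

variable {A : VDC.{o, v, h, c}} {X Y Z W V : FamObj.{o, v, h, c, u} A}

/-- The elements of a path consisting of one matrix. -/
abbrev elt₁ (Δ : (matSys A).H X Y) (x : X.idx) (y : Y.idx) :
    Elt (matSys A).ind (.one Δ) (x : (matSys A).ind.idx X) (y : (matSys A).ind.idx Y) :=
  .cons PUnit.unit (.nil _)

/-- The elements of a path consisting of two matrices. -/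
abbrev elt₂ (Δ : (matSys A).H X Y) (Δ' : (matSys A).H Y V) (x : X.idx) (y : Y.idx) (z : V.idx) :
    Elt (matSys A).ind (.cons Δ (.one Δ')) (x : (matSys A).ind.idx X)
      (z : (matSys A).ind.idx V) := .cons PUnit.unit (elt₁ Δ' y z)

/-- The elements of a path consisting of three matrices. -/
abbrev elt₃ (Δ : (matSys A).H X Y) (Δ' : (matSys A).H Y V) (Δ'' : (matSys A).H V W) (x : X.idx)
    (y : Y.idx) (z : V.idx) (t : W.idx) :
    Elt (matSys A).ind (.cons Δ (.cons Δ' (.one Δ''))) (x : (matSys A).ind.idx X)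
      (t : (matSys A).ind.idx W) := .cons PUnit.unit (elt₂ Δ' Δ'' y z t)

/-- The entries of a nullary multicell of matrices. -/
def at₀ {f : X ⟶ Z} {g : X ⟶ W} {Γ : (matSys A).H Z W} (θ : (matSys A).Cell (.nil X) f g Γ)
    (x : X.idx) : A.Cell (.nil (X.obj x)) (f.hom x) (g.hom x) (Γ (f.map x) (g.map x)) :=
  θ.cell (.nil (D := (matSys A).ind) x)

/-- The entries of a unary multicell of matrices. -/
def at₁ {f : X ⟶ Z} {g : Y ⟶ W} {Δ : (matSys A).H X Y} {Γ : (matSys A).H Z W}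
    (θ : (matSys A).Cell (.one Δ) f g Γ) (x : X.idx) (y : Y.idx) :
    A.Cell (.one (Δ x y)) (f.hom x) (g.hom y) (Γ (f.map x) (g.map y)) :=
  θ.cell (elt₁ Δ x y)

/-- The entries of a binary multicell of matrices. -/
def at₂ {f : X ⟶ Z} {g : V ⟶ W} {Δ : (matSys A).H X Y} {Δ' : (matSys A).H Y V}
    {Γ : (matSys A).H Z W} (θ : (matSys A).Cell (.cons Δ (.one Δ')) f g Γ) (x : X.idx) (y : Y.idx)
    (z : V.idx) : A.Cell (.cons (Δ x y) (.one (Δ' y z))) (f.hom x) (g.hom z)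
      (Γ (f.map x) (g.map z)) :=
  θ.cell (elt₂ Δ Δ' x y z)

/-- The entries of a ternary multicell of matrices. -/
def at₃ {X' : FamObj.{o, v, h, c, u} A} {f : X ⟶ X'} {g : W ⟶ Z} {Δ : (matSys A).H X Y}
    {Δ' : (matSys A).H Y V} {Δ'' : (matSys A).H V W} {Γ : (matSys A).H X' Z}
    (θ : (matSys A).Cell (.cons Δ (.cons Δ' (.one Δ''))) f g Γ) (x : X.idx) (y : Y.idx) (z : V.idx)
    (t : W.idx) : A.Cell (.cons (Δ x y) (.cons (Δ' y z) (.one (Δ'' z t)))) (f.hom x) (g.hom t)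
      (Γ (f.map x) (g.map t)) :=
  θ.cell (elt₃ Δ Δ' Δ'' x y z t)

/-- The nullary multicell of matrices with given entries. -/
def mk₀ {f : X ⟶ Z} {g : X ⟶ W} {Γ : (matSys A).H Z W}
    (k : ∀ x : X.idx, A.Cell (.nil (X.obj x)) (f.hom x) (g.hom x) (Γ (f.map x) (g.map x))) :
    (matSys A).Cell (.nil X) f g Γ where
  map _ _ _ := PUnit.unit
  cell | _, _, .nil x => k x

/-- The unary multicell of matrices with given entries. -/
def mk₁ {f : X ⟶ Z} {g : Y ⟶ W} {Δ : (matSys A).H X Y} {Γ : (matSys A).H Z W}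
    (k : ∀ x y, A.Cell (.one (Δ x y)) (f.hom x) (g.hom y) (Γ (f.map x) (g.map y))) :
    (matSys A).Cell (.one Δ) f g Γ where
  map _ _ _ := PUnit.unit
  cell | x, _, .cons _ (.nil y) => k x y

/-- The binary multicell of matrices with given entries. -/
def mk₂ {f : X ⟶ Z} {g : V ⟶ W} {Δ : (matSys A).H X Y} {Δ' : (matSys A).H Y V}
    {Γ : (matSys A).H Z W} (k : ∀ x y z, A.Cell (.cons (Δ x y) (.one (Δ' y z))) (f.hom x) (g.hom z)
      (Γ (f.map x) (g.map z))) : (matSys A).Cell (.cons Δ (.one Δ')) f g Γ where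
  map _ _ _ := PUnit.unit
  cell | x, _, .cons (j := y) _ (.cons _ (.nil z)) => k x y z

theorem ext₀ {f : X ⟶ Z} {g : X ⟶ W} {Γ : (matSys A).H Z W}
    {θ θ' : (matSys A).Cell (.nil X) f g Γ} : θ = θ' ↔ ∀ x, at₀ θ x = at₀ θ' x := by
  refine ⟨fun e _ => by rw [e], fun e => matCell_ext ?_⟩
  rintro _ _ (_ | _)
  exact e _

theorem ext₁ {f : X ⟶ Z} {g : Y ⟶ W} {Δ : (matSys A).H X Y} {Γ : (matSys A).H Z W}
    {θ θ' : (matSys A).Cell (.one Δ) f g Γ} : θ = θ' ↔ ∀ x y, at₁ θ x y = at₁ θ' x y := by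
  refine ⟨fun e _ _ => by rw [e], fun e => matCell_ext ?_⟩
  rintro _ _ (_ | ⟨_, _ | _⟩)
  exact e _ _

theorem ext₂ {f : X ⟶ Z} {g : V ⟶ W} {Δ : (matSys A).H X Y} {Δ' : (matSys A).H Y V}
    {Γ : (matSys A).H Z W} {θ θ' : (matSys A).Cell (.cons Δ (.one Δ')) f g Γ} :
    θ = θ' ↔ ∀ x y z, at₂ θ x y z = at₂ θ' x y z := by
  refine ⟨fun e _ _ _ => by rw [e], fun e => matCell_ext ?_⟩
  rintro _ _ (_ | ⟨_, _ | ⟨_, _ | _⟩⟩)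
  exact e _ _ _

/-- An equation between composites of matrices is an equation between composites in `A`, when the
composite vertical morphisms have the same underlying functions. -/
theorem comp_cell_eq {B C D E F G : FamObj.{o, v, h, c, u} A} {p : HPath (matSys A).H B C}
    {f : B ⟶ D} {g : C ⟶ E} {q : HPath (matSys A).H D E} {f' : D ⟶ F} {g' : E ⟶ G}
    {Γ : (matSys A).H F G} {a : B ⟶ F} {b : C ⟶ G}
    (Θ : Sq (matSys A).Cell p f g q) (θ : (matSys A).Cell q f' g' Γ) (hu : f ≫ f' = a)
    (hv : g ≫ g' = b) {i : (matSys A).ind.idx B} {j : (matSys A).ind.idx C}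
    (s : Elt (matSys A).ind p i j) {κ : A.Cell ((matSys A).path s) (a.hom i) (b.hom j)
      (Γ (a.map i) (b.map j))}
    (e : A.comp ((matSys A).runCell Θ s) (θ.cell ((matSys A).run Θ s)) rfl rfl ≍ κ) :
    ((matSys A).comp Θ θ hu hv).cell s = κ :=
  eq_of_heq ((matCell_comp Θ θ hu hv s).trans e)


section Monad

variable {k : (matSys A).H X X} (η : (matSys A).Cell (.nil X) (𝟙 X) (𝟙 X) k)
  (μ : (matSys A).Cell (.cons k (.one k)) (𝟙 X) (𝟙 X) k)

/-- Evaluating the law of matrices at a pair of indices gives the law in `A`: at a concrete sequence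
of indices the action of a chain reduces by computation, and only the presentation of the outer
sides has to be adjusted. The other equivalences below rest on the same computation. -/
theorem unit_mul_iff :
    (MatVDC A).comp (.pair (r := .one k) η ((MatVDC A).ident k)) μ (Category.id_comp (𝟙 X))
      (Category.id_comp (𝟙 X)) = (MatVDC A).ident k ↔
    ∀ x y, A.comp (.pair (r := .one (k x y)) (at₀ η x) (A.ident (k x y))) (at₂ μ x x y)
      (Category.id_comp _) (Category.id_comp _) = A.ident (k x y) := by
  refine ext₁.trans (forall_congr' fun x => forall_congr' fun y => ?_)
  refine Eq.congr (comp_cell_eq _ _ _ _ (elt₁ k x y) ?_) rfl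
  exact VDC.comp_heq rfl rfl HEq.rfl HEq.rfl _ _ _ _

theorem mul_unit_iff :
    (MatVDC A).comp (.pair (r := .one k) ((MatVDC A).ident k) η) μ (Category.id_comp (𝟙 X))
      (Category.id_comp (𝟙 X)) = (MatVDC A).ident k ↔
    ∀ x y, A.comp (.pair (r := .one (k x y)) (A.ident (k x y)) (at₀ η y)) (at₂ μ x y y)
      (Category.id_comp _) (Category.id_comp _) = A.ident (k x y) := by
  refine ext₁.trans (forall_congr' fun x => forall_congr' fun y => ?_)
  refine Eq.congr (comp_cell_eq _ _ _ _ (elt₁ k x y) ?_) rfl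
  exact VDC.comp_heq rfl rfl HEq.rfl HEq.rfl _ _ _ _

theorem assoc_iff :
    (MatVDC A).comp (.pair (r := .cons k (.cons k (.one k))) μ ((MatVDC A).ident k)) μ
        (Category.id_comp (𝟙 X)) (Category.id_comp (𝟙 X)) =
      (MatVDC A).comp (.pair (r := .cons k (.cons k (.one k))) ((MatVDC A).ident k) μ) μ
        (Category.id_comp (𝟙 X)) (Category.id_comp (𝟙 X)) ↔
    ∀ x y z t, A.comp (.pair (r := .cons (k x y) (.cons (k y z) (.one (k z t)))) (at₂ μ x y z)
        (A.ident (k z t))) (at₂ μ x z t) (Category.id_comp _) (Category.id_comp _) =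
      A.comp (.pair (r := .cons (k x y) (.cons (k y z) (.one (k z t)))) (A.ident (k x y))
        (at₂ μ y z t)) (at₂ μ x y t) (Category.id_comp _) (Category.id_comp _) := by
  have e₁ := fun x y z t => comp_cell_eq (.pair (r := .cons k (.cons k (.one k))) μ
    ((MatVDC A).ident k)) μ (Category.id_comp (𝟙 X)) (Category.id_comp (𝟙 X))
    (elt₃ k k k x y z t)
    (κ := A.comp (.pair (r := .cons (k x y) (.cons (k y z) (.one (k z t)))) (at₂ μ x y z)
        (A.ident (k z t))) (at₂ μ x z t) (Category.id_comp _) (Category.id_comp _))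
    (VDC.comp_heq rfl rfl HEq.rfl HEq.rfl _ _ _ _)
  have e₂ := fun x y z t => comp_cell_eq (.pair (r := .cons k (.cons k (.one k)))
    ((MatVDC A).ident k) μ) μ (Category.id_comp (𝟙 X)) (Category.id_comp (𝟙 X))
    (elt₃ k k k x y z t)
    (κ := A.comp (.pair (r := .cons (k x y) (.cons (k y z) (.one (k z t)))) (A.ident (k x y))
        (at₂ μ y z t)) (at₂ μ x y t) (Category.id_comp _) (Category.id_comp _))
    (VDC.comp_heq rfl rfl HEq.rfl HEq.rfl _ _ _ _)
  -- Both ternary composites have been computed at every sequence of four indices; an element of a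
  -- path of three matrices is exactly such a sequence.
  refine ⟨fun e x y z t => ?_, fun e => matCell_ext ?_⟩
  · refine (e₁ x y z t).symm.trans (Eq.trans ?_ (e₂ x y z t))
    exact congrArg (fun θ => at₃ θ x y z t) e
  · rintro _ _ (_ | ⟨_, _ | ⟨_, _ | ⟨_, _ | _⟩⟩⟩)
    exact (e₁ _ _ _ _).trans ((e _ _ _ _).trans (e₂ _ _ _ _).symm)

end Monad

section Hom

variable {k : (matSys A).H X X} {l : (matSys A).H Y Y} (f : X ⟶ Y)
  (φ : (matSys A).Cell (.one k) f f l)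

theorem map_unit_iff (η : (matSys A).Cell (.nil X) (𝟙 X) (𝟙 X) k)
    (ε : (matSys A).Cell (.nil Y) (𝟙 Y) (𝟙 Y) l) :
    (MatVDC A).comp (.nil f) ε (Category.comp_id f) (Category.comp_id f) =
      (MatVDC A).comp (.single η) φ (Category.id_comp f) (Category.id_comp f) ↔
    ∀ x, A.comp (.nil (f.hom x)) (at₀ ε (f.map x)) (Category.comp_id _) (Category.comp_id _) =
      A.comp (.single (at₀ η x)) (at₁ φ x x) (Category.id_comp _) (Category.id_comp _) := by
  refine ext₀.trans (forall_congr' fun x => ?_)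
  refine Eq.congr (comp_cell_eq _ _ _ _ (.nil (D := (matSys A).ind) x) ?_) (comp_cell_eq _ _ _ _ (.nil (D := (matSys A).ind) x) ?_)
  · exact VDC.comp_heq rfl rfl HEq.rfl HEq.rfl _ _ _ _
  · exact VDC.comp_heq rfl rfl HEq.rfl HEq.rfl _ _ _ _

theorem map_mul_iff (μ : (matSys A).Cell (.cons k (.one k)) (𝟙 X) (𝟙 X) k)
    (ν : (matSys A).Cell (.cons l (.one l)) (𝟙 Y) (𝟙 Y) l) :
    (MatVDC A).comp (.pair (r := .cons k (.one k)) φ φ) ν (Category.comp_id f)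
        (Category.comp_id f) =
      (MatVDC A).comp (.single μ) φ (Category.id_comp f) (Category.id_comp f) ↔
    ∀ x y z, A.comp (.pair (r := .cons (k x y) (.one (k y z))) (at₁ φ x y) (at₁ φ y z))
        (at₂ ν (f.map x) (f.map y) (f.map z)) (Category.comp_id _) (Category.comp_id _) =
      A.comp (.single (at₂ μ x y z)) (at₁ φ x z) (Category.id_comp _) (Category.id_comp _) := by
  refine ext₂.trans (forall_congr' fun x => forall_congr' fun y => forall_congr' fun z => ?_)
  refine Eq.congr (comp_cell_eq _ _ _ _ (elt₂ k k x y z) ?_)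
    (comp_cell_eq _ _ _ _ (elt₂ k k x y z) ?_)
  · exact VDC.comp_heq rfl rfl HEq.rfl HEq.rfl _ _ _ _
  · exact VDC.comp_heq rfl rfl HEq.rfl HEq.rfl _ _ _ _

/-- The equation is oriented as the outer law of nullary multicells, with the cell of the source
functor first. Naturality of enriched transformations is written the other way round, so it is
reversed where the two meet. -/
theorem naturality_iff (g : X ⟶ Y) (ψ : (matSys A).Cell (.one k) g g l)
    (ν : (matSys A).Cell (.cons l (.one l)) (𝟙 Y) (𝟙 Y) l) (θ : (matSys A).Cell (.nil X) f g l) :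
    (MatVDC A).comp (.pair (r := .one k) φ θ) ν (Category.comp_id f) (Category.comp_id g) =
      (MatVDC A).comp (.pair (r := .one k) θ ψ) ν (Category.comp_id f) (Category.comp_id g) ↔
    ∀ x y, A.comp (.pair (r := .one (k x y)) (at₁ φ x y) (at₀ θ y))
        (at₂ ν (f.map x) (f.map y) (g.map y)) (Category.comp_id _) (Category.comp_id _) =
      A.comp (.pair (r := .one (k x y)) (at₀ θ x) (at₁ ψ x y))
        (at₂ ν (f.map x) (g.map x) (g.map y)) (Category.comp_id _) (Category.comp_id _) := by
  refine ext₁.trans (forall_congr' fun x => forall_congr' fun y => ?_)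
  refine Eq.congr (comp_cell_eq _ _ _ _ (elt₁ k x y) ?_) (comp_cell_eq _ _ _ _ (elt₁ k x y) ?_)
  · exact VDC.comp_heq rfl rfl HEq.rfl HEq.rfl _ _ _ _
  · exact VDC.comp_heq rfl rfl HEq.rfl HEq.rfl _ _ _ _

end Hom

end MatCell

/-! ### Enriched categories as monads of matrices -/

namespace ACat

variable {A : VDC.{o, v, h, c}}

open Bicategory

/-- The monad of matrices given by an enriched category. -/
def toMonad (C : ACat.{o, v, h, c, u} A) : HMonad (MatVDC.{o, v, h, c, u} A) where
  obj := (⟨C.ob, C.extent⟩ : FamObj.{o, v, h, c, u} A)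
  hor := C.hom
  unit := MatCell.mk₀ (X := ⟨C.ob, C.extent⟩) C.unit
  mul := MatCell.mk₂ (X := ⟨C.ob, C.extent⟩) C.mul
  unit_mul := (MatCell.unit_mul_iff _ _).2 C.unit_mul
  mul_unit := (MatCell.mul_unit_iff _ _).2 C.mul_unit
  assoc := (MatCell.assoc_iff _).2 C.assoc

/-- The enriched category given by a monad of matrices. -/
def ofMonad (M : HMonad (MatVDC.{o, v, h, c, u} A)) : ACat.{o, v, h, c, u} A where
  ob := FamObj.idx M.obj
  extent := FamObj.obj M.obj
  hom := M.hor
  unit := MatCell.at₀ M.unit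
  mul := MatCell.at₂ M.mul
  unit_mul := (MatCell.unit_mul_iff _ _).1 M.unit_mul
  mul_unit := (MatCell.mul_unit_iff _ _).1 M.mul_unit
  assoc := (MatCell.assoc_iff _).1 M.assoc

/-- Only the unit and the multiplication need an argument: multicells rebuilt from their entries
agree with the original ones by extensionality. -/
theorem toMonad_ofMonad (M : HMonad (MatVDC.{o, v, h, c, u} A)) : toMonad (ofMonad M) = M :=
  HMonad.ext_heq rfl HEq.rfl (heq_of_eq (MatCell.ext₀.2 fun _ => rfl))
    (heq_of_eq (MatCell.ext₂.2 fun _ _ _ => rfl))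

/-- The morphism of monads given by an enriched functor. -/
def toMonadHom {C D : ACat.{o, v, h, c, u} A} (f : AFunctor C D) : toMonad C ⟶ toMonad D :=
  HMonadHom.mk (S := toMonad C) (T := toMonad D) (FamHom.mk f.obj f.vert)
    (MatCell.mk₁ (X := ⟨C.ob, C.extent⟩) (Y := ⟨C.ob, C.extent⟩) f.cell)
    ((MatCell.map_unit_iff _ _ _ _).2 fun x => (f.map_unit x).symm)
    ((MatCell.map_mul_iff _ _ _ _).2 fun x y z => (f.map_mul x y z).symm)

/-- The enriched functor given by a morphism of monads. -/
def ofMonadHom {C D : ACat.{o, v, h, c, u} A} (f : HMonadHom (toMonad C) (toMonad D)) :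
    AFunctor C D where
  obj := FamHom.map f.hom
  vert := FamHom.hom f.hom
  cell := MatCell.at₁ f.cell
  map_unit x := ((MatCell.map_unit_iff _ _ _ _).1 f.map_unit x).symm
  map_mul x y z := ((MatCell.map_mul_iff _ _ _ _).1 f.map_mul x y z).symm

theorem toMonadHom_ofMonadHom {C D : ACat.{o, v, h, c, u} A}
    (f : HMonadHom (toMonad C) (toMonad D)) : toMonadHom (ofMonadHom f) = f :=
  HMonadHom.ext rfl (heq_of_eq (MatCell.ext₁.2 fun _ _ => rfl))

theorem toMonadHom_id (C : ACat.{o, v, h, c, u} A) :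
    toMonadHom (AFunctor.id C) = 𝟙 (toMonad C) :=
  HMonadHom.ext rfl (heq_of_eq (MatCell.ext₁.2 fun _ _ => rfl))

/-- The function on objects and the vertical morphisms compose definitionally; the cell of the
composite is computed entry by entry. -/
theorem toMonadHom_comp {C D E : ACat.{o, v, h, c, u} A} (f : AFunctor C D) (g : AFunctor D E) :
    toMonadHom (f.comp g) = toMonadHom f ≫ toMonadHom g :=
  HMonadHom.ext rfl (heq_of_eq (MatCell.ext₁.2 fun x y => (MatCell.comp_cell_eq
    (.single (HMonadHom.cell (toMonadHom f))) (HMonadHom.cell (toMonadHom g)) rfl rfl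
    (MatCell.elt₁ (X := ⟨C.ob, C.extent⟩) (Y := ⟨C.ob, C.extent⟩) C.hom x y) (VDC.comp_heq rfl rfl HEq.rfl HEq.rfl _ _ _ _)).symm))

/-- The 2-category of monads of matrices. -/
abbrev Mon (A : VDC.{o, v, h, c}) := VCat (ProfVDC.{o, v, h, c, u} A)

/-- An enriched category, as an object of the 2-category of monads of matrices. -/
abbrev toMon (C : ACat.{o, v, h, c, u} A) : Mon.{o, v, h, c, u} A := toMonad C

/-- An enriched functor, as a 1-cell of the 2-category of monads of matrices. -/
abbrev toMor {C D : ACat.{o, v, h, c, u} A} (f : AFunctor C D) : toMon C ⟶ toMon D := toMonadHom f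

/-- The components of an enriched transformation form a nullary multicell of matrices, and enriched
naturality is exactly the condition for it to come from a 2-cell. -/
theorem exists_toCell {C D : ACat.{o, v, h, c, u} A} {f g : AFunctor C D} (α : ANatTrans f g) :
    ∃ β : toMor f ⟶ toMor g, VCat.nullCell β = MatCell.mk₀ (X := ⟨C.ob, C.extent⟩)
      (Z := ⟨D.ob, D.extent⟩) (W := ⟨D.ob, D.extent⟩) (f := ⟨f.obj, f.vert⟩) (g := ⟨g.obj, g.vert⟩)
      (Γ := D.hom) α.app :=
  VCat.exists_nullCell (S := toMon C) _
    ((MatCell.naturality_iff _ _ _ _ _ _).2 fun x y => (α.naturality x y).symm)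

/-- The 2-cell between morphisms of monads given by an enriched natural transformation. -/
noncomputable def toCell {C D : ACat.{o, v, h, c, u} A} {f g : AFunctor C D} (α : ANatTrans f g) :
    toMor f ⟶ toMor g :=
  (exists_toCell α).choose

/-- The entries of a 2-cell between morphisms of monads of matrices. -/
noncomputable def entry {C D : ACat.{o, v, h, c, u} A} {f g : toMon C ⟶ toMon D} (α : f ⟶ g)
    (x : C.ob) : A.Cell (.nil (C.extent x)) (FamHom.hom (HMonadHom.hom f) x)
      (FamHom.hom (HMonadHom.hom g) x)
      (D.hom (FamHom.map (HMonadHom.hom f) x) (FamHom.map (HMonadHom.hom g) x)) :=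
  MatCell.at₀ (VCat.nullCell α) x

theorem entry_toCell {C D : ACat.{o, v, h, c, u} A} {f g : AFunctor C D} (α : ANatTrans f g)
    (x : C.ob) : entry (toCell α) x = α.app x :=
  MatCell.ext₀.1 (exists_toCell α).choose_spec x

/-- A 2-cell is determined by its nullary multicell, and a nullary multicell of matrices by its
entries. -/
theorem entry_ext {C D : ACat.{o, v, h, c, u} A} {f g : toMon C ⟶ toMon D} {α β : f ⟶ g}
    (e : ∀ x, entry α x = entry β x) : α = β :=
  VCat.nullCell_inj (MatCell.ext₀.2 e)

theorem entry_heq {C D : ACat.{o, v, h, c, u} A} {f g f' g' : toMon C ⟶ toMon D} {α : f ⟶ g}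
    {β : f' ⟶ g'} (hf : f = f') (hg : g = g') (e : ∀ x, entry α x ≍ entry β x) : α ≍ β := by
  subst hf hg
  exact heq_of_eq (entry_ext fun x => eq_of_heq (e x))

/-- With the three formulas that follow, this shows that the operations on 2-cells act on entries by
the formulas defining the operations on enriched transformations. Each is the corresponding formula
for `VCat.nullCell`, read at one index. -/
theorem entry_id {C D : ACat.{o, v, h, c, u} A} (f : toMon C ⟶ toMon D) (x : C.ob) :
    entry (𝟙 f) x = A.comp (.nil (FamHom.hom (HMonadHom.hom f) x))
      (D.unit (FamHom.map (HMonadHom.hom f) x)) (Category.comp_id _) (Category.comp_id _) := by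
  refine (MatCell.ext₀.1 (VCat.nullCell_id f) x).trans (MatCell.comp_cell_eq _ _ _ _
    (.nil (D := (matSys A).ind) (X := ⟨C.ob, C.extent⟩) x) ?_)
  exact VDC.comp_heq rfl rfl HEq.rfl HEq.rfl _ _ _ _

theorem entry_comp {C D : ACat.{o, v, h, c, u} A} {f g k : toMon C ⟶ toMon D} (α : f ⟶ g)
    (β : g ⟶ k) (x : C.ob) : entry (α ≫ β) x = A.comp (.pair (r := .nil (C.extent x)) (entry α x)
      (entry β x)) (D.mul _ _ _) (Category.comp_id _) (Category.comp_id _) := by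
  refine (MatCell.ext₀.1 (VCat.nullCell_comp α β) x).trans (MatCell.comp_cell_eq _ _ _ _
    (.nil (D := (matSys A).ind) (X := ⟨C.ob, C.extent⟩) x) ?_)
  exact VDC.comp_heq rfl rfl HEq.rfl HEq.rfl _ _ _ _

theorem entry_whiskerLeft {C D E : ACat.{o, v, h, c, u} A} (f : toMon C ⟶ toMon D)
    {g k : toMon D ⟶ toMon E} (α : g ⟶ k) (x : C.ob) :
    entry (C := C) (D := E) (f ◁ α) x = A.comp (.nil (FamHom.hom (HMonadHom.hom f) x))
      (entry α (FamHom.map (HMonadHom.hom f) x)) rfl rfl := by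
  refine (MatCell.ext₀.1 (VCat.nullCell_whiskerLeft f α) x).trans (MatCell.comp_cell_eq
    (B := ⟨C.ob, C.extent⟩) (D := ⟨D.ob, D.extent⟩) (F := ⟨E.ob, E.extent⟩) (G := ⟨E.ob, E.extent⟩)
    (Γ := E.hom) (.nil (HMonadHom.hom f)) (VCat.nullCell α) rfl rfl
    (.nil (D := (matSys A).ind) (X := ⟨C.ob, C.extent⟩) x) ?_)
  exact VDC.comp_heq rfl rfl HEq.rfl HEq.rfl _ _ _ _

theorem entry_whiskerRight {C D E : ACat.{o, v, h, c, u} A} {f g : toMon C ⟶ toMon D} (α : f ⟶ g)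
    (k : toMon D ⟶ toMon E) (x : C.ob) :
    entry (C := C) (D := E) (α ▷ k) x = A.comp (.single (entry α x))
      (MatCell.at₁ (HMonadHom.cell k) (FamHom.map (HMonadHom.hom f) x)
        (FamHom.map (HMonadHom.hom g) x)) rfl rfl := by
  refine (MatCell.ext₀.1 (VCat.nullCell_whiskerRight α k) x).trans (MatCell.comp_cell_eq
    (B := ⟨C.ob, C.extent⟩) (D := ⟨D.ob, D.extent⟩) (F := ⟨E.ob, E.extent⟩) (G := ⟨E.ob, E.extent⟩)
    (Γ := E.hom) (.single (VCat.nullCell α)) (HMonadHom.cell k) rfl rfl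
    (.nil (D := (matSys A).ind) (X := ⟨C.ob, C.extent⟩) x) ?_)
  exact VDC.comp_heq rfl rfl HEq.rfl HEq.rfl _ _ _ _

/-- The entries of a 2-cell are natural because its nullary multicell is, and they determine the
2-cell. -/
theorem toCell_surjective {C D : ACat.{o, v, h, c, u} A} {f g : AFunctor C D}
    (β : toMor f ⟶ toMor g) : ∃ α : ANatTrans f g, toCell α = β := by
  refine ⟨⟨entry β, fun x y => ?_⟩, entry_ext fun x => entry_toCell _ x⟩
  exact ((MatCell.naturality_iff _ _ _ _ _ _).1 (VCat.nullCell_naturality β) x y).symm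

end ACat

open Bicategory in
/-- The 2-functor sending an enriched category to its monad of matrices. -/
noncomputable def ACat.monadFunctor (A : VDC.{o, v, h, c}) :
    StrictPseudofunctor (ACat.{o, v, h, c, u} A) (VCat (ProfVDC.{o, v, h, c, u} A)) :=
  TwoCatData.functor (B := ACat.{o, v, h, c, u} A) (C := VCat (ProfVDC.{o, v, h, c, u} A))
    (fun C => ACat.toMon C)
    (fun {C D : ACat.{o, v, h, c, u} A} (f : AFunctor C D) => ACat.toMor f)
    (fun {C D : ACat.{o, v, h, c, u} A} {f g : AFunctor C D} (α : ANatTrans f g) => ACat.toCell α)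
    (fun {C D : ACat.{o, v, h, c, u} A} (f : AFunctor C D) => ACat.entry_ext fun x =>
      (ACat.entry_toCell (ANatTrans.id f) x).trans (ACat.entry_id (ACat.toMor f) x).symm)
    (fun {C D : ACat.{o, v, h, c, u} A} {f g k : AFunctor C D} (α : ANatTrans f g)
      (β : ANatTrans g k) => ACat.entry_ext fun x => by
        refine (ACat.entry_toCell (ANatTrans.vcomp α β) x).trans
          (Eq.trans ?_ (ACat.entry_comp (ACat.toCell α) (ACat.toCell β) x).symm)
        rw [ACat.entry_toCell, ACat.entry_toCell]
        rfl)
    (fun C => ACat.toMonadHom_id C)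
    (fun {C D E : ACat.{o, v, h, c, u} A} (f : AFunctor C D) (g : AFunctor D E) =>
      ACat.toMonadHom_comp f g)
    (fun {C D E : ACat.{o, v, h, c, u} A} (f : AFunctor C D) {g k : AFunctor D E}
      (α : ANatTrans g k) => by
        refine ACat.entry_heq (C := C) (D := E) (ACat.toMonadHom_comp f g)
          (ACat.toMonadHom_comp f k) fun x => heq_of_eq ?_
        refine (ACat.entry_toCell (ANatTrans.left f α) x).trans
          (Eq.trans ?_ (ACat.entry_whiskerLeft (ACat.toMor f) (ACat.toCell α) x).symm)
        exact congrArg (fun θ => A.comp (.nil (f.vert x)) θ rfl rfl)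
          (ACat.entry_toCell α (f.obj x)).symm)
    (fun {C D E : ACat.{o, v, h, c, u} A} {f g : AFunctor C D} (α : ANatTrans f g)
      (k : AFunctor D E) => by
        refine ACat.entry_heq (C := C) (D := E) (ACat.toMonadHom_comp f k)
          (ACat.toMonadHom_comp g k) fun x => heq_of_eq ?_
        refine (ACat.entry_toCell (ANatTrans.right α k) x).trans
          (Eq.trans ?_ (ACat.entry_whiskerRight (ACat.toCell α) (ACat.toMor k) x).symm)
        rw [ACat.entry_toCell]
        rfl)

namespace ACat

variable (A : VDC.{o, v, h, c})

theorem monadFunctor_obj_bijective :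
    Function.Bijective (monadFunctor.{o, v, h, c, u} A).obj := by
  refine ⟨fun C D e => ?_, fun M => ⟨ofMonad M, toMonad_ofMonad M⟩⟩
  -- Reading off the entries of the monad of an enriched category returns that category
  -- definitionally, so `ofMonad` cancels `toMonad`.
  exact congrArg (fun M : HMonad (MatVDC A) => ofMonad M) e

theorem monadFunctor_map_bijective (C D : ACat.{o, v, h, c, u} A) :
    Function.Bijective (fun f : C ⟶ D => (monadFunctor A).map f) := by
  refine ⟨fun f g e => ?_, fun f => ⟨ofMonadHom f, toMonadHom_ofMonadHom f⟩⟩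
  exact congrArg (fun k : HMonadHom (toMonad C) (toMonad D) => ofMonadHom k) e

theorem monadFunctor_map₂_bijective (C D : ACat.{o, v, h, c, u} A) (f g : C ⟶ D) :
    Function.Bijective (fun α : f ⟶ g => (monadFunctor A).map₂ α) := by
  refine ⟨fun (α β : ANatTrans (A := A) f g) e => ?_, fun β => toCell_surjective β⟩
  refine ANatTrans.ext (funext fun x => ?_)
  exact (entry_toCell α x).symm.trans ((congrArg (fun γ => entry γ x) e).trans (entry_toCell β x))

/-- The square of profunctors commutes strictly; evaluating that equation at monads, monad morphisms
and multicells between units gives the equation of 2-functors. -/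
theorem monadFunctor_comm :
    ((monadFunctor.{o, v, h, c, u} A).comp (VCat.map (ModVDC.map (matFam A)))).comp
      (VCat.map (ModVDC.map (famSpan A))) = (obFunctor A).comp chaoticCat := by
  have e := (prof_isHcPullback.{o, v, h, c, u} A).comm
  refine StrictPseudofunctor.ext_heq (fun C => VFunctor.obj_congr e (toMonad C))
    (fun {C D} f => VFunctor.map_congr e (toMonadHom (C := C) (D := D) f)) ?_
  intro C D f g α
  have h := VFunctor.cell_congr e (X := toMonad C) (Z := toMonad D)
    (p := .one (HMonad.bimod (toMonad C))) (toCell (A := A) (f := f) (g := g) α)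
  exact (VFunctor.comp_cell_heq _ _ _).symm.trans (h.trans (VFunctor.comp_cell_heq
    (VFunctor.toHc (A := BimodVDC (MatVDC A)) (HMonad.forget (MatVDC A) ⋙ famIdx A))
    chaoticProf.toVFunctor _))

/-- The elementwise criterion for the square of profunctors is restricted to objects, vertical
morphisms and multicells between units, and then transported along the bijections given by
`monadFunctor`. -/
theorem monadFunctor_isPullback :
    IsTwoCatPullback.{_, _, _, _, _, _, _, _, o₄, v₄, _, _, _, _, w₄}
      ((monadFunctor.{o, v, h, c, u} A).comp (VCat.map (ModVDC.map (matFam A)))) (obFunctor A)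
      (VCat.map (ModVDC.map (famSpan A))) chaoticCat := by
  have i := prof_isHcPullback.{o, v, h, c, u} A
  refine IsTwoCatPullbackElementwise.isTwoCatPullback ⟨monadFunctor_comm A, ?_, ?_, ?_, ?_, ?_, ?_⟩
  · intro M I e
    obtain ⟨N, h₁, h₂⟩ := i.obj_surj M I e
    obtain ⟨C, rfl⟩ := (monadFunctor_obj_bijective A).2 N
    exact ⟨C, h₁, h₂⟩
  · intro C D h₁ h₂
    exact (monadFunctor_obj_bijective A).1 (i.obj_inj _ _ h₁ h₂)
  · intro C D a b e
    obtain ⟨f, h₁, h₂⟩ := i.map_surj (x := toMonad C) (x' := toMonad D) a b e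
    obtain ⟨f, rfl⟩ := (monadFunctor_map_bijective A C D).2 f
    exact ⟨f, h₁, h₂⟩
  · intro C D f g h₁ h₂
    exact (monadFunctor_map_bijective A C D).1 (i.map_inj (x := toMonad C) (x' := toMonad D)
      _ _ h₁ h₂)
  · intro C D f g a b _
    -- A 2-cell of families between images is a multicell whose top and bottom are images of units,
    -- so it lifts to a multicell between units of matrix monads.
    obtain ⟨β, h⟩ := i.cell_surj (x := toMonad C) (z := toMonad D)
      (p := .one (HMonad.bimod (toMonad C))) (f := toMonadHom (C := C) (D := D) f)
      (g := toMonadHom (C := C) (D := D) g) (Γ := HMonad.bimod (toMonad D)) a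
    obtain ⟨α, rfl⟩ := (monadFunctor_map₂_bijective A C D f g).2 β
    exact ⟨α, h, rfl⟩
  · intro C D f g α β h _
    exact (monadFunctor_map₂_bijective A C D f g).1 (i.cell_inj (x := toMonad C) (z := toMonad D)
      (p := .one (HMonad.bimod (toMonad C))) (f := toMonadHom (C := C) (D := D) f)
      (g := toMonadHom (C := C) (D := D) g) (Γ := HMonad.bimod (toMonad D)) _ _ h)

end ACat

/-! ### Internal categories in sets -/

/-- The value in the apex does not see the equations describing the sides. Comparing elements of
fibres by their values in the apex thus avoids transports along these equations. -/
theorem SpanVDC.comp_val {B C D E F G : SpanVDC.{u}.Obj} {p : SpanVDC.Path B C} {f : B ⟶ D}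
    {g : C ⟶ E} {q : SpanVDC.Path D E} {f' : D ⟶ F} {g' : E ⟶ G} {S : SpanVDC.Hor F G} {a : B ⟶ F}
    {b : C ⟶ G} (Θ : SpanVDC.Chain p f g q) (θ : SpanVDC.Cell q f' g' S) (hu : f ≫ f' = a)
    (hv : g ≫ g' = b) {i : spanIdx.idx B} {j : spanIdx.idx C} (s : Elt spanIdx.{u} p i j) :
    (VDC.comp SpanVDC Θ θ hu hv s).1 = (θ (SpanVDC.run Θ s)).1 := by
  subst hu hv; rfl

theorem SpanVDC.comp_val_eq {B C D E F G : SpanVDC.{u}.Obj} {p : SpanVDC.Path B C} {f : B ⟶ D}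
    {g : C ⟶ E} {q : SpanVDC.Path D E} {f' : D ⟶ F} {g' : E ⟶ G} {S : SpanVDC.Hor F G} {a : B ⟶ F}
    {b : C ⟶ G} {Θ : SpanVDC.Chain p f g q} {θ : SpanVDC.Cell q f' g' S} {hu : f ≫ f' = a}
    {hv : g ≫ g' = b} {κ : SpanVDC.Cell p a b S} (e : VDC.comp SpanVDC Θ θ hu hv = κ)
    {i : spanIdx.idx B} {j : spanIdx.idx C} (s : Elt spanIdx.{u} p i j) :
    (θ (SpanVDC.run Θ s)).1 = (κ s).1 :=
  e ▸ (SpanVDC.comp_val Θ θ hu hv s).symm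

/-- Turns an equation between composite multimaps into an equation between elements; all laws of
internal categories and functors are extracted through it or through `SpanVDC.comp_val_eq`. -/
theorem SpanVDC.comp_congr {B C D E F G D' E' : SpanVDC.{u}.Obj} {p : SpanVDC.Path B C} {f : B ⟶ D}
    {g : C ⟶ E} {q : SpanVDC.Path D E} {f' : D ⟶ F} {g' : E ⟶ G} {S : SpanVDC.Hor F G} {a : B ⟶ F}
    {b : C ⟶ G} {k : B ⟶ D'} {l : C ⟶ E'} {q' : SpanVDC.Path D' E'} {k' : D' ⟶ F} {l' : E' ⟶ G}
    {Θ : SpanVDC.Chain p f g q} {θ : SpanVDC.Cell q f' g' S} {hu : f ≫ f' = a}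
    {hv : g ≫ g' = b} {Θ' : SpanVDC.Chain p k l q'} {θ' : SpanVDC.Cell q' k' l' S}
    {hu' : k ≫ k' = a} {hv' : l ≫ l' = b}
    (e : VDC.comp SpanVDC Θ θ hu hv = VDC.comp SpanVDC Θ' θ' hu' hv')
    {i : spanIdx.idx B} {j : spanIdx.idx C} (s : Elt spanIdx.{u} p i j) :
    (θ (SpanVDC.run Θ s)).1 = (θ' (SpanVDC.run Θ' s)).1 :=
  (SpanVDC.comp_val_eq e s).trans (SpanVDC.comp_val Θ' θ' hu' hv' s)

/-! ### The category of an internal category: hom-sets are fibres of the span -/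

namespace HMonad

/-- The set of objects of an internal category. -/
abbrev ob (M : HMonad SpanVDC.{u}) : Type u := M.obj

/-- The underlying span of an internal category. -/
abbrev span (M : HMonad SpanVDC.{u}) : SpanHor M.ob M.ob := M.hor

/-- The element of the iterated pullback given by a morphism. -/
abbrev elt₁ (M : HMonad SpanVDC.{u}) {x y : M.ob} (a : M.span.Fiber x y) :
    Elt spanIdx (HPath.one M.span) x y :=
  .cons (D := spanIdx) (H := SpanHor) a (.nil (D := spanIdx) (X := M.ob) y)

/-- The identity morphisms of an internal category. -/
def one (M : HMonad SpanVDC.{u}) (x : M.ob) : M.span.Fiber x x :=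
  M.unit (.nil (D := spanIdx) (X := M.ob) x)

/-- The composition of an internal category. -/
def times (M : HMonad SpanVDC.{u}) {x y z : M.ob} (a : M.span.Fiber x y) (b : M.span.Fiber y z) :
    M.span.Fiber x z :=
  M.mul (.cons (D := spanIdx) (H := SpanHor) a (M.elt₁ b))

/-- The left unit law of the monad, evaluated at the one-step path consisting of `a`. -/
theorem one_times (M : HMonad SpanVDC.{u}) {x y : M.ob} (a : M.span.Fiber x y) :
    M.times (M.one x) a = a :=
  Subtype.ext (SpanVDC.comp_val_eq M.unit_mul (M.elt₁ a))

theorem times_one (M : HMonad SpanVDC.{u}) {x y : M.ob} (a : M.span.Fiber x y) :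
    M.times a (M.one y) = a :=
  Subtype.ext (SpanVDC.comp_val_eq M.mul_unit (M.elt₁ a))

/-- The associativity law of the monad, evaluated at the path consisting of `a`, `b` and `d`. -/
theorem times_assoc (M : HMonad SpanVDC.{u}) {x y z w : M.ob} (a : M.span.Fiber x y)
    (b : M.span.Fiber y z) (d : M.span.Fiber z w) :
    M.times (M.times a b) d = M.times a (M.times b d) :=
  Subtype.ext (SpanVDC.comp_congr M.assoc
    (.cons (D := spanIdx) (H := SpanHor) a (.cons (D := spanIdx) (H := SpanHor) b (M.elt₁ d))))

/-- The small category given by an internal category in sets. -/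
instance category (M : HMonad SpanVDC.{u}) : Category.{u} M.ob where
  Hom x y := M.span.Fiber x y
  id x := M.one x
  comp a b := M.times a b
  id_comp a := M.one_times a
  comp_id a := M.times_one a
  assoc a b d := M.times_assoc a b d

end HMonad

/-! ### Internal functors and ordinary functors -/

namespace HMonadHom

variable {M N : HMonad SpanVDC.{u}}

/-- The function on objects of an internal functor. -/
abbrev onOb (f : HMonadHom M N) (x : M.ob) : N.ob :=
  SpanVDC.fn (I := M.ob) (J := N.ob) f.hom x

/-- The function on morphisms of an internal functor. -/
def onHom (f : HMonadHom M N) {x y : M.ob} (a : M.span.Fiber x y) :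
    N.span.Fiber (f.onOb x) (f.onOb y) :=
  f.cell (M.elt₁ a)

/-- The functor given by an internal functor. -/
def functor (f : HMonadHom M N) : M.ob ⥤ N.ob where
  obj x := f.onOb x
  map a := f.onHom a
  map_id x := Subtype.ext (SpanVDC.comp_congr f.map_unit (.nil (D := spanIdx) (X := M.ob) x)).symm
  map_comp a b := Subtype.ext (SpanVDC.comp_congr f.map_mul
    (.cons (D := spanIdx) (H := SpanHor) a (M.elt₁ b))).symm

end HMonadHom

theorem SpanVDC.comp_ext {B C D E F G D' E' : SpanVDC.{u}.Obj} {p : SpanVDC.Path B C} {f : B ⟶ D}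
    {g : C ⟶ E} {q : SpanVDC.Path D E} {f' : D ⟶ F} {g' : E ⟶ G} {S : SpanVDC.Hor F G} {a : B ⟶ F}
    {b : C ⟶ G} {k : B ⟶ D'} {l : C ⟶ E'} {q' : SpanVDC.Path D' E'} {k' : D' ⟶ F} {l' : E' ⟶ G}
    {Θ : SpanVDC.Chain p f g q} {θ : SpanVDC.Cell q f' g' S} {hu : f ≫ f' = a}
    {hv : g ≫ g' = b} {Θ' : SpanVDC.Chain p k l q'} {θ' : SpanVDC.Cell q' k' l' S}
    {hu' : k ≫ k' = a} {hv' : l ≫ l' = b}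
    (e : ∀ ⦃i : spanIdx.idx B⦄ ⦃j : spanIdx.idx C⦄ (s : Elt spanIdx.{u} p i j),
      (θ (SpanVDC.run Θ s)).1 = (θ' (SpanVDC.run Θ' s)).1) :
    VDC.comp SpanVDC Θ θ hu hv = VDC.comp SpanVDC Θ' θ' hu' hv' :=
  funext fun _ => funext fun _ => funext fun s => Subtype.ext ((SpanVDC.comp_val Θ θ hu hv s).trans
    ((e s).trans (SpanVDC.comp_val Θ' θ' hu' hv' s).symm))

namespace HMonadHom

variable {M N : HMonad SpanVDC.{u}}

/-- The function on objects is recovered from the functor, and an element of a one-step path is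
nothing but a morphism, so the multimap is recovered as well. -/
theorem functor_injective : Function.Injective (functor (M := M) (N := N)) := by
  rintro ⟨k, θ, h₁, h₂⟩ ⟨k', θ', h₁', h₂'⟩ e
  obtain rfl : k = k' := ConcreteCategory.hom_ext (C := Type u) k k' fun x => Functor.congr_obj e x
  refine HMonadHom.ext rfl (heq_of_eq (funext fun i => funext fun j => funext fun s => ?_))
  match i, j, s with
  | _, _, .cons a (.nil _) =>
    exact eq_of_heq (Functor.hcongr_hom e (a : (_ : M.ob) ⟶ _))

/-- The multimap of spans given by a family of functions. -/
def spanCell (f : M.ob → N.ob)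
    (k : ∀ {x y : M.ob}, M.span.Fiber x y → N.span.Fiber (f x) (f y)) :
    SpanCell (HPath.one M.span) (TypeCat.ofHom f) (TypeCat.ofHom f) N.span
  | _, _, .cons a (.nil _) => k a

/-- The internal functor given by a functor. -/
def ofFunctor (F : M.ob ⥤ N.ob) : HMonadHom M N where
  hom := TypeCat.ofHom F.obj
  cell := spanCell F.obj fun a => F.map a
  map_unit := SpanVDC.comp_ext fun i j s => by
    match i, j, s with
    | _, _, .nil x => exact (congrArg Subtype.val (F.map_id (X := (x : M.ob)))).symm
  map_mul := SpanVDC.comp_ext fun i j s => by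
    match i, j, s with
    | _, _, .cons a (.cons b (.nil _)) =>
      exact (congrArg Subtype.val (F.map_comp (a : (_ : M.ob) ⟶ _) (b : (_ : M.ob) ⟶ _))).symm

end HMonadHom

/-! ### Internal natural transformations as families of morphisms -/

namespace HMonad

open Bicategory

/-- An internal category, as an object of the 2-category of internal categories. -/
abbrev toV (M : HMonad SpanVDC.{u}) : VCat (ModVDC SpanVDC.{u}) := M

variable {M N R : HMonad SpanVDC.{u}}

/-- The components of an internal natural transformation. -/
noncomputable def component {f g : M.toV ⟶ N.toV} (α : f ⟶ g) (x : M.ob) :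
    N.span.Fiber (HMonadHom.onOb f x) (HMonadHom.onOb g x) :=
  VCat.nullCell α (.nil (D := spanIdx) (X := M.ob) x)

/-- The formulas for `VCat.nullCell`, evaluated at the empty path on an object, give the
componentwise formulas for the operations on natural transformations; this is the first of them. -/
theorem component_id (f : M.toV ⟶ N.toV) (x : M.ob) :
    component (𝟙 f) x = N.one (HMonadHom.onOb f x) :=
  Subtype.ext (SpanVDC.comp_val_eq (VCat.nullCell_id f).symm
    (.nil (D := spanIdx) (X := M.ob) x)).symm

theorem component_comp {f g k : M.toV ⟶ N.toV} (α : f ⟶ g) (β : g ⟶ k) (x : M.ob) :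
    component (α ≫ β) x = N.times (component α x) (component β x) :=
  Subtype.ext (SpanVDC.comp_val_eq (VCat.nullCell_comp α β).symm
    (.nil (D := spanIdx) (X := M.ob) x)).symm

theorem component_whiskerLeft (f : M.toV ⟶ N.toV) {g k : N.toV ⟶ R.toV} (α : g ⟶ k) (x : M.ob) :
    component (M := M) (N := R) (f ◁ α) x = component α (HMonadHom.onOb f x) :=
  Subtype.ext (SpanVDC.comp_val_eq (VCat.nullCell_whiskerLeft f α).symm
    (.nil (D := spanIdx) (X := M.ob) x)).symm

theorem component_whiskerRight {f g : M.toV ⟶ N.toV} (α : f ⟶ g) (k : N.toV ⟶ R.toV) (x : M.ob) :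
    component (M := M) (N := R) (α ▷ k) x = HMonadHom.onHom k (component α x) :=
  Subtype.ext (SpanVDC.comp_val_eq (VCat.nullCell_whiskerRight α k).symm
    (.nil (D := spanIdx) (X := M.ob) x)).symm

/-- The naturality law of the nullary multimap, evaluated at a single morphism, is the usual
naturality square. -/
theorem component_naturality {f g : M.toV ⟶ N.toV} (α : f ⟶ g) {x y : M.ob}
    (a : M.span.Fiber x y) : N.times (HMonadHom.onHom f a) (component α y) =
      N.times (component α x) (HMonadHom.onHom g a) :=
  Subtype.ext (SpanVDC.comp_congr (VCat.nullCell_naturality α) (M.elt₁ a))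

theorem component_ext {f g : M.toV ⟶ N.toV} {α β : f ⟶ g}
    (e : ∀ x, component α x = component β x) : α = β :=
  VCat.nullCell_inj (funext fun i => funext fun j => funext fun s => by
    match i, j, s with
    | _, _, .nil x => exact e x)

/-- The nullary multimap of spans given by a family of elements. -/
def nullSpanCell {k l : M.ob ⟶ N.ob}
    (t : ∀ x, N.span.Fiber (SpanVDC.fn k x) (SpanVDC.fn l x)) :
    SpanCell (.nil M.ob) k l N.span
  | _, _, .nil x => t x

/-- A family indexed by the objects is a nullary multimap, since an empty path has one element for
every object. Naturality squares give the condition under which it extends to a 2-cell. -/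
theorem exists_component {f g : M.toV ⟶ N.toV}
    (t : ∀ x, N.span.Fiber (HMonadHom.onOb f x) (HMonadHom.onOb g x))
    (e : ∀ {x y : M.ob} (a : M.span.Fiber x y), N.times (HMonadHom.onHom f a) (t y) =
      N.times (t x) (HMonadHom.onHom g a)) : ∃ α : f ⟶ g, ∀ x, component α x = t x := by
  obtain ⟨α, h⟩ := VCat.exists_nullCell (S := M.toV) (T := N.toV) (f := f) (g := g)
    (nullSpanCell t) (SpanVDC.comp_ext fun i j s => by
      match i, j, s with
      | _, _, .cons a (.nil _) => exact congrArg Subtype.val (e a))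
  exact ⟨α, fun x => congrArg (fun θ : SpanCell (.nil M.ob) _ _ N.span =>
    θ (.nil (D := spanIdx) (X := M.ob) x)) h⟩

/-- The natural transformation given by an internal natural transformation. -/
noncomputable def natTrans {f g : M.toV ⟶ N.toV} (α : f ⟶ g) :
    HMonadHom.functor f ⟶ HMonadHom.functor g where
  app x := component α x
  naturality _ _ a := component_naturality α a

end HMonad

/-! ### Comparison with the 2-category of small categories -/

namespace HMonad

open Bicategory

/-- The small category given by an internal category in sets, as an object of `Cat`. -/
abbrev cat (M : HMonad SpanVDC.{u}) : Cat.{u, u} := Cat.of M.ob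

/-- The functor given by an internal functor, as a 1-cell of `Cat`. -/
abbrev catHom {M N : HMonad SpanVDC.{u}} (f : HMonadHom M N) : M.cat ⟶ N.cat :=
  f.functor.toCatHom

/-- The natural transformation given by an internal natural transformation, as a 2-cell of
`Cat`. -/
noncomputable abbrev catHom₂ {M N : HMonad SpanVDC.{u}} {f g : M.toV ⟶ N.toV} (α : f ⟶ g) :
    catHom (M := M) (N := N) f ⟶ catHom (M := M) (N := N) g :=
  (natTrans α).toCatHom₂

/-- The 2-functor from internal categories in sets to small categories. -/
noncomputable def toCat : StrictPseudofunctor (VCat (ModVDC SpanVDC.{u})) Cat.{u, u} :=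
  TwoCatData.functor (B := VCat (ModVDC SpanVDC.{u})) (C := Cat.{u, u})
    (fun M => HMonad.cat M)
    (fun {M N} f => catHom (M := M) (N := N) f)
    (fun {M N f g} α => catHom₂ (M := M) (N := N) (f := f) (g := g) α)
    (fun {M N} f => Cat.Hom₂.ext (NatTrans.ext (funext fun x =>
      component_id (M := M) (N := N) f x)))
    (fun {M N _ _ _} α β => Cat.Hom₂.ext (NatTrans.ext (funext fun x =>
      component_comp (M := M) (N := N) α β x)))
    (fun _ => rfl) (fun _ _ => rfl)
    (fun {M N R} f {_ _} α => heq_of_eq (Cat.Hom₂.ext (NatTrans.ext (funext fun x =>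
      component_whiskerLeft (M := M) (N := N) (R := R) f α x))))
    (fun {M N R _ _} α k => heq_of_eq (Cat.Hom₂.ext (NatTrans.ext (funext fun x =>
      component_whiskerRight (M := M) (N := N) (R := R) α k x))))

theorem toCat_map_bijective (M N : VCat (ModVDC SpanVDC.{u})) :
    Function.Bijective (fun f : M ⟶ N => toCat.map f) := by
  refine ⟨fun f g e => ?_, fun (F : HMonad.cat M ⟶ HMonad.cat N) =>
    ⟨HMonadHom.ofFunctor F.toFunctor, rfl⟩⟩
  exact HMonadHom.functor_injective (M := M) (N := N)
    (congrArg (fun F : HMonad.cat M ⟶ HMonad.cat N => F.toFunctor) e)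

/-- Both kinds of 2-cells amount to natural families of morphisms; naturality in the fibres of the
span is literally naturality in the associated categories. -/
theorem toCat_map₂_bijective (M N : VCat (ModVDC SpanVDC.{u})) (f g : M ⟶ N) :
    Function.Bijective (fun α : f ⟶ g => toCat.map₂ α) := by
  refine ⟨fun α β e => ?_, fun (γ : catHom (M := M) (N := N) f ⟶ catHom (M := M) (N := N) g) => ?_⟩
  · exact component_ext (M := M) (N := N) fun x =>
      congrArg (fun γ : catHom (M := M) (N := N) f ⟶ catHom (M := M) (N := N) g =>
        γ.toNatTrans.app x) (show catHom₂ (M := M) (N := N) α = catHom₂ (M := M) (N := N) β from e)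
  · obtain ⟨α, h⟩ := exists_component (M := M) (N := N) (f := f) (g := g)
      (fun x => γ.toNatTrans.app x)
      (fun {x y} a => γ.toNatTrans.naturality (X := x) (Y := y) a)
    exact ⟨α, show catHom₂ (M := M) (N := N) α = γ from Cat.Hom₂.ext (NatTrans.ext (funext h))⟩

/-! ### Every small category comes from an internal one -/

section OfCategory

variable (C : Type u) [Category.{u} C]

/-- The span of objects and morphisms of a small category. -/
def homSpan : SpanHor C C where
  apex := Σ x y : C, x ⟶ y
  src s := s.1
  tgt s := s.2.1

variable {C}

/-- A morphism, as an element of a fiber of the span of morphisms. -/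
def toFiber {x y : C} (a : x ⟶ y) : (homSpan C).Fiber x y := ⟨⟨x, y, a⟩, rfl, rfl⟩

/-- An element of a fiber of the span of morphisms, as a morphism. -/
def ofFiber {x y : C} (s : (homSpan C).Fiber x y) : x ⟶ y :=
  eqToHom s.2.1.symm ≫ s.1.2.2 ≫ eqToHom s.2.2

theorem ofFiber_toFiber {x y : C} (a : x ⟶ y) : ofFiber (toFiber a) = a :=
  (Category.id_comp _).trans (Category.comp_id a)

/-- An element of a fibre is a morphism together with equations for its ends; eliminating these
equations turns the correcting `eqToHom`s into identities. -/
theorem toFiber_ofFiber : ∀ {x y : C} (s : (homSpan C).Fiber x y), toFiber (ofFiber s) = s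
  | _, _, ⟨⟨_, _, a⟩, rfl, rfl⟩ => congrArg toFiber (ofFiber_toFiber a)

variable (C)

/-- The element of a fiber of the span of morphisms given by an identity morphism. -/
abbrev idFiber (x : C) : (homSpan C).Fiber x x := toFiber (𝟙 x)

/-- The nullary multimap of spans given by the identity morphisms of a small category. -/
def homSpanUnit : SpanCell (.nil C) (𝟙 C) (𝟙 C) (homSpan C)
  | _, _, .nil x => idFiber C x

/-- The binary multimap of spans given by the composition of a small category. -/
def homSpanMul : SpanCell (.cons (homSpan C) (.one (homSpan C))) (𝟙 C) (𝟙 C) (homSpan C)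
  | _, _, .cons a (.cons b (.nil _)) => toFiber (ofFiber a ≫ ofFiber b)

theorem _root_.SpanVDC.comp_eq_of_val {B C D E F G : SpanVDC.{u}.Obj} {p : SpanVDC.Path B C}
    {f : B ⟶ D} {g : C ⟶ E} {q : SpanVDC.Path D E} {f' : D ⟶ F} {g' : E ⟶ G}
    {S : SpanVDC.Hor F G} {a : B ⟶ F} {b : C ⟶ G} {Θ : SpanVDC.Chain p f g q}
    {θ : SpanVDC.Cell q f' g' S} {hu : f ≫ f' = a} {hv : g ≫ g' = b} {κ : SpanVDC.Cell p a b S}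
    (e : ∀ ⦃i : spanIdx.idx B⦄ ⦃j : spanIdx.idx C⦄ (s : Elt spanIdx.{u} p i j),
      (θ (SpanVDC.run Θ s)).1 = (κ s).1) : VDC.comp SpanVDC Θ θ hu hv = κ :=
  funext fun _ => funext fun _ => funext fun s =>
    Subtype.ext ((SpanVDC.comp_val Θ θ hu hv s).trans (e s))

/-- The internal category in sets given by a small category. -/
def ofCategory : HMonad SpanVDC.{u} where
  obj := C
  hor := homSpan C
  unit := homSpanUnit C
  mul := homSpanMul C
  unit_mul := SpanVDC.comp_eq_of_val fun i j s => by
    match i, j, s with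
    | _, _, .cons a (.nil _) =>
      -- The composite is computed among morphisms of `C`, by moving `a` out of its fibre and back;
      -- the unit moved out of its fibre is an identity morphism.
      refine congrArg Subtype.val (Eq.trans ?_ (toFiber_ofFiber (C := C) a))
      refine congrArg (toFiber (C := C)) (Eq.trans ?_ (Category.id_comp (ofFiber (C := C) a)))
      exact congrArg (fun b => b ≫ ofFiber (C := C) a) (ofFiber_toFiber _)
  mul_unit := SpanVDC.comp_eq_of_val fun i j s => by
    match i, j, s with
    | _, _, .cons a (.nil _) =>
      refine congrArg Subtype.val (Eq.trans ?_ (toFiber_ofFiber (C := C) a))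
      refine congrArg (toFiber (C := C)) (Eq.trans ?_ (Category.comp_id (ofFiber (C := C) a)))
      exact congrArg (fun b => ofFiber (C := C) a ≫ b) (ofFiber_toFiber _)
  assoc := SpanVDC.comp_ext fun i j s => by
    match i, j, s with
    | _, _, .cons a (.cons b (.cons d (.nil _))) =>
      refine congrArg (fun k => (toFiber (C := C) k).1) (Eq.trans ?_ ((Category.assoc
        (ofFiber (C := C) a) (ofFiber (C := C) b) (ofFiber (C := C) d)).trans ?_))
      · exact congrArg (fun k => k ≫ ofFiber (C := C) d) (ofFiber_toFiber _)
      · exact congrArg (fun k => ofFiber (C := C) a ≫ k) (ofFiber_toFiber _).symm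

/-- The functor from the category given by the internal category of a small category. -/
def ofCategoryTo : (ofCategory C).ob ⥤ C where
  obj x := x
  map a := ofFiber (C := C) a
  map_id x := ofFiber_toFiber (C := C) (CategoryStruct.id (obj := C) x)
  map_comp a b := ofFiber_toFiber (ofFiber (C := C) a ≫ ofFiber (C := C) b)

theorem ofCategoryTo_map_bijective (x y : (ofCategory C).ob) :
    Function.Bijective (fun a : x ⟶ y => (ofCategoryTo C).map a) :=
  ⟨fun a b e => (toFiber_ofFiber (C := C) a).symm.trans
    ((congrArg (toFiber (C := C)) e).trans (toFiber_ofFiber (C := C) b)),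
    fun a => ⟨toFiber (C := C) a, ofFiber_toFiber (C := C) a⟩⟩

end OfCategory

/-- A functor that is bijective on objects and on morphisms is an isomorphism of categories. -/
theorem _root_.CategoryTheory.Cat.nonempty_iso_of_bijective {C D : Cat.{u, u}} (F : C ⥤ D)
    (h : Function.Bijective F.obj) (h' : ∀ x y : C, Function.Bijective (F.map (X := x) (Y := y))) :
    Nonempty (C ≅ D) := by
  let e := Equiv.ofBijective F.obj h
  let r (x y : C) := Equiv.ofBijective _ (h' x y)
  have hr (x y : C) (a : F.obj x ⟶ F.obj y) : F.map ((r x y).symm a) = a :=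
    (r x y).apply_symm_apply a
  have he (d : D) : F.obj (e.symm d) = d := e.apply_symm_apply d
  -- The inverse bijection on objects is inverse only up to equations, so a morphism of `D` is
  -- conjugated by these before its preimage under `F` is taken. Functoriality follows from
  -- faithfulness of `F`.
  let G : D ⥤ C :=
    { obj := e.symm
      map {x y} a := (r _ _).symm (eqToHom (he x) ≫ a ≫ eqToHom (he y).symm)
      map_id x := (h' _ _).1 (by simp [hr])
      map_comp a b := (h' _ _).1 (by simp [hr]) }
  refine ⟨F.toCatHom, G.toCatHom, Cat.ext ?_, Cat.ext ?_⟩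
  -- The equation of morphisms is checked after the faithful functor `F`, which carries the
  -- correcting equalities in `C` to those used in the definition of `G`.
  · refine CategoryTheory.Functor.ext (fun x => e.symm_apply_apply x) fun x y a => (h' _ _).1 ?_
    refine (hr _ _ _).trans ?_
    rw [Functor.map_comp, Functor.map_comp, eqToHom_map]
    exact congrArg (· ≫ F.map a ≫ _) (eqToHom_map F _).symm
  · refine CategoryTheory.Functor.ext he fun x y a => ?_
    exact hr _ _ _

/-- The hom-sets obtained from the span of all morphisms are its fibres, which are in bijection with
the original hom-sets but not equal to them; hence an isomorphism of categories. -/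
theorem toCat_essSurj (C : Cat.{u, u}) :
    ∃ M : VCat (ModVDC SpanVDC.{u}), Nonempty (toCat.obj M ≅ C) :=
  ⟨ofCategory C, Cat.nonempty_iso_of_bijective (ofCategoryTo C) Function.bijective_id
    (ofCategoryTo_map_bijective C)⟩

/-- The chaotic internal category on a set. -/
noncomputable abbrev chaotic (I : Type u) : HMonad SpanVDC.{u} := chaoticCat.obj (I : SetLc.{u})

/-- The pair `(x, y)` is the only element of `I × I` over `x` and `y`. -/
theorem chaotic_fiber (I : Type u) (x y : (chaotic I).ob) :
    Nonempty (Unique ((chaotic I).span.Fiber x y)) :=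
  ⟨⟨⟨⟨(x, y), rfl, rfl⟩⟩, fun _ => SpanHor.fiber_prod_ext _ _⟩⟩

/-- The functor to the category given by a chaotic internal category from a category with exactly
one morphism from any object to any object. -/
noncomputable def ofChaotic {C : Cat.{u, u}} (k : ∀ x y : C, Nonempty (Unique (x ⟶ y))) :
    (chaotic C).ob ⥤ C where
  obj x := x
  map {x y} _ := (k x y).some.default
  map_id x := (k x x).some.uniq _ |>.symm
  map_comp {x _ z} _ _ := (k x z).some.uniq _ |>.symm

/-- Having exactly one morphism between any two objects is invariant under isomorphism. Conversely,
for such a category the identity on objects extends to a functor from the chaotic category on its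
set of objects, and it is bijective on hom-sets, which have one element on both sides. -/
theorem chaotic_iff (C : Cat.{u, u}) :
    (∃ I : SetLc.{u}, Nonempty (toCat.obj (chaoticCat.obj I) ≅ C)) ↔
      ∀ x y : C, Nonempty (Unique (x ⟶ y)) := by
  constructor
  · rintro ⟨I, ⟨e⟩⟩ x y
    -- An isomorphism in `Cat` has a fully faithful inverse, so the hom-set of `C` is in bijection
    -- with a fibre of the chaotic span.
    let F := (Cat.equivOfIso e).symm.fullyFaithfulFunctor.homEquiv (X := x) (Y := y)
    obtain ⟨k⟩ := chaotic_fiber I _ _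
    exact ⟨@Equiv.unique _ _ k F⟩
  · intro k
    refine ⟨(C : Type u), Cat.nonempty_iso_of_bijective (ofChaotic k) Function.bijective_id
      fun x y => ⟨fun a b _ => SpanHor.fiber_prod_ext a b, fun a => ?_⟩⟩
    exact ⟨(chaotic_fiber (C : Type u) x y).some.default,
      ((k x y).some.uniq _).trans ((k x y).some.uniq a).symm⟩

end HMonad

/-- A multimap into a span of projections is determined by its sides, so an internal functor between
chaotic categories is just its function on objects. -/
theorem chaoticCat_map_bijective (I J : SetLc.{u}) :
    Function.Bijective (fun f : I ⟶ J => chaoticCat.map f) := by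
  refine ⟨fun f g e => congrArg (fun f : HMonadHom (A := SpanVDC.{u}) _ _ => f.hom) e, fun f => ?_⟩
  refine ⟨(f : HMonadHom (A := SpanVDC.{u}) _ _).hom, HMonadHom.ext rfl (heq_of_eq ?_)⟩
  exact funext fun i => funext fun j => funext fun s => SpanHor.fiber_prod_ext _ _

/-- Components of a 2-cell between such functors lie in one-element fibres, so any 2-cell is the
image of the unique one. -/
theorem chaoticCat_map₂_bijective (I J : SetLc.{u}) (f g : I ⟶ J) :
    Function.Bijective (fun α : f ⟶ g => chaoticCat.map₂ α) := by
  refine ⟨fun α β _ => PUnit.ext α β, fun β => ⟨PUnit.unit, ?_⟩⟩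
  exact HMonad.component_ext fun x => SpanHor.fiber_prod_ext _ _

/-- Matrices, enriched profunctors and enriched categories as pullbacks of their family versions. -/
theorem mainTheorem9 (A : VDC.{o, v, h, c}) :
    -- matrices, in the 2-category of virtual double categories
    VDC.IsPullback.{_, _, _, _, _, _, _, _, _, _, _, _, _, _, _, _, o₄, v₄, h₄, c₄}
      (matFam.{o, v, h, c, u} A) (matIdx A) (famSpan A) chaoticSpan ∧
    -- enriched profunctors, in the 2-category of unital virtual double categories
    UVDC.IsPullback.{_, _, _, _, _, _, _, _, _, _, _, _, _, _, _, _, o₄, v₄, h₄, c₄}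
      (ModVDC.map (matFam.{o, v, h, c, u} A)) (profObj A) (ModVDC.map (famSpan A)) chaoticProf ∧
    -- enriched categories, in the 2-category of 2-categories
    (∃ (e : StrictPseudofunctor (ACat.{o, v, h, c, u} A) (VCat (ProfVDC.{o, v, h, c, u} A)))
      (e' : StrictPseudofunctor (VCat (ProfVDC.{o, v, h, c, u} A)) (ACat.{o, v, h, c, u} A)),
      e.comp e' = .id _ ∧ e'.comp e = .id _ ∧
      (∀ C : ACat.{o, v, h, c, u} A,
        HMonad.obj (e.obj C) = (⟨C.ob, C.extent⟩ : FamObj.{o, v, h, c, u} A) ∧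
          HMonad.hor (e.obj C) ≍ C.hom) ∧
      IsTwoCatPullback.{_, _, _, _, _, _, _, _, o₄, v₄, _, _, _, _, w₄}
        (e.comp (VCat.map (ModVDC.map (matFam A)))) (ACat.obFunctor A)
        (VCat.map (ModVDC.map (famSpan A))) chaoticCat) ∧
    -- the lower leg of the last square is the inclusion of the chaotic categories
    (∃ E : StrictPseudofunctor (VCat (ModVDC SpanVDC.{u})) Cat.{u, u},
      (∀ S : VCat (ModVDC SpanVDC.{u}), (E.obj S : Type u) = HMonad.obj S) ∧
      (∀ S T : VCat (ModVDC SpanVDC.{u}), Function.Bijective (fun f : S ⟶ T => E.map f)) ∧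
      (∀ (S T : VCat (ModVDC SpanVDC.{u})) (f g : S ⟶ T),
        Function.Bijective (fun α : f ⟶ g => E.map₂ α)) ∧
      (∀ C : Cat.{u, u}, ∃ S : VCat (ModVDC SpanVDC.{u}), Nonempty (E.obj S ≅ C)) ∧
      (∀ C : Cat.{u, u}, (∃ I : SetLc.{u}, Nonempty (E.obj (chaoticCat.obj I) ≅ C)) ↔
        ∀ x y : C, Nonempty (Unique (x ⟶ y)))) ∧
    (∀ I J : SetLc.{u}, Function.Bijective (fun f : I ⟶ J => chaoticCat.map f)) ∧
    (∀ (I J : SetLc.{u}) (f g : I ⟶ J),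
      Function.Bijective (fun α : f ⟶ g => chaoticCat.map₂ α)) :=
  ⟨(matFam_isHcPullback A).isPullback, (prof_isHcPullback A).isPullback_uvdc, by
    -- The inverse 2-functor is obtained from bijectivity on cells of each dimension. The prescribed
    -- underlying family and matrix are those of `ACat.toMonad`, so the description on objects holds
    -- by definition.
    obtain ⟨e', h₁, h₂⟩ := StrictPseudofunctor.exists_inverse (ACat.monadFunctor.{o, v, h, c, u} A)
      (ACat.monadFunctor_obj_bijective A) (ACat.monadFunctor_map_bijective A)
      (ACat.monadFunctor_map₂_bijective A)
    exact ⟨ACat.monadFunctor A, e', h₁, h₂, fun C => ⟨rfl, HEq.rfl⟩,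
      ACat.monadFunctor_isPullback A⟩,
    ⟨HMonad.toCat, fun _ => rfl, HMonad.toCat_map_bijective, HMonad.toCat_map₂_bijective,
      HMonad.toCat_essSurj, HMonad.chaotic_iff⟩,
    chaoticCat_map_bijective, chaoticCat_map₂_bijective⟩
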